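/- \textbf{Conventions.} For $r,s\ge 0$, $n=r+s$, let $\langle\cdot,\cdot\rangle$ be the standard form of signature $(r,s)$ on $\mathbb R^n$, $\mathrm{Cl}_{r,s}$ its Clifford algebra (with $v\cdot v=-\langle v,v\rangle$), $\mathrm{Spin}_{r,s}\subset \mathrm{Cl}_{r,s}^*$ the group of products of an even number of vectors $v_j$ with $\langle v_j,v_j\rangle=\pm1$, $\mathrm{Spin}^c_{r,s}=\mathrm{Spin}_{r,s}\times_{\mathbb Z_2}\mathbb S^1$, realised as the group of products $zx$ ($x\in\mathrm{Spin}_{r,s}$, $z\in\mathbb S^1$) in $\mathbb C\otimes \mathrm{Cl}_{r,s}$, and $\xi^c([x,z])=(\mathrm{Ad}_x,z^2)\in \mathrm{SO}_{r,s}\times\mathbb S^1$, where $\mathrm{SO}_{r,s}$ is the group of isometries of determinant $1$. For an oriented semi-Riemannian manifold $N$ of signature $(r,s)$, let $P_{\mathrm{SO}}N$ be the bundle of positively oriented orthonormal frames. A \emph{$\mathrm{Spin}^c$ structure} on $N$ consists of a smooth principal $\mathrm{Spin}^c_{r,s}$-bundle $P_{\mathrm{Spin}^c}N$, a smooth principal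 $\mathbb S^1$-bundle $P_{\mathbb S^1}N$ and a smooth twofold covering $\Theta:P_{\mathrm{Spin}^c}N\to P_{\mathrm{SO}}N\times_N P_{\mathbb S^1}N$ over $N$ with $\Theta(ua)=\Theta(u)\xi^c(a)$. An isomorphism of $\mathrm{Spin}^c$ structures is a pair of isomorphisms of the two principal bundles that commutes with the maps $\Theta$ and induces the identity on $P_{\mathrm{SO}}N$. Let $M$ be a smooth (Hausdorff, second countable) oriented $n$-manifold, $I\subset\mathbb R$ an interval, $(g_t)_{t\in I}$ a smooth family of semi-Riemannian metrics of signature $(r,s)$ on $M$, and $\mathcal Z=I\times M$ the generalized cylinder with the metric $dt^2+g_t$ of signature $(r+1,s)$, oriented so that $(\partial_t,e_1,\dots,e_n)$ is positive when $(e_1,\dots,e_n)$ is. Fix $t_0\in I$ and identify $M$ with $\{t_0\}\times M$, with the metric $g_{t_0}$. \emph{Restriction.} The restriction to $M$ of a $\mathrm{Spin}^c$ structure on $\mathcal Z$ has $P_{\mathbb S^1}M=P_{\mathbb S^1}\mathcal Z|_M$, and $P_{\mathrm{Spin}^c}M$ is the pull-back of $P_{\mathrm{Spin}^c}\mathcal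 Z|_M$ under $P_{\mathrm{SO}}M\to P_{\mathrm{SO}}\mathcal Z|_M$, $(e_1,\dots,e_n)\mapsto(\partial_t,e_1,\dots,e_n)$. \emph{Pull-back.} A $\mathrm{Spin}^c$ structure on $\mathcal Z$ is a pull-back, along the projection $pr_2:I\times M\to M$, of a $\mathrm{Spin}^c$ structure on $(M,g_{t_0})$ if $P_{\mathbb S^1}\mathcal Z=pr_2^*P_{\mathbb S^1}M$, if $P_{\mathrm{Spin}^c}\mathcal Z$ is the enlargement of $pr_2^*P_{\mathrm{Spin}^c}M$ along the embedding $\mathrm{Spin}^c_{r,s}\hookrightarrow\mathrm{Spin}^c_{r+1,s}$ that covers $(a,z)\mapsto(\mathrm{diag}(1,a),z)$, and if $\Theta$ is induced from that of $M$ by the maps $(e_1,\dots,e_n)\mapsto(\partial_t,A_{t,x}e_1,\dots,A_{t,x}e_n)$ on frames at $x$, for some family of linear isometries $A_{t,x}:(T_xM,g_{t_0})\to(T_xM,g_t)$, smooth in $(t,x)$, with $A_{t_0,x}=\mathrm{id}$. \textbf{Proposition.} There is a one-to-one correspondence between the isomorphism classes of $\mathrm{Spin}^c$ structures on $\mathcal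 Z$ and those on $M$. The class of a structure $\tau$ on $\mathcal Z$ corresponds to the class of a structure $\sigma$ on $M$ if and only if $\sigma$ is (isomorphic to) the restriction of $\tau$ to $M$, and also if and only if $\tau$ is (isomorphic to) a pull-back of $\sigma$ along $pr_2$. In particular restrictions and pull-backs exist, are unique up to isomorphism, and are inverse to each other. -/

import Mathlib

open scoped Manifold ContDiff TensorProduct

noncomputable section

namespace SpinCGeom

universe u

/-! ### Linear groups, the groups `S¹`, `Spin` and `Spin^c` -/

/-- A group presented as a group of units of a finite-dimensional real algebra. All groups below
are closed subgroups, so their manifold structure is the one inherited from the algebra: a map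
into the group is smooth when it is smooth as a map into the algebra. -/
structure LinearGroup where
  Alg : Type
  [ring : Ring Alg]
  [algebra : Algebra ℝ Alg]
  group : Subgroup Algˣ

attribute [instance] LinearGroup.ring LinearGroup.algebra

/-- The type of elements of a linear group. -/
def LinearGroup.El (𝒢 : LinearGroup) : Type := 𝒢.group

instance (𝒢 : LinearGroup) : Group 𝒢.El := inferInstanceAs (Group 𝒢.group)

/-- An element of the group, seen in the ambient algebra. -/
def LinearGroup.val {𝒢 : LinearGroup} (a : 𝒢.El) : 𝒢.Alg :=
  ((show 𝒢.group from a : 𝒢.Algˣ) : 𝒢.Alg)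

/-- The subspace topology from the (finite-dimensional) algebra: the coarsest topology for which
all linear coordinates are continuous. -/
instance (𝒢 : LinearGroup) : TopologicalSpace 𝒢.El :=
  ⨅ φ : 𝒢.Alg →ₗ[ℝ] ℝ, TopologicalSpace.induced (fun a => φ (LinearGroup.val a)) inferInstance

/-- The unit circle in `ℂˣ`. -/
def circleSubgroup : Subgroup ℂˣ where
  carrier := {z | ‖(z : ℂ)‖ = 1}
  one_mem' := by simp
  mul_mem' := by
    intro a b ha hb
    simp only [Set.mem_ofPred_eq] at ha hb ⊢
    simp [ha, hb]
  inv_mem' := by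
    intro a ha
    simp only [Set.mem_ofPred_eq] at ha ⊢
    simp [ha]

/-- The Lie group `S¹`. -/
def S1 : LinearGroup where
  Alg := ℂ
  group := circleSubgroup

section Spin

variable {ι : Type} [Fintype ι]

/-- The form `⟨v, v⟩ = ∑ ε i * (v i)²` for a vector of signs `ε`. -/
def innerSq (ε : ι → ℝ) (v : ι → ℝ) : ℝ := ∑ i, ε i * (v i * v i)

/-- The quadratic form of the Clifford algebra with the convention `v · v = -⟨v, v⟩`. -/
def cliffordForm (ε : ι → ℝ) : QuadraticForm ℝ (ι → ℝ) :=
  QuadraticMap.weightedSumSquares ℝ (fun i => -ε i)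

/-- The real Clifford algebra `Cl`. -/
abbrev Cl (ε : ι → ℝ) : Type := CliffordAlgebra (cliffordForm ε)

/-- The spin group: products `v₁ ⋯ v₂ₖ` of an even number of vectors with `⟨vⱼ, vⱼ⟩ = ±1`, written
as the group generated by the products of two such vectors. -/
def spin (ε : ι → ℝ) : Subgroup (Cl ε)ˣ :=
  Subgroup.closure {x | ∃ v w : ι → ℝ, |innerSq ε v| = 1 ∧ |innerSq ε w| = 1 ∧
    (x : Cl ε) = CliffordAlgebra.ι (cliffordForm ε) v * CliffordAlgebra.ι (cliffordForm ε) w}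

/-- The complex Clifford algebra. -/
abbrev CCl (ε : ι → ℝ) : Type := ℂ ⊗[ℝ] Cl ε

/-- The homomorphism `Spin × S¹ → ℂlˣ`, `(x, z) ↦ z x`. -/
def spinCHom (ε : ι → ℝ) : spin ε × circleSubgroup →* (CCl ε)ˣ :=
  MonoidHom.noncommCoprod
    ((Units.map (Algebra.TensorProduct.includeRight (R := ℝ) (A := ℂ) (B := Cl ε)).toRingHom.toMonoidHom).comp
      (spin ε).subtype)
    ((Units.map (Algebra.TensorProduct.includeLeft (R := ℝ) (S := ℝ) (A := ℂ) (B := Cl ε)).toRingHom.toMonoidHom).comp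
      circleSubgroup.subtype)
    (by
      intro x z
      apply Units.ext
      simp)

/-- The complex spin group `Spin^c = Spin ×_{±1} S¹`, realised inside the complex Clifford algebra
as the group of the products `z x` with `x ∈ Spin` and `z ∈ S¹`. -/
def SpinC (ε : ι → ℝ) : LinearGroup where
  Alg := CCl ε
  group := (spinCHom ε).range

/-- The class `[x, z]` in `Spin^c`. -/
def SpinC.mk {ε : ι → ℝ} (x : spin ε) (z : S1.El) : (SpinC ε).El :=
  (spinCHom ε).rangeRestrict (x, z)

/-- `Ad x : v ↦ x · v · x⁻¹` on `ℝⁿ`. -/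
def Ad {ε : ι → ℝ} (x : spin ε) : (ι → ℝ) →ₗ[ℝ] (ι → ℝ) :=
  (CliffordAlgebra.ι (cliffordForm ε)).leftInverse ∘ₗ
    LinearMap.mulRight ℝ (((x : (Cl ε)ˣ)⁻¹ : (Cl ε)ˣ) : Cl ε) ∘ₗ
    LinearMap.mulLeft ℝ ((x : (Cl ε)ˣ) : Cl ε) ∘ₗ CliffordAlgebra.ι (cliffordForm ε)

/-- The signs of `ℝ ⊕ ℝⁿ`, the added first direction (indexed by `none`) being spacelike. -/
def ext (ε : ι → ℝ) : Option ι → ℝ := fun i => i.elim 1 ε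

/-- The inclusion `ℝⁿ ⊂ ℝ ⊕ ℝⁿ`. -/
def vecIncl : (ι → ℝ) →ₗ[ℝ] (Option ι → ℝ) where
  toFun v := fun i => i.elim 0 v
  map_add' v w := by ext i; cases i <;> simp
  map_smul' c v := by ext i; cases i <;> simp

/-- The inclusion `ℝⁿ ⊂ ℝ ⊕ ℝⁿ` is isometric. -/
def isomIncl (ε : ι → ℝ) : cliffordForm ε →qᵢ cliffordForm (ext ε) where
  toLinearMap := vecIncl
  map_app' v := by simp [cliffordForm, vecIncl, ext, Fintype.sum_option]

/-- The inclusion of Clifford algebras; on even elements it is `eᵢ eⱼ ↦ (ν eᵢ) (ν eⱼ)`. -/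
def clIncl (ε : ι → ℝ) : Cl ε →ₐ[ℝ] Cl (ext ε) := CliffordAlgebra.map (isomIncl ε)

theorem map_mem_spin (ε : ι → ℝ) (x : spin ε) :
    Units.map (clIncl ε).toRingHom.toMonoidHom (x : (Cl ε)ˣ) ∈ spin (ext ε) := by
  obtain ⟨x, hx⟩ := x
  induction hx using Subgroup.closure_induction with
  | mem x hx =>
    obtain ⟨v, w, hv, hw, hvw⟩ := hx
    refine Subgroup.subset_closure ⟨vecIncl v, vecIncl w, ?_, ?_, ?_⟩
    · simpa [innerSq, vecIncl, ext, Fintype.sum_option] using hv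
    · simpa [innerSq, vecIncl, ext, Fintype.sum_option] using hw
    · simp only [Units.coe_map, MonoidHom.coe_coe, RingHom.toMonoidHom_eq_coe]
      erw [hvw]
      simp only [clIncl, map_mul, AlgHom.toRingHom_eq_coe, RingHom.coe_coe,
        CliffordAlgebra.map_apply_ι]
      rfl
  | one => simp [one_mem]
  | mul x y _ _ hx hy => simpa using mul_mem hx hy
  | inv x _ hx => simpa using inv_mem hx

/-- The inclusion `Spin(r, s) ⊂ Spin(r + 1, s)`. -/
def spinIncl (ε : ι → ℝ) : spin ε →* spin (ext ε) :=
  ((Units.map (clIncl ε).toRingHom.toMonoidHom).comp (spin ε).subtype).codRestrict (spin (ext ε))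
    (map_mem_spin ε)

/-- The inclusion of complex Clifford algebras. -/
def cclIncl (ε : ι → ℝ) : CCl ε →ₐ[ℝ] CCl (ext ε) :=
  Algebra.TensorProduct.map (AlgHom.id ℝ ℂ) (clIncl ε)

theorem cclIncl_spinCHom (ε : ι → ℝ) (p : spin ε × circleSubgroup) :
    Units.map (cclIncl ε).toRingHom.toMonoidHom (spinCHom ε p) =
      spinCHom (ext ε) (spinIncl ε p.1, p.2) := by
  apply Units.ext
  simp [spinCHom, cclIncl, spinIncl]

/-- The embedding `Spin^c(r, s) → Spin^c(r + 1, s)`, `[x, z] ↦ [x, z]`. It covers the embedding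
`(a, z) ↦ (diag (1, a), z)` of `SO(r, s) × S¹` in `SO(r + 1, s) × S¹`. -/
def spinCIncl (ε : ι → ℝ) : (SpinC ε).El →* (SpinC (ext ε)).El :=
  ((Units.map (cclIncl ε).toRingHom.toMonoidHom).comp (spinCHom ε).range.subtype).codRestrict
    (spinCHom (ext ε)).range (by
      rintro ⟨_, p, rfl⟩
      exact ⟨_, (cclIncl_spinCHom ε p).symm⟩)

theorem spinCIncl_mk (ε : ι → ℝ) (x : spin ε) (z : S1.El) :
    spinCIncl ε (SpinC.mk x z) = SpinC.mk (spinIncl ε x) z :=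
  Subtype.ext (cclIncl_spinCHom ε (x, z))

end Spin

/-! ### Smooth maps and principal bundles

The base spaces below are spaces `B` sitting in a manifold `N` by an embedding `j : B → N`:
either `B = N` is a manifold, or `B = J × M` is a cylinder over an arbitrary interval `J ⊆ ℝ`,
which sits in `ℝ × M`. -/

section Bundles

variable {E H E' H' : Type*} [NormedAddCommGroup E] [NormedSpace ℝ E] [TopologicalSpace H]
  [NormedAddCommGroup E'] [NormedSpace ℝ E'] [TopologicalSpace H']
  {N N' : Type*} [TopologicalSpace N] [ChartedSpace H N] [TopologicalSpace N'] [ChartedSpace H' N']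

/-- A map on (a part `U` of) a subspace of a manifold is smooth if it is locally the restriction of
a smooth map that is defined on an open subset of the manifold. -/
def SmoothAlong {B : Type*} (I : ModelWithCorners ℝ E H) (j : B → N)
    (I' : ModelWithCorners ℝ E' H') (f : B → N') (U : Set B) : Prop :=
  ∀ b ∈ U, ∃ W : Set N, IsOpen W ∧ j b ∈ W ∧ ∃ F : N → N', ContMDiffOn I I' ∞ F W ∧
    ∀ c ∈ U, j c ∈ W → F (j c) = f c

/-- A smooth principal `𝒢`-bundle: a space with a right action of `𝒢` and an atlas of local
trivialisations that are equivariant (`𝒢` acts on itself by right multiplication) and whose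
transition functions are smooth. -/
structure PrincipalBundle {B : Type u} [TopologicalSpace B] (I : ModelWithCorners ℝ E H)
    (j : B → N) (𝒢 : LinearGroup) where
  Total : Type u
  [top : TopologicalSpace Total]
  proj : Total → B
  act : Total → 𝒢.El → Total
  act_one : ∀ p, act p 1 = p
  act_mul : ∀ p a b, act p (a * b) = act (act p a) b
  continuous_act : Continuous fun q : Total × 𝒢.El => act q.1 q.2
  proj_act : ∀ p a, proj (act p a) = proj p
  atlas : Set (Bundle.Trivialization 𝒢.El proj)
  exists_mem_atlas : ∀ b, ∃ e ∈ atlas, b ∈ e.baseSet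
  atlas_act : ∀ e ∈ atlas, ∀ p, proj p ∈ e.baseSet → ∀ a, (e (act p a)).2 = (e p).2 * a
  atlas_smooth : ∀ e ∈ atlas, ∀ e' ∈ atlas, ∀ φ : 𝒢.Alg →ₗ[ℝ] ℝ,
    SmoothAlong I j 𝓘(ℝ, ℝ) (fun b => φ (LinearGroup.val (e' (e.invFun (b, 1))).2))
      (e.baseSet ∩ e'.baseSet)

attribute [instance] PrincipalBundle.top

namespace PrincipalBundle

variable {B : Type u} [TopologicalSpace B] {I : ModelWithCorners ℝ E H} {j : B → N}
  {𝒢 : LinearGroup}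

/-- Smoothness on `U` of a map `s` into the total space of a principal bundle (which covers a
smooth map into the base): its components in the local trivialisations are smooth. -/
def SmoothInto (P : PrincipalBundle I j 𝒢) {B' : Type*} (I' : ModelWithCorners ℝ E' H')
    (j' : B' → N') (s : B' → P.Total) (U : Set B') : Prop :=
  ∀ e ∈ P.atlas, ∀ φ : 𝒢.Alg →ₗ[ℝ] ℝ,
    SmoothAlong I' j' 𝓘(ℝ, ℝ) (fun b => φ (LinearGroup.val (e (s b)).2))
      (U ∩ {b | P.proj (s b) ∈ e.baseSet})

/-- Smooth local sections over an open set `U`. -/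
def IsSmoothSection (P : PrincipalBundle I j 𝒢) (s : B → P.Total) (U : Set B) : Prop :=
  IsOpen U ∧ (∀ b ∈ U, P.proj (s b) = b) ∧ P.SmoothInto I j s U

/-- Isomorphisms of principal bundles over the identity of the base. -/
structure Iso (P Q : PrincipalBundle I j 𝒢) where
  equiv : P.Total ≃ Q.Total
  proj_equiv : ∀ p, Q.proj (equiv p) = P.proj p
  equiv_act : ∀ p a, equiv (P.act p a) = Q.act (equiv p) a
  smooth : ∀ s U, P.IsSmoothSection s U → Q.IsSmoothSection (fun b => equiv (s b)) U
  smooth_symm : ∀ s U, Q.IsSmoothSection s U → P.IsSmoothSection (fun b => equiv.symm (s b)) U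

def Iso.refl (P : PrincipalBundle I j 𝒢) : Iso P P where
  equiv := Equiv.refl _
  proj_equiv _ := rfl
  equiv_act _ _ := rfl
  smooth _ _ h := h
  smooth_symm _ _ h := h

def Iso.symm {P Q : PrincipalBundle I j 𝒢} (f : Iso P Q) : Iso Q P where
  equiv := f.equiv.symm
  proj_equiv q := by rw [← f.proj_equiv, Equiv.apply_symm_apply]
  equiv_act q a := by rw [Equiv.symm_apply_eq, f.equiv_act, Equiv.apply_symm_apply]
  smooth := f.smooth_symm
  smooth_symm := f.smooth

def Iso.trans {P Q R : PrincipalBundle I j 𝒢} (f : Iso P Q) (g : Iso Q R) : Iso P R where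
  equiv := f.equiv.trans g.equiv
  proj_equiv p := by simp [f.proj_equiv, g.proj_equiv]
  equiv_act p a := by simp [f.equiv_act, g.equiv_act]
  smooth _ _ h := g.smooth _ _ (f.smooth _ _ h)
  smooth_symm _ _ h := f.smooth_symm _ _ (g.smooth_symm _ _ h)

end PrincipalBundle

/-! ### Frames and `Spin^c` structures -/

/-- A tuple of tangent vectors of `N`, indexed by `ι`, at a point of `B`. -/
structure TangentTuple {B : Type u} (I : ModelWithCorners ℝ E H) (j : B → N) (ι : Type) where
  base : B
  vec : ι → TangentSpace I (j base)

namespace TangentTuple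

variable {B : Type u} [TopologicalSpace B] {I : ModelWithCorners ℝ E H} {j : B → N} {ι : Type}

/-- The `i`-th vector as an element of the tangent bundle. -/
def tvec (F : TangentTuple I j ι) (i : ι) : TangentBundle I N := ⟨j F.base, F.vec i⟩

instance [IsManifold I ∞ N] : TopologicalSpace (TangentTuple I j ι) :=
  TopologicalSpace.induced (fun F => (F.base, F.tvec)) inferInstance

/-- The tuple `F · T`, whose `k`-th vector is `∑ i, T i k • F i`. -/
def transform [Fintype ι] [DecidableEq ι] (F : TangentTuple I j ι)
    (T : (ι → ℝ) →ₗ[ℝ] (ι → ℝ)) : TangentTuple I j ι where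
  base := F.base
  vec k := ∑ i, T (Pi.single k 1) i • F.vec i

end TangentTuple

/-- The matrix of `g` in the tuple `v` is the diagonal matrix with entries `ε`. -/
def IsOrthonormal {ι V : Type*} [DecidableEq ι] [AddCommGroup V] [Module ℝ V]
    (ε : ι → ℝ) (g : LinearMap.BilinForm ℝ V) (v : ι → V) : Prop :=
  ∀ i k, g (v i) (v k) = if i = k then ε i else 0

/-- The tuple `v` is a positively oriented basis. -/
def IsPositiveBasis {ι V : Type*} [Fintype ι] [DecidableEq ι] [AddCommGroup V] [Module ℝ V]
    (o : Orientation ℝ V ι) (v : ι → V) : Prop :=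
  ∃ b : Module.Basis ι ℝ V, ⇑b = v ∧ b.orientation = o

section SpinCStructure

variable {B : Type u} [TopologicalSpace B] {I : ModelWithCorners ℝ E H} [IsManifold I ∞ N]
  {j : B → N} {ι : Type} [Fintype ι] [DecidableEq ι]

/-- The bundle `P_SO` of positively oriented orthonormal frames for the metric `g` and the
orientation `o`. -/
def PSO (ε : ι → ℝ) (g : ∀ b, LinearMap.BilinForm ℝ (TangentSpace I (j b)))
    (o : ∀ b, Orientation ℝ (TangentSpace I (j b)) ι) : Set (TangentTuple I j ι) :=
  {F | IsOrthonormal ε (g F.base) F.vec ∧ IsPositiveBasis (o F.base) F.vec}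

/-- The fibre product `P_SO × P_{S¹}` over the base. -/
def FrameProd (ε : ι → ℝ) (g : ∀ b, LinearMap.BilinForm ℝ (TangentSpace I (j b)))
    (o : ∀ b, Orientation ℝ (TangentSpace I (j b)) ι) (L : PrincipalBundle I j S1) : Type _ :=
  {q : TangentTuple I j ι × L.Total // q.1 ∈ PSO ε g o ∧ q.1.base = L.proj q.2}

instance (ε : ι → ℝ) (g : ∀ b, LinearMap.BilinForm ℝ (TangentSpace I (j b)))
    (o : ∀ b, Orientation ℝ (TangentSpace I (j b)) ι) (L : PrincipalBundle I j S1) :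
    TopologicalSpace (FrameProd ε g o L) :=
  instTopologicalSpaceSubtype

/-- A `Spin^c` structure: a principal `Spin^c`-bundle `P`, a principal `S¹`-bundle `L` and a
twofold covering map `Θ : P → P_SO × L` over the base with `Θ (u · a) = Θ u · ξᶜ a`, where
`ξᶜ [x, z] = (Ad x, z²)`. -/
structure SpinCStructure (ε : ι → ℝ)
    (g : ∀ b, LinearMap.BilinForm ℝ (TangentSpace I (j b)))
    (o : ∀ b, Orientation ℝ (TangentSpace I (j b)) ι) where
  P : PrincipalBundle I j (SpinC ε)
  L : PrincipalBundle I j S1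
  Θ : P.Total → FrameProd ε g o L
  base_Θ : ∀ u, (Θ u).1.1.base = P.proj u
  isCoveringMap : IsCoveringMap Θ
  twofold : ∀ q, (Θ ⁻¹' {q}).ncard = 2
  frame_act : ∀ u x z, (Θ (P.act u (SpinC.mk x z))).1.1 = (Θ u).1.1.transform (Ad x)
  circle_act : ∀ u x z, (Θ (P.act u (SpinC.mk x z))).1.2 = L.act (Θ u).1.2 (z ^ 2)
  smooth_frame : ∀ s U, P.IsSmoothSection s U → ∀ i,
    SmoothAlong I j I.tangent (fun b => (Θ (s b)).1.1.tvec i) U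
  smooth_circle : ∀ s U, P.IsSmoothSection s U → L.IsSmoothSection (fun b => (Θ (s b)).1.2) U

namespace SpinCStructure

variable {ε : ι → ℝ} {g : ∀ b, LinearMap.BilinForm ℝ (TangentSpace I (j b))}
  {o : ∀ b, Orientation ℝ (TangentSpace I (j b)) ι}

/-- The frame part of `Θ`. -/
def frame (σ : SpinCStructure ε g o) (u : σ.P.Total) : TangentTuple I j ι := (σ.Θ u).1.1

/-- The circle part of `Θ`. -/
def circle (σ : SpinCStructure ε g o) (u : σ.P.Total) : σ.L.Total := (σ.Θ u).1.2

/-- Two `Spin^c` structures are isomorphic if there are isomorphisms of their principal bundles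
that commute with the maps `Θ` (and are the identity on `P_SO`). -/
def Isomorphic (σ τ : SpinCStructure ε g o) : Prop :=
  ∃ (f : σ.P.Iso τ.P) (h : σ.L.Iso τ.L), ∀ u,
    τ.frame (f.equiv u) = σ.frame u ∧ τ.circle (f.equiv u) = h.equiv (σ.circle u)

variable (ε g o) in
/-- `Spin^c` structures up to isomorphism. -/
def isoSetoid : Setoid (SpinCStructure ε g o) where
  r := Isomorphic
  iseqv :=
    { refl := fun σ => ⟨.refl _, .refl _, fun _ => ⟨rfl, rfl⟩⟩
      symm := by
        rintro σ τ ⟨f, h, H⟩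
        refine ⟨f.symm, h.symm, fun u => ?_⟩
        have := H (f.equiv.symm u)
        rw [Equiv.apply_symm_apply] at this
        exact ⟨this.1.symm, (h.equiv.symm_apply_eq.2 this.2).symm⟩
      trans := by
        rintro σ τ ρ ⟨f, h, H⟩ ⟨f', h', H'⟩
        refine ⟨f.trans f', h.trans h', fun u => ⟨?_, ?_⟩⟩
        · exact (H' _).1.trans (H u).1
        · exact (H' _).2.trans (congrArg _ (H u).2) }

variable (ε g o) in
/-- The set of isomorphism classes of `Spin^c` structures. -/
def Classes : Type _ := Quotient (isoSetoid ε g o)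

/-- The isomorphism class of a `Spin^c` structure. -/
def cls (σ : SpinCStructure ε g o) : Classes ε g o := Quotient.mk (isoSetoid ε g o) σ

end SpinCStructure

end SpinCStructure

end Bundles

/-! ### Generalized cylinders -/

section Cylinder

/-- The signs of the standard form of signature `(r, s)`. -/
def sig (r s : ℕ) : Fin r ⊕ Fin s → ℝ := Sum.elim (fun _ => 1) (fun _ => -1)

variable {E : Type*} [NormedAddCommGroup E] [NormedSpace ℝ E]
  {M : Type u} [TopologicalSpace M] [ChartedSpace E M] [IsManifold 𝓘(ℝ, E) ∞ M]

/-- A vector field on `M` is smooth on `U`. -/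
def IsSmoothField (X : ∀ x : M, TangentSpace 𝓘(ℝ, E) x) (U : Set M) : Prop :=
  ContMDiffOn 𝓘(ℝ, E) 𝓘(ℝ, E).tangent ∞ (fun x => (⟨x, X x⟩ : TangentBundle 𝓘(ℝ, E) M)) U

/-- An orientation of the manifold `M`: an orientation of each tangent space such that near every
point there is a smooth frame that is positively oriented. -/
structure ManifoldOrientation (E : Type*) [NormedAddCommGroup E] [NormedSpace ℝ E]
    (M : Type u) [TopologicalSpace M] [ChartedSpace E M] [IsManifold 𝓘(ℝ, E) ∞ M] (ι : Type) [Fintype ι]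
    [DecidableEq ι] where
  at_ : ∀ x : M, Orientation ℝ (TangentSpace 𝓘(ℝ, E) x) ι
  exists_frame : ∀ x : M, ∃ U : Set M, IsOpen U ∧ x ∈ U ∧
    ∃ X : ι → ∀ y : M, TangentSpace 𝓘(ℝ, E) y, (∀ i, IsSmoothField (X i) U) ∧
      ∀ y ∈ U, IsPositiveBasis (at_ y) (fun i => X i y)

/-- The inclusion of the cylinder `J × M` in the manifold `ℝ × M`. -/
def cylMap (J : Set ℝ) (M : Type u) : J × M → ℝ × M := fun z => ((z.1 : ℝ), z.2)

/-- The model of the manifold `ℝ × M`. -/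
abbrev cylModel (E : Type*) [NormedAddCommGroup E] [NormedSpace ℝ E] :
    ModelWithCorners ℝ (ℝ × E) (ModelProd ℝ E) := (𝓘(ℝ, ℝ)).prod 𝓘(ℝ, E)

/-- A smooth one-parameter family `g t`, `t ∈ J`, of semi-Riemannian metrics of signature `(r, s)`
on `M`. -/
structure MetricFamily (E : Type*) [NormedAddCommGroup E] [NormedSpace ℝ E]
    (M : Type u) [TopologicalSpace M] [ChartedSpace E M] [IsManifold 𝓘(ℝ, E) ∞ M] (r s : ℕ) (J : Set ℝ) where
  g : J → ∀ x : M, LinearMap.BilinForm ℝ (TangentSpace 𝓘(ℝ, E) x)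
  signature : ∀ t x, ∃ b : Module.Basis (Fin r ⊕ Fin s) ℝ (TangentSpace 𝓘(ℝ, E) x),
    IsOrthonormal (sig r s) (g t x) b
  smooth : ∀ (U : Set M) (X Y : ∀ x : M, TangentSpace 𝓘(ℝ, E) x), IsOpen U →
    IsSmoothField X U → IsSmoothField Y U →
    SmoothAlong (cylModel E) (cylMap J M) 𝓘(ℝ, ℝ) (fun z => g z.1 z.2 (X z.2) (Y z.2))
      {z | z.2 ∈ U}

/-- The tangent space `ℝ × T_x M` of `ℝ × M` at a point of the cylinder. -/
abbrev CylTangent (E : Type*) [NormedAddCommGroup E] [NormedSpace ℝ E]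
    {M : Type u} [TopologicalSpace M] [ChartedSpace E M] [IsManifold 𝓘(ℝ, E) ∞ M] {J : Set ℝ} (z : J × M) : Type _ :=
  TangentSpace (cylModel E) (cylMap J M z)

/-- The identification of `T_{(t, x)} (ℝ × M)` with `ℝ × T_x M` (the identity). -/
def cylTangentEquiv {J : Set ℝ} (z : J × M) :
    CylTangent E z ≃ₗ[ℝ] ℝ × TangentSpace 𝓘(ℝ, E) z.2 :=
  LinearEquiv.refl ℝ (ℝ × E)

/-- The metric `dt² + g_t`. -/
def cylMetric {r s : ℕ} {J : Set ℝ} (g : MetricFamily E M r s J) (z : J × M) :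
    LinearMap.BilinForm ℝ (CylTangent E z) :=
  ((LinearMap.mul ℝ ℝ).compl₁₂ (LinearMap.fst ℝ ℝ _) (LinearMap.fst ℝ ℝ _) +
    (g.g z.1 z.2).compl₁₂ (LinearMap.snd ℝ ℝ _) (LinearMap.snd ℝ ℝ _)).compl₁₂
      (cylTangentEquiv z).toLinearMap (cylTangentEquiv z).toLinearMap

/-- The basis `(∂_t, b)` of `ℝ ⊕ V`. -/
def consBasis {ι V : Type*} [AddCommGroup V] [Module ℝ V] (b : Module.Basis ι ℝ V) :
    Module.Basis (Option ι) ℝ (ℝ × V) :=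
  ((Module.Basis.singleton Unit ℝ).prod b).reindex
    ((Equiv.sumComm Unit ι).trans (Equiv.optionEquivSumPUnit ι).symm)

/-- The orientation of the cylinder: `(∂_t, e₁, …, eₙ)` is positive if and only if
`(e₁, …, eₙ)` is. (It does not depend on the chosen positive basis of `T_x M`.) -/
def cylOrientation {ι : Type} [Fintype ι] [DecidableEq ι] (o : ManifoldOrientation E M ι)
    {J : Set ℝ} (z : J × M) : Orientation ℝ (CylTangent E z) (Option ι) :=
  have h : ∃ b : Module.Basis ι ℝ (TangentSpace 𝓘(ℝ, E) z.2), b.orientation = o.at_ z.2 := by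
    obtain ⟨U, -, hz, X, -, hX⟩ := o.exists_frame z.2
    obtain ⟨b, -, hb⟩ := hX _ hz
    exact ⟨b, hb⟩
  ((consBasis h.choose).map (cylTangentEquiv z).symm).orientation

/-- The tuple `(∂_t, e₁, …, eₙ)` at `(t, x)`, for a tuple `(e₁, …, eₙ)` at `x`. -/
def cylTuple {ι : Type} {J : Set ℝ} (t : J) (F : TangentTuple 𝓘(ℝ, E) (id : M → M) ι) :
    TangentTuple (cylModel E) (cylMap J M) (Option ι) where
  base := (t, F.base)
  vec i := (cylTangentEquiv (t, F.base)).symm (i.elim (1, 0) (fun k => (0, F.vec k)))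

variable {r s : ℕ} {J : Set ℝ}

/-- `Spin^c` structures on the oriented semi-Riemannian manifold `(M, g_t)`. -/
abbrev SpinCOn (g : MetricFamily E M r s J) (o : ManifoldOrientation E M (Fin r ⊕ Fin s))
    (t : J) : Type _ :=
  SpinCStructure (I := 𝓘(ℝ, E)) (j := (id : M → M)) (sig r s) (g.g t) o.at_

/-- `Spin^c` structures on the generalized cylinder `(J × M, dt² + g_t)`. -/
abbrev SpinCOnCyl (g : MetricFamily E M r s J)
    (o : ManifoldOrientation E M (Fin r ⊕ Fin s)) : Type _ :=
  SpinCStructure (I := cylModel E) (j := cylMap J M) (ext (sig r s)) (cylMetric g)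
    (cylOrientation o)

/-- Isomorphism classes of `Spin^c` structures on `(M, g_t)`. -/
abbrev SpinCClasses (g : MetricFamily E M r s J)
    (o : ManifoldOrientation E M (Fin r ⊕ Fin s)) (t : J) : Type _ :=
  SpinCStructure.Classes (I := 𝓘(ℝ, E)) (j := (id : M → M)) (sig r s) (g.g t) o.at_

/-- Isomorphism classes of `Spin^c` structures on the generalized cylinder. -/
abbrev SpinCClassesCyl (g : MetricFamily E M r s J)
    (o : ManifoldOrientation E M (Fin r ⊕ Fin s)) : Type _ :=
  SpinCStructure.Classes (I := cylModel E) (j := cylMap J M) (ext (sig r s)) (cylMetric g)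
    (cylOrientation o)

/-- `σ` is the restriction of `τ` to the hypersurface `{t} × M`: there is a commutative square
with vertical maps `Θ`, lower map `(e, l) ↦ ((∂_t, e), f l)` and upper map `F`, where `F` and `f`
are smooth maps of principal bundles over the inclusion `x ↦ (t, x)`, equivariant for
`Spin^c(r, s) ⊂ Spin^c(r + 1, s)` and for `S¹`. In other words, `P_{S¹} M` is the restriction of
`P_{S¹} Z`, and `P_{Spin^c} M` is the pull-back of the restriction of `P_{Spin^c} Z` under
`e ↦ (∂_t, e)`. -/
def IsRestriction {g : MetricFamily E M r s J} {o : ManifoldOrientation E M (Fin r ⊕ Fin s)}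
    (t : J) (τ : SpinCOnCyl g o) (σ : SpinCOn g o t) : Prop :=
  ∃ (F : σ.P.Total → τ.P.Total) (f : σ.L.Total → τ.L.Total),
    (∀ u, τ.P.proj (F u) = (t, σ.P.proj u)) ∧
    (∀ l, τ.L.proj (f l) = (t, σ.L.proj l)) ∧
    (∀ u a, F (σ.P.act u a) = τ.P.act (F u) (spinCIncl (sig r s) a)) ∧
    (∀ l z, f (σ.L.act l z) = τ.L.act (f l) z) ∧
    (∀ p U, σ.P.IsSmoothSection p U →
      τ.P.SmoothInto 𝓘(ℝ, E) (id : M → M) (fun x => F (p x)) U) ∧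
    (∀ l U, σ.L.IsSmoothSection l U →
      τ.L.SmoothInto 𝓘(ℝ, E) (id : M → M) (fun x => f (l x)) U) ∧
    (∀ u, τ.frame (F u) = cylTuple t (σ.frame u)) ∧
    (∀ u, τ.circle (F u) = f (σ.circle u))

/-- `τ` is the pull-back of `σ`, a `Spin^c` structure on `(M, g_{t₀})`, along the projection
`pr : J × M → M`. The total spaces of `pr^* P` and `pr^* L` are `J × P` and `J × L`. The bundle
`P_{S¹} Z` is `pr^* P_{S¹} M` (through `f`), and `P_{Spin^c} Z` is the extension of
`pr^* P_{Spin^c} M` along `Spin^c(r, s) ⊂ Spin^c(r + 1, s)` (through `F`). The map `Θ` sends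
`(t, u)` to `((∂_t, e), (t, l))`, where `l` is the circle part of `Θ u` and `e` is a frame of
`(M, g_t)`, which is the frame part of `Θ u` for `t = t₀`; by equivariance, `e` is obtained from
the frame part of `Θ u` by an isometry from `g_{t₀}` to `g_t` that depends smoothly on `(t, x)`. -/
def IsPullback {g : MetricFamily E M r s J} {o : ManifoldOrientation E M (Fin r ⊕ Fin s)}
    (t₀ : J) (σ : SpinCOn g o t₀) (τ : SpinCOnCyl g o) : Prop :=
  ∃ (F : J × σ.P.Total → τ.P.Total) (f : J × σ.L.Total → τ.L.Total),
    (∀ t u, τ.P.proj (F (t, u)) = (t, σ.P.proj u)) ∧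
    (∀ t l, τ.L.proj (f (t, l)) = (t, σ.L.proj l)) ∧
    (∀ t u a, F (t, σ.P.act u a) = τ.P.act (F (t, u)) (spinCIncl (sig r s) a)) ∧
    (∀ t l z, f (t, σ.L.act l z) = τ.L.act (f (t, l)) z) ∧
    (∀ p U, σ.P.IsSmoothSection p U →
      τ.P.SmoothInto (cylModel E) (cylMap J M) (fun z => F (z.1, p z.2)) {z | z.2 ∈ U}) ∧
    (∀ l U, σ.L.IsSmoothSection l U →
      τ.L.SmoothInto (cylModel E) (cylMap J M) (fun z => f (z.1, l z.2)) {z | z.2 ∈ U}) ∧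
    (∀ t u, ∃ e, τ.frame (F (t, u)) = cylTuple t e) ∧
    (∀ u, τ.frame (F (t₀, u)) = cylTuple t₀ (σ.frame u)) ∧
    (∀ t u, τ.circle (F (t, u)) = f (t, σ.circle u))

end Cylinder

end SpinCGeom

end

noncomputable section

namespace SpinCGeom

universe u

set_option autoImplicit false
set_option linter.all false

/-! ### The Clifford algebra of a diagonal form -/

section CliffordFacts

variable {ι : Type} [Fintype ι] {ε : ι → ℝ}

/-! A cylinder contracts onto each of its slices, so bundles over it should be determined by their
restriction. The work is to carry out this contraction smoothly, equivariantly and compatibly with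
frames, over an interval `J` that may contain its endpoints. The correspondence is the map on
isomorphism classes given by restriction; it has to be shown to exist, to be injective and to be
surjective.

Existence (`exists_restriction`). Near a slice there are smooth local sections whose frames begin
with `∂_t` (`exists_adapted_section`). Their transition functions fix the first basis vector, hence
lie in the smaller group (`exists_spinCIncl_eq`), and this cocycle glues to the restricted bundle.
Two restrictions of one structure map into it with the same image, so they are isomorphic
(`IsRestriction.unique`).

Injectivity (`IsRestriction.unique_cyl`). Two structures on the cylinder have local sections with
equal frames, so their transition functions differ by a cocycle in the central circle, the kernel of
`Spin^c → SO`. A common restriction trivialises this cocycle over the slice, and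
`exists_circle_extension` extends the trivialisation to the cylinder. The result is an equivariant
map that preserves frames, and such a map induces the isomorphism of circle bundles by itself
(`isomorphic_of_map`).

Surjectivity (`exists_pullback`). Local frames of `g t₀` extend to local orthonormal frames of all
`g t` with the same transition functions (`exists_frame_extension`); this amounts to a smooth family
of isometries from `g t₀` to `g t` that is the identity at `t₀`. The cocycle of `σ`, pulled back and
included in the larger group, together with the frames `(∂_t, e)`, is then a structure on the
cylinder that restricts to `σ`.

Both extensions are cases of `exists_transport`: instead of solving a differential equation, `t₀` is
joined to `t` by finitely many steps whose relative size is a positive smooth function on the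
cylinder. A step for circle-valued data averages locally constant extensions with a partition of
unity and divides by the modulus. A step for isometries multiplies by `(1 + Y) ^ (-1/2)`, where `1 +
Y` is the new metric in the transported frame.

The algebra behind this: `Spin^c` maps onto the isometries of positive determinant times the circle
with kernel `±1`, `Ad` has a smooth section near the identity, and `adC` and `sqC` are smooth. It
follows (`EquivariantData.toSpinC`) that smooth equivariant maps to frames and to a circle bundle
automatically form a twofold covering, so each construction only has to supply equivariant maps. -/

/-- The bilinear form `⟨v, w⟩`. -/
def ip (ε : ι → ℝ) (v w : ι → ℝ) : ℝ := ∑ i, ε i * (v i * w i)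

theorem innerSq_eq_ip (v : ι → ℝ) : innerSq ε v = ip ε v v := rfl

theorem ip_comm (v w : ι → ℝ) : ip ε v w = ip ε w v := by
  simp [ip, mul_comm]

theorem ip_add_left (v v' w : ι → ℝ) : ip ε (v + v') w = ip ε v w + ip ε v' w := by
  simp only [ip, ← Finset.sum_add_distrib, Pi.add_apply]
  exact Finset.sum_congr rfl fun _ _ => by ring

theorem ip_smul_left (c : ℝ) (v w : ι → ℝ) : ip ε (c • v) w = c * ip ε v w := by
  simp only [ip, Finset.mul_sum, Pi.smul_apply, smul_eq_mul]
  exact Finset.sum_congr rfl fun _ _ => by ring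

theorem ip_add_right (v w w' : ι → ℝ) : ip ε v (w + w') = ip ε v w + ip ε v w' := by
  rw [ip_comm, ip_add_left, ip_comm, ip_comm w']

theorem ip_smul_right (c : ℝ) (v w : ι → ℝ) : ip ε v (c • w) = c * ip ε v w := by
  rw [ip_comm, ip_smul_left, ip_comm]

theorem ip_neg_right (v w : ι → ℝ) : ip ε v (-w) = -ip ε v w := by
  rw [← neg_one_smul ℝ w, ip_smul_right]; ring

theorem ip_sub_right (v w w' : ι → ℝ) : ip ε v (w - w') = ip ε v w - ip ε v w' := by
  rw [sub_eq_add_neg, ip_add_right, ip_neg_right, sub_eq_add_neg]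

theorem ip_sub_left (v v' w : ι → ℝ) : ip ε (v - v') w = ip ε v w - ip ε v' w := by
  rw [ip_comm, ip_sub_right, ip_comm, ip_comm w v']

theorem ip_neg_left (v w : ι → ℝ) : ip ε (-v) w = -ip ε v w := by
  rw [ip_comm, ip_neg_right, ip_comm]

theorem ip_single_right [DecidableEq ι] (v : ι → ℝ) (i : ι) :
    ip ε v (Pi.single i 1) = ε i * v i := by
  simp [ip, Pi.single_apply]

theorem ip_single_left [DecidableEq ι] (v : ι → ℝ) (i : ι) :
    ip ε (Pi.single i 1) v = ε i * v i := by
  rw [ip_comm, ip_single_right]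

theorem cliffordForm_apply (v : ι → ℝ) : cliffordForm ε v = -innerSq ε v := by
  simp [cliffordForm, innerSq, QuadraticMap.weightedSumSquares_apply, Finset.sum_neg_distrib]

/-- The inclusion of vectors in the Clifford algebra. -/
abbrev gam (ε : ι → ℝ) : (ι → ℝ) →ₗ[ℝ] Cl ε := CliffordAlgebra.ι (cliffordForm ε)

theorem gam_sq (v : ι → ℝ) : gam ε v * gam ε v = algebraMap ℝ (Cl ε) (-innerSq ε v) := by
  rw [CliffordAlgebra.ι_sq_scalar, cliffordForm_apply]

theorem gam_swap (v w : ι → ℝ) :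
    gam ε v * gam ε w + gam ε w * gam ε v = algebraMap ℝ (Cl ε) (-(2 * ip ε v w)) := by
  rw [CliffordAlgebra.ι_mul_ι_add_swap, QuadraticMap.polar]
  congr 1
  simp only [cliffordForm_apply, innerSq_eq_ip, ip_add_left, ip_add_right, ip_comm w v]
  ring

/-- As `2` is invertible, the Clifford algebra is linearly isomorphic to the exterior algebra. -/
instance : Nontrivial (Cl ε) :=
  haveI : Invertible (2 : ℝ) := invertibleOfNonzero two_ne_zero
  (CliffordAlgebra.equivExterior (cliffordForm ε)).toEquiv.nontrivial

theorem algebraMap_injective' : Function.Injective (algebraMap ℝ (Cl ε)) :=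
  (algebraMap ℝ (Cl ε)).injective

/-- The anticommutator of `gam ε v` with the `i`-th basis vector is the scalar `-2 * (ε i * v i)`,
which recovers `v`. -/
theorem gam_injective (hε : ∀ i, ε i * ε i = 1) : Function.Injective (gam ε) := by
  classical
  rw [← LinearMap.ker_eq_bot, LinearMap.ker_eq_bot']
  intro v hv
  ext i
  have := gam_swap (ε := ε) v (Pi.single i 1)
  rw [hv, zero_mul, mul_zero, add_zero, ← map_zero (algebraMap ℝ (Cl ε))] at this
  have := algebraMap_injective' this
  rw [ip_single_right] at this
  have h0 : ε i ≠ 0 := fun h => by simpa [h] using hε i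
  have : ε i * v i = 0 := by linarith
  simpa [h0] using this

/-- The reflection in the hyperplane orthogonal to `u`. -/
def hypRefl (ε : ι → ℝ) (u : ι → ℝ) : (ι → ℝ) →ₗ[ℝ] (ι → ℝ) where
  toFun v := v - (2 * ip ε u v / innerSq ε u) • u
  map_add' v w := by
    simp only [ip_add_right, mul_add, add_div, add_smul]; abel
  map_smul' c v := by
    simp only [ip_smul_right, RingHom.id_apply, smul_sub, smul_smul]
    congr 2; ring

theorem hypRefl_apply (u v : ι → ℝ) :
    hypRefl ε u v = v - (2 * ip ε u v / innerSq ε u) • u := rfl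

/-- The sign cancels in products of two vectors; this is why even products act by composites of
reflections. -/
theorem gam_conj {u : ι → ℝ} (hu : innerSq ε u ≠ 0) (v : ι → ℝ) :
    gam ε u * gam ε v = -(gam ε (hypRefl ε u v) * gam ε u) := by
  have h := gam_swap (ε := ε) u v
  have h2 := gam_sq (ε := ε) u
  rw [hypRefl_apply, map_sub, map_smul, sub_mul, smul_mul_assoc, h2, Algebra.smul_def,
    ← map_mul (algebraMap ℝ (Cl ε)), neg_sub, eq_sub_of_add_eq h]
  congr 2
  field_simp

theorem ip_hypRefl {u : ι → ℝ} (hu : innerSq ε u ≠ 0) (v w : ι → ℝ) :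
    ip ε (hypRefl ε u v) (hypRefl ε u w) = ip ε v w := by
  simp only [hypRefl_apply, ip_sub_left, ip_sub_right, ip_smul_left, ip_smul_right]
  rw [← innerSq_eq_ip, ip_comm v u]
  field_simp
  ring

theorem det_hypRefl {u : ι → ℝ} (hu : innerSq ε u ≠ 0) : LinearMap.det (hypRefl ε u) = -1 := by
  -- A reflection is the transvection `v ↦ v + f v • u` with `f u = -2`, of determinant `1 + f u`.
  let f : Module.Dual ℝ (ι → ℝ) :=
    { toFun := fun v => -(2 * ip ε u v / innerSq ε u)
      map_add' := fun v w => by simp only [ip_add_right]; ring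
      map_smul' := fun c v => by simp only [ip_smul_right, RingHom.id_apply, smul_eq_mul]; ring }
  have : hypRefl ε u = LinearMap.transvection f u := by
    ext1 v
    ext i
    simp [hypRefl_apply, LinearMap.transvection, f, sub_eq_add_neg]
  rw [this, LinearMap.transvection.det]
  simp only [f, LinearMap.coe_mk, AddHom.coe_mk, ← innerSq_eq_ip]
  field_simp
  norm_num

/-- Linear isometries of `ℝⁿ`. -/
def IsIsom (ε : ι → ℝ) (T : (ι → ℝ) →ₗ[ℝ] (ι → ℝ)) : Prop :=
  ∀ v w, ip ε (T v) (T w) = ip ε v w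

theorem innerSq_ne_zero {v : ι → ℝ} (h : |innerSq ε v| = 1) : innerSq ε v ≠ 0 := by
  intro h0; simp [h0] at h

theorem IsIsom.comp {S T : (ι → ℝ) →ₗ[ℝ] (ι → ℝ)} (hS : IsIsom ε S) (hT : IsIsom ε T) :
    IsIsom ε (S ∘ₗ T) := fun v w => by simp [hS _ _, hT _ _]

/-- `x` twists vectors by `T`. -/
def Twists (x : (Cl ε)ˣ) (T : (ι → ℝ) →ₗ[ℝ] (ι → ℝ)) : Prop :=
  ∀ v, (x : Cl ε) * gam ε v = gam ε (T v) * x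

theorem Twists.mul {x y : (Cl ε)ˣ} {S T : (ι → ℝ) →ₗ[ℝ] (ι → ℝ)} (hx : Twists x S)
    (hy : Twists y T) : Twists (x * y) (S ∘ₗ T) := fun v => by
  rw [Units.val_mul, mul_assoc, hy, ← mul_assoc, hx, mul_assoc]; rfl

theorem twists_pair {v w : ι → ℝ} (hv : innerSq ε v ≠ 0) (hw : innerSq ε w ≠ 0) {x : (Cl ε)ˣ}
    (hx : (x : Cl ε) = gam ε v * gam ε w) : Twists x (hypRefl ε v ∘ₗ hypRefl ε w) := fun a => by
  rw [hx, mul_assoc, gam_conj hw, mul_neg, ← mul_assoc, gam_conj hv, neg_mul, neg_neg, mul_assoc]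
  rfl

/-- `Ad` is built from an arbitrary left inverse of `gam`, so it is under control only once `x v
x⁻¹` is known to be a vector. Induction over the generators produces that vector map together with
its isometry property and its determinant. -/
theorem exists_twists {x : (Cl ε)ˣ} (hx : x ∈ spin ε) :
    ∃ T, Twists x T ∧ IsIsom ε T ∧ LinearMap.det T = 1 := by
  induction hx using Subgroup.closure_induction with
  | mem x hx =>
    obtain ⟨v, w, hv, hw, hvw⟩ := hx
    have hv' := innerSq_ne_zero hv
    have hw' := innerSq_ne_zero hw
    refine ⟨_, twists_pair hv' hw' hvw, IsIsom.comp (ip_hypRefl hv') (ip_hypRefl hw'), ?_⟩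
    rw [LinearMap.det_comp, det_hypRefl hv', det_hypRefl hw']; norm_num
  | one => exact ⟨LinearMap.id, fun v => by simp, fun v w => rfl, LinearMap.det_id⟩
  | mul x y _ _ hx hy =>
    obtain ⟨S, h1, h2, h3⟩ := hx
    obtain ⟨T, h4, h5, h6⟩ := hy
    exact ⟨_, h1.mul h4, h2.comp h5, by rw [LinearMap.det_comp, h3, h6, one_mul]⟩
  | inv x _ hx =>
    classical
    obtain ⟨T, h1, h2, h3⟩ := hx
    let e := LinearEquiv.ofIsUnitDet (f := T) (v := Pi.basisFun ℝ ι) (v' := Pi.basisFun ℝ ι)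
      (by rw [LinearMap.det_toMatrix, h3]; exact isUnit_one)
    have he : ∀ v, T (e.symm v) = v := e.apply_symm_apply
    refine ⟨e.symm, fun v => ?_, fun v w => ?_, ?_⟩
    · have := h1 (e.symm v)
      rw [he] at this
      rw [Units.inv_mul_eq_iff_eq_mul, ← mul_assoc, LinearEquiv.coe_coe, this, mul_assoc,
        Units.mul_inv, mul_one]
    · rw [← h2]; simp [he]
    · have : LinearMap.det (T ∘ₗ (e.symm : (ι → ℝ) →ₗ[ℝ] (ι → ℝ))) = 1 := by
        have : T ∘ₗ (e.symm : (ι → ℝ) →ₗ[ℝ] (ι → ℝ)) = LinearMap.id := by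
          ext1 v; ext1; simp [he]
        rw [this, LinearMap.det_id]
      rwa [LinearMap.det_comp, h3, one_mul] at this

theorem Twists.ad_eq (hε : ∀ i, ε i * ε i = 1) {x : spin ε} {T : (ι → ℝ) →ₗ[ℝ] (ι → ℝ)}
    (h : Twists (x : (Cl ε)ˣ) T) : Ad x = T := by
  ext1 v
  ext1
  have h1 : (x : (Cl ε)ˣ) * gam ε v * (((x : (Cl ε)ˣ)⁻¹ : (Cl ε)ˣ) : Cl ε) = gam ε (T v) := by
    rw [h, mul_assoc, Units.mul_inv, mul_one]
  simp only [Ad, LinearMap.comp_apply, LinearMap.mulRight_apply, LinearMap.mulLeft_apply]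
  rw [h1, LinearMap.leftInverse_apply_of_inj (LinearMap.ker_eq_bot.2 (gam_injective hε))]

theorem ad_twists (hε : ∀ i, ε i * ε i = 1) (x : spin ε) : Twists (x : (Cl ε)ˣ) (Ad x) := by
  obtain ⟨T, h, -⟩ := exists_twists x.2
  rwa [h.ad_eq hε]

theorem isIsom_ad (hε : ∀ i, ε i * ε i = 1) (x : spin ε) : IsIsom ε (Ad x) := by
  obtain ⟨T, h, h', -⟩ := exists_twists x.2
  rwa [h.ad_eq hε]

theorem det_ad (hε : ∀ i, ε i * ε i = 1) (x : spin ε) : LinearMap.det (Ad x) = 1 := by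
  obtain ⟨T, h, -, h'⟩ := exists_twists x.2
  rwa [h.ad_eq hε]

theorem ad_mul (hε : ∀ i, ε i * ε i = 1) (x y : spin ε) : Ad (x * y) = Ad x ∘ₗ Ad y :=
  Twists.ad_eq hε ((ad_twists hε x).mul (ad_twists hε y))

theorem ad_one (hε : ∀ i, ε i * ε i = 1) : Ad (1 : spin ε) = LinearMap.id :=
  Twists.ad_eq hε fun v => by simp

end CliffordFacts

/-! ### Even elements that commute with all vectors, and finite dimension of the Clifford algebra -/

section CliffordCentre

variable {ι : Type} [Fintype ι] [DecidableEq ι] {ε : ι → ℝ}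

/-- The generators of the Clifford algebra. -/
def gen (ε : ι → ℝ) (i : ι) : Cl ε := gam ε (Pi.single i 1)

theorem gen_mul_self (i : ι) : gen ε i * gen ε i = algebraMap ℝ (Cl ε) (-ε i) := by
  rw [gen, gam_sq, innerSq_eq_ip, ip_single_right, Pi.single_eq_same, mul_one]

theorem gen_mul_gen {i k : ι} (h : i ≠ k) : gen ε i * gen ε k = -(gen ε k * gen ε i) := by
  rw [eq_neg_iff_add_eq_zero, gen, gen, gam_swap, ip_single_right, Pi.single_eq_of_ne h.symm]
  simp

/-- The subalgebra generated by some of the generators. -/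
def genAlg (ε : ι → ℝ) (S : Finset ι) : Subalgebra ℝ (Cl ε) := Algebra.adjoin ℝ (gen ε '' S)

theorem gen_mem {S : Finset ι} {i : ι} (h : i ∈ S) : gen ε i ∈ genAlg ε S :=
  Algebra.subset_adjoin ⟨i, h, rfl⟩

theorem involute_mem_genAlg {S : Finset ι} {a : Cl ε} (ha : a ∈ genAlg ε S) :
    CliffordAlgebra.involute a ∈ genAlg ε S := by
  induction ha using Algebra.adjoin_induction with
  | mem x hx =>
    obtain ⟨i, hi, rfl⟩ := hx
    rw [gen, CliffordAlgebra.involute_ι]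
    exact neg_mem (gen_mem hi)
  | algebraMap r => rw [AlgHom.commutes]; exact Subalgebra.algebraMap_mem _ r
  | add x y _ _ hx hy => rw [map_add]; exact add_mem hx hy
  | mul x y _ _ hx hy => rw [map_mul]; exact mul_mem hx hy

/-- Each generator from `S` anticommutes with `gen ε k`, so moving `gen ε k` to the left changes the
sign of the odd part. -/
theorem mul_gen {S : Finset ι} {k : ι} (hk : k ∉ S) {a : Cl ε} (ha : a ∈ genAlg ε S) :
    a * gen ε k = gen ε k * CliffordAlgebra.involute a := by
  induction ha using Algebra.adjoin_induction with
  | mem x hx =>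
    obtain ⟨i, hi, rfl⟩ := hx
    rw [gen_mul_gen (by rintro rfl; exact hk hi), gen, gen, CliffordAlgebra.involute_ι, mul_neg]
  | algebraMap r => rw [AlgHom.commutes, Algebra.commutes]
  | add x y _ _ hx hy => rw [map_add, add_mul, mul_add, hx, hy]
  | mul x y _ _ hx hy => rw [map_mul, mul_assoc, hy, ← mul_assoc, hx, mul_assoc]

theorem involute_mul_gen {S : Finset ι} {k : ι} (hk : k ∉ S) {a : Cl ε} (ha : a ∈ genAlg ε S) :
    CliffordAlgebra.involute a * gen ε k = gen ε k * a := by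
  rw [mul_gen hk (involute_mem_genAlg ha), CliffordAlgebra.involute_involute]

/-- The sums `a + gen ε k * b` are closed under products: `mul_gen` moves `gen ε k` to the left, and
its square is a scalar. This serves both the computation of the centre and the finiteness of the
dimension. -/
theorem exists_decomp {S : Finset ι} {k : ι} (hk : k ∉ S) {x : Cl ε}
    (hx : x ∈ genAlg ε (insert k S)) :
    ∃ a ∈ genAlg ε S, ∃ b ∈ genAlg ε S, x = a + gen ε k * b := by
  induction hx using Algebra.adjoin_induction with
  | mem x hx =>
    obtain ⟨i, hi, rfl⟩ := hx
    rcases Finset.mem_insert.1 hi with rfl | hi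
    · exact ⟨0, zero_mem _, 1, one_mem _, by simp⟩
    · exact ⟨_, gen_mem hi, 0, zero_mem _, by simp⟩
  | algebraMap r => exact ⟨_, Subalgebra.algebraMap_mem _ r, 0, zero_mem _, by simp⟩
  | add x y _ _ hx hy =>
    obtain ⟨a, ha, b, hb, rfl⟩ := hx
    obtain ⟨c, hc, d, hd, rfl⟩ := hy
    exact ⟨_, add_mem ha hc, _, add_mem hb hd, by rw [mul_add]; abel⟩
  | mul x y _ _ hx hy =>
    obtain ⟨a, ha, b, hb, rfl⟩ := hx
    obtain ⟨c, hc, d, hd, rfl⟩ := hy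
    refine ⟨a * c + (-ε k) • (CliffordAlgebra.involute b * d),
      add_mem (mul_mem ha hc) (Subalgebra.smul_mem _ (mul_mem (involute_mem_genAlg hb) hd) _),
      CliffordAlgebra.involute a * d + b * c,
      add_mem (mul_mem (involute_mem_genAlg ha) hd) (mul_mem hb hc), ?_⟩
    have h1 : a * (gen ε k * d) = gen ε k * (CliffordAlgebra.involute a * d) := by
      rw [← mul_assoc, mul_gen hk ha, mul_assoc]
    have h2 : gen ε k * b * (gen ε k * d) = (-ε k) • (CliffordAlgebra.involute b * d) := by
      rw [mul_assoc, ← mul_assoc b, mul_gen hk hb, ← mul_assoc, ← mul_assoc, gen_mul_self,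
        Algebra.smul_def, mul_assoc]
    rw [add_mul, mul_add, mul_add, h1, h2, mul_add, mul_assoc]
    abel

theorem genAlg_empty : genAlg ε ∅ = ⊥ := by simp [genAlg]

theorem genAlg_univ : genAlg ε Finset.univ = ⊤ := by
  rw [eq_top_iff, ← CliffordAlgebra.adjoin_range_ι]
  refine Algebra.adjoin_le ?_
  rintro _ ⟨v, rfl⟩
  have : v = ∑ i, v i • (Pi.single i (1 : ℝ) : ι → ℝ) := by
    ext j; simp [Finset.sum_apply, Pi.single_apply]
  rw [this, map_sum]
  refine sum_mem fun i _ => ?_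
  rw [map_smul]
  exact Subalgebra.smul_mem _ (gen_mem (Finset.mem_univ i)) _

/-- Even elements of the Clifford algebra that commute with all vectors are scalars. -/
theorem scalar_of_commute (hε : ∀ i, ε i * ε i = 1) {x : Cl ε}
    (hx : CliffordAlgebra.involute x = x) (hc : ∀ i, x * gen ε i = gen ε i * x) :
    ∃ c : ℝ, x = algebraMap ℝ (Cl ε) c := by
  -- Generators are removed one at a time. For `x = a + e_k b` even, moving `e_k` to the left gives
  -- `x e_k = e_k (a - e_k b)`; if `x` also commutes with `e_k`, then `e_k b = 0`, because `e_k` is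
  -- invertible.
  have key : ∀ S : Finset ι, x ∈ genAlg ε S → x ∈ genAlg ε ∅ := by
    intro S
    induction S using Finset.induction_on with
    | empty => exact id
    | insert k S hk ih =>
      intro h
      obtain ⟨a, ha, b, hb, rfl⟩ := exists_decomp hk h
      have h1 : (a + gen ε k * b) * gen ε k = gen ε k * (a - gen ε k * b) := by
        conv_lhs => rw [← hx]
        rw [map_add, map_mul, gen, CliffordAlgebra.involute_ι, ← gen]
        rw [add_mul, mul_assoc, involute_mul_gen hk hb, involute_mul_gen hk ha, mul_sub, neg_mul,
          sub_eq_add_neg]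
      rw [hc, ← sub_eq_zero, ← mul_sub] at h1
      have h2 : gen ε k * b = 0 := by
        have h3 : gen ε k * (gen ε k * (2 * (gen ε k * b))) = 0 := by
          rw [show (2 : Cl ε) * (gen ε k * b) = a + gen ε k * b - (a - gen ε k * b) by
            rw [two_mul]; abel, h1, mul_zero]
        rw [← mul_assoc, gen_mul_self, ← Algebra.smul_def] at h3
        have h0 : -ε k ≠ 0 := fun h => by simpa [neg_eq_zero.1 h] using hε k
        have := (smul_eq_zero.1 h3).resolve_left h0
        rw [two_mul, ← two_smul ℝ] at this
        exact (smul_eq_zero.1 this).resolve_left two_ne_zero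
      rw [h2, add_zero] at hx hc h ⊢
      simpa [h2] using ih (by simpa [h2] using ha)
  have := key Finset.univ (by rw [genAlg_univ]; trivial)
  rw [genAlg_empty, Algebra.mem_bot] at this
  obtain ⟨c, rfl⟩ := this
  exact ⟨c, rfl⟩

end CliffordCentre

/-- By `exists_decomp`, one more generator at most doubles the dimension. -/
instance finite_cl {ι : Type} [Fintype ι] (ε : ι → ℝ) : Module.Finite ℝ (Cl ε) := by
  classical
  have : ∀ S : Finset ι, (Subalgebra.toSubmodule (genAlg ε S)).FG := by
    intro S
    induction S using Finset.induction_on with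
    | empty => rw [genAlg_empty, Algebra.toSubmodule_bot, Submodule.one_eq_span]; exact Submodule.fg_span_singleton (R := ℝ) (1 : Cl ε)
    | insert k S hk ih =>
      have h : Subalgebra.toSubmodule (genAlg ε (insert k S)) ≤ Subalgebra.toSubmodule (genAlg ε S) ⊔
          (Subalgebra.toSubmodule (genAlg ε S)).map (LinearMap.mulLeft ℝ (gen ε k)) := by
        intro x hx
        obtain ⟨a, ha, b, hb, rfl⟩ := exists_decomp hk hx
        exact Submodule.add_mem_sup ha ⟨b, hb, rfl⟩
      have := (ih.sup (ih.map (LinearMap.mulLeft ℝ (gen ε k))))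
      have := Module.Finite.iff_fg.2 this
      have := Module.Finite.of_injective (Submodule.inclusion h) (Submodule.inclusion_injective h)
      exact Module.Finite.iff_fg.1 this
  have := this Finset.univ
  rw [genAlg_univ, Algebra.top_toSubmodule] at this
  exact ⟨this⟩

/-! ### The kernel and the image of `Ad` on the spin group -/

section SpinFacts

variable {ι : Type} [Fintype ι] {ε : ι → ℝ}

theorem involute_spin (x : spin ε) :
    CliffordAlgebra.involute ((x : (Cl ε)ˣ) : Cl ε) = (x : (Cl ε)ˣ) := by
  obtain ⟨x, hx⟩ := x
  induction hx using Subgroup.closure_induction with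
  | mem x hx =>
    obtain ⟨v, w, hv, hw, hvw⟩ := hx
    simp [hvw]
  | one => simp
  | mul x y _ _ hx hy => simp only [Units.val_mul, map_mul] at *; rw [hx, hy]
  | inv x _ hx =>
    simp only at hx ⊢
    rw [← Units.mul_eq_one_iff_eq_inv]
    conv_lhs => rw [← hx]
    rw [← map_mul, Units.inv_mul, map_one]

/-- This sign is a spinor norm. Scalars of the spin group have square `s` with `s * s = 1`, which
leaves only `±1`. -/
theorem reverse_spin (x : spin ε) : ∃ s : ℝ, s * s = 1 ∧
    ((x : (Cl ε)ˣ) : Cl ε) * CliffordAlgebra.reverse ((x : (Cl ε)ˣ) : Cl ε) =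
      algebraMap ℝ (Cl ε) s := by
  obtain ⟨x, hx⟩ := x
  induction hx using Subgroup.closure_induction with
  | mem x hx =>
    obtain ⟨v, w, hv, hw, hvw⟩ := hx
    refine ⟨innerSq ε v * innerSq ε w, ?_, ?_⟩
    · rw [← abs_mul_abs_self, abs_mul, hv, hw]; norm_num
    · simp only at hvw ⊢
      rw [hvw, CliffordAlgebra.reverse.map_mul, CliffordAlgebra.reverse_ι,
        CliffordAlgebra.reverse_ι, mul_assoc, ← mul_assoc (gam ε w), gam_sq,
        Algebra.commutes, ← mul_assoc, gam_sq, ← map_mul]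
      congr 1; ring
  | one => exact ⟨1, by norm_num, by simp⟩
  | mul x y _ _ hx hy =>
    obtain ⟨s, hs, hx⟩ := hx
    obtain ⟨t, ht, hy⟩ := hy
    refine ⟨s * t, by linear_combination s * s * ht + hs, ?_⟩
    simp only at hx hy ⊢
    rw [Units.val_mul, CliffordAlgebra.reverse.map_mul, mul_assoc, ← mul_assoc (y : Cl ε), hy,
      Algebra.commutes, ← mul_assoc, hx, map_mul]
  | inv x _ hx =>
    obtain ⟨s, hs, hx⟩ := hx
    refine ⟨s, hs, ?_⟩
    simp only at hx ⊢
    have h1 : CliffordAlgebra.reverse (x : Cl ε) = (x⁻¹ : (Cl ε)ˣ) * algebraMap ℝ (Cl ε) s := by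
      rw [← hx, Units.inv_mul_cancel_left]
    have h2 : CliffordAlgebra.reverse (x : Cl ε) * CliffordAlgebra.reverse ((x⁻¹ : (Cl ε)ˣ) : Cl ε)
        = 1 := by
      rw [← CliffordAlgebra.reverse.map_mul, Units.inv_mul, CliffordAlgebra.reverse.map_one]
    rw [h1, ← Algebra.commutes, mul_assoc] at h2
    have h3 := congrArg (algebraMap ℝ (Cl ε) s * ·) h2
    simp only [← mul_assoc, ← map_mul, hs, map_one, one_mul, mul_one] at h3
    exact h3

theorem eq_one_or_neg_one_of_scalar {x : spin ε} {c : ℝ}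
    (h : ((x : (Cl ε)ˣ) : Cl ε) = algebraMap ℝ (Cl ε) c) : c = 1 ∨ c = -1 := by
  obtain ⟨s, hs, hx⟩ := reverse_spin x
  rw [h, CliffordAlgebra.reverse.commutes, ← map_mul] at hx
  have := algebraMap_injective' hx
  have h1 : c * c = 1 := by
    have h4 : (c * c) * (c * c) = 1 := by rw [this, hs]
    nlinarith [mul_self_nonneg c]
  exact mul_self_eq_one_iff.1 h1

theorem ad_eq_id (hε : ∀ i, ε i * ε i = 1) {x : spin ε} (h : Ad x = LinearMap.id) :
    ((x : (Cl ε)ˣ) : Cl ε) = 1 ∨ ((x : (Cl ε)ˣ) : Cl ε) = -1 := by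
  classical
  obtain ⟨c, hc⟩ := scalar_of_commute hε (involute_spin x) (fun i => by
    have := ad_twists hε x (Pi.single i 1)
    rwa [h] at this)
  rcases eq_one_or_neg_one_of_scalar hc with rfl | rfl
  · left; simpa using hc
  · right; simpa using hc

theorem ad_inv' (hε : ∀ i, ε i * ε i = 1) (x : spin ε) : Ad x⁻¹ ∘ₗ Ad x = LinearMap.id := by
  rw [← ad_mul hε, inv_mul_cancel, ad_one hε]

theorem eq_or_eq_neg_of_ad_eq (hε : ∀ i, ε i * ε i = 1) {x y : spin ε} (h : Ad x = Ad y) :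
    ((x : (Cl ε)ˣ) : Cl ε) = ((y : (Cl ε)ˣ) : Cl ε) ∨
      ((x : (Cl ε)ˣ) : Cl ε) = -((y : (Cl ε)ˣ) : Cl ε) := by
  have : Ad (y⁻¹ * x) = LinearMap.id := by rw [ad_mul hε, h, ad_inv' hε]
  have h2 : ((x : (Cl ε)ˣ) : Cl ε) =
      ((y : (Cl ε)ˣ) : Cl ε) * (((y⁻¹ * x : spin ε) : (Cl ε)ˣ) : Cl ε) := by
    simp
  rcases ad_eq_id hε this with h1 | h1
  · left; rw [h2, h1, mul_one]
  · right; rw [h2, h1, mul_neg, mul_one]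

/-! ### Reflections and surjectivity -/

theorem isUnit_gam {v : ι → ℝ} (hv : innerSq ε v ≠ 0) : IsUnit (gam ε v) :=
  CliffordAlgebra.isUnit_ι_of_isUnit (cliffordForm ε) (by
    rw [cliffordForm_apply]; exact (neg_ne_zero.2 hv).isUnit)

/-- The product of two unit vectors, as an element of the spin group. -/
def spinPair (v w : ι → ℝ) (hv : |innerSq ε v| = 1) (hw : |innerSq ε w| = 1) : spin ε :=
  ⟨(isUnit_gam (innerSq_ne_zero hv)).unit * (isUnit_gam (innerSq_ne_zero hw)).unit,
    Subgroup.subset_closure ⟨v, w, hv, hw, rfl⟩⟩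

theorem spinPair_val (v w : ι → ℝ) (hv : |innerSq ε v| = 1) (hw : |innerSq ε w| = 1) :
    ((spinPair v w hv hw : (Cl ε)ˣ) : Cl ε) = gam ε v * gam ε w := rfl

theorem ad_spinPair (hε : ∀ i, ε i * ε i = 1) (v w : ι → ℝ) (hv : |innerSq ε v| = 1)
    (hw : |innerSq ε w| = 1) : Ad (spinPair v w hv hw) = hypRefl ε v ∘ₗ hypRefl ε w :=
  Twists.ad_eq hε (twists_pair (innerSq_ne_zero hv) (innerSq_ne_zero hw) rfl)

theorem innerSq_smul (c : ℝ) (v : ι → ℝ) : innerSq ε (c • v) = c * c * innerSq ε v := by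
  rw [innerSq_eq_ip, ip_smul_left, ip_smul_right, innerSq_eq_ip, mul_assoc]

theorem hypRefl_smul {c : ℝ} (hc : c ≠ 0) (u : ι → ℝ) : hypRefl ε (c • u) = hypRefl ε u := by
  apply LinearMap.ext
  intro v
  rw [hypRefl_apply, hypRefl_apply, ip_smul_left, innerSq_smul, smul_smul]
  congr 2
  field_simp

theorem exists_unit_smul {v : ι → ℝ} (hv : innerSq ε v ≠ 0) :
    ∃ c : ℝ, c ≠ 0 ∧ |innerSq ε (c • v)| = 1 := by
  have h0 : 0 < |innerSq ε v| := abs_pos.2 hv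
  refine ⟨(√|innerSq ε v|)⁻¹, inv_ne_zero (Real.sqrt_pos.2 h0).ne', ?_⟩
  rw [innerSq_smul, abs_mul, abs_mul_self, ← mul_inv, Real.mul_self_sqrt h0.le,
    inv_mul_cancel₀ h0.ne']

theorem hypRefl_comp_self {u : ι → ℝ} (hu : innerSq ε u ≠ 0) :
    hypRefl ε u ∘ₗ hypRefl ε u = LinearMap.id := by
  apply LinearMap.ext
  intro v
  rw [LinearMap.comp_apply, hypRefl_apply, hypRefl_apply, ip_sub_right, ip_smul_right,
    ← innerSq_eq_ip, LinearMap.id_apply, sub_sub, ← add_smul]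
  have : 2 * ip ε u v / innerSq ε u +
    2 * (ip ε u v - 2 * ip ε u v / innerSq ε u * innerSq ε u) / innerSq ε u = 0 := by
    field_simp; ring
  rw [this, zero_smul, sub_zero]

theorem hypRefl_sub {a b : ι → ℝ} (h : innerSq ε a = innerSq ε b) (hu : innerSq ε (a - b) ≠ 0) :
    hypRefl ε (a - b) a = b := by
  have h1 : innerSq ε (a - b) = 2 * ip ε (a - b) a := by
    rw [innerSq_eq_ip, innerSq_eq_ip] at h
    rw [innerSq_eq_ip, ip_sub_right, ip_sub_left, ip_sub_left, ← h, ip_comm b a]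
    ring
  rw [hypRefl_apply, ← h1, div_self hu, one_smul, sub_sub_cancel]

theorem hypRefl_fix {u v : ι → ℝ} (h : ip ε u v = 0) : hypRefl ε u v = v := by
  rw [hypRefl_apply, h]; simp

/-- A product of an even or odd number of reflections. -/
def IsReflProd (T : (ι → ℝ) →ₗ[ℝ] (ι → ℝ)) : Prop :=
  ∃ x : spin ε, T = Ad x ∨ ∃ v, |innerSq ε v| = 1 ∧ T = hypRefl ε v ∘ₗ Ad x

/-- Reflections are involutions, so undoing one exchanges the even and the odd case; `u` is rescaled
to a unit vector to get an element of the spin group. -/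
theorem IsReflProd.hypRefl_comp (hε : ∀ i, ε i * ε i = 1) {T : (ι → ℝ) →ₗ[ℝ] (ι → ℝ)} {u : ι → ℝ}
    (hu : innerSq ε u ≠ 0) (h : IsReflProd (ε := ε) (hypRefl ε u ∘ₗ T)) :
    IsReflProd (ε := ε) T := by
  obtain ⟨c, hc, hcu⟩ := exists_unit_smul hu
  have hT : T = hypRefl ε (c • u) ∘ₗ (hypRefl ε u ∘ₗ T) := by
    rw [hypRefl_smul hc, ← LinearMap.comp_assoc, hypRefl_comp_self hu, LinearMap.id_comp]
  obtain ⟨x, h | ⟨v, hv, h⟩⟩ := h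
  · exact ⟨x, Or.inr ⟨_, hcu, by rw [← h]; exact hT⟩⟩
  · refine ⟨spinPair _ v hcu hv * x, Or.inl ?_⟩
    rw [ad_mul hε, ad_spinPair hε, LinearMap.comp_assoc, ← h]; exact hT

theorem isIsom_hypRefl {u : ι → ℝ} (hu : innerSq ε u ≠ 0) : IsIsom ε (hypRefl ε u) :=
  ip_hypRefl hu

theorem innerSq_single [DecidableEq ι] (k : ι) : innerSq ε (Pi.single k 1) = ε k := by
  rw [innerSq_eq_ip, ip_single_right]; simp

theorem ip_single_single [DecidableEq ι] {i k : ι} (h : i ≠ k) :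
    ip ε (Pi.single i 1) (Pi.single k 1) = 0 := by
  rw [ip_single_right, Pi.single_eq_of_ne h.symm, mul_zero]

theorem eq_id_of_fix [DecidableEq ι] {T : (ι → ℝ) →ₗ[ℝ] (ι → ℝ)}
    (h : ∀ i, T (Pi.single i 1) = Pi.single i 1) : T = LinearMap.id :=
  (Pi.basisFun ℝ ι).ext fun i => by simp [Pi.basisFun_apply, h i]

/-- Cartan–Dieudonné, by induction on a set `S` of basis vectors outside of which `T` fixes the
basis. The reflection in `T e_k - e_k` takes `T e_k` back to `e_k` and does not disturb the basis
vectors already fixed. If that vector is isotropic, the reflection in `T e_k + e_k` followed by the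
one in `e_k` does the same. -/
theorem isReflProd_of_isIsom (hε : ∀ i, ε i * ε i = 1) {T : (ι → ℝ) →ₗ[ℝ] (ι → ℝ)}
    (hT : IsIsom ε T) : IsReflProd (ε := ε) T := by
  classical
  have hε0 : ∀ k, ε k ≠ 0 := fun k h => by simpa [h] using hε k
  have key : ∀ (S : Finset ι) (T : (ι → ℝ) →ₗ[ℝ] (ι → ℝ)), IsIsom ε T →
      (∀ i ∉ S, T (Pi.single i 1) = Pi.single i 1) → IsReflProd (ε := ε) T := by
    intro S
    induction S using Finset.induction_on with
    | empty =>
      intro T _ h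
      exact ⟨1, Or.inl (by rw [ad_one hε]; exact eq_id_of_fix fun i => h i (by simp))⟩
    | insert k S hk ih =>
      intro T hT h
      have hq : innerSq ε (T (Pi.single k 1)) = innerSq ε (Pi.single k 1) := hT _ _
      have horth : ∀ i, i ∉ insert k S → ip ε (T (Pi.single k 1)) (Pi.single i 1) = 0 ∧
          ip ε (Pi.single k 1) (Pi.single i 1) = 0 := by
        intro i hi
        have hik : k ≠ i := by rintro rfl; simp at hi
        refine ⟨?_, ip_single_single hik⟩
        rw [← h i hi, hT, ip_single_single hik]
      by_cases hm : innerSq ε (T (Pi.single k 1) - Pi.single k 1) = 0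
      -- The squares of `T e_k - e_k` and `T e_k + e_k` add up to `4 * ε k`, so they do not both
      -- vanish.
      · have hp : innerSq ε (T (Pi.single k 1) - -Pi.single k 1) ≠ 0 := by
          intro hp
          apply hε0 k
          rw [← innerSq_single (ε := ε) k]
          simp only [innerSq_eq_ip, ip_sub_left, ip_sub_right, ip_neg_left, ip_neg_right] at hm hp hq ⊢
          linarith
        have hq' : innerSq ε (T (Pi.single k 1)) = innerSq ε (-Pi.single k 1) := by
          rw [hq]; simp [innerSq_eq_ip, ip_neg_left, ip_neg_right]
        have he : innerSq ε (Pi.single k 1) ≠ 0 := by rw [innerSq_single]; exact hε0 k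
        refine IsReflProd.hypRefl_comp hε hp (IsReflProd.hypRefl_comp hε he (ih _ ?_ ?_))
        · exact (isIsom_hypRefl he).comp ((isIsom_hypRefl hp).comp hT)
        · intro i hi
          simp only [LinearMap.comp_apply]
          by_cases hik : i = k
          · subst hik
            rw [hypRefl_sub hq' hp, map_neg, hypRefl_apply, ← innerSq_eq_ip, mul_div_assoc,
              div_self he, mul_one, two_smul]
            abel
          · have hi' : i ∉ insert k S := by simp [hik, hi]
            rw [h i hi', hypRefl_fix (u := T _ - -_), hypRefl_fix (horth i hi').2]
            rw [ip_sub_left, ip_neg_left, (horth i hi').1, (horth i hi').2]; simp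
      · refine IsReflProd.hypRefl_comp hε hm (ih _ ((isIsom_hypRefl hm).comp hT) ?_)
        intro i hi
        simp only [LinearMap.comp_apply]
        by_cases hik : i = k
        · subst hik; rw [hypRefl_sub hq hm]
        · have hi' : i ∉ insert k S := by simp [hik, hi]
          rw [h i hi', hypRefl_fix]
          rw [ip_sub_left, (horth i hi').1, (horth i hi').2]; simp
  exact key Finset.univ T hT (by simp)

/-- Isometries of determinant `1` are in the image of the spin group. -/
theorem exists_ad_eq (hε : ∀ i, ε i * ε i = 1) {T : (ι → ℝ) →ₗ[ℝ] (ι → ℝ)} (hT : IsIsom ε T)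
    (hd : 0 < LinearMap.det T) : ∃ x : spin ε, Ad x = T := by
  obtain ⟨x, h | ⟨v, hv, h⟩⟩ := isReflProd_of_isIsom hε hT
  · exact ⟨x, h.symm⟩
  · rw [h, LinearMap.det_comp, det_hypRefl (innerSq_ne_zero hv), det_ad hε] at hd
    norm_num at hd

end SpinFacts

/-! ### Smoothness in an algebra without norm, tested by linear functionals -/

section Functionals

/-- Linear functionals on products in terms of coordinates. -/
theorem functional_mul {A : Type*} [Ring A] [Algebra ℝ A] [Module.Finite ℝ A]
    (φ : A →ₗ[ℝ] ℝ) (x y : A) :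
    φ (x * y) = ∑ i, ∑ k, (Module.finBasis ℝ A).coord i x * ((Module.finBasis ℝ A).coord k y *
      φ (Module.finBasis ℝ A i * Module.finBasis ℝ A k)) := by
  conv_lhs => rw [← (Module.finBasis ℝ A).sum_repr x, ← (Module.finBasis ℝ A).sum_repr y]
  rw [Finset.sum_mul, map_sum]
  refine Finset.sum_congr rfl fun i _ => ?_
  rw [Finset.mul_sum, map_sum]
  refine Finset.sum_congr rfl fun k _ => ?_
  rw [smul_mul_assoc, mul_smul_comm, map_smul, map_smul]
  rfl

theorem contDiffAt_functional_mul {A : Type*} [Ring A] [Algebra ℝ A] [Module.Finite ℝ A]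
    {X : Type*} [NormedAddCommGroup X] [NormedSpace ℝ X] {f g : X → A} {x : X}
    (hf : ∀ φ : A →ₗ[ℝ] ℝ, ContDiffAt ℝ ∞ (fun y => φ (f y)) x)
    (hg : ∀ φ : A →ₗ[ℝ] ℝ, ContDiffAt ℝ ∞ (fun y => φ (g y)) x) (φ : A →ₗ[ℝ] ℝ) :
    ContDiffAt ℝ ∞ (fun y => φ (f y * g y)) x := by
  rw [show (fun y => φ (f y * g y)) = _ from funext fun y => functional_mul φ (f y) (g y)]
  exact ContDiffAt.sum fun i _ => ContDiffAt.sum fun k _ =>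
    (hf _).mul ((hg _).mul contDiffAt_const)

end Functionals

/-! ### A smooth local section of `Ad` -/

section LocalSection

variable {ι : Type} [Fintype ι] [DecidableEq ι] {ε : ι → ℝ}

/-- The scalar normalises `w + e_k`; its sign makes the product with `e_k` equal to `1` at `w =
e_k`, see `rot_self`. -/
theorem rot_unit (hε : ∀ i, ε i * ε i = 1) (k : ι) {w : ι → ℝ}
    (h : 0 < ε k * innerSq ε (w + Pi.single k 1)) :
    |innerSq ε ((-(ε k / √(ε k * innerSq ε (w + Pi.single k 1)))) • (w + Pi.single k 1))| = 1 := by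
  set q := innerSq ε (w + Pi.single k 1)
  have hk : |ε k| = 1 := by
    rcases mul_self_eq_one_iff.1 (hε k) with h | h <;> simp [h]
  have hq : ε k * q = |q| := by rw [← abs_of_pos h, abs_mul, hk, one_mul]
  have h0 : 0 < |q| := hq ▸ h
  rw [innerSq_smul, abs_mul, abs_mul_self, neg_mul_neg, div_mul_div_comm, hε,
    Real.mul_self_sqrt h.le, hq]
  exact one_div_mul_cancel h0.ne'

theorem abs_innerSq_single (hε : ∀ i, ε i * ε i = 1) (k : ι) :
    |innerSq ε (Pi.single k 1)| = 1 := by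
  rw [innerSq_single]
  rcases mul_self_eq_one_iff.1 (hε k) with h | h <;> simp [h]

open Classical in
/-- An element of the spin group that rotates the `k`-th basis vector to the unit vector `w`, given
by an explicit formula for `w` near the basis vector. -/
def rot (hε : ∀ i, ε i * ε i = 1) (k : ι) (w : ι → ℝ) : spin ε :=
  if h : 0 < ε k * innerSq ε (w + Pi.single k 1) then
    spinPair _ (Pi.single k 1) (rot_unit hε k h) (abs_innerSq_single hε k)
  else 1

theorem rot_val (hε : ∀ i, ε i * ε i = 1) (k : ι) {w : ι → ℝ}
    (h : 0 < ε k * innerSq ε (w + Pi.single k 1)) : ((rot hε k w : (Cl ε)ˣ) : Cl ε) =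
      (-(ε k / √(ε k * innerSq ε (w + Pi.single k 1)))) •
        (gam ε (w + Pi.single k 1) * gam ε (Pi.single k 1)) := by
  rw [rot, dif_pos h, spinPair_val, map_smul, smul_mul_assoc]

theorem ad_rot (hε : ∀ i, ε i * ε i = 1) (k : ι) {w : ι → ℝ}
    (h : 0 < ε k * innerSq ε (w + Pi.single k 1)) : Ad (rot hε k w) =
      hypRefl ε (w + Pi.single k 1) ∘ₗ hypRefl ε (Pi.single k 1) := by
  rw [rot, dif_pos h, ad_spinPair hε, hypRefl_smul]
  rw [neg_ne_zero]
  have : ε k ≠ 0 := fun h => by simpa [h] using hε k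
  exact div_ne_zero this (Real.sqrt_pos.2 h).ne'

theorem hypRefl_single (hε : ∀ i, ε i * ε i = 1) (k : ι) :
    hypRefl ε (Pi.single k 1) (Pi.single k 1) = -Pi.single k 1 := by
  have he : innerSq ε (Pi.single k 1) ≠ 0 := innerSq_ne_zero (abs_innerSq_single hε k)
  rw [hypRefl_apply, ← innerSq_eq_ip, mul_div_assoc, div_self he, mul_one, two_smul]
  abel

/-- The reflection in `e_k` gives `-e_k`, and the reflection in `w + e_k = w - (-e_k)` exchanges
`-e_k` and `w`. -/
theorem ad_rot_single (hε : ∀ i, ε i * ε i = 1) (k : ι) {w : ι → ℝ} (hw : innerSq ε w = ε k)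
    (h : 0 < ε k * innerSq ε (w + Pi.single k 1)) : Ad (rot hε k w) (Pi.single k 1) = w := by
  have hq : innerSq ε (w + Pi.single k 1) ≠ 0 := fun h0 => by simp [h0] at h
  have hq' : innerSq ε (w - -Pi.single k 1) ≠ 0 := by rwa [sub_neg_eq_add]
  have h1 : innerSq ε w = innerSq ε (-Pi.single k 1) := by
    rw [hw, ← neg_one_smul ℝ (Pi.single k 1 : ι → ℝ), innerSq_smul, innerSq_single]; ring
  have h2 := hypRefl_sub h1 hq'
  rw [sub_neg_eq_add] at h2
  rw [ad_rot hε k h, LinearMap.comp_apply, hypRefl_single hε, ← h2]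
  exact LinearMap.congr_fun (hypRefl_comp_self hq) w

theorem innerSq_double (hε : ∀ i, ε i * ε i = 1) (k : ι) :
    ε k * innerSq ε (Pi.single k 1 + Pi.single k 1) = 4 := by
  rw [← two_smul ℝ (Pi.single k 1 : ι → ℝ), innerSq_smul, innerSq_single]
  linear_combination 4 * hε k

theorem rot_self (hε : ∀ i, ε i * ε i = 1) (k : ι) : rot hε k (Pi.single k 1) = 1 := by
  have h : 0 < ε k * innerSq ε (Pi.single k 1 + Pi.single k 1) := by
    rw [innerSq_double hε]; norm_num
  apply Subtype.ext
  apply Units.ext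
  rw [rot_val hε k h, innerSq_double hε, ← two_smul ℝ (Pi.single k 1 : ι → ℝ), map_smul,
    smul_mul_assoc, smul_smul, gam_sq, innerSq_single, Algebra.smul_def, ← map_mul]
  have h4 : √(4 : ℝ) = 2 := by
    rw [show (4 : ℝ) = 2 ^ 2 by norm_num]; exact Real.sqrt_sq two_pos.le
  rw [h4, show -(ε k / 2) * 2 * -ε k = 1 by linear_combination hε k, map_one]
  rfl

omit [DecidableEq ι] in
theorem contDiff_innerSq : ContDiff ℝ ∞ (innerSq ε) := by
  unfold innerSq
  fun_prop

theorem contDiffAt_rot (hε : ∀ i, ε i * ε i = 1) (k : ι) {w : ι → ℝ}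
    (h : 0 < ε k * innerSq ε (w + Pi.single k 1)) (φ : Cl ε →ₗ[ℝ] ℝ) :
    ContDiffAt ℝ ∞ (fun w => φ (rot hε k w : (Cl ε)ˣ)) w := by
  have hq : ContDiff ℝ ∞ fun w => ε k * innerSq ε (w + Pi.single k 1) :=
    contDiff_const.mul (contDiff_innerSq.comp (contDiff_id.add contDiff_const))
  have hev : ∀ᶠ w' in nhds w, 0 < ε k * innerSq ε (w' + Pi.single k 1) :=
    (hq.continuous.isOpen_preimage _ isOpen_Ioi).mem_nhds h
  let ψ : (ι → ℝ) →ₗ[ℝ] ℝ := φ ∘ₗ LinearMap.mulRight ℝ (gam ε (Pi.single k 1)) ∘ₗ gam ε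
  have hψ : ContDiff ℝ ∞ ψ := ψ.toContinuousLinearMap.contDiff
  have h2 : ContDiffAt ℝ ∞ (fun w => (-(ε k / √(ε k * innerSq ε (w + Pi.single k 1)))) *
      ψ (w + Pi.single k 1)) w := by
    refine ContDiffAt.mul (ContDiffAt.neg (contDiffAt_const.div
      (hq.contDiffAt.sqrt h.ne') (Real.sqrt_pos.2 h).ne')) ?_
    exact (hψ.comp (contDiff_id.add contDiff_const)).contDiffAt
  refine h2.congr_of_eventuallyEq ?_
  filter_upwards [hev] with w' hw'
  rw [rot_val hε k hw', map_smul, smul_eq_mul]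
  rfl

/-- The reflection as a continuous linear map. -/
def hypReflL (ε : ι → ℝ) (u : ι → ℝ) : (ι → ℝ) →L[ℝ] (ι → ℝ) :=
  (hypRefl ε u).toContinuousLinearMap

omit [DecidableEq ι] in
theorem contDiffAt_hypReflL {u : ι → ℝ} (hu : innerSq ε u ≠ 0) :
    ContDiffAt ℝ ∞ (hypReflL ε) u := by
  have : ∀ u, hypReflL ε u = ContinuousLinearMap.id ℝ _ -
      (2 / innerSq ε u) • ∑ i, (ε i * u i) • (ContinuousLinearMap.proj (R := ℝ) i).smulRight u := by
    intro u
    ext v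
    simp only [hypReflL, LinearMap.coe_toContinuousLinearMap', hypRefl_apply, ip, Pi.sub_apply,
      Pi.smul_apply, smul_eq_mul, sub_apply, ContinuousLinearMap.id_apply,
      smul_apply, sum_apply, Finset.sum_apply,
      ContinuousLinearMap.smulRight_apply, ContinuousLinearMap.proj_apply, Finset.mul_sum,
      Finset.sum_mul, Finset.sum_div]
    congr 1
    exact Finset.sum_congr rfl fun i _ => by ring
  rw [show hypReflL ε = _ from funext this]
  refine contDiffAt_const.sub (ContDiffAt.fun_smul (contDiffAt_const.div
    contDiff_innerSq.contDiffAt hu) (ContDiffAt.sum fun i _ => ContDiffAt.fun_smul ?_ ?_))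
  · fun_prop
  · exact (contDiff_const.smulRight contDiff_id).contDiffAt

/-- Near the identity, the map `Ad` onto the isometries has a smooth section. -/
theorem exists_smooth_section (hε : ∀ i, ε i * ε i = 1) :
    ∃ c : ((ι → ℝ) →L[ℝ] (ι → ℝ)) → spin ε, c 1 = 1 ∧ ∀ᶠ T in nhds 1,
      (∀ φ : Cl ε →ₗ[ℝ] ℝ, ContDiffAt ℝ ∞ (fun T => φ (c T : (Cl ε)ˣ)) T) ∧
      (IsIsom ε (T : (ι → ℝ) →ₗ[ℝ] (ι → ℝ)) → Ad (c T) = T) := by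
  suffices key : ∀ S : Finset ι, ∃ c : ((ι → ℝ) →L[ℝ] (ι → ℝ)) → spin ε, c 1 = 1 ∧
      ∀ᶠ T in nhds 1, (∀ φ : Cl ε →ₗ[ℝ] ℝ, ContDiffAt ℝ ∞ (fun T => φ (c T : (Cl ε)ˣ)) T) ∧
      (IsIsom ε (T : (ι → ℝ) →ₗ[ℝ] (ι → ℝ)) → (∀ i ∉ S, T (Pi.single i 1) = Pi.single i 1) →
        Ad (c T) = T) by
    obtain ⟨c, h1, h2⟩ := key Finset.univ
    exact ⟨c, h1, h2.mono fun T hT => ⟨hT.1, fun h => hT.2 h (by simp)⟩⟩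
  intro S
  induction S using Finset.induction_on with
  | empty =>
    refine ⟨fun _ => 1, rfl, Filter.Eventually.of_forall fun T => ⟨fun φ => contDiffAt_const,
      fun _ h => ?_⟩⟩
    rw [ad_one hε]
    exact (eq_id_of_fix fun i => h i (by simp)).symm
  | insert k S hk ih =>
    obtain ⟨c, hc1, hc⟩ := ih
    let m : ((ι → ℝ) →L[ℝ] (ι → ℝ)) → (ι → ℝ) := fun T => T (Pi.single k 1) + Pi.single k 1
    have hap : ContDiff ℝ ∞ fun T : (ι → ℝ) →L[ℝ] (ι → ℝ) => T (Pi.single k 1) :=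
      contDiff_id.clm_apply contDiff_const
    have hm : ContDiff ℝ ∞ m := hap.add contDiff_const
    let R := hypReflL ε (Pi.single k 1)
    -- `T'` is `T` with the rotation of `e_k` to `T e_k` undone. For an isometry `T` it fixes `e_k`
    -- as well as the vectors that `T` already fixes, and `T = Ad (rot ..) ∘ T'`.
    let T' : ((ι → ℝ) →L[ℝ] (ι → ℝ)) → ((ι → ℝ) →L[ℝ] (ι → ℝ)) := fun T =>
      R ∘L (hypReflL ε (m T) ∘L T)
    have he : innerSq ε (Pi.single k 1) ≠ 0 := innerSq_ne_zero (abs_innerSq_single hε k)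
    -- At `T = 1` the mirror vector is `2 e_k`, so the two reflections agree and cancel. Hence `T'`
    -- is near `1` when `T` is, and the section of the induction hypothesis applies to it.
    have hT1 : T' 1 = 1 := by
      have h2 : m 1 = (2 : ℝ) • Pi.single k 1 := by simp [m, two_smul]
      apply ContinuousLinearMap.ext
      intro v
      simp only [T', R, h2, hypReflL, hypRefl_smul (two_ne_zero)]
      exact LinearMap.congr_fun (hypRefl_comp_self he) v
    have hpos : ∀ᶠ T in nhds (1 : (ι → ℝ) →L[ℝ] (ι → ℝ)), 0 < ε k * innerSq ε (m T) := by
      have : Continuous fun T => ε k * innerSq ε (m T) :=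
        continuous_const.mul (contDiff_innerSq.continuous.comp hm.continuous)
      refine (this.isOpen_preimage _ isOpen_Ioi).mem_nhds ?_
      change 0 < ε k * innerSq ε (Pi.single k 1 + Pi.single k 1)
      rw [innerSq_double hε]; norm_num
    have hsm : ∀ T, 0 < ε k * innerSq ε (m T) → ContDiffAt ℝ ∞ T' T := by
      intro T h
      have hq : innerSq ε (m T) ≠ 0 := fun h0 => by simp [h0] at h
      exact contDiffAt_const.clm_comp
        (((contDiffAt_hypReflL hq).comp T hm.contDiffAt).clm_comp contDiffAt_id)
    have hT'c : Filter.Tendsto T' (nhds 1) (nhds 1) := by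
      have := (hsm 1 hpos.self_of_nhds).continuousAt.tendsto
      rwa [hT1] at this
    refine ⟨fun T => rot hε k (T (Pi.single k 1)) * c (T' T), ?_, ?_⟩
    · change rot hε k _ * c (T' 1) = 1
      rw [hT1, hc1, mul_one]; exact rot_self hε k
    · filter_upwards [hpos, hT'c.eventually hc] with T hT hcT
      refine ⟨?_, fun hiso hfix => ?_⟩
      · refine contDiffAt_functional_mul (fun φ => ?_) (fun φ => ?_)
        · exact ContDiffAt.comp (g := fun w => φ (rot hε k w : (Cl ε)ˣ)) T
            (contDiffAt_rot hε k hT φ) hap.contDiffAt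
        · exact ContDiffAt.comp (g := fun T => φ (c T : (Cl ε)ˣ)) T (hcT.1 φ) (hsm T hT)
      · have hq : innerSq ε (m T) ≠ 0 := fun h0 => by simp [h0] at hT
        have hw : innerSq ε (T (Pi.single k 1)) = ε k := by
          rw [← innerSq_single (ε := ε) k]; exact hiso _ _
        have hTT : (T : (ι → ℝ) →ₗ[ℝ] (ι → ℝ)) = Ad (rot hε k (T (Pi.single k 1))) ∘ₗ (T' T) := by
          rw [ad_rot hε k hT]
          apply LinearMap.ext
          intro v
          have h1 := LinearMap.congr_fun (hypRefl_comp_self he) (hypRefl ε (m T) (T v))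
          have h2 := LinearMap.congr_fun (hypRefl_comp_self hq) (T v)
          simp only [LinearMap.comp_apply, LinearMap.id_apply] at h1 h2
          change T v = hypRefl ε (m T) (hypRefl ε (Pi.single k 1)
            (hypRefl ε (Pi.single k 1) (hypRefl ε (m T) (T v))))
          rw [h1, h2]
        have hiso' : IsIsom ε (T' T : (ι → ℝ) →ₗ[ℝ] (ι → ℝ)) :=
          (isIsom_hypRefl he).comp ((isIsom_hypRefl hq).comp hiso)
        rw [ad_mul hε, hcT.2 hiso' ?_, ← hTT]
        intro i hi
        by_cases hik : i = k
        · subst hik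
          have := ad_rot_single hε i hw hT
          rw [ad_rot hε i hT] at this
          have h2 := LinearMap.congr_fun (hypRefl_comp_self hq) (hypRefl ε (Pi.single i 1) (Pi.single i 1))
          have h1 := LinearMap.congr_fun (hypRefl_comp_self he) (Pi.single i 1)
          simp only [LinearMap.comp_apply, LinearMap.id_apply] at h1 h2 this
          change hypRefl ε (Pi.single i 1) (hypRefl ε (m T) (T (Pi.single i 1))) = _
          rw [← this]
          exact (congrArg _ h2).trans h1
        · have hi' : i ∉ insert k S := by simp [hik, hi]
          have hik' : k ≠ i := fun h => hik h.symm
          change hypRefl ε (Pi.single k 1) (hypRefl ε (m T) (T (Pi.single i 1))) = _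
          have h1 : ip ε (T (Pi.single k 1)) (Pi.single i 1) = 0 := by
            have := hiso (Pi.single k 1) (Pi.single i 1)
            rw [ip_single_single hik'] at this
            simpa [hfix i hi'] using this
          rw [hfix i hi', hypRefl_fix (u := m T), hypRefl_fix (ip_single_single hik')]
          rw [ip_add_left, h1, ip_single_single hik', add_zero]

end LocalSection

/-! ### Elements of linear groups -/

section LinearGroupBasics

variable {𝒢 : LinearGroup}

theorem LinearGroup.val_injective : Function.Injective (LinearGroup.val (𝒢 := 𝒢)) :=
  fun _ _ h => Subtype.ext (Units.ext h)

theorem LinearGroup.val_mul (a b : 𝒢.El) :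
    LinearGroup.val (a * b) = LinearGroup.val a * LinearGroup.val b := rfl

theorem LinearGroup.val_one : LinearGroup.val (1 : 𝒢.El) = 1 := rfl

theorem LinearGroup.val_mul_inv (a : 𝒢.El) :
    LinearGroup.val a * LinearGroup.val a⁻¹ = 1 := by
  rw [← LinearGroup.val_mul, mul_inv_cancel, LinearGroup.val_one]

theorem LinearGroup.val_inv_mul (a : 𝒢.El) :
    LinearGroup.val a⁻¹ * LinearGroup.val a = 1 := by
  rw [← LinearGroup.val_mul, inv_mul_cancel, LinearGroup.val_one]

/-- An element of `S¹` as a complex number. -/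
def S1.coe (z : S1.El) : ℂ := LinearGroup.val z

/-- A complex number of norm `1` as an element of `S¹`. -/
def S1.ofNorm (w : ℂ) (h : ‖w‖ = 1) : S1.El :=
  (⟨Units.mk0 w (by rintro rfl; simp at h), h⟩ : circleSubgroup)

theorem S1.coe_ofNorm (w : ℂ) (h : ‖w‖ = 1) : S1.coe (S1.ofNorm w h) = w := rfl

theorem S1.norm_coe (z : S1.El) : ‖S1.coe z‖ = 1 := (show circleSubgroup from z).2

theorem S1.coe_mul (z w : S1.El) : S1.coe (z * w) = S1.coe z * S1.coe w := rfl

theorem S1.coe_one : S1.coe 1 = 1 := rfl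

theorem S1.coe_ne_zero (z : S1.El) : S1.coe z ≠ 0 := fun h => by
  simpa [h] using S1.norm_coe z

theorem S1.coe_injective : Function.Injective S1.coe := LinearGroup.val_injective

theorem S1.mul_comm (z w : S1.El) : z * w = w * z :=
  S1.coe_injective (by rw [S1.coe_mul, S1.coe_mul, _root_.mul_comm])

/-- The element `-1` of `S¹`. -/
def S1.negOne : S1.El := S1.ofNorm (-1) (by simp)

theorem S1.exists_sq (z : S1.El) : ∃ w : S1.El, w ^ 2 = z := by
  obtain ⟨w, hw⟩ := IsAlgClosed.exists_pow_nat_eq (S1.coe z) (n := 2) two_pos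
  have h1 : ‖w‖ ^ 2 = 1 := by rw [← norm_pow, hw, S1.norm_coe]
  have h2 : ‖w‖ = 1 := (pow_eq_one_iff_of_nonneg (norm_nonneg w) two_ne_zero).1 h1
  refine ⟨S1.ofNorm w h2, S1.coe_injective ?_⟩
  rw [← hw, pow_two, pow_two, S1.coe_mul, S1.coe_ofNorm]

theorem S1.sq_eq_sq {z w : S1.El} (h : z ^ 2 = w ^ 2) : z = w ∨ z = w * S1.negOne := by
  have h1 : S1.coe z ^ 2 = S1.coe w ^ 2 := by
    have := congrArg S1.coe h
    simpa only [pow_two, S1.coe_mul] using this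
  rcases sq_eq_sq_iff_eq_or_eq_neg.1 h1 with h | h
  · exact Or.inl (S1.coe_injective h)
  · exact Or.inr (S1.coe_injective (by rw [h, S1.coe_mul, S1.negOne, S1.coe_ofNorm]; ring))

end LinearGroupBasics

/-! ### The homomorphisms from `Spin^c` to the isometries and to the circle -/

section SpinCFacts

variable {ι : Type} [Fintype ι] {ε : ι → ℝ}

instance finite_S1 : Module.Finite ℝ S1.Alg := inferInstanceAs (Module.Finite ℝ ℂ)

instance finite_SpinC (ε : ι → ℝ) : Module.Finite ℝ (SpinC ε).Alg :=
  Module.Finite.tensorProduct ℝ ℂ (Cl ε)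

/-- An element of `Spin` in the Clifford algebra. -/
def spinVal (x : spin ε) : Cl ε := ((x : (Cl ε)ˣ) : Cl ε)

theorem spinVal_injective : Function.Injective (spinVal (ε := ε)) :=
  fun _ _ h => Subtype.ext (Units.ext h)

/-- An element of `Spin^c` in the complex Clifford algebra. -/
def SpinC.cval (a : (SpinC ε).El) : CCl ε := LinearGroup.val a

theorem SpinC.val_mk (x : spin ε) (z : S1.El) :
    SpinC.cval (SpinC.mk x z) = (S1.coe z ⊗ₜ[ℝ] spinVal x : CCl ε) := by
  change ((spinCHom ε (x, z) : (CCl ε)ˣ) : CCl ε) = _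
  change (1 : ℂ) ⊗ₜ[ℝ] spinVal x * S1.coe z ⊗ₜ[ℝ] (1 : Cl ε) = _
  simp

theorem SpinC.exists_mk (a : (SpinC ε).El) : ∃ x z, SpinC.mk x z = a := by
  obtain ⟨p, hp⟩ := (show (spinCHom ε).range from a).2
  exact ⟨p.1, p.2, Subtype.ext hp⟩

theorem SpinC.mk_mul (x y : spin ε) (z w : S1.El) :
    SpinC.mk x z * SpinC.mk y w = SpinC.mk (x * y) (z * w) :=
  ((spinCHom ε).rangeRestrict.map_mul (x, z) (y, w)).symm

theorem SpinC.mk_one : SpinC.mk (1 : spin ε) 1 = 1 := (spinCHom ε).rangeRestrict.map_one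

/-- `w ⊗ y ↦ α w • y`. -/
def tensorEval (ε : ι → ℝ) (α : ℂ →ₗ[ℝ] ℝ) : CCl ε →ₗ[ℝ] Cl ε :=
  TensorProduct.lid ℝ (Cl ε) ∘ₗ TensorProduct.map α LinearMap.id

theorem tensorEval_tmul (α : ℂ →ₗ[ℝ] ℝ) (w : ℂ) (y : Cl ε) :
    tensorEval ε α (w ⊗ₜ y) = α w • y := by
  simp [tensorEval]

theorem tensor_eq_one_tensor {w : ℂ} {y : Cl ε} (h : w ⊗ₜ[ℝ] (1 : Cl ε) = (1 : ℂ) ⊗ₜ[ℝ] y) :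
    w.im = 0 ∧ y = algebraMap ℝ (Cl ε) w.re := by
  have h1 := congrArg (tensorEval ε Complex.imLm) h
  have h2 := congrArg (tensorEval ε Complex.reLm) h
  rw [tensorEval_tmul, tensorEval_tmul] at h1 h2
  simp at h1 h2
  exact ⟨h1, by rw [← h2, Algebra.smul_def, mul_one]⟩

/-- The kernel of `Spin × S¹ → Spin^c` is `±(1, 1)`. After division, `w ⊗ 1 = 1 ⊗ y` with `w` in the
circle and `y` in the spin group; comparing real and imaginary parts makes both the same real
scalar, which is `±1`. -/
theorem SpinC.mk_eq_mk {x x' : spin ε} {z z' : S1.El} (h : SpinC.mk x z = SpinC.mk x' z') :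
    (spinVal x = spinVal x' ∧ z = z') ∨ (spinVal x = -spinVal x' ∧ z = z' * S1.negOne) := by
  have h1 : SpinC.mk (1 : spin ε) (z * z'⁻¹) = SpinC.mk (x' * x⁻¹) 1 := by
    have : SpinC.mk x⁻¹ z'⁻¹ * SpinC.mk x z = SpinC.mk x⁻¹ z'⁻¹ * SpinC.mk x' z' := by rw [h]
    have h3 := congrArg (fun t => SpinC.mk x 1 * t * SpinC.mk x⁻¹ 1) this
    simp only [SpinC.mk_mul] at h3
    simpa [S1.mul_comm] using h3
  have h2 := congrArg SpinC.cval h1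
  rw [SpinC.val_mk, SpinC.val_mk, show spinVal (1 : spin ε) = 1 from rfl, S1.coe_one] at h2
  obtain ⟨him, hre⟩ := tensor_eq_one_tensor h2
  have hx' : spinVal x' = spinVal (x' * x⁻¹) * spinVal x := by
    change _ = spinVal x' * spinVal x⁻¹ * spinVal x
    rw [mul_assoc]
    change spinVal x' = spinVal x' * spinVal (x⁻¹ * x)
    rw [inv_mul_cancel]; simp [spinVal]
  rw [hre] at hx'
  have hz : z = z' * (z * z'⁻¹) := by rw [S1.mul_comm z, mul_inv_cancel_left]
  have hw : S1.coe (z * z'⁻¹) = ((S1.coe (z * z'⁻¹)).re : ℂ) := by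
    apply Complex.ext <;> simp [him]
  rcases eq_one_or_neg_one_of_scalar hre with h4 | h4
  · left
    rw [h4] at hx' hw
    refine ⟨by simpa using hx'.symm, ?_⟩
    have : z * z'⁻¹ = 1 := S1.coe_injective (by rw [hw, S1.coe_one]; simp)
    rw [hz, this, mul_one]
  · right
    rw [h4] at hx' hw
    refine ⟨by rw [hx']; simp, ?_⟩
    have : z * z'⁻¹ = S1.negOne := S1.coe_injective (by
      rw [hw, S1.negOne, S1.coe_ofNorm]; simp)
    rw [← this]; exact hz

theorem Twists.congr_neg {x y : (Cl ε)ˣ} {T : (ι → ℝ) →ₗ[ℝ] (ι → ℝ)} (h : Twists x T)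
    (hxy : (y : Cl ε) = -x) : Twists y T := fun v => by
  rw [hxy, neg_mul, h, mul_neg]

theorem ad_eq_of_mk_eq (hε : ∀ i, ε i * ε i = 1) {x x' : spin ε} {z z' : S1.El}
    (h : SpinC.mk x z = SpinC.mk x' z') : Ad x = Ad x' := by
  rcases SpinC.mk_eq_mk h with h | h
  · rw [spinVal_injective h.1]
  · exact Twists.ad_eq hε ((ad_twists hε x').congr_neg h.1)

/-- The vector representation of `Spin^c`. -/
def adC (a : (SpinC ε).El) : (ι → ℝ) →ₗ[ℝ] (ι → ℝ) := Ad (SpinC.exists_mk a).choose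

/-- The homomorphism `[x, z] ↦ z²`. -/
def sqC (a : (SpinC ε).El) : S1.El := (SpinC.exists_mk a).choose_spec.choose ^ 2

theorem adC_mk (hε : ∀ i, ε i * ε i = 1) (x : spin ε) (z : S1.El) :
    adC (SpinC.mk x z) = Ad x :=
  ad_eq_of_mk_eq hε (SpinC.exists_mk (SpinC.mk x z)).choose_spec.choose_spec

theorem S1.negOne_sq : S1.negOne ^ 2 = 1 :=
  S1.coe_injective (by rw [pow_two, S1.coe_mul, S1.negOne, S1.coe_ofNorm, S1.coe_one]; norm_num)

theorem S1.mul_sq (z w : S1.El) : (z * w) ^ 2 = z ^ 2 * w ^ 2 :=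
  S1.coe_injective (by simp only [pow_two, S1.coe_mul]; ring)

theorem sqC_mk (x : spin ε) (z : S1.El) : sqC (SpinC.mk x z) = z ^ 2 := by
  rcases SpinC.mk_eq_mk (SpinC.exists_mk (SpinC.mk x z)).choose_spec.choose_spec with h | h
  · rw [sqC, h.2]
  · rw [sqC, h.2, S1.mul_sq, S1.negOne_sq, mul_one]

theorem adC_mul (hε : ∀ i, ε i * ε i = 1) (a b : (SpinC ε).El) :
    adC (a * b) = adC a ∘ₗ adC b := by
  obtain ⟨x, z, rfl⟩ := SpinC.exists_mk a
  obtain ⟨y, w, rfl⟩ := SpinC.exists_mk b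
  rw [SpinC.mk_mul, adC_mk hε, adC_mk hε, adC_mk hε, ad_mul hε]

theorem adC_one (hε : ∀ i, ε i * ε i = 1) : adC (1 : (SpinC ε).El) = LinearMap.id := by
  rw [← SpinC.mk_one, adC_mk hε, ad_one hε]

theorem sqC_mul (a b : (SpinC ε).El) : sqC (a * b) = sqC a * sqC b := by
  obtain ⟨x, z, rfl⟩ := SpinC.exists_mk a
  obtain ⟨y, w, rfl⟩ := SpinC.exists_mk b
  rw [SpinC.mk_mul, sqC_mk, sqC_mk, sqC_mk, S1.mul_sq]

theorem isIsom_adC (hε : ∀ i, ε i * ε i = 1) (a : (SpinC ε).El) : IsIsom ε (adC a) :=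
  isIsom_ad hε _

theorem det_adC (hε : ∀ i, ε i * ε i = 1) (a : (SpinC ε).El) : LinearMap.det (adC a) = 1 :=
  det_ad hε _

/-- The circle in `Spin^c`. -/
def circ (ε : ι → ℝ) (z : S1.El) : (SpinC ε).El := SpinC.mk 1 z

theorem circ_mul (z w : S1.El) : circ ε (z * w) = circ ε z * circ ε w := by
  rw [circ, circ, circ, SpinC.mk_mul, one_mul]

theorem circ_comm (z : S1.El) (a : (SpinC ε).El) : circ ε z * a = a * circ ε z := by
  obtain ⟨y, w, rfl⟩ := SpinC.exists_mk a
  rw [circ, SpinC.mk_mul, SpinC.mk_mul, one_mul, mul_one, S1.mul_comm]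

theorem adC_circ (hε : ∀ i, ε i * ε i = 1) (z : S1.El) : adC (circ ε z) = LinearMap.id := by
  rw [circ, adC_mk hε, ad_one hε]

theorem val_circ (z : S1.El) :
    SpinC.cval (circ ε z) = (S1.coe z ⊗ₜ[ℝ] (1 : Cl ε) : CCl ε) := SpinC.val_mk 1 z

theorem circ_injective : Function.Injective (circ ε) := by
  intro z w h
  have h1 := congrArg (fun t => tensorEval ε Complex.imLm (SpinC.cval t)) h
  have h2 := congrArg (fun t => tensorEval ε Complex.reLm (SpinC.cval t)) h
  simp only [val_circ, tensorEval_tmul] at h1 h2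
  have h0 : (1 : Cl ε) ≠ 0 := one_ne_zero
  exact S1.coe_injective (Complex.ext (smul_left_injective ℝ h0 h2) (smul_left_injective ℝ h0 h1))

/-- The kernel of `adC` is the central circle: the sign left undetermined in the spin group is
absorbed by `S1.negOne`. -/
theorem exists_circ_of_adC_eq (hε : ∀ i, ε i * ε i = 1) {a b : (SpinC ε).El}
    (h : adC a = adC b) : ∃ z, b = circ ε z * a := by
  obtain ⟨x, z, rfl⟩ := SpinC.exists_mk a
  obtain ⟨y, w, rfl⟩ := SpinC.exists_mk b
  rw [adC_mk hε, adC_mk hε] at h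
  rcases eq_or_eq_neg_of_ad_eq hε h with h | h
  · refine ⟨w * z⁻¹, ?_⟩
    rw [circ, SpinC.mk_mul, one_mul, inv_mul_cancel_right, spinVal_injective h]
  · refine ⟨w * z⁻¹ * S1.negOne, ?_⟩
    rw [circ, SpinC.mk_mul, one_mul]
    apply LinearGroup.val_injective
    change SpinC.cval _ = SpinC.cval _
    rw [SpinC.val_mk, SpinC.val_mk]
    have : w * z⁻¹ * S1.negOne * z = w * S1.negOne := by
      rw [mul_assoc, mul_assoc, S1.mul_comm S1.negOne, inv_mul_cancel_left]
    rw [this, S1.coe_mul, S1.negOne, S1.coe_ofNorm, show spinVal x = -spinVal y from h,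
      mul_neg_one, TensorProduct.neg_tmul, TensorProduct.tmul_neg, neg_neg]

/-- The element `-1` of `Spin^c`. -/
def negC (ε : ι → ℝ) : (SpinC ε).El := circ ε S1.negOne

theorem val_negC : SpinC.cval (negC ε) = (-1 : CCl ε) := by
  rw [negC, val_circ, S1.negOne, S1.coe_ofNorm, TensorProduct.neg_tmul]; rfl

theorem negC_mul_self : negC ε * negC ε = 1 := by
  rw [negC, ← circ_mul, ← pow_two, S1.negOne_sq]; exact SpinC.mk_one

instance : Nontrivial (CCl ε) := by
  refine ⟨⟨1, 0, fun h => ?_⟩⟩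
  have := congrArg (tensorEval ε Complex.reLm) h
  rw [Algebra.TensorProduct.one_def, tensorEval_tmul, map_zero] at this
  simp at this

theorem eq_or_eq_neg_of_xi_eq (hε : ∀ i, ε i * ε i = 1) {a b : (SpinC ε).El}
    (h : adC a = adC b) (h' : sqC a = sqC b) : b = a ∨ b = a * negC ε := by
  obtain ⟨z, rfl⟩ := exists_circ_of_adC_eq hε h
  rw [sqC_mul, circ, sqC_mk] at h'
  have : z ^ 2 = 1 ^ 2 := by
    rw [one_pow]; exact mul_eq_right.1 h'.symm
  rcases S1.sq_eq_sq this with rfl | rfl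
  · left; rw [circ, SpinC.mk_one, one_mul]
  · right; rw [one_mul, ← negC, negC, circ_comm]

theorem exists_xi_eq (hε : ∀ i, ε i * ε i = 1) {T : (ι → ℝ) →ₗ[ℝ] (ι → ℝ)} (hT : IsIsom ε T)
    (hd : 0 < LinearMap.det T) (z : S1.El) : ∃ a : (SpinC ε).El, adC a = T ∧ sqC a = z := by
  obtain ⟨x, hx⟩ := exists_ad_eq hε hT hd
  obtain ⟨w, hw⟩ := S1.exists_sq z
  exact ⟨SpinC.mk x w, by rw [adC_mk hε, hx], by rw [sqC_mk, hw]⟩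

/-! ### Algebraic formulas -/

/-- The vector `v` in the complex Clifford algebra. -/
def cgam (ε : ι → ℝ) (v : ι → ℝ) : CCl ε := 1 ⊗ₜ gam ε v

/-- `adC` is defined by a choice of representative. This formula in terms of `a` and its inverse is
what makes it smooth. -/
theorem cgam_adC (hε : ∀ i, ε i * ε i = 1) (a : (SpinC ε).El) (v : ι → ℝ) :
    cgam ε (adC a v) = (SpinC.cval a * cgam ε v * SpinC.cval a⁻¹) := by
  obtain ⟨x, z, rfl⟩ := SpinC.exists_mk a
  have h : SpinC.cval (SpinC.mk x z) * cgam ε v =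
      cgam ε (Ad x v) * SpinC.cval (SpinC.mk x z) := by
    rw [SpinC.val_mk, cgam, cgam]
    change S1.coe z ⊗ₜ[ℝ] spinVal x * (1 : ℂ) ⊗ₜ[ℝ] gam ε v = _ * S1.coe z ⊗ₜ[ℝ] spinVal x
    rw [Algebra.TensorProduct.tmul_mul_tmul, Algebra.TensorProduct.tmul_mul_tmul, mul_one, one_mul]
    congr 1
    exact ad_twists hε x v
  have h2 : SpinC.cval (SpinC.mk x z) * SpinC.cval (SpinC.mk x z)⁻¹ = (1 : CCl ε) :=
    LinearGroup.val_mul_inv _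
  rw [adC_mk hε, h]
  exact ((mul_assoc _ _ _).trans ((congrArg _ h2).trans (mul_one _))).symm

/-- The functional `w ⊗ v ↦ Re w * vᵢ`. -/
def vecCoord (ε : ι → ℝ) (i : ι) : CCl ε →ₗ[ℝ] ℝ :=
  LinearMap.proj i ∘ₗ (gam ε).leftInverse ∘ₗ tensorEval ε Complex.reLm

theorem vecCoord_cgam (hε : ∀ i, ε i * ε i = 1) (i : ι) (v : ι → ℝ) :
    vecCoord ε i (cgam ε v) = v i := by
  simp only [vecCoord, cgam, LinearMap.comp_apply, tensorEval_tmul]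
  simp [LinearMap.leftInverse_apply_of_inj (LinearMap.ker_eq_bot.2 (gam_injective hε))]

/-- The reversion of the complex Clifford algebra, complex linear or conjugate linear. -/
def revC (ε : ι → ℝ) (α : ℂ →ₗ[ℝ] ℂ) : CCl ε →ₗ[ℝ] CCl ε :=
  TensorProduct.map α CliffordAlgebra.reverse

/-- For `a = z x` with `x * reverse x = s`, the two factors are `z² s` and `|z|² s = s`, and `s * s
= 1`. The right-hand side is polynomial in the real coordinates of `a`, so `sqC` is smooth although
it is defined by a choice. -/
theorem coe_sqC (a : (SpinC ε).El) : (S1.coe (sqC a) ⊗ₜ[ℝ] (1 : Cl ε) : CCl ε) =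
    (SpinC.cval a * revC ε LinearMap.id (SpinC.cval a)) *
      (SpinC.cval a * revC ε Complex.conjLIE.toLinearMap (SpinC.cval a)) := by
  obtain ⟨x, z, rfl⟩ := SpinC.exists_mk a
  obtain ⟨s, hs, hx⟩ := reverse_spin x
  rw [SpinC.val_mk, sqC_mk, revC, revC, TensorProduct.map_tmul, TensorProduct.map_tmul]
  rw [Algebra.TensorProduct.tmul_mul_tmul, Algebra.TensorProduct.tmul_mul_tmul,
    Algebra.TensorProduct.tmul_mul_tmul, show spinVal x = ((x : (Cl ε)ˣ) : Cl ε) from rfl, hx,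
    ← map_mul, hs, map_one]
  congr 1
  have : S1.coe z * (starRingEnd ℂ) (S1.coe z) = 1 := by
    rw [Complex.mul_conj, Complex.normSq_eq_norm_sq, S1.norm_coe]; simp
  simp only [LinearMap.id_apply]
  change _ = _ * (S1.coe z * (starRingEnd ℂ) (S1.coe z))
  rw [this, mul_one, pow_two, S1.coe_mul]

end SpinCFacts

/-! ### The inclusion of `Spin^c(r, s)` in `Spin^c(r + 1, s)` -/

section Inclusion

variable {ι : Type} [Fintype ι] {ε : ι → ℝ}

omit [Fintype ι] in
theorem ext_sign (hε : ∀ i, ε i * ε i = 1) : ∀ i, ext ε i * ext ε i = 1 := by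
  rintro (_ | i)
  · simp [ext]
  · simpa [ext] using hε i

theorem sig_sign (r s : ℕ) : ∀ i, sig r s i * sig r s i = 1 := by
  rintro (i | i) <;> simp [sig]

/-- The Clifford algebra of `ℝ ⊕ ℝⁿ` acts on the double of the Clifford algebra of `ℝⁿ`. -/
def clDouble (ε : ι → ℝ) : Cl (ext ε) →ₐ[ℝ] Matrix (Fin 2) (Fin 2) (Cl ε) :=
  CliffordAlgebra.lift (cliffordForm (ext ε)) ⟨
    { toFun := fun v => !![gam ε (fun i => v (some i)), -algebraMap ℝ (Cl ε) (v none);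
        algebraMap ℝ (Cl ε) (v none), -gam ε (fun i => v (some i))]
      map_add' := fun v w => by
        have : (fun i => (v + w) (some i)) = (fun i => v (some i)) + fun i => w (some i) := rfl
        rw [this]
        ext i j
        fin_cases i <;> fin_cases j <;> simp [add_comm]
      map_smul' := fun c v => by
        have : (fun i => (c • v) (some i)) = c • fun i => v (some i) := rfl
        rw [this]
        ext i j
        fin_cases i <;> fin_cases j <;> simp [Algebra.algebraMap_eq_smul_one, mul_smul] }, fun v => by
    have h := gam_sq (ε := ε) (fun i => v (some i))
    have h2 : cliffordForm (ext ε) v = -innerSq ε (fun i => v (some i)) - v none * v none := by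
      rw [cliffordForm_apply, innerSq, Fintype.sum_option]
      simp [ext, innerSq]; ring
    rw [h2, Matrix.algebraMap_eq_diagonal]
    ext i j
    fin_cases i <;> fin_cases j
    · simp [Matrix.mul_apply, Fin.sum_univ_two, h, sub_eq_add_neg]
    · simp [Matrix.mul_apply, Fin.sum_univ_two, Algebra.commutes]
    · simp [Matrix.mul_apply, Fin.sum_univ_two, Algebra.commutes]
    · simp [Matrix.mul_apply, Fin.sum_univ_two, h, sub_eq_add_neg, add_comm]⟩

/-- The upper left entry of the double inverts the inclusion. The resulting linear retraction gives
injectivity and, later, smoothness of maps into the smaller group from smoothness in the larger one.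
-/
theorem clDouble_clIncl (x : Cl ε) : clDouble ε (clIncl ε x) =
    !![x, 0; 0, CliffordAlgebra.involute x] := by
  induction x using CliffordAlgebra.induction with
  | algebraMap r =>
    rw [AlgHom.commutes, AlgHom.commutes, AlgHom.commutes, Matrix.algebraMap_eq_diagonal]
    ext i j
    fin_cases i <;> fin_cases j <;> simp
  | ι v =>
    rw [clIncl, CliffordAlgebra.map_apply_ι, clDouble, CliffordAlgebra.lift_ι_apply,
      CliffordAlgebra.involute_ι]
    have h1 : (isomIncl ε v) none = 0 := rfl
    have h2 : (fun i => (isomIncl ε v) (some i)) = v := rfl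
    simp only [LinearMap.coe_mk, AddHom.coe_mk, h1, h2, map_zero, neg_zero]
  | mul x y hx hy =>
    rw [map_mul, map_mul, map_mul, hx, hy]
    ext i j
    fin_cases i <;> fin_cases j <;> simp [Matrix.mul_apply, Fin.sum_univ_two]
  | add x y hx hy =>
    rw [map_add, map_add, map_add, hx, hy]
    ext i j
    fin_cases i <;> fin_cases j <;> simp

/-- A linear retraction of the inclusion of Clifford algebras. -/
def clRetr (ε : ι → ℝ) : Cl (ext ε) →ₗ[ℝ] Cl ε where
  toFun x := clDouble ε x 0 0
  map_add' x y := by simp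
  map_smul' c x := by simp

theorem clRetr_clIncl (x : Cl ε) : clRetr ε (clIncl ε x) = x := by
  change clDouble ε (clIncl ε x) 0 0 = x
  rw [clDouble_clIncl]; rfl

/-- A linear retraction of the inclusion of complex Clifford algebras. -/
def cclRetr (ε : ι → ℝ) : CCl (ext ε) →ₗ[ℝ] CCl ε := TensorProduct.map LinearMap.id (clRetr ε)

theorem cclRetr_cclIncl (x : CCl ε) : cclRetr ε (cclIncl ε x) = x := by
  induction x using TensorProduct.induction_on with
  | zero => simp
  | tmul w y => simp [cclRetr, cclIncl, clRetr_clIncl]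
  | add x y hx hy => rw [map_add, map_add, hx, hy]

theorem cval_spinCIncl (a : (SpinC ε).El) :
    SpinC.cval (spinCIncl ε a) = cclIncl ε (SpinC.cval a) := rfl

theorem spinCIncl_injective : Function.Injective (spinCIncl ε) := by
  intro a b h
  apply LinearGroup.val_injective
  change SpinC.cval a = SpinC.cval b
  rw [← cclRetr_cclIncl (SpinC.cval a), ← cclRetr_cclIncl (SpinC.cval b), ← cval_spinCIncl,
    ← cval_spinCIncl, h]

/-- `diag (1, T)`. -/
def diagOne (T : (ι → ℝ) →ₗ[ℝ] (ι → ℝ)) : (Option ι → ℝ) →ₗ[ℝ] (Option ι → ℝ) where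
  toFun v := fun i => i.elim (v none) (T fun k => v (some k))
  map_add' v w := by
    have : (fun i => (v + w) (some i)) = (fun i => v (some i)) + fun i => w (some i) := rfl
    rw [this, map_add]
    ext (_ | i) <;> simp
  map_smul' c v := by
    have : (fun i => (c • v) (some i)) = c • fun i => v (some i) := rfl
    rw [this, map_smul]
    ext (_ | i) <;> simp

theorem ip_ext (v w : Option ι → ℝ) : ip (ext ε) v w =
    v none * w none + ip ε (fun i => v (some i)) (fun i => w (some i)) := by
  rw [ip, Fintype.sum_option]; simp [ext, ip]

theorem gam_ext (v : Option ι → ℝ) [DecidableEq ι] : gam (ext ε) v =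
    v none • gam (ext ε) (Pi.single none 1) + clIncl ε (gam ε fun i => v (some i)) := by
  rw [clIncl, CliffordAlgebra.map_apply_ι, ← map_smul, ← map_add]
  congr 1
  ext (_ | i)
  · change v none = v none • (1 : ℝ) + 0; simp
  · simp
    rfl

theorem clIncl_none [DecidableEq ι] (x : Cl ε) : clIncl ε x * gam (ext ε) (Pi.single none 1) =
    gam (ext ε) (Pi.single none 1) * clIncl ε (CliffordAlgebra.involute x) := by
  induction x using CliffordAlgebra.induction with
  | algebraMap r => rw [AlgHom.commutes, AlgHom.commutes, AlgHom.commutes, Algebra.commutes]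
  | ι v =>
    rw [CliffordAlgebra.involute_ι, map_neg, mul_neg, clIncl, CliffordAlgebra.map_apply_ι,
      eq_neg_iff_add_eq_zero, gam_swap, ip_single_right]
    have h1 : (isomIncl ε v) none = 0 := rfl
    rw [h1]; simp
  | mul x y hx hy => rw [map_mul, map_mul, map_mul, mul_assoc, hy, ← mul_assoc, hx, mul_assoc]
  | add x y hx hy => rw [map_add, map_add, map_add, add_mul, mul_add, hx, hy]

/-- Elements of the spin group are even, so they commute with the added basis vector. -/
theorem ad_spinIncl (hε : ∀ i, ε i * ε i = 1) (x : spin ε) :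
    Ad (spinIncl ε x) = diagOne (Ad x) := by
  classical
  refine Twists.ad_eq (ext_sign hε) fun v => ?_
  have hx : ((spinIncl ε x : (Cl (ext ε))ˣ) : Cl (ext ε)) = clIncl ε (spinVal x) := rfl
  have h1 := ad_twists hε x (fun i => v (some i))
  rw [hx, gam_ext v, gam_ext (diagOne (Ad x) v), mul_add, add_mul, mul_smul_comm, clIncl_none,
    show CliffordAlgebra.involute (spinVal x) = spinVal x from involute_spin x, ← map_mul,
    show spinVal x * gam ε (fun i => v (some i)) = _ from h1, map_mul, smul_mul_assoc]
  rfl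

theorem adC_spinCIncl (hε : ∀ i, ε i * ε i = 1) (a : (SpinC ε).El) :
    adC (spinCIncl ε a) = diagOne (adC a) := by
  obtain ⟨x, z, rfl⟩ := SpinC.exists_mk a
  rw [spinCIncl_mk, adC_mk (ext_sign hε), adC_mk hε, ad_spinIncl hε]

theorem sqC_spinCIncl (a : (SpinC ε).El) : sqC (spinCIncl ε a) = sqC a := by
  obtain ⟨x, z, rfl⟩ := SpinC.exists_mk a
  rw [spinCIncl_mk, sqC_mk, sqC_mk]

/-- An isometry that fixes the added vector preserves its orthogonal complement. -/
theorem eq_diagOne [DecidableEq ι] {T : (Option ι → ℝ) →ₗ[ℝ] (Option ι → ℝ)}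
    (hT : IsIsom (ext ε) T) (h : T (Pi.single none 1) = Pi.single none 1) :
    ∃ T' : (ι → ℝ) →ₗ[ℝ] (ι → ℝ), IsIsom ε T' ∧ T = diagOne T' := by
  have h1 : ∀ v, T v none = v none := by
    intro v
    have := hT v (Pi.single none 1)
    rw [h, ip_single_right, ip_single_right] at this
    simpa [ext] using this
  have h2 : ∀ v, T v = v none • Pi.single none 1 + T (vecIncl fun i => v (some i)) := by
    intro v
    conv_lhs => rw [show v = v none • Pi.single none 1 + vecIncl fun i => v (some i) by
      ext (_ | i) <;> simp [vecIncl]]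
    rw [map_add, map_smul, h]
  refine ⟨LinearMap.funLeft ℝ ℝ some ∘ₗ T ∘ₗ vecIncl, fun v w => ?_, ?_⟩
  · have := hT (vecIncl v) (vecIncl w)
    rw [ip_ext, ip_ext, h1, h1] at this
    simp only [vecIncl, LinearMap.coe_mk, AddHom.coe_mk, Option.elim_none, zero_mul, zero_add] at this
    exact this
  · apply LinearMap.ext
    intro v
    ext (_ | i)
    · rw [h1]; rfl
    · rw [h2 v]; simp [diagOne, LinearMap.funLeft]

/-- Elements of `Spin^c` that fix the added vector come from the smaller group. -/
theorem exists_spinCIncl_eq (hε : ∀ i, ε i * ε i = 1) [DecidableEq ι] {b : (SpinC (ext ε)).El}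
    (h : adC b (Pi.single none 1) = Pi.single none 1) : ∃ a, spinCIncl ε a = b := by
  have hε' := ext_sign hε
  obtain ⟨T, hT, hb⟩ := eq_diagOne (isIsom_adC hε' b) h
  obtain ⟨x, hx | ⟨v, hv, hx⟩⟩ := isReflProd_of_isIsom hε hT
  · have : adC (spinCIncl ε (SpinC.mk x 1)) = adC b := by
      rw [hb, hx, adC_spinCIncl hε, adC_mk hε]
    obtain ⟨z, hz⟩ := exists_circ_of_adC_eq hε' this
    refine ⟨SpinC.mk x z, ?_⟩
    rw [hz, spinCIncl_mk, spinCIncl_mk, circ, SpinC.mk_mul, one_mul, mul_one]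
  -- In the odd case `adC b` would be a reflection times a rotation, hence of determinant `-1`.
  · exfalso
    have hv' : innerSq (ext ε) (vecIncl v) = innerSq ε v := by
      simp only [innerSq_eq_ip]; rw [ip_ext]; simp [vecIncl]
    have : adC b = hypRefl (ext ε) (vecIncl v) ∘ₗ Ad (spinIncl ε x) := by
      rw [hb, hx, ad_spinIncl hε]
      apply LinearMap.ext
      intro w
      have h0 : ∀ w, ip (ext ε) (vecIncl v) w = ip ε v (fun k => w (some k)) := by
        intro w; rw [ip_ext]; simp [vecIncl]
      rw [LinearMap.comp_apply, hypRefl_apply, hv', h0]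
      ext (_ | i)
      · simp [diagOne, vecIncl]
      · rfl
    have h1 := congrArg LinearMap.det this
    rw [det_adC hε', LinearMap.det_comp, det_ad hε', det_hypRefl] at h1
    · norm_num at h1
    · rw [hv']; exact innerSq_ne_zero hv

end Inclusion

/-! ### Calculus of smooth maps along a subspace -/

section SmoothAlongCalculus

variable {E H E' H' E'' H'' : Type*} [NormedAddCommGroup E] [NormedSpace ℝ E] [TopologicalSpace H]
  [NormedAddCommGroup E'] [NormedSpace ℝ E'] [TopologicalSpace H']
  [NormedAddCommGroup E''] [NormedSpace ℝ E''] [TopologicalSpace H'']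
  {N N' N'' : Type*} [TopologicalSpace N] [ChartedSpace H N] [TopologicalSpace N']
  [ChartedSpace H' N'] [TopologicalSpace N''] [ChartedSpace H'' N'']
  {B B' : Type*} {I : ModelWithCorners ℝ E H} {j : B → N} {I' : ModelWithCorners ℝ E' H'}
  {I'' : ModelWithCorners ℝ E'' H''} {f g : B → N'} {U U' : Set B}

theorem SmoothAlong.mono (h : SmoothAlong I j I' f U) (hU : U' ⊆ U) : SmoothAlong I j I' f U' :=
  fun b hb => by
    obtain ⟨W, hW, hbW, F, hF, hFf⟩ := h b (hU hb)
    exact ⟨W, hW, hbW, F, hF, fun c hc => hFf c (hU hc)⟩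

theorem SmoothAlong.congr (h : SmoothAlong I j I' f U) (hfg : ∀ b ∈ U, g b = f b) :
    SmoothAlong I j I' g U :=
  fun b hb => by
    obtain ⟨W, hW, hbW, F, hF, hFf⟩ := h b hb
    exact ⟨W, hW, hbW, F, hF, fun c hc hcW => (hFf c hc hcW).trans (hfg c hc).symm⟩

theorem SmoothAlong.of_local [TopologicalSpace B] (hj : Topology.IsInducing j)
    (h : ∀ b ∈ U, ∃ V ∈ nhds b, SmoothAlong I j I' f (U ∩ V)) : SmoothAlong I j I' f U :=
  fun b hb => by
    obtain ⟨V, hV, hs⟩ := h b hb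
    rw [hj.nhds_eq_comap, Filter.mem_comap] at hV
    obtain ⟨W', hW', hWV⟩ := hV
    obtain ⟨W₀, hW₀s, hW₀, hbW₀⟩ := mem_nhds_iff.1 hW'
    obtain ⟨W, hW, hbW, F, hF, hFf⟩ := hs b ⟨hb, hWV (hW₀s hbW₀)⟩
    exact ⟨W ∩ W₀, hW.inter hW₀, ⟨hbW, hbW₀⟩, F, hF.mono Set.inter_subset_left,
      fun c hc hcW => hFf c ⟨hc, hWV (hW₀s hcW.2)⟩ hcW.1⟩

theorem smoothAlong_const (c : N') : SmoothAlong I j I' (fun _ => c) U :=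
  fun _ _ => ⟨Set.univ, isOpen_univ, trivial, fun _ => c, contMDiffOn_const, fun _ _ _ => rfl⟩

theorem smoothAlong_self : SmoothAlong I j I j U :=
  fun _ _ => ⟨Set.univ, isOpen_univ, trivial, id, contMDiffOn_id, fun _ _ _ => rfl⟩

theorem SmoothAlong.continuousOn [TopologicalSpace B] (hj : Continuous j)
    (h : SmoothAlong I j I' f U) : ContinuousOn f U := by
  intro b hb
  obtain ⟨W, hW, hbW, F, hF, hFf⟩ := h b hb
  have h1 : ContinuousAt (F ∘ j) b :=
    (hF.continuousOn.continuousAt (hW.mem_nhds hbW)).comp hj.continuousAt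
  have h2 : f b = (F ∘ j) b := (hFf b hb hbW).symm
  refine h1.continuousWithinAt.congr_of_eventuallyEq ?_ h2
  filter_upwards [self_mem_nhdsWithin,
    mem_nhdsWithin_of_mem_nhds (hj.continuousAt.preimage_mem_nhds (hW.mem_nhds hbW))] with c hc hcW
  exact (hFf c hc hcW).symm

/-- Composition with a smooth map defined near the values. -/
theorem SmoothAlong.comp_contMDiffOn (h : SmoothAlong I j I' f U) {G : N' → N''}
    (hG : ∀ b ∈ U, ∃ O, IsOpen O ∧ f b ∈ O ∧ ContMDiffOn I' I'' ∞ G O) :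
    SmoothAlong I j I'' (fun b => G (f b)) U :=
  fun b hb => by
    obtain ⟨W, hW, hbW, F, hF, hFf⟩ := h b hb
    obtain ⟨O, hO, hbO, hGO⟩ := hG b hb
    refine ⟨W ∩ F ⁻¹' O, hF.continuousOn.isOpen_inter_preimage hW hO,
      ⟨hbW, by rw [Set.mem_preimage, hFf b hb hbW]; exact hbO⟩, G ∘ F, ?_, ?_⟩
    · exact hGO.comp (hF.mono Set.inter_subset_left) fun x hx => hx.2
    · intro c hc hcW
      rw [Function.comp_apply, hFf c hc hcW.1]

theorem SmoothAlong.comp_contMDiff (h : SmoothAlong I j I' f U) {G : N' → N''}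
    (hG : ContMDiff I' I'' ∞ G) : SmoothAlong I j I'' (fun b => G (f b)) U :=
  h.comp_contMDiffOn fun _ _ => ⟨Set.univ, isOpen_univ, trivial, hG.contMDiffOn⟩

/-- Pull-back of a smooth map under a smooth map of the bases. -/
theorem SmoothAlong.precomp {j' : B' → N'} {β : B' → B} {V : Set B'}
    (hβ : SmoothAlong I' j' I (fun b => j (β b)) V) {f : B → N''} (h : SmoothAlong I j I'' f U)
    (hVU : ∀ b ∈ V, β b ∈ U) : SmoothAlong I' j' I'' (fun b => f (β b)) V :=
  fun b hb => by
    obtain ⟨W, hW, hbW, F, hF, hFf⟩ := h (β b) (hVU b hb)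
    obtain ⟨W', hW', hbW', Φ, hΦ, hΦβ⟩ := hβ b hb
    refine ⟨W' ∩ Φ ⁻¹' W, hΦ.continuousOn.isOpen_inter_preimage hW' hW,
      ⟨hbW', by rw [Set.mem_preimage, hΦβ b hb hbW']; exact hbW⟩, F ∘ Φ, ?_, ?_⟩
    · exact hF.comp (hΦ.mono Set.inter_subset_left) fun x hx => hx.2
    · intro c hc hcW
      have h1 : Φ (j' c) = j (β c) := hΦβ c hc hcW.1
      rw [Function.comp_apply, h1]
      refine hFf (β c) (hVU c hc) ?_
      rw [← h1]; exact hcW.2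

theorem SmoothAlong.prodMk {f : B → N'} {g : B → N''} (hf : SmoothAlong I j I' f U)
    (hg : SmoothAlong I j I'' g U) : SmoothAlong I j (I'.prod I'') (fun b => (f b, g b)) U :=
  fun b hb => by
    obtain ⟨W, hW, hbW, F, hF, hFf⟩ := hf b hb
    obtain ⟨W', hW', hbW', G, hG, hGg⟩ := hg b hb
    exact ⟨W ∩ W', hW.inter hW', ⟨hbW, hbW'⟩, fun x => (F x, G x),
      (hF.mono Set.inter_subset_left).prodMk (hG.mono Set.inter_subset_right),
      fun c hc hcW => Prod.ext (hFf c hc hcW.1) (hGg c hc hcW.2)⟩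

variable {V V' V'' : Type*} [NormedAddCommGroup V] [NormedSpace ℝ V] [NormedAddCommGroup V']
  [NormedSpace ℝ V'] [NormedAddCommGroup V''] [NormedSpace ℝ V'']

theorem SmoothAlong.comp_contDiffOn {f : B → V} (h : SmoothAlong I j 𝓘(ℝ, V) f U) {G : V → V'}
    (hG : ∀ b ∈ U, ∀ᶠ v in nhds (f b), ContDiffAt ℝ ∞ G v) :
    SmoothAlong I j 𝓘(ℝ, V') (fun b => G (f b)) U :=
  h.comp_contMDiffOn fun b hb => by
    obtain ⟨O, hO, hOo, hbO⟩ := mem_nhds_iff.1 (hG b hb)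
    exact ⟨O, hOo, hbO, contMDiffOn_iff_contDiffOn.2 fun v hv =>
      (show ContDiffAt ℝ ∞ G v from hO hv).contDiffWithinAt⟩

theorem SmoothAlong.comp_contDiff {f : B → V} (h : SmoothAlong I j 𝓘(ℝ, V) f U) {G : V → V'}
    (hG : ContDiff ℝ ∞ G) : SmoothAlong I j 𝓘(ℝ, V') (fun b => G (f b)) U :=
  h.comp_contDiffOn fun _ _ => Filter.Eventually.of_forall fun _ => hG.contDiffAt

theorem SmoothAlong.prodMk_space {f : B → V} {g : B → V'} (hf : SmoothAlong I j 𝓘(ℝ, V) f U)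
    (hg : SmoothAlong I j 𝓘(ℝ, V') g U) : SmoothAlong I j 𝓘(ℝ, V × V') (fun b => (f b, g b)) U := by
  rw [modelWithCornersSelf_prod, ← chartedSpaceSelf_prod]
  exact hf.prodMk hg

theorem SmoothAlong.comp₂ {f : B → V} {g : B → V'} (hf : SmoothAlong I j 𝓘(ℝ, V) f U)
    (hg : SmoothAlong I j 𝓘(ℝ, V') g U) {G : V × V' → V''} (hG : ContDiff ℝ ∞ G) :
    SmoothAlong I j 𝓘(ℝ, V'') (fun b => G (f b, g b)) U :=
  (hf.prodMk_space hg).comp_contDiff hG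

theorem SmoothAlong.add {f g : B → V} (hf : SmoothAlong I j 𝓘(ℝ, V) f U)
    (hg : SmoothAlong I j 𝓘(ℝ, V) g U) : SmoothAlong I j 𝓘(ℝ, V) (fun b => f b + g b) U :=
  hf.comp₂ hg (contDiff_fst.add contDiff_snd)

theorem SmoothAlong.sub {f g : B → V} (hf : SmoothAlong I j 𝓘(ℝ, V) f U)
    (hg : SmoothAlong I j 𝓘(ℝ, V) g U) : SmoothAlong I j 𝓘(ℝ, V) (fun b => f b - g b) U :=
  hf.comp₂ hg (contDiff_fst.sub contDiff_snd)

theorem SmoothAlong.smul {f : B → ℝ} {g : B → V} (hf : SmoothAlong I j 𝓘(ℝ, ℝ) f U)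
    (hg : SmoothAlong I j 𝓘(ℝ, V) g U) : SmoothAlong I j 𝓘(ℝ, V) (fun b => f b • g b) U :=
  hf.comp₂ hg (contDiff_fst.smul contDiff_snd)

theorem SmoothAlong.mul {f g : B → ℝ} (hf : SmoothAlong I j 𝓘(ℝ, ℝ) f U)
    (hg : SmoothAlong I j 𝓘(ℝ, ℝ) g U) : SmoothAlong I j 𝓘(ℝ, ℝ) (fun b => f b * g b) U :=
  hf.smul hg

theorem SmoothAlong.sum {κ : Type*} {s : Finset κ} {f : κ → B → V}
    (hf : ∀ i ∈ s, SmoothAlong I j 𝓘(ℝ, V) (f i) U) :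
    SmoothAlong I j 𝓘(ℝ, V) (fun b => ∑ i ∈ s, f i b) U := by
  classical
  induction s using Finset.induction_on with
  | empty => simpa using smoothAlong_const (0 : V)
  | insert i s hi ih =>
    simp only [Finset.sum_insert hi]
    exact (hf i (by simp)).add (ih fun k hk => hf k (by simp [hk]))

theorem SmoothAlong.pi {κ : Type*} [Fintype κ] {f : B → κ → ℝ}
    (hf : ∀ i, SmoothAlong I j 𝓘(ℝ, ℝ) (fun b => f b i) U) :
    SmoothAlong I j 𝓘(ℝ, κ → ℝ) f U := by
  classical
  have : f = fun b => ∑ i, f b i • (Pi.single i (1 : ℝ) : κ → ℝ) := by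
    ext b k; simp [Pi.single_apply]
  rw [this]
  exact SmoothAlong.sum fun i _ => (hf i).smul (smoothAlong_const _)

/-- Smoothness of maps into a real algebra without a norm. -/
def SmoothAlg {A : Type*} [AddCommGroup A] [Module ℝ A] (I : ModelWithCorners ℝ E H) (j : B → N)
    (f : B → A) (U : Set B) : Prop :=
  ∀ φ : A →ₗ[ℝ] ℝ, SmoothAlong I j 𝓘(ℝ, ℝ) (fun b => φ (f b)) U

section Alg

variable {A A' : Type*} [Ring A] [Algebra ℝ A] [Ring A'] [Algebra ℝ A']

theorem SmoothAlg.mul [Module.Finite ℝ A] {f g : B → A} (hf : SmoothAlg I j f U)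
    (hg : SmoothAlg I j g U) : SmoothAlg I j (fun b => f b * g b) U := fun φ =>
  (SmoothAlong.sum fun _ _ => SmoothAlong.sum fun _ _ => (hf _).mul ((hg _).mul
    (smoothAlong_const _))).congr fun b _ => functional_mul φ (f b) (g b)

theorem SmoothAlg.mono {f : B → A} (hf : SmoothAlg I j f U) (hU : U' ⊆ U) : SmoothAlg I j f U' :=
  fun φ => (hf φ).mono hU

theorem SmoothAlg.congr {f g : B → A} (hf : SmoothAlg I j f U) (hfg : ∀ b ∈ U, g b = f b) :
    SmoothAlg I j g U :=
  fun φ => (hf φ).congr fun b hb => by rw [hfg b hb]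

theorem smoothAlg_const (a : A) : SmoothAlg I j (fun _ => a) U :=
  fun _ => smoothAlong_const _

theorem SmoothAlg.map {f : B → A} (hf : SmoothAlg I j f U) (L : A →ₗ[ℝ] A') :
    SmoothAlg I j (fun b => L (f b)) U := fun φ => hf (φ ∘ₗ L)

theorem SmoothAlg.of_local [TopologicalSpace B] (hj : Topology.IsInducing j) {f : B → A}
    (h : ∀ b ∈ U, ∃ V ∈ nhds b, SmoothAlg I j f (U ∩ V)) : SmoothAlg I j f U :=
  fun φ => SmoothAlong.of_local hj fun b hb =>
    let ⟨V, hV, hs⟩ := h b hb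
    ⟨V, hV, hs φ⟩

theorem SmoothAlg.precomp {j' : B' → N'} {β : B' → B} {V : Set B'}
    (hβ : SmoothAlong I' j' I (fun b => j (β b)) V) {f : B → A} (h : SmoothAlg I j f U)
    (hVU : ∀ b ∈ V, β b ∈ U) : SmoothAlg I' j' (fun b => f (β b)) V :=
  fun φ => SmoothAlong.precomp hβ (h φ) hVU

theorem SmoothAlg.toSpace {f : B → V} [FiniteDimensional ℝ V]
    (hf : ∀ φ : V →ₗ[ℝ] ℝ, SmoothAlong I j 𝓘(ℝ, ℝ) (fun b => φ (f b)) U) :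
    SmoothAlong I j 𝓘(ℝ, V) f U := by
  let b := Module.finBasis ℝ V
  have : f = fun x => ∑ i, b.coord i (f x) • b i := by
    ext x; exact (b.sum_repr (f x)).symm
  rw [this]
  exact SmoothAlong.sum fun i _ => (hf _).smul (smoothAlong_const _)

theorem SmoothAlong.toAlg {f : B → V} [FiniteDimensional ℝ V] (hf : SmoothAlong I j 𝓘(ℝ, V) f U)
    (φ : V →ₗ[ℝ] ℝ) : SmoothAlong I j 𝓘(ℝ, ℝ) (fun b => φ (f b)) U :=
  hf.comp_contDiff φ.toContinuousLinearMap.contDiff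

/-- The inverse of a smooth family of units is smooth. -/
theorem SmoothAlg.inv [Module.Finite ℝ A] {f g : B → A} (hf : SmoothAlg I j f U)
    (hfg : ∀ b ∈ U, f b * g b = 1) (hgf : ∀ b ∈ U, g b * f b = 1) : SmoothAlg I j g U := by
  let κ := (Module.finBasis ℝ A).equivFun
  let X := Fin (Module.finrank ℝ A) → ℝ
  -- Left multiplication represents `A`, which carries no norm, by operators on `X`, where inversion
  -- is smooth. Applying the inverse operator to `1` recovers `g`.
  let L : A →ₗ[ℝ] (X →L[ℝ] X) :=
    { toFun := fun a => (κ.toLinearMap ∘ₗ LinearMap.mulLeft ℝ a ∘ₗ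
        κ.symm.toLinearMap).toContinuousLinearMap
      map_add' := fun a a' => by ext v i; simp [add_mul]
      map_smul' := fun c a => by ext v i; simp }
  have hL : ∀ a a', L (a * a') = L a * L a' := fun a a' => by
    ext v i; simp [L]
  have hL1 : L 1 = 1 := by ext v i; simp [L]
  have h1 : SmoothAlong I j 𝓘(ℝ, X →L[ℝ] X) (fun b => L (f b)) U :=
    SmoothAlg.toSpace fun φ => hf (φ ∘ₗ L)
  let u : ∀ b ∈ U, (X →L[ℝ] X)ˣ := fun b hb => ⟨L (f b), L (g b),
    by rw [← hL, hfg b hb, hL1], by rw [← hL, hgf b hb, hL1]⟩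
  have h2 : SmoothAlong I j 𝓘(ℝ, X →L[ℝ] X) (fun b => Ring.inverse (L (f b))) U :=
    h1.comp_contDiffOn fun b hb => by
      have : {x : X →L[ℝ] X | IsUnit x} ∈ nhds (L (f b)) :=
        Units.isOpen.mem_nhds (u b hb).isUnit
      filter_upwards [this] with x hx
      obtain ⟨y, rfl⟩ := hx
      exact contDiffAt_ringInverse ℝ y
  have h3 : SmoothAlong I j 𝓘(ℝ, X) (fun b => L (g b) (κ 1)) U :=
    (h2.comp_contDiff (G := fun T : X →L[ℝ] X => T (κ 1))
      (contDiff_id.clm_apply contDiff_const)).congr fun b hb => by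
        have : Ring.inverse (L (f b)) = L (g b) := Ring.inverse_unit (u b hb)
        simp only [this]
  intro φ
  refine (h3.comp_contDiff (G := φ ∘ₗ κ.symm.toLinearMap)
    (φ ∘ₗ κ.symm.toLinearMap).toContinuousLinearMap.contDiff).congr fun b _ => ?_
  simp [L]

end Alg

end SmoothAlongCalculus

/-! ### Topology of linear groups -/

section LinearGroupTopology

variable {𝒢 : LinearGroup} {X : Type*} [TopologicalSpace X]

theorem continuousWithinAt_el_iff {f : X → 𝒢.El} {s : Set X} {x : X} : ContinuousWithinAt f s x ↔
    ∀ φ : 𝒢.Alg →ₗ[ℝ] ℝ, ContinuousWithinAt (fun x => φ (LinearGroup.val (f x))) s x := by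
  unfold ContinuousWithinAt
  rw [nhds_iInf, Filter.tendsto_iInf]
  simp only [nhds_induced, Filter.tendsto_comap_iff]
  rfl

theorem continuousOn_el_iff {f : X → 𝒢.El} {s : Set X} : ContinuousOn f s ↔
    ∀ φ : 𝒢.Alg →ₗ[ℝ] ℝ, ContinuousOn (fun x => φ (LinearGroup.val (f x))) s := by
  unfold ContinuousOn
  simp only [continuousWithinAt_el_iff]
  exact ⟨fun h φ x hx => h x hx φ, fun h x hx φ => h φ x hx⟩

theorem continuousAt_el_iff {f : X → 𝒢.El} {x : X} : ContinuousAt f x ↔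
    ∀ φ : 𝒢.Alg →ₗ[ℝ] ℝ, ContinuousAt (fun x => φ (LinearGroup.val (f x))) x := by
  simp only [← continuousWithinAt_univ, continuousWithinAt_el_iff]

theorem continuous_el_iff {f : X → 𝒢.El} : Continuous f ↔
    ∀ φ : 𝒢.Alg →ₗ[ℝ] ℝ, Continuous (fun x => φ (LinearGroup.val (f x))) := by
  simp only [← continuousOn_univ, continuousOn_el_iff]

theorem continuous_functional (φ : 𝒢.Alg →ₗ[ℝ] ℝ) :
    Continuous fun a : 𝒢.El => φ (LinearGroup.val a) :=
  continuous_el_iff.1 continuous_id φ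

instance [Module.Finite ℝ 𝒢.Alg] : ContinuousMul 𝒢.El where
  continuous_mul := continuous_el_iff.2 fun φ => by
    rw [show (fun x : 𝒢.El × 𝒢.El => φ (LinearGroup.val (x.1 * x.2))) = _ from
      funext fun x => functional_mul φ (LinearGroup.val x.1) (LinearGroup.val x.2)]
    exact continuous_finsetSum _ fun i _ => continuous_finsetSum _ fun k _ =>
      ((continuous_functional _).comp continuous_fst).mul
        (((continuous_functional _).comp continuous_snd).mul continuous_const)

end LinearGroupTopology

/-! ### Principal bundles -/

namespace PrincipalBundle

variable {E H E' H' : Type*} [NormedAddCommGroup E] [NormedSpace ℝ E] [TopologicalSpace H]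
  [NormedAddCommGroup E'] [NormedSpace ℝ E'] [TopologicalSpace H']
  {N N' : Type*} [TopologicalSpace N] [ChartedSpace H N] [TopologicalSpace N'] [ChartedSpace H' N']
  {B : Type u} [TopologicalSpace B] {I : ModelWithCorners ℝ E H} {j : B → N}
  {𝒢 ℋ : LinearGroup} (P : PrincipalBundle I j 𝒢)
  {B' : Type*} [TopologicalSpace B'] {I' : ModelWithCorners ℝ E' H'} {j' : B' → N'}

theorem proj_invFun {e : Bundle.Trivialization 𝒢.El P.proj} {b : B} (hb : b ∈ e.baseSet) (g : 𝒢.El) :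
    P.proj (e.invFun (b, g)) = b := e.proj_symm_apply' hb

theorem apply_invFun {e : Bundle.Trivialization 𝒢.El P.proj} {b : B} (hb : b ∈ e.baseSet)
    (g : 𝒢.El) : e (e.invFun (b, g)) = (b, g) := e.apply_symm_apply' hb

theorem ext_triv {e : Bundle.Trivialization 𝒢.El P.proj} {p q : P.Total}
    (hp : P.proj p ∈ e.baseSet) (h : P.proj p = P.proj q) (h2 : (e p).2 = (e q).2) : p = q := by
  refine e.injOn (e.mem_source.2 hp) (e.mem_source.2 (h ▸ hp)) (Prod.ext ?_ h2)
  change (e p).1 = (e q).1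
  rw [e.coe_fst' hp, e.coe_fst' (h ▸ hp), h]

theorem exists_act_eq {p q : P.Total} (h : P.proj p = P.proj q) : ∃ a, P.act p a = q := by
  obtain ⟨e, he, hb⟩ := P.exists_mem_atlas (P.proj p)
  refine ⟨(e p).2⁻¹ * (e q).2, P.ext_triv (e := e) (by rwa [P.proj_act]) (by rw [P.proj_act, h]) ?_⟩
  rw [P.atlas_act e he p hb, mul_inv_cancel_left]

theorem act_injective {p : P.Total} {a b : 𝒢.El} (h : P.act p a = P.act p b) : a = b := by
  obtain ⟨e, he, hb⟩ := P.exists_mem_atlas (P.proj p)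
  have := congrArg (fun q => (e q).2) h
  simp only [P.atlas_act e he p hb] at this
  exact mul_left_cancel this

open Classical in
/-- The element of the group that takes `p` to `q`. -/
def diff (p q : P.Total) : 𝒢.El :=
  if h : P.proj p = P.proj q then (P.exists_act_eq h).choose else 1

variable {P}

theorem act_diff {p q : P.Total} (h : P.proj p = P.proj q) : P.act p (P.diff p q) = q := by
  rw [diff, dif_pos h]; exact (P.exists_act_eq h).choose_spec

theorem diff_eq_iff {p q : P.Total} {a : 𝒢.El} (h : P.proj p = P.proj q) :
    P.diff p q = a ↔ P.act p a = q :=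
  ⟨fun h' => h' ▸ act_diff h, fun h' => P.act_injective ((act_diff h).trans h'.symm)⟩

theorem diff_act_right {p q : P.Total} (h : P.proj p = P.proj q) (a : 𝒢.El) :
    P.diff p (P.act q a) = P.diff p q * a :=
  (diff_eq_iff (h.trans (P.proj_act q a).symm)).2 (by rw [P.act_mul, act_diff h])

theorem diff_mul_diff {p q r : P.Total} (h : P.proj p = P.proj q) (h' : P.proj q = P.proj r) :
    P.diff p q * P.diff q r = P.diff p r := by
  rw [← diff_act_right h, act_diff h']

theorem triv_diff {e : Bundle.Trivialization 𝒢.El P.proj} (he : e ∈ P.atlas) {p q : P.Total}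
    (hp : P.proj p ∈ e.baseSet) (h : P.proj p = P.proj q) :
    P.diff p q = (e p).2⁻¹ * (e q).2 := by
  have := P.atlas_act e he p hp (P.diff p q)
  rw [act_diff h] at this
  rw [this, inv_mul_cancel_left]

theorem isSmoothSection_invFun {e : Bundle.Trivialization 𝒢.El P.proj} (he : e ∈ P.atlas) :
    P.IsSmoothSection (fun b => e.invFun (b, 1)) e.baseSet :=
  ⟨e.open_baseSet, fun _ hb => P.proj_invFun hb 1, fun e' he' φ =>
    (P.atlas_smooth e he e' he' φ).mono fun b hb => ⟨hb.1, by
      have h2 := hb.2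
      rwa [Set.mem_ofPred_eq, P.proj_invFun hb.1] at h2⟩⟩

theorem SmoothInto.mono {s : B' → P.Total} {U U' : Set B'} (h : P.SmoothInto I' j' s U)
    (hU : U' ⊆ U) : P.SmoothInto I' j' s U' := fun e he φ =>
  (h e he φ).mono (Set.inter_subset_inter_left _ hU)

theorem SmoothInto.congr {s s' : B' → P.Total} {U : Set B'} (h : P.SmoothInto I' j' s U)
    (hs : ∀ b ∈ U, s' b = s b) : P.SmoothInto I' j' s' U := fun e he φ =>
  ((h e he φ).mono fun b hb => ⟨hb.1, by
    have h2 := hb.2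
    rwa [Set.mem_ofPred_eq, hs b hb.1] at h2⟩).congr fun b hb => by rw [hs b hb.1]

theorem SmoothInto.of_local (hj : Topology.IsInducing j') {s : B' → P.Total} {U : Set B'}
    (h : ∀ b ∈ U, ∃ V ∈ nhds b, P.SmoothInto I' j' s (U ∩ V)) : P.SmoothInto I' j' s U :=
  fun e he φ => SmoothAlong.of_local hj fun b hb => by
    obtain ⟨V, hV, hs⟩ := h b hb.1
    exact ⟨V, hV, (hs e he φ).mono fun c hc => ⟨⟨hc.1.1, hc.2⟩, hc.1.2⟩⟩

theorem SmoothInto.act [Module.Finite ℝ 𝒢.Alg] {s : B' → P.Total} {U : Set B'}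
    (h : P.SmoothInto I' j' s U) {a : B' → 𝒢.El}
    (ha : SmoothAlg I' j' (fun b => LinearGroup.val (a b)) U) :
    P.SmoothInto I' j' (fun b => P.act (s b) (a b)) U := fun e he φ => by
  have h1 : SmoothAlg I' j' (fun b => LinearGroup.val (e (s b)).2)
      (U ∩ {b | P.proj (s b) ∈ e.baseSet}) := h e he
  refine (((h1.mul (ha.mono Set.inter_subset_left)) φ).mono fun b hb => ?_).congr fun b hb => ?_
  · have h2 := hb.2
    rw [Set.mem_ofPred_eq, P.proj_act] at h2
    exact ⟨hb.1, h2⟩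
  · have h2 := hb.2
    rw [Set.mem_ofPred_eq, P.proj_act] at h2
    rw [P.atlas_act e he _ h2]
    rfl

theorem smoothAlg_val_inv [Module.Finite ℝ 𝒢.Alg] {a : B' → 𝒢.El} {U : Set B'}
    (ha : SmoothAlg I' j' (fun b => LinearGroup.val (a b)) U) :
    SmoothAlg I' j' (fun b => LinearGroup.val (a b)⁻¹) U :=
  ha.inv (fun _ _ => LinearGroup.val_mul_inv _) fun _ _ => LinearGroup.val_inv_mul _

theorem SmoothInto.diff [Module.Finite ℝ 𝒢.Alg] (hj : Topology.IsInducing j') {s s' : B' → P.Total}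
    {U : Set B'} (h : P.SmoothInto I' j' s U) (h' : P.SmoothInto I' j' s' U)
    (hp : ∀ b ∈ U, P.proj (s b) = P.proj (s' b)) (hc : ContinuousOn (fun b => P.proj (s b)) U) :
    SmoothAlg I' j' (fun b => LinearGroup.val (P.diff (s b) (s' b))) U := by
  refine SmoothAlg.of_local hj fun b hb => ?_
  obtain ⟨e, he, hbe⟩ := P.exists_mem_atlas (P.proj (s b))
  have h1 := hc b hb (e.open_baseSet.mem_nhds hbe)
  rw [Filter.mem_map, mem_nhdsWithin_iff_exists_mem_nhds_inter] at h1
  obtain ⟨V, hV, hVU⟩ := h1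
  have hm : ∀ c ∈ U ∩ V, P.proj (s c) ∈ e.baseSet := fun c hc => hVU ⟨hc.2, hc.1⟩
  refine ⟨V, hV, ?_⟩
  have h2 : SmoothAlg I' j' (fun b => LinearGroup.val (e (s b)).2) (U ∩ V) :=
    fun φ => (h e he φ).mono fun c hc => ⟨hc.1, hm c hc⟩
  have h3 : SmoothAlg I' j' (fun b => LinearGroup.val (e (s' b)).2) (U ∩ V) :=
    fun φ => (h' e he φ).mono fun c hc => ⟨hc.1, by
      rw [Set.mem_ofPred_eq, ← hp c hc.1]; exact hm c hc⟩
  exact ((smoothAlg_val_inv h2).mul h3).congr fun c hc => by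
    rw [triv_diff he (hm c hc) (hp c hc.1)]; rfl

theorem SmoothInto.precomp {s : B → P.Total} {U : Set B} (h : P.SmoothInto I j s U) {β : B' → B}
    {V : Set B'} (hβ : SmoothAlong I' j' I (fun b => j (β b)) V) (hV : ∀ b ∈ V, β b ∈ U) :
    P.SmoothInto I' j' (fun b => s (β b)) V := fun e he φ =>
  SmoothAlong.precomp (hβ.mono Set.inter_subset_left) (h e he φ) fun b hb => ⟨hV b hb.1, hb.2⟩

theorem IsSmoothSection.mono {s : B → P.Total} {U U' : Set B} (h : P.IsSmoothSection s U)
    (hU' : IsOpen U') (hU : U' ⊆ U) : P.IsSmoothSection s U' :=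
  ⟨hU', fun b hb => h.2.1 b (hU hb), h.2.2.mono hU⟩

theorem IsSmoothSection.act [Module.Finite ℝ 𝒢.Alg] {s : B → P.Total} {U : Set B}
    (h : P.IsSmoothSection s U) {a : B → 𝒢.El} (ha : SmoothAlg I j (fun b => LinearGroup.val (a b)) U) :
    P.IsSmoothSection (fun b => P.act (s b) (a b)) U :=
  ⟨h.1, fun b hb => by rw [P.proj_act]; exact h.2.1 b hb, h.2.2.act ha⟩

theorem IsSmoothSection.diff [Module.Finite ℝ 𝒢.Alg] (hj : Topology.IsInducing j)
    {s s' : B → P.Total} {U : Set B} (h : P.IsSmoothSection s U) (h' : P.IsSmoothSection s' U) :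
    SmoothAlg I j (fun b => LinearGroup.val (P.diff (s b) (s' b))) U :=
  h.2.2.diff hj h'.2.2 (fun b hb => (h.2.1 b hb).trans (h'.2.1 b hb).symm)
    (continuousOn_id.congr fun b hb => h.2.1 b hb)

theorem exists_section [Module.Finite ℝ 𝒢.Alg] (p : P.Total) : ∃ s U, P.IsSmoothSection s U ∧
    P.proj p ∈ U ∧ s (P.proj p) = p := by
  obtain ⟨e, he, hb⟩ := P.exists_mem_atlas (P.proj p)
  have h := isSmoothSection_invFun he
  exact ⟨_, _, h.act (a := fun _ => P.diff (e.invFun (P.proj p, 1)) p) (smoothAlg_const _), hb,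
    act_diff (h.2.1 _ hb)⟩

theorem exists_section_at (b : B) : ∃ s U, P.IsSmoothSection s U ∧ b ∈ U := by
  obtain ⟨e, he, hb⟩ := P.exists_mem_atlas b
  exact ⟨_, _, isSmoothSection_invFun he, hb⟩

/-- An equivariant map of principal bundles that is smooth on some local sections is smooth on all
local sections. -/
theorem smoothInto_map [Module.Finite ℝ 𝒢.Alg] [Module.Finite ℝ ℋ.Alg]
    (hj : Topology.IsInducing j) (hj' : Topology.IsInducing j')
    {E₂ H₂ N₂ : Type*} [NormedAddCommGroup E₂] [NormedSpace ℝ E₂] [TopologicalSpace H₂]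
    [TopologicalSpace N₂] [ChartedSpace H₂ N₂] {B₂ : Type u} [TopologicalSpace B₂]
    {I₂ : ModelWithCorners ℝ E₂ H₂} {j₂ : B₂ → N₂} {Q : PrincipalBundle I₂ j₂ ℋ}
    {π : B' → B} (hπc : Continuous π) (hπ : SmoothAlong I' j' I (fun b => j (π b)) Set.univ)
    {F : B' → P.Total → Q.Total} {ρ : 𝒢.El → ℋ.El} (R : 𝒢.Alg →ₗ[ℝ] ℋ.Alg)
    (hR : ∀ a, LinearGroup.val (ρ a) = R (LinearGroup.val a))
    (hF : ∀ z p a, F z (P.act p a) = Q.act (F z p) (ρ a))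
    (hloc : ∀ z, ∃ s U, P.IsSmoothSection s U ∧ π z ∈ U ∧ ∃ V ∈ nhds z,
      Q.SmoothInto I' j' (fun z => F z (s (π z))) V)
    {s : B → P.Total} {U : Set B} (hs : P.IsSmoothSection s U) :
    Q.SmoothInto I' j' (fun z => F z (s (π z))) (π ⁻¹' U) := by
  refine SmoothInto.of_local hj' fun z hz => ?_
  obtain ⟨s', U', hs', hzU', V, hV, hFV⟩ := hloc z
  have hUU : IsOpen (U ∩ U') := hs.1.inter hs'.1
  -- Every section is the known local section `s'` times a smooth function to the group, and `R`
  -- carries that function to the other group.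
  have hd := (hs'.mono hUU Set.inter_subset_right).diff hj (hs.mono hUU Set.inter_subset_left)
  have hW : π ⁻¹' (U ∩ U') ∈ nhds z := (hUU.preimage hπc).mem_nhds ⟨hz, hzU'⟩
  refine ⟨V ∩ π ⁻¹' (U ∩ U'), Filter.inter_mem hV hW, ?_⟩
  have hd2 : SmoothAlg I' j' (fun z => LinearGroup.val (ρ (P.diff (s' (π z)) (s (π z)))))
      (V ∩ π ⁻¹' (U ∩ U')) :=
    ((SmoothAlg.precomp (hπ.mono (Set.subset_univ _)) hd fun b hb => hb.2).map R).congr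
      fun b _ => hR _
  refine (((hFV.mono Set.inter_subset_left).act hd2).mono Set.inter_subset_right).congr
    fun c hc => ?_
  rw [← hF, act_diff]
  exact (hs'.2.1 _ hc.2.2.2).trans (hs.2.1 _ hc.2.2.1).symm

theorem exists_proj_eq (P : PrincipalBundle I j 𝒢) (b : B) : ∃ p, P.proj p = b := by
  obtain ⟨e, -, hb⟩ := P.exists_mem_atlas b
  exact ⟨_, P.proj_invFun hb 1⟩

/-- A smooth equivariant map over the identity is an isomorphism. -/
theorem exists_iso [Module.Finite ℝ 𝒢.Alg] (hj : Topology.IsInducing j)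
    {P Q : PrincipalBundle I j 𝒢} (F : P.Total → Q.Total) (hp : ∀ p, Q.proj (F p) = P.proj p)
    (hF : ∀ p a, F (P.act p a) = Q.act (F p) a)
    (hloc : ∀ b, ∃ s U, P.IsSmoothSection s U ∧ b ∈ U ∧ Q.IsSmoothSection (fun b => F (s b)) U) :
    ∃ f : P.Iso Q, ∀ p, f.equiv p = F p := by
  have hinj : Function.Injective F := by
    intro p q h
    have hpq : P.proj p = P.proj q := by rw [← hp, h, hp]
    have h1 : Q.act (F p) (P.diff p q) = Q.act (F p) 1 := by
      rw [← hF, act_diff hpq, Q.act_one, h]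
    rw [← act_diff hpq, Q.act_injective h1, P.act_one]
  have hsurj : Function.Surjective F := by
    intro q
    obtain ⟨p, hpq⟩ := P.exists_proj_eq (Q.proj q)
    exact ⟨P.act p (Q.diff (F p) q), by rw [hF, act_diff (by rw [hp, hpq])]⟩
  let f := Equiv.ofBijective F ⟨hinj, hsurj⟩
  have hf : ∀ p, f p = F p := fun _ => rfl
  have hfs : ∀ q, F (f.symm q) = q := f.apply_symm_apply
  have hps : ∀ q, P.proj (f.symm q) = Q.proj q := fun q => by rw [← hp, hfs]
  have hFs : ∀ q a, f.symm (Q.act q a) = P.act (f.symm q) a := fun q a => by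
    rw [Equiv.symm_apply_eq, hf, hF, hfs]
  refine ⟨⟨f, hp, hF, fun s U hs => ⟨hs.1, fun b hb => (hp _).trans (hs.2.1 b hb), ?_⟩,
    fun s U hs => ⟨hs.1, fun b hb => (hps _).trans (hs.2.1 b hb), ?_⟩⟩, hf⟩
  · refine smoothInto_map (I' := I) (j' := j) hj hj continuous_id smoothAlong_self (ρ := id)
      (π := id) (F := fun _ => F) LinearMap.id (fun _ => rfl) (fun _ => hF) (fun z => ?_) hs
    obtain ⟨s, U, h1, h2, h3⟩ := hloc z
    exact ⟨s, U, h1, h2, U, h1.1.mem_nhds h2, h3.2.2⟩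
  · refine smoothInto_map (I' := I) (j' := j) hj hj continuous_id smoothAlong_self (ρ := id)
      (π := id) (F := fun _ => f.symm) LinearMap.id (fun _ => rfl) (fun _ => hFs) (fun z => ?_) hs
    obtain ⟨s, U, h1, h2, h3⟩ := hloc z
    refine ⟨_, U, h3, h2, U, h1.1.mem_nhds h2, h1.2.2.congr fun b _ => ?_⟩
    exact f.symm_apply_apply _

/-- Equivariant maps out of a principal bundle, given by their values on local sections. -/
theorem exists_equivariant {K X : Type*} {U : K → Set B} (hcov : ∀ b, ∃ i, b ∈ U i)
    {s : K → B → P.Total} (hs : ∀ i, ∀ b ∈ U i, P.proj (s i b) = b) (actX : X → 𝒢.El → X)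
    (hact : ∀ x a b, actX x (a * b) = actX (actX x a) b) (y : K → B → X)
    (hy : ∀ i k b, b ∈ U i → b ∈ U k → y k b = actX (y i b) (P.diff (s i b) (s k b))) :
    ∃ D : P.Total → X, (∀ i, ∀ b ∈ U i, D (s i b) = y i b) ∧
      ∀ p a, D (P.act p a) = actX (D p) a := by
  choose ix hix using hcov
  -- The map is defined with an index chosen from the base point; its value does not depend on this
  -- choice.
  have key : ∀ i p, P.proj p ∈ U i → actX (y (ix (P.proj p)) (P.proj p))
      (P.diff (s (ix (P.proj p)) (P.proj p)) p) =
      actX (y i (P.proj p)) (P.diff (s i (P.proj p)) p) := by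
    intro i p hp
    have h1 := hs _ _ (hix (P.proj p))
    have h2 := hs _ _ hp
    rw [hy i _ _ hp (hix _), ← hact, diff_mul_diff (h2.trans h1.symm) h1]
  refine ⟨fun p => actX (y (ix (P.proj p)) (P.proj p)) (P.diff (s (ix (P.proj p)) (P.proj p)) p),
    fun i b hb => ?_, fun p a => ?_⟩
  · have hb' := hs i b hb
    have h1 := key i (s i b) (by rw [hb']; exact hb)
    refine h1.trans ?_
    rw [hb', ← hy i i b hb hb]
  · simp only [P.proj_act]
    rw [diff_act_right (hs _ _ (hix _)), hact]

/-- The principal bundle with given transition functions. -/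
theorem exists_of_cocycle [Module.Finite ℝ 𝒢.Alg] (hj : Continuous j) {K : Type*} {U : K → Set B}
    (hU : ∀ i, IsOpen (U i)) (hcov : ∀ b, ∃ i, b ∈ U i) (c : K → K → B → 𝒢.El)
    (hc : ∀ i k l b, b ∈ U i → b ∈ U k → b ∈ U l → c i k b * c k l b = c i l b)
    (hsm : ∀ i k, SmoothAlg I j (fun b => LinearGroup.val (c i k b)) (U i ∩ U k)) :
    ∃ (P : PrincipalBundle I j 𝒢) (s : K → B → P.Total),
      (∀ i, P.IsSmoothSection (s i) (U i)) ∧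
      ∀ i k b, b ∈ U i → b ∈ U k → s k b = P.act (s i b) (c i k b) := by
  choose ix hix using hcov
  have hc1 : ∀ i b, b ∈ U i → c i i b = 1 := fun i b hb => by
    have := hc i i i b hb hb hb
    exact mul_eq_left.1 this
  let Z : FiberBundleCore K B 𝒢.El :=
    { baseSet := U
      isOpen_baseSet := hU
      indexAt := ix
      mem_baseSet_at := hix
      -- The coordinate of a point in chart `i` is the `g` with `p = s_i g`, and `s_i = s_k c_{ki}`;
      -- hence the reversed indices. Left multiplication commutes with the right action, which
      -- therefore descends.
      coordChange := fun i k b g => c k i b * g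
      coordChange_self := fun i b hb g => by rw [hc1 i b hb, one_mul]
      continuousOn_coordChange := fun i k => by
        have h1 : ContinuousOn (c k i) (U i ∩ U k) := continuousOn_el_iff.2 fun φ =>
          ((hsm k i φ).mono fun b hb => ⟨hb.2, hb.1⟩).continuousOn hj
        exact (h1.comp continuousOn_fst fun p hp => hp.1).mul continuousOn_snd
      coordChange_comp := fun i k l b hb g => by
        rw [← mul_assoc, hc l k i b hb.2 hb.1.2 hb.1.1] }
  let act : Z.TotalSpace → 𝒢.El → Z.TotalSpace := fun p a =>
    ⟨p.1, (show 𝒢.El from (show 𝒢.El from p.2) * a)⟩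
  have happly : ∀ i (p : Z.TotalSpace), Z.localTriv i p =
      (p.1, c i (ix p.1) p.1 * (show 𝒢.El from p.2)) := fun i p => rfl
  have hapact : ∀ i (p : Z.TotalSpace) a, Z.localTriv i (act p a) =
      ((Z.localTriv i p).1, (Z.localTriv i p).2 * a) := fun i p a => by
    rw [happly, happly, mul_assoc]
  have hsym : ∀ i b (g : 𝒢.El), b ∈ U i → (Z.localTriv i).invFun (b, g) =
      (⟨b, (show 𝒢.El from c (ix b) i b * g)⟩ : Z.TotalSpace) := fun i b g hb => rfl
  let P : PrincipalBundle I j 𝒢 :=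
    { Total := Z.TotalSpace
      proj := Z.proj
      act := act
      act_one := fun p => by
        change (⟨p.1, _⟩ : Z.TotalSpace) = p
        rw [show ((show 𝒢.El from p.2) * 1 : 𝒢.El) = p.2 from mul_one _]
      act_mul := fun p a b => by
        change (⟨p.1, _⟩ : Z.TotalSpace) = ⟨p.1, _⟩
        rw [← mul_assoc]
      continuous_act := by
        rw [continuous_iff_continuousAt]
        rintro ⟨p, a⟩
        let e := Z.localTriv (ix p.1)
        have hp : p ∈ e.source := e.mem_source.2 (hix p.1)
        have h1 : ∀ᶠ q : Z.TotalSpace × 𝒢.El in nhds (p, a), q.1 ∈ e.source :=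
          continuous_fst.continuousAt.eventually (e.open_source.mem_nhds hp)
        have h2 : ContinuousAt (fun q : Z.TotalSpace × 𝒢.El => ((e q.1).1, (e q.1).2 * q.2))
            (p, a) := by
          have := (e.continuousAt hp).comp (x := (p, a)) continuous_fst.continuousAt
          exact (continuous_fst.continuousAt.comp this).prodMk
            ((continuous_snd.continuousAt.comp this).mul continuous_snd.continuousAt)
        have h3 : ((e p).1, (e p).2 * a) ∈ e.target := by
          rw [e.target_eq]; exact ⟨hix p.1, trivial⟩
        have h4 : ContinuousAt (fun q : Z.TotalSpace × 𝒢.El =>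
            e.toOpenPartialHomeomorph.symm ((e q.1).1, (e q.1).2 * q.2)) (p, a) :=
          ContinuousAt.comp (f := fun q : Z.TotalSpace × 𝒢.El => ((e q.1).1, (e q.1).2 * q.2))
            (e.toOpenPartialHomeomorph.continuousAt_symm h3) h2
        refine h4.congr ?_
        filter_upwards [h1] with q hq
        change _ = act q.1 q.2
        rw [← hapact]
        refine e.toOpenPartialHomeomorph.left_inv ?_
        exact e.mem_source.2 (e.mem_source.1 hq)
      proj_act := fun _ _ => rfl
      atlas := Set.range Z.localTriv
      exists_mem_atlas := fun b => ⟨_, ⟨ix b, rfl⟩, hix b⟩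
      atlas_act := by
        rintro _ ⟨i, rfl⟩ p - a
        rw [hapact]
      atlas_smooth := by
        rintro _ ⟨i, rfl⟩ _ ⟨k, rfl⟩ φ
        refine ((hsm k i φ).mono fun b hb => ⟨hb.2, hb.1⟩).congr fun b hb => ?_
        rw [hsym i b 1 hb.1, happly]
        simp only
        rw [mul_one, hc k _ i b hb.2 (hix b) hb.1] }
  refine ⟨P, fun i b => (Z.localTriv i).invFun (b, 1), fun i =>
    isSmoothSection_invFun (P := P) ⟨i, rfl⟩, fun i k b hi hk => ?_⟩
  change (Z.localTriv k).invFun (b, 1) = act ((Z.localTriv i).invFun (b, 1)) (c i k b)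
  rw [hsym i b 1 hi, hsym k b 1 hk]
  change (⟨b, _⟩ : Z.TotalSpace) = ⟨b, _⟩
  rw [mul_one, mul_one, hc _ i k b (hix b) hi hk]

end PrincipalBundle

/-! ### Frames: linear algebra -/

section LinearFrames

variable {ι : Type} [Fintype ι] [DecidableEq ι] {V : Type*} [AddCommGroup V] [Module ℝ V]
  {ε : ι → ℝ} {g : LinearMap.BilinForm ℝ V} {o : Orientation ℝ V ι}

theorem linearCombination_single (v : ι → V) (k : ι) :
    Fintype.linearCombination ℝ v (Pi.single k 1) = v k := by
  rw [Fintype.linearCombination_apply_single, one_smul]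

theorem linearCombination_transform (v : ι → V) (T : (ι → ℝ) →ₗ[ℝ] (ι → ℝ)) :
    Fintype.linearCombination ℝ
      (fun k => Fintype.linearCombination ℝ v (T (Pi.single k 1))) =
      Fintype.linearCombination ℝ v ∘ₗ T := by
  refine LinearMap.pi_ext' fun k => LinearMap.ext_ring ?_
  simp only [LinearMap.comp_apply, LinearMap.coe_single]
  rw [linearCombination_single]

/-- Read as a statement on the coordinate map of `v`, orthonormality behaves well under a change of
frame, which is composition of maps by `linearCombination_transform`. -/
theorem isOrthonormal_iff (v : ι → V) : IsOrthonormal ε g v ↔ ∀ x y,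
    g (Fintype.linearCombination ℝ v x) (Fintype.linearCombination ℝ v y) = ip ε x y := by
  constructor
  · intro h x y
    simp only [Fintype.linearCombination_apply, map_sum, LinearMap.sum_apply, map_smul,
      LinearMap.smul_apply, h _ _, smul_eq_mul, ip]
    simp only [mul_ite, mul_zero, Finset.sum_ite_eq, Finset.sum_ite_eq', Finset.mem_univ, if_true]
    exact Finset.sum_congr rfl fun i _ => by ring
  · intro h i k
    have := h (Pi.single i 1) (Pi.single k 1)
    rw [linearCombination_single, linearCombination_single] at this
    rw [this, ip_single_left]
    by_cases hik : i = k
    · subst hik; simp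
    · simp [hik, Pi.single_apply]

theorem IsOrthonormal.transform {v : ι → V} (h : IsOrthonormal ε g v)
    {T : (ι → ℝ) →ₗ[ℝ] (ι → ℝ)} (hT : IsIsom ε T) :
    IsOrthonormal ε g fun k => Fintype.linearCombination ℝ v (T (Pi.single k 1)) := by
  rw [isOrthonormal_iff, linearCombination_transform]
  intro x y
  rw [LinearMap.comp_apply, LinearMap.comp_apply, (isOrthonormal_iff v).1 h, hT]

theorem basis_det_eq (b : Module.Basis ι ℝ V) {T : (ι → ℝ) →ₗ[ℝ] (ι → ℝ)} :
    b.det (fun k => Fintype.linearCombination ℝ b (T (Pi.single k 1))) = LinearMap.det T := by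
  rw [Module.Basis.det_apply, ← LinearMap.det_toMatrix']
  congr 1
  ext i k
  rw [Module.Basis.toMatrix_apply, LinearMap.toMatrix'_apply, Fintype.linearCombination_apply,
    b.repr_sum_self]

theorem IsPositiveBasis.transform {v : ι → V} (h : IsPositiveBasis o v)
    {T : (ι → ℝ) →ₗ[ℝ] (ι → ℝ)} (hT : 0 < LinearMap.det T) :
    IsPositiveBasis o fun k => Fintype.linearCombination ℝ v (T (Pi.single k 1)) := by
  obtain ⟨b, rfl, rfl⟩ := h
  let Te := LinearMap.equivOfDetNeZero T hT.ne'
  let b' := Module.Basis.ofEquivFun (Te.trans b.equivFun.symm).symm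
  have hb' : ⇑b' = fun k => Fintype.linearCombination ℝ b (T (Pi.single k 1)) := by
    ext k
    rw [Module.Basis.coe_ofEquivFun]
    simp only [LinearEquiv.symm_symm, LinearEquiv.trans_apply, Module.Basis.equivFun_symm_apply]
    rfl
  refine ⟨b', hb', ?_⟩
  rw [eq_comm, Module.Basis.orientation_eq_iff_det_pos, hb', basis_det_eq]
  exact hT

theorem IsPositiveBasis.exists_transform {v w : ι → V} (hv : IsPositiveBasis o v)
    (hw : IsPositiveBasis o w) : ∃ T : (ι → ℝ) →ₗ[ℝ] (ι → ℝ), 0 < LinearMap.det T ∧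
      w = fun k => Fintype.linearCombination ℝ v (T (Pi.single k 1)) := by
  obtain ⟨b, rfl, rfl⟩ := hv
  obtain ⟨b', rfl, h⟩ := hw
  have h1 : ⇑b' = fun k => Fintype.linearCombination ℝ b
      ((b.equivFun.toLinearMap ∘ₗ Fintype.linearCombination ℝ b') (Pi.single k 1)) := by
    ext k
    rw [LinearMap.comp_apply, linearCombination_single, Fintype.linearCombination_apply]
    exact (b.sum_equivFun (b' k)).symm
  refine ⟨_, ?_, h1⟩
  rw [← basis_det_eq b, ← h1]
  exact (b.orientation_eq_iff_det_pos b').1 h.symm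

theorem IsPositiveBasis.linearCombination_injective {v : ι → V} (hv : IsPositiveBasis o v) :
    Function.Injective (Fintype.linearCombination ℝ v) := by
  obtain ⟨b, rfl, -⟩ := hv
  have h : ⇑(Fintype.linearCombination ℝ ⇑b) = b.equivFun.symm := by
    ext x
    rw [b.equivFun_symm_apply, Fintype.linearCombination_apply]
  rw [h]
  exact b.equivFun.symm.injective

theorem IsOrthonormal.isIsom {v : ι → V} (hv : IsOrthonormal ε g v) {T : (ι → ℝ) →ₗ[ℝ] (ι → ℝ)}
    (hw : IsOrthonormal ε g fun k => Fintype.linearCombination ℝ v (T (Pi.single k 1))) :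
    IsIsom ε T := by
  rw [isOrthonormal_iff, linearCombination_transform] at hw
  intro x y
  rw [← (isOrthonormal_iff v).1 hv, ← hw, LinearMap.comp_apply, LinearMap.comp_apply]

end LinearFrames

/-! ### Tuples of tangent vectors -/

namespace TangentTuple

variable {E H E' H' : Type*} [NormedAddCommGroup E] [NormedSpace ℝ E] [TopologicalSpace H]
  [NormedAddCommGroup E'] [NormedSpace ℝ E'] [TopologicalSpace H']
  {N N' : Type*} [TopologicalSpace N] [ChartedSpace H N] [TopologicalSpace N'] [ChartedSpace H' N']
  {B : Type u} [TopologicalSpace B] {I : ModelWithCorners ℝ E H} [IsManifold I ∞ N] {j : B → N}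
  {ι : Type} [Fintype ι] [DecidableEq ι]

/-- Two tuples at the same point are equal if they have the same vectors. -/
theorem ext_base {F G : TangentTuple I j ι} (h : F.base = G.base)
    (h' : ∀ i, (show E from F.vec i) = (show E from G.vec i)) : F = G := by
  obtain ⟨b, v⟩ := F
  obtain ⟨b', w⟩ := G
  obtain rfl : b = b' := h
  congr
  exact funext h'

/-- The linear map `v ↦ ∑ v i • F i`. -/
def lin (F : TangentTuple I j ι) : (ι → ℝ) →ₗ[ℝ] TangentSpace I (j F.base) :=
  Fintype.linearCombination ℝ F.vec

theorem lin_single (F : TangentTuple I j ι) (k : ι) : F.lin (Pi.single k 1) = F.vec k :=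
  linearCombination_single _ _

theorem transform_vec (F : TangentTuple I j ι) (T : (ι → ℝ) →ₗ[ℝ] (ι → ℝ)) :
    (F.transform T).vec = fun k => F.lin (T (Pi.single k 1)) := rfl

theorem lin_transform (F : TangentTuple I j ι) (T : (ι → ℝ) →ₗ[ℝ] (ι → ℝ)) :
    (F.transform T).lin = F.lin ∘ₗ T := linearCombination_transform _ _

theorem transform_transform (F : TangentTuple I j ι) (S T : (ι → ℝ) →ₗ[ℝ] (ι → ℝ)) :
    (F.transform S).transform T = F.transform (S ∘ₗ T) := by
  refine ext_base rfl fun k => ?_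
  change (F.transform S).lin (T (Pi.single k 1)) = F.lin (S (T (Pi.single k 1)))
  rw [lin_transform]
  rfl

theorem transform_id (F : TangentTuple I j ι) : F.transform LinearMap.id = F :=
  ext_base rfl fun k => F.lin_single k

theorem transform_injective {F : TangentTuple I j ι} (hF : Function.Injective F.lin)
    {S T : (ι → ℝ) →ₗ[ℝ] (ι → ℝ)} (h : F.transform S = F.transform T) : S = T := by
  refine LinearMap.pi_ext' fun k => LinearMap.ext_ring ?_
  have h1 : (fun G : TangentTuple I j ι => (show E from G.vec k)) (F.transform S) =
    (fun G : TangentTuple I j ι => (show E from G.vec k)) (F.transform T) := by rw [h]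
  exact hF h1

variable {ε : ι → ℝ} {g : ∀ b, LinearMap.BilinForm ℝ (TangentSpace I (j b))}
  {o : ∀ b, Orientation ℝ (TangentSpace I (j b)) ι}

theorem transform_mem {F : TangentTuple I j ι} (hF : F ∈ PSO ε g o) {T : (ι → ℝ) →ₗ[ℝ] (ι → ℝ)}
    (hT : IsIsom ε T) (hd : 0 < LinearMap.det T) : F.transform T ∈ PSO ε g o :=
  ⟨hF.1.transform hT, hF.2.transform hd⟩

theorem lin_injective {F : TangentTuple I j ι} (hF : F ∈ PSO ε g o) : Function.Injective F.lin :=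
  hF.2.linearCombination_injective

theorem exists_transform {F G : TangentTuple I j ι} (hF : F ∈ PSO ε g o) (hG : G ∈ PSO ε g o)
    (h : F.base = G.base) : ∃ T, IsIsom ε T ∧ 0 < LinearMap.det T ∧ G = F.transform T := by
  obtain ⟨b, v⟩ := F
  obtain ⟨b', w⟩ := G
  obtain rfl : b = b' := h
  obtain ⟨T, hT, hw⟩ := hF.2.exists_transform hG.2
  have hw' : w = fun k => Fintype.linearCombination ℝ v (T (Pi.single k 1)) := hw
  refine ⟨T, hF.1.isIsom ?_, hT, ext_base rfl fun k => congrFun hw' k⟩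
  exact hw' ▸ hG.1

/-! ### Coordinates of tuples -/

/-- The matrix of a tuple in the trivialisation of the tangent bundle around `x₀`. -/
def coord (x₀ : N) (F : TangentTuple I j ι) : (ι → ℝ) →L[ℝ] E :=
  (Fintype.linearCombination ℝ fun i =>
    (trivializationAt E (TangentSpace I) x₀ (F.tvec i)).2).toContinuousLinearMap

omit [TopologicalSpace B] in
theorem coord_single (x₀ : N) (F : TangentTuple I j ι) (i : ι) :
    coord x₀ F (Pi.single i 1) = (trivializationAt E (TangentSpace I) x₀ (F.tvec i)).2 :=
  linearCombination_single _ _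

theorem coord_eq (x₀ : N) {F : TangentTuple I j ι}
    (h : j F.base ∈ (trivializationAt E (TangentSpace I) x₀).baseSet) (v : ι → ℝ) :
    coord x₀ F v = (trivializationAt E (TangentSpace I) x₀).continuousLinearEquivAt ℝ _ h
      (F.lin v) := by
  rw [lin]
  change Fintype.linearCombination ℝ _ v = _
  rw [Fintype.linearCombination_apply, Fintype.linearCombination_apply, map_sum]
  refine Finset.sum_congr rfl fun i _ => ?_
  rw [map_smul]
  rfl

theorem coord_transform (x₀ : N) {F : TangentTuple I j ι}
    (h : j F.base ∈ (trivializationAt E (TangentSpace I) x₀).baseSet)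
    (T : (ι → ℝ) →ₗ[ℝ] (ι → ℝ)) :
    coord x₀ (F.transform T) = coord x₀ F ∘L T.toContinuousLinearMap := by
  ext1 v
  rw [coord_eq (F := F.transform T) x₀ h, lin_transform, ContinuousLinearMap.comp_apply,
    coord_eq x₀ h]
  rfl

theorem isInvertible_coord (x₀ : N) {F : TangentTuple I j ι}
    (h : j F.base ∈ (trivializationAt E (TangentSpace I) x₀).baseSet) (hF : F ∈ PSO ε g o) :
    (coord x₀ F).IsInvertible := by
  obtain ⟨b, hb, -⟩ := hF.2
  have : FiniteDimensional ℝ (TangentSpace I (j F.base)) := b.finiteDimensional_of_finite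
  have hE : FiniteDimensional ℝ E := this
  let L := b.equivFun.symm.trans
    ((trivializationAt E (TangentSpace I) x₀).continuousLinearEquivAt ℝ _ h).toLinearEquiv
  refine ⟨L.toContinuousLinearEquiv, ?_⟩
  ext1 v
  rw [coord_eq x₀ h, lin, ← hb, Fintype.linearCombination_apply, ← b.equivFun_symm_apply]
  rfl

/-- The matrix between two frames is recovered from their coordinates; its continuity and smoothness
reduce to those of `ContinuousLinearMap.inverse`. -/
theorem toContinuousLinearMap_eq_inverse (x₀ : N) {F : TangentTuple I j ι}
    (h : j F.base ∈ (trivializationAt E (TangentSpace I) x₀).baseSet) (hF : F ∈ PSO ε g o)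
    (T : (ι → ℝ) →ₗ[ℝ] (ι → ℝ)) : T.toContinuousLinearMap =
      (coord x₀ F).inverse ∘L coord x₀ (F.transform T) := by
  rw [coord_transform x₀ h, ← ContinuousLinearMap.comp_assoc,
    (isInvertible_coord x₀ h hF).inverse_comp_self]
  rfl

/-! ### Continuity -/

variable {X : Type*} [TopologicalSpace X]

omit [Fintype ι] [DecidableEq ι] in
theorem continuousAt_iff_tvec {F : X → TangentTuple I j ι} {x : X} : ContinuousAt F x ↔
    ContinuousAt (fun x => (F x).base) x ∧ ∀ i, ContinuousAt (fun x => (F x).tvec i) x := by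
  have h1 : Topology.IsInducing (fun F : TangentTuple I j ι => (F.base, F.tvec)) := ⟨rfl⟩
  rw [h1.continuousAt_iff]
  exact ⟨fun h => ⟨h.fst, continuousAt_pi.1 h.snd⟩, fun h => h.1.prodMk (continuousAt_pi.2 h.2)⟩

theorem continuousAt_iff (hj : Continuous j) {F : X → TangentTuple I j ι} {x : X} :
    ContinuousAt F x ↔ ContinuousAt (fun x => (F x).base) x ∧
      ContinuousAt (fun y => coord (j (F x).base) (F y)) x := by
  rw [continuousAt_iff_tvec]
  refine and_congr_right fun hb => ?_
  have h1 : ∀ i, ContinuousAt (fun x => (F x).tvec i) x ↔ ContinuousAt (fun y =>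
      (trivializationAt E (TangentSpace I) (j (F x).base) ((F y).tvec i)).2) x := fun i => by
    rw [FiberBundle.continuousAt_totalSpace]
    exact and_iff_right (hj.continuousAt.comp hb)
  simp only [h1]
  constructor
  · intro h
    have h2 : ∀ y, coord (j (F x).base) (F y) = ∑ i,
        (ContinuousLinearMap.proj (R := ℝ) (φ := fun _ : ι => ℝ) i).smulRight
          (trivializationAt E (TangentSpace I) (j (F x).base) ((F y).tvec i)).2 := fun y => by
      ext1 v
      simp [coord, Fintype.linearCombination_apply]
    simp only [h2]
    refine tendsto_finsetSum _ fun i _ => ?_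
    exact ((ContinuousLinearMap.smulRightL ℝ (ι → ℝ) E
      (ContinuousLinearMap.proj (R := ℝ) (φ := fun _ : ι => ℝ) i)).continuous.continuousAt).comp (h i)
  · intro h i
    simp only [← coord_single]
    exact h.clm_apply continuousAt_const

theorem continuousAt_transform (hj : Continuous j) {F : X → TangentTuple I j ι} {x : X}
    (hF : ContinuousAt F x) {T : X → (ι → ℝ) →ₗ[ℝ] (ι → ℝ)}
    (hT : ContinuousAt (fun x => (T x).toContinuousLinearMap) x) :
    ContinuousAt (fun x => (F x).transform (T x)) x := by
  rw [continuousAt_iff hj] at hF ⊢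
  refine ⟨hF.1, ?_⟩
  have h1 : ∀ᶠ y in nhds x, j (F y).base ∈
      (trivializationAt E (TangentSpace I) (j (F x).base)).baseSet :=
    (hj.continuousAt.comp hF.1).eventually
      ((trivializationAt E (TangentSpace I) (j (F x).base)).open_baseSet.mem_nhds
        (FiberBundle.mem_baseSet_trivializationAt' _))
  refine ContinuousAt.congr (hF.2.clm_comp hT) ?_
  filter_upwards [h1] with y hy
  rw [← coord_transform _ hy]
  rfl

theorem continuousAt_matrix (hj : Continuous j) {F : X → TangentTuple I j ι} {x : X}
    (hF : ContinuousAt F x) (hP : ∀ᶠ y in nhds x, F y ∈ PSO ε g o) {T : X → (ι → ℝ) →ₗ[ℝ] (ι → ℝ)}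
    (hT : ContinuousAt (fun x => (F x).transform (T x)) x) :
    ContinuousAt (fun x => (T x).toContinuousLinearMap) x := by
  rw [continuousAt_iff hj] at hF hT
  have h0 := FiberBundle.mem_baseSet_trivializationAt' (F := E) (E := TangentSpace I) (j (F x).base)
  have h1 : ∀ᶠ y in nhds x, j (F y).base ∈
      (trivializationAt E (TangentSpace I) (j (F x).base)).baseSet :=
    (hj.continuousAt.comp hF.1).eventually
      ((trivializationAt E (TangentSpace I) (j (F x).base)).open_baseSet.mem_nhds h0)
  have h2 : ContinuousAt (fun y => (coord (j (F x).base) (F y)).inverse) x :=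
    ContinuousAt.comp (f := fun y => coord (j (F x).base) (F y))
      ((isInvertible_coord _ h0 hP.self_of_nhds).contDiffAt_map_inverse
        (n := 0)).continuousAt hF.2
  refine ContinuousAt.congr (h2.clm_comp hT.2) ?_
  filter_upwards [h1, hP] with y hy hy'
  exact (toContinuousLinearMap_eq_inverse _ hy hy' _).symm

/-! ### Smoothness -/

variable {B' : Type*} {I' : ModelWithCorners ℝ E' H'} {j' : B' → N'}

/-- A smooth family of tuples. -/
def Smooth (I' : ModelWithCorners ℝ E' H') (j' : B' → N') (F : B' → TangentTuple I j ι)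
    (U : Set B') : Prop :=
  ∀ i, SmoothAlong I' j' I.tangent (fun b => (F b).tvec i) U

omit [TopologicalSpace B] [Fintype ι] [DecidableEq ι] in
theorem Smooth.mono {F : B' → TangentTuple I j ι} {U U' : Set B'} (h : Smooth I' j' F U)
    (hU : U' ⊆ U) : Smooth I' j' F U' := fun i => (h i).mono hU

omit [TopologicalSpace B] [Fintype ι] [DecidableEq ι] in
theorem Smooth.congr {F G : B' → TangentTuple I j ι} {U : Set B'} (h : Smooth I' j' F U)
    (hFG : ∀ b ∈ U, G b = F b) : Smooth I' j' G U := fun i =>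
  (h i).congr fun b hb => by rw [hFG b hb]

omit [TopologicalSpace B] [Fintype ι] [DecidableEq ι] in
theorem Smooth.of_local [TopologicalSpace B'] (hj' : Topology.IsInducing j')
    {F : B' → TangentTuple I j ι} {U : Set B'}
    (h : ∀ b ∈ U, ∃ V ∈ nhds b, Smooth I' j' F (U ∩ V)) : Smooth I' j' F U := fun i =>
  SmoothAlong.of_local hj' fun b hb =>
    let ⟨V, hV, hs⟩ := h b hb
    ⟨V, hV, hs i⟩

theorem Smooth.coord {F : B' → TangentTuple I j ι} {U : Set B'} (h : Smooth I' j' F U) (x₀ : N)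
    (hU : ∀ b ∈ U, j (F b).base ∈ (trivializationAt E (TangentSpace I) x₀).baseSet) :
    SmoothAlong I' j' 𝓘(ℝ, (ι → ℝ) →L[ℝ] E) (fun b => coord x₀ (F b)) U := by
  have h1 : ∀ i, SmoothAlong I' j' 𝓘(ℝ, E)
      (fun b => (trivializationAt E (TangentSpace I) x₀ ((F b).tvec i)).2) U := fun i =>
    ((h i).comp_contMDiffOn fun b hb => ⟨_, (trivializationAt E (TangentSpace I) x₀).open_source,
      (trivializationAt E (TangentSpace I) x₀).mem_source.2 (hU b hb),
      (trivializationAt E (TangentSpace I) x₀).contMDiffOn⟩).comp_contMDiff contMDiff_snd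
  refine (SmoothAlong.sum (s := Finset.univ) fun i _ => (h1 i).comp_contDiff
    (ContinuousLinearMap.smulRightL ℝ (ι → ℝ) E
      (ContinuousLinearMap.proj (R := ℝ) (φ := fun _ : ι => ℝ) i)).contDiff).congr fun b _ => ?_
  ext1 v
  simp [TangentTuple.coord, Fintype.linearCombination_apply]

theorem smooth_of_coord {F : B' → TangentTuple I j ι} {U : Set B'} (x₀ : N)
    (hU : ∀ b ∈ U, j (F b).base ∈ (trivializationAt E (TangentSpace I) x₀).baseSet)
    (hb : SmoothAlong I' j' I (fun b => j (F b).base) U)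
    (h : SmoothAlong I' j' 𝓘(ℝ, (ι → ℝ) →L[ℝ] E) (fun b => TangentTuple.coord x₀ (F b)) U) :
    Smooth I' j' F U := fun i => by
  let e := trivializationAt E (TangentSpace I) x₀
  have h1 := h.comp_contDiff (G := fun A : (ι → ℝ) →L[ℝ] E => A (Pi.single i 1))
    (ContinuousLinearMap.apply ℝ E (Pi.single i (1 : ℝ) : ι → ℝ)).contDiff
  refine ((hb.prodMk h1).comp_contMDiffOn (I'' := I.tangent) (G := e.toOpenPartialHomeomorph.symm)
    fun b hb => ⟨e.target, e.open_target, ?_, e.contMDiffOn_symm⟩).congr fun b hb => ?_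
  · rw [e.target_eq]; exact ⟨hU b hb, trivial⟩
  · rw [coord_single]
    refine (e.toOpenPartialHomeomorph.left_inv (e.mem_source.2 (hU b hb))).symm.trans ?_
    congr 1

theorem Smooth.transform [TopologicalSpace B'] (hj' : Topology.IsInducing j')
    {F : B' → TangentTuple I j ι} {U : Set B'} (h : Smooth I' j' F U)
    (hb : SmoothAlong I' j' I (fun b => j (F b).base) U)
    {T : B' → (ι → ℝ) →ₗ[ℝ] (ι → ℝ)} (hT : SmoothAlg I' j' T U) :
    Smooth I' j' (fun b => (F b).transform (T b)) U := by
  refine Smooth.of_local hj' fun b hbU => ?_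
  let e := trivializationAt E (TangentSpace I) (j (F b).base)
  have h1 := hb.continuousOn hj'.continuous b hbU (e.open_baseSet.mem_nhds
    (FiberBundle.mem_baseSet_trivializationAt' _))
  rw [Filter.mem_map, mem_nhdsWithin_iff_exists_mem_nhds_inter] at h1
  obtain ⟨V, hV, hVU⟩ := h1
  have hm : ∀ c ∈ U ∩ V, j (F c).base ∈ e.baseSet := fun c hc => hVU ⟨hc.2, hc.1⟩
  refine ⟨V, hV, smooth_of_coord (j (F b).base) hm (hb.mono Set.inter_subset_left) ?_⟩
  have h2 : SmoothAlong I' j' 𝓘(ℝ, (ι → ℝ) →L[ℝ] (ι → ℝ))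
      (fun b => (T b).toContinuousLinearMap) (U ∩ V) :=
    SmoothAlg.toSpace fun φ => (hT.mono Set.inter_subset_left)
      (φ ∘ₗ LinearMap.toContinuousLinearMap.toLinearMap)
  refine (((h.mono Set.inter_subset_left).coord _ hm).comp₂ h2
    (G := fun p => p.1 ∘L p.2) isBoundedBilinearMap_comp.contDiff).congr fun c hc => ?_
  rw [← coord_transform _ (hm c hc)]

theorem Smooth.matrix [TopologicalSpace B'] (hj' : Topology.IsInducing j')
    {F : B' → TangentTuple I j ι} {U : Set B'} (h : Smooth I' j' F U)
    (hb : SmoothAlong I' j' I (fun b => j (F b).base) U) (hF : ∀ b ∈ U, F b ∈ PSO ε g o)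
    {T : B' → (ι → ℝ) →ₗ[ℝ] (ι → ℝ)} (hT : Smooth I' j' (fun b => (F b).transform (T b)) U) :
    SmoothAlg I' j' T U := by
  refine SmoothAlg.of_local (A := Module.End ℝ (ι → ℝ)) hj' fun b hbU => ?_
  let e := trivializationAt E (TangentSpace I) (j (F b).base)
  have h1 := hb.continuousOn hj'.continuous b hbU (e.open_baseSet.mem_nhds
    (FiberBundle.mem_baseSet_trivializationAt' _))
  rw [Filter.mem_map, mem_nhdsWithin_iff_exists_mem_nhds_inter] at h1
  obtain ⟨V, hV, hVU⟩ := h1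
  have hm : ∀ c ∈ U ∩ V, j (F c).base ∈ e.baseSet := fun c hc => hVU ⟨hc.2, hc.1⟩
  refine ⟨V, hV, ?_⟩
  have h2 : SmoothAlong I' j' 𝓘(ℝ, (ι → ℝ) →L[ℝ] (ι → ℝ))
      (fun b => (T b).toContinuousLinearMap) (U ∩ V) := by
    have h3 := ((h.mono Set.inter_subset_left).coord (j (F b).base) hm).comp_contDiffOn
      (G := ContinuousLinearMap.inverse) fun c hc => by
        have h4 := isInvertible_coord (j (F b).base) (hm c hc) (hF c hc.1)
        obtain ⟨Φ, hΦ⟩ := h4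
        have := Φ.nhds
        rw [hΦ] at this
        filter_upwards [this] with A hA
        obtain ⟨Ψ, rfl⟩ := hA
        exact contDiffAt_map_inverse Ψ
    refine (h3.comp₂ ((hT.mono Set.inter_subset_left).coord (j (F b).base) hm)
      (G := fun p => p.1 ∘L p.2) isBoundedBilinearMap_comp.contDiff).congr fun c hc => ?_
    exact toContinuousLinearMap_eq_inverse _ (hm c hc) (hF c hc.1) _
  intro φ
  exact h2.toAlg (φ ∘ₗ LinearMap.toContinuousLinearMap.symm.toLinearMap)

end TangentTuple

/-! ### Continuity and smoothness of the homomorphisms of groups -/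

section ElTopology

variable {𝒢 ℋ : LinearGroup} [Module.Finite ℝ 𝒢.Alg]

/-- Linear coordinates on a linear group. -/
def elCoord (𝒢 : LinearGroup) [Module.Finite ℝ 𝒢.Alg] (a : 𝒢.El) :
    Fin (Module.finrank ℝ 𝒢.Alg) → ℝ := (Module.finBasis ℝ 𝒢.Alg).equivFun (LinearGroup.val a)

theorem continuous_elCoord : Continuous (elCoord 𝒢) :=
  continuous_pi fun i => continuous_functional ((Module.finBasis ℝ 𝒢.Alg).coord i)

/-- With the group embedded by its linear coordinates, the smoothness lemmas apply to the identity
map of the group and yield continuity of inversion, `adC` and `sqC`. -/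
theorem smoothAlg_elCoord (U : Set 𝒢.El) :
    SmoothAlg 𝓘(ℝ, Fin (Module.finrank ℝ 𝒢.Alg) → ℝ) (elCoord 𝒢)
      (fun a : 𝒢.El => LinearGroup.val a) U := fun φ => by
  have h := smoothAlong_self (I := 𝓘(ℝ, Fin (Module.finrank ℝ 𝒢.Alg) → ℝ)) (j := elCoord 𝒢) (U := U)
  refine (h.toAlg (φ ∘ₗ (Module.finBasis ℝ 𝒢.Alg).equivFun.symm.toLinearMap)).congr fun b _ => ?_
  rw [LinearMap.comp_apply]
  congr 1
  exact ((Module.finBasis ℝ 𝒢.Alg).equivFun.symm_apply_apply _).symm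

instance : ContinuousInv 𝒢.El where
  continuous_inv := continuous_el_iff.2 fun φ => by
    have := PrincipalBundle.smoothAlg_val_inv (smoothAlg_elCoord (𝒢 := 𝒢) Set.univ) φ
    exact continuousOn_univ.1 (this.continuousOn continuous_elCoord)

end ElTopology

section EndSmooth

variable {E H : Type*} [NormedAddCommGroup E] [NormedSpace ℝ E] [TopologicalSpace H]
  {N : Type*} [TopologicalSpace N] [ChartedSpace H N] {B : Type*} {I : ModelWithCorners ℝ E H}
  {j : B → N} {U : Set B} {ι κ : Type} [Fintype ι] [DecidableEq ι] [Fintype κ] [DecidableEq κ]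

theorem functional_end (φ : Module.End ℝ (ι → ℝ) →ₗ[ℝ] ℝ) (T : Module.End ℝ (ι → ℝ)) :
    φ T = ∑ k, ∑ i, T (Pi.single k 1) i *
      φ ((LinearMap.proj k : (ι → ℝ) →ₗ[ℝ] ℝ).smulRight (Pi.single i 1)) := by
  have : T = ∑ k, ∑ i, T (Pi.single k 1) i •
      (LinearMap.proj k : (ι → ℝ) →ₗ[ℝ] ℝ).smulRight (Pi.single i (1 : ℝ) : ι → ℝ) := by
    refine LinearMap.pi_ext' fun k => LinearMap.ext_ring ?_
    ext i
    simp only [LinearMap.comp_apply, LinearMap.coe_single, LinearMap.sum_apply,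
      LinearMap.smul_apply, LinearMap.smulRight_apply, LinearMap.proj_apply, Finset.sum_apply,
      Pi.smul_apply, smul_eq_mul]
    rw [Finset.sum_eq_single k (fun c _ hc => by simp [hc]) (by simp)]
    simp [Pi.single_apply]
  conv_lhs => rw [this]
  simp [map_sum, map_smul]

theorem smoothAlg_end {T : B → Module.End ℝ (ι → ℝ)}
    (h : ∀ i k, SmoothAlong I j 𝓘(ℝ, ℝ) (fun b => T b (Pi.single k 1) i) U) :
    SmoothAlg I j T U := fun φ =>
  (SmoothAlong.sum (s := Finset.univ) fun k _ => SmoothAlong.sum (s := Finset.univ) fun i _ =>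
    (h i k).mul (smoothAlong_const _)).congr fun b _ => functional_end φ (T b)

theorem SmoothAlg.entry {T : B → Module.End ℝ (ι → ℝ)} (h : SmoothAlg I j T U) (v : ι → ℝ) (i : ι) :
    SmoothAlong I j 𝓘(ℝ, ℝ) (fun b => T b v i) U :=
  h (LinearMap.proj i ∘ₗ LinearMap.applyₗ v)

variable {ε : ι → ℝ}

theorem SpinC.cval_mul (a b : (SpinC ε).El) :
    SpinC.cval (a * b) = SpinC.cval a * SpinC.cval b := LinearGroup.val_mul a b

theorem SpinC.cval_mul_inv (a : (SpinC ε).El) : SpinC.cval a * SpinC.cval a⁻¹ = 1 :=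
  LinearGroup.val_mul_inv a

theorem smoothAlg_val_inv' {𝒢 : LinearGroup} [Module.Finite ℝ 𝒢.Alg] {a : B → 𝒢.El}
    (ha : SmoothAlg I j (fun b => LinearGroup.val (a b)) U) :
    SmoothAlg I j (fun b => LinearGroup.val (a b)⁻¹) U :=
  ha.inv (fun _ _ => LinearGroup.val_mul_inv _) fun _ _ => LinearGroup.val_inv_mul _

theorem smoothAlg_adC (hε : ∀ i, ε i * ε i = 1) {a : B → (SpinC ε).El}
    (ha : SmoothAlg I j (fun b => LinearGroup.val (a b)) U) :
    SmoothAlg I j (fun b => (adC (a b) : Module.End ℝ (ι → ℝ))) U := by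
  refine smoothAlg_end fun i k => ?_
  have h1 : SmoothAlg I j (fun b => SpinC.cval (a b)) U := ha
  have h2 : SmoothAlg I j (fun b => SpinC.cval (a b)⁻¹) U := smoothAlg_val_inv' ha
  refine (((h1.mul (smoothAlg_const (cgam ε (Pi.single k 1)))).mul h2) (vecCoord ε i)).congr
    fun b _ => ?_
  change adC (a b) (Pi.single k 1) i = _
  rw [← vecCoord_cgam hε i (adC (a b) (Pi.single k 1)), cgam_adC hε]

theorem exists_scalar_functional (ε : ι → ℝ) : ∃ ψ : Cl ε →ₗ[ℝ] ℝ, ψ 1 = 1 := by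
  have h : ¬ ∀ ψ : Module.Dual ℝ (Cl ε), ψ 1 = 0 := fun h =>
    one_ne_zero ((Module.forall_dual_apply_eq_zero_iff ℝ (1 : Cl ε)).1 h)
  push Not at h
  obtain ⟨ψ, hψ⟩ := h
  exact ⟨(ψ 1)⁻¹ • ψ, by simp [hψ]⟩

theorem smoothAlg_sqC {a : B → (SpinC ε).El}
    (ha : SmoothAlg I j (fun b => LinearGroup.val (a b)) U) :
    SmoothAlg I j (fun b => LinearGroup.val (sqC (a b))) U := fun φ => by
  -- `ψ` removes the tensor factor `1` from `z² ⊗ 1` in `coe_sqC`.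
  obtain ⟨ψ, hψ⟩ := exists_scalar_functional ε
  have h1 : SmoothAlg I j (fun b => (SpinC.cval (a b) : CCl ε)) U := ha
  have h := ((h1.mul (h1.map (revC ε LinearMap.id))).mul
    (h1.mul (h1.map (revC ε Complex.conjLIE.toLinearMap))))
    (ψ ∘ₗ tensorEval ε (show ℂ →ₗ[ℝ] ℝ from φ))
  refine h.congr fun b _ => ?_
  have h2 := congrArg (ψ ∘ₗ tensorEval ε (show ℂ →ₗ[ℝ] ℝ from φ)) (coe_sqC (a b))
  rw [LinearMap.comp_apply, tensorEval_tmul, map_smul, hψ, smul_eq_mul, mul_one] at h2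
  exact h2

theorem smoothAlg_spinCIncl {a : B → (SpinC ε).El}
    (ha : SmoothAlg I j (fun b => LinearGroup.val (a b)) U) :
    SmoothAlg I j (fun b => LinearGroup.val (spinCIncl ε (a b))) U :=
  SmoothAlg.map (A := CCl ε) (A' := CCl (ext ε)) ha (cclIncl ε).toLinearMap

theorem smoothAlg_circ {z : B → S1.El}
    (hz : SmoothAlg I j (fun b => LinearGroup.val (z b)) U) :
    SmoothAlg I j (fun b => LinearGroup.val (circ ε (z b))) U :=
  (SmoothAlg.map (A := ℂ) (A' := CCl ε) hz
    ((TensorProduct.mk ℝ ℂ (Cl ε)).flip 1)).congr fun b _ => val_circ (z b)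

theorem continuous_adC (hε : ∀ i, ε i * ε i = 1) :
    Continuous fun a : (SpinC ε).El => (adC a).toContinuousLinearMap := by
  have h := smoothAlg_adC hε (smoothAlg_elCoord (𝒢 := SpinC ε) Set.univ)
  have h2 := SmoothAlg.toSpace (V := (ι → ℝ) →L[ℝ] (ι → ℝ)) fun φ =>
    h (φ ∘ₗ LinearMap.toContinuousLinearMap.toLinearMap)
  exact continuousOn_univ.1 (h2.continuousOn continuous_elCoord)

theorem continuous_sqC : Continuous fun a : (SpinC ε).El => sqC a :=
  continuous_el_iff.2 fun φ => continuousOn_univ.1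
    ((smoothAlg_sqC (smoothAlg_elCoord (𝒢 := SpinC ε) Set.univ) φ).continuousOn continuous_elCoord)

end EndSmooth

/-- A square root on the circle that is continuous near `1`. -/
def S1.sqrt (z : S1.El) : S1.El :=
  S1.ofNorm ((S1.coe z) ^ ((2 : ℕ) : ℂ)⁻¹) (by
    have h : ((S1.coe z) ^ ((2 : ℕ) : ℂ)⁻¹) ^ 2 = S1.coe z :=
      Complex.cpow_nat_inv_pow _ two_ne_zero
    have h2 := congrArg norm h
    rw [norm_pow, S1.norm_coe] at h2
    exact (pow_eq_one_iff_of_nonneg (norm_nonneg _) two_ne_zero).1 h2)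

theorem S1.sqrt_sq (z : S1.El) : S1.sqrt z ^ 2 = z := S1.coe_injective (by
  rw [pow_two, S1.coe_mul, S1.sqrt, S1.coe_ofNorm, ← pow_two]
  exact Complex.cpow_nat_inv_pow _ two_ne_zero)

theorem S1.sqrt_one : S1.sqrt 1 = 1 := S1.coe_injective (by
  rw [S1.sqrt, S1.coe_ofNorm, S1.coe_one, Complex.one_cpow])

theorem continuous_complex_functional (ψ : ℂ →ₗ[ℝ] ℝ) : Continuous ψ :=
  ψ.continuous_of_finiteDimensional

theorem S1.continuousAt_sqrt : ContinuousAt S1.sqrt 1 := continuousAt_el_iff.2 fun φ => by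
  have h1 : Continuous fun z : S1.El => S1.coe z := by
    have hre := continuous_functional (𝒢 := S1) Complex.reLm
    have him := continuous_functional (𝒢 := S1) Complex.imLm
    have := (Complex.continuous_ofReal.comp hre).add
      ((Complex.continuous_ofReal.comp him).mul (continuous_const (Y := ℂ) (y := Complex.I)))
    exact this.congr fun z => Complex.re_add_im (S1.coe z)
  have h2 : ContinuousAt (fun z : S1.El => (S1.coe z) ^ ((2 : ℕ) : ℂ)⁻¹) 1 :=
    h1.continuousAt.cpow continuousAt_const (by rw [S1.coe_one]; simp)
  have h3 := continuous_complex_functional φ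
  exact (h3.continuousAt.comp h2).congr (Filter.Eventually.of_forall fun z => by
    exact congrArg (show ℂ →ₗ[ℝ] ℝ from φ) (S1.coe_ofNorm _ _).symm)

/-! ### Continuity of maps into principal bundles -/

namespace PrincipalBundle

variable {E H : Type*} [NormedAddCommGroup E] [NormedSpace ℝ E] [TopologicalSpace H]
  {N : Type*} [TopologicalSpace N] [ChartedSpace H N]
  {B : Type u} [TopologicalSpace B] {I : ModelWithCorners ℝ E H} {j : B → N}
  {𝒢 : LinearGroup} {P : PrincipalBundle I j 𝒢} {X : Type*} [TopologicalSpace X]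

theorem continuous_proj (P : PrincipalBundle I j 𝒢) : Continuous P.proj := by
  rw [continuous_iff_continuousAt]
  intro p
  obtain ⟨e, -, hb⟩ := P.exists_mem_atlas (P.proj p)
  exact e.continuousAt_proj (e.mem_source.2 hb)

theorem continuousAt_of_triv {e : Bundle.Trivialization 𝒢.El P.proj} {f : X → P.Total} {x : X}
    (h : P.proj (f x) ∈ e.baseSet) (hp : ContinuousAt (fun x => P.proj (f x)) x)
    (h2 : ContinuousAt (fun x => (e (f x)).2) x) : ContinuousAt f x := by
  have h1 : ∀ᶠ y in nhds x, P.proj (f y) ∈ e.baseSet := hp.eventually (e.open_baseSet.mem_nhds h)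
  have h3 : (P.proj (f x), (e (f x)).2) ∈ e.target := by rw [e.target_eq]; exact ⟨h, trivial⟩
  have h4 : ContinuousAt (fun y => e.toOpenPartialHomeomorph.symm (P.proj (f y), (e (f y)).2)) x :=
    ContinuousAt.comp (f := fun y => (P.proj (f y), (e (f y)).2))
      (e.toOpenPartialHomeomorph.continuousAt_symm h3) (hp.prodMk h2)
  refine h4.congr ?_
  filter_upwards [h1] with y hy
  have : (P.proj (f y), (e (f y)).2) = e (f y) := Prod.ext (e.coe_fst' hy).symm rfl
  rw [this]
  exact e.toOpenPartialHomeomorph.left_inv (e.mem_source.2 hy)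

theorem continuousAt_triv {e : Bundle.Trivialization 𝒢.El P.proj} {f : X → P.Total} {x : X}
    (h : P.proj (f x) ∈ e.baseSet) (hf : ContinuousAt f x) :
    ContinuousAt (fun x => (e (f x)).2) x :=
  (ContinuousAt.comp (f := f) (e.continuousAt (e.mem_source.2 h)) hf).snd

theorem IsSmoothSection.continuousAt (hj : Continuous j) {s : B → P.Total} {U : Set B}
    (h : P.IsSmoothSection s U) {b : B} (hb : b ∈ U) : ContinuousAt s b := by
  obtain ⟨e, he, hbe⟩ := P.exists_mem_atlas b
  have hU := h.1.mem_nhds hb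
  refine continuousAt_of_triv (e := e) (by rwa [h.2.1 b hb]) ?_ ?_
  · refine continuousAt_id.congr ?_
    filter_upwards [hU] with c hc using (h.2.1 c hc).symm
  · refine continuousAt_el_iff.2 fun φ => ?_
    refine ((h.2.2 e he φ).continuousOn hj).continuousAt ?_
    filter_upwards [hU, e.open_baseSet.mem_nhds hbe] with c hc hce
    exact ⟨hc, by rwa [Set.mem_ofPred_eq, h.2.1 c hc]⟩

theorem continuousAt_diff [Module.Finite ℝ 𝒢.Alg] {p q : X → P.Total} {x : X}
    (hp : ContinuousAt p x) (hq : ContinuousAt q x)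
    (h : ∀ᶠ y in nhds x, P.proj (p y) = P.proj (q y)) :
    ContinuousAt (fun y => P.diff (p y) (q y)) x := by
  obtain ⟨e, he, hbe⟩ := P.exists_mem_atlas (P.proj (p x))
  refine ((continuousAt_triv hbe hp).inv.mul
    (continuousAt_triv (h.self_of_nhds ▸ hbe) hq)).congr ?_
  filter_upwards [h, (P.continuous_proj.continuousAt.comp hp).eventually
    (e.open_baseSet.mem_nhds hbe)] with y hy hye
  exact (triv_diff he hye hy).symm

end PrincipalBundle

/-! ### Construction of `Spin^c` structures -/

section Construction

open PrincipalBundle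

variable {E H : Type*} [NormedAddCommGroup E] [NormedSpace ℝ E] [TopologicalSpace H]
  {N : Type*} [TopologicalSpace N] [ChartedSpace H N]
  {B : Type u} [TopologicalSpace B] {I : ModelWithCorners ℝ E H} [IsManifold I ∞ N]
  {j : B → N} {ι : Type} [Fintype ι] [DecidableEq ι] {ε : ι → ℝ}
  {g : ∀ b, LinearMap.BilinForm ℝ (TangentSpace I (j b))}
  {o : ∀ b, Orientation ℝ (TangentSpace I (j b)) ι}

/-- Equivariant maps to the bundle of frames and to a circle bundle, smooth on local sections. -/
structure EquivariantData (P : PrincipalBundle I j (SpinC ε)) (L : PrincipalBundle I j S1)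
    (g : ∀ b, LinearMap.BilinForm ℝ (TangentSpace I (j b)))
    (o : ∀ b, Orientation ℝ (TangentSpace I (j b)) ι) where
  fr : P.Total → TangentTuple I j ι
  ci : P.Total → L.Total
  fr_mem : ∀ u, fr u ∈ PSO ε g o
  fr_base : ∀ u, (fr u).base = P.proj u
  proj_ci : ∀ u, L.proj (ci u) = P.proj u
  fr_act : ∀ u a, fr (P.act u a) = (fr u).transform (adC a)
  ci_act : ∀ u a, ci (P.act u a) = L.act (ci u) (sqC a)
  exists_smooth : ∀ b, ∃ s U, P.IsSmoothSection s U ∧ b ∈ U ∧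
    TangentTuple.Smooth I j (fun b => fr (s b)) U ∧ L.IsSmoothSection (fun b => ci (s b)) U

namespace EquivariantData

variable {P : PrincipalBundle I j (SpinC ε)} {L : PrincipalBundle I j S1}
  (D : EquivariantData P L g o)

include D in
theorem smooth_fr (hε : ∀ i, ε i * ε i = 1) (hj : Topology.IsInducing j) {s : B → P.Total}
    {U : Set B} (hs : P.IsSmoothSection s U) :
    TangentTuple.Smooth I j (fun b => D.fr (s b)) U := by
  refine TangentTuple.Smooth.of_local hj fun b hb => ?_
  obtain ⟨s', U', hs', hb', hfr, -⟩ := D.exists_smooth b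
  have hUU : IsOpen (U ∩ U') := hs.1.inter hs'.1
  have hd := (hs'.mono hUU Set.inter_subset_right).diff hj (hs.mono hUU Set.inter_subset_left)
  refine ⟨U', hs'.1.mem_nhds hb', ((hfr.mono Set.inter_subset_right).transform hj ?_
    (smoothAlg_adC hε hd)).congr fun c hc => ?_⟩
  · refine smoothAlong_self.congr fun c hc => ?_
    rw [D.fr_base, hs'.2.1 c hc.2]
  · rw [← D.fr_act, act_diff]
    rw [hs.2.1 c hc.1, hs'.2.1 c hc.2]

theorem smooth_ci (hj : Topology.IsInducing j) {s : B → P.Total}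
    {U : Set B} (hs : P.IsSmoothSection s U) : L.IsSmoothSection (fun b => D.ci (s b)) U := by
  refine ⟨hs.1, fun b hb => (D.proj_ci _).trans (hs.2.1 b hb), SmoothInto.of_local hj
    fun b hb => ?_⟩
  obtain ⟨s', U', hs', hb', -, hci⟩ := D.exists_smooth b
  have hUU : IsOpen (U ∩ U') := hs.1.inter hs'.1
  have hd := (hs'.mono hUU Set.inter_subset_right).diff hj (hs.mono hUU Set.inter_subset_left)
  refine ⟨U', hs'.1.mem_nhds hb', ((hci.2.2.mono Set.inter_subset_right).act
    (smoothAlg_sqC hd)).congr fun c hc => ?_⟩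
  rw [← D.ci_act, act_diff]
  rw [hs.2.1 c hc.1, hs'.2.1 c hc.2]

theorem act_triv {e : Bundle.Trivialization (SpinC ε).El P.proj} (he : e ∈ P.atlas) {u : P.Total}
    (hu : P.proj u ∈ e.baseSet) : P.act (e.invFun (P.proj u, 1)) (e u).2 = u := by
  have h1 := P.proj_invFun hu 1
  refine P.ext_triv (e := e) (by rwa [P.proj_act, h1]) (by rw [P.proj_act, h1]) ?_
  rw [P.atlas_act e he _ (by rwa [h1]), P.apply_invFun hu, one_mul]

/-- In a trivialisation every point is `s (proj u)` times its group coordinate, so by equivariance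
`fr u` is a continuous family of frames transformed by a continuous family of matrices. -/
theorem continuous_fr (hε : ∀ i, ε i * ε i = 1) (hj : Topology.IsInducing j) :
    Continuous D.fr := by
  rw [continuous_iff_continuousAt]
  intro u
  obtain ⟨e, he, hu⟩ := P.exists_mem_atlas (P.proj u)
  have hs := isSmoothSection_invFun he
  have h1 : ContinuousAt (fun b => D.fr (e.invFun (b, 1))) (P.proj u) := by
    rw [TangentTuple.continuousAt_iff_tvec]
    have hU := hs.1.mem_nhds hu
    constructor
    · refine continuousAt_id.congr ?_
      filter_upwards [hU] with b hb
      rw [D.fr_base, hs.2.1 b hb]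
      rfl
    · exact fun i => ((D.smooth_fr hε hj hs i).continuousOn hj.continuous).continuousAt hU
  have h2 : ContinuousAt (fun v => D.fr (e.invFun (P.proj v, 1))) u :=
    ContinuousAt.comp (f := P.proj) h1 P.continuous_proj.continuousAt
  have h3 : ContinuousAt (fun v : P.Total => (adC (e v).2).toContinuousLinearMap) u :=
    ((continuous_adC hε).continuousAt).comp (continuousAt_triv (f := id) hu continuousAt_id)
  refine (TangentTuple.continuousAt_transform hj.continuous h2 h3).congr ?_
  filter_upwards [P.continuous_proj.continuousAt.eventually (e.open_baseSet.mem_nhds hu)] with v hv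
  rw [← D.fr_act, act_triv he hv]

theorem continuous_ci (hj : Topology.IsInducing j) : Continuous D.ci := by
  rw [continuous_iff_continuousAt]
  intro u
  obtain ⟨e, he, hu⟩ := P.exists_mem_atlas (P.proj u)
  have hs := isSmoothSection_invFun he
  have h1 : ContinuousAt (fun v => D.ci (e.invFun (P.proj v, 1))) u :=
    ContinuousAt.comp (f := P.proj) ((D.smooth_ci hj hs).continuousAt hj.continuous hu)
      P.continuous_proj.continuousAt
  have h3 : ContinuousAt (fun v : P.Total => sqC (e v).2) u :=
    continuous_sqC.continuousAt.comp (continuousAt_triv (f := id) hu continuousAt_id)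
  refine (L.continuous_act.continuousAt.comp (h1.prodMk h3)).congr ?_
  filter_upwards [P.continuous_proj.continuousAt.eventually (e.open_baseSet.mem_nhds hu)] with v hv
  change L.act _ _ = _
  rw [← D.ci_act, act_triv he hv]

/-- The map `Θ`. -/
def theta (u : P.Total) : FrameProd ε g o L :=
  ⟨(D.fr u, D.ci u), D.fr_mem u, (D.fr_base u).trans (D.proj_ci u).symm⟩

theorem exists_act (hε : ∀ i, ε i * ε i = 1) {u : P.Total} {q : FrameProd ε g o L}
    (h : P.proj u = q.1.1.base) : ∃ a, D.theta (P.act u a) = q := by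
  obtain ⟨T, hT, hd, hq⟩ := TangentTuple.exists_transform (D.fr_mem u) q.2.1
    ((D.fr_base u).trans h)
  obtain ⟨a, ha, ha'⟩ := exists_xi_eq hε hT hd (L.diff (D.ci u) q.1.2)
  refine ⟨a, Subtype.ext (Prod.ext ?_ ?_)⟩
  · change D.fr _ = _
    rw [D.fr_act, ha, hq]
  · change D.ci _ = _
    rw [D.ci_act, ha', act_diff]
    rw [D.proj_ci, h, q.2.2]

theorem surjective (hε : ∀ i, ε i * ε i = 1) : Function.Surjective D.theta := fun q => by
  obtain ⟨u, hu⟩ := P.exists_proj_eq q.1.1.base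
  obtain ⟨a, ha⟩ := D.exists_act hε hu
  exact ⟨_, ha⟩

/-- The kernel of `(adC, sqC)` is `±1`, and frames and circle bundles have free structure groups. -/
theorem theta_eq_iff (hε : ∀ i, ε i * ε i = 1) {u v : P.Total} :
    D.theta u = D.theta v ↔ u = v ∨ u = P.act v (negC ε) := by
  constructor
  · intro h
    have hf : D.fr u = D.fr v := congrArg (fun q => q.1.1) h
    have hc : D.ci u = D.ci v := congrArg (fun q => q.1.2) h
    have hp : P.proj v = P.proj u := by rw [← D.fr_base, ← D.fr_base, hf]
    have h1 : adC (P.diff v u) = adC (1 : (SpinC ε).El) := by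
      refine TangentTuple.transform_injective (TangentTuple.lin_injective (D.fr_mem v)) ?_
      rw [← D.fr_act, ← D.fr_act, act_diff hp, P.act_one, hf]
    have h2 : sqC (P.diff v u) = sqC (1 : (SpinC ε).El) := by
      refine L.act_injective (p := D.ci v) ?_
      rw [← D.ci_act, ← D.ci_act, act_diff hp, P.act_one, hc]
    rcases eq_or_eq_neg_of_xi_eq hε h1.symm h2.symm with h3 | h3
    · left; rw [← act_diff hp, h3, P.act_one]
    · right; rw [← act_diff hp, h3, one_mul]
  · rintro (rfl | rfl)
    · rfl
    · refine Subtype.ext (Prod.ext ?_ ?_)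
      · change D.fr _ = D.fr v
        rw [D.fr_act, negC, adC_circ hε, TangentTuple.transform_id]
      · change D.ci _ = D.ci v
        rw [D.ci_act, negC, circ, sqC_mk, S1.negOne_sq, L.act_one]

theorem act_negC_ne (u : P.Total) : P.act u (negC ε) ≠ u := fun h => by
  have h1 : P.act u (negC ε) = P.act u 1 := by rw [h, P.act_one]
  have h2 := congrArg SpinC.cval (P.act_injective h1)
  rw [val_negC] at h2
  have h3 : (1 : CCl ε) = -1 := h2.symm
  have h4 : (2 : ℝ) • (1 : CCl ε) = 0 := by
    rw [two_smul]; nth_rewrite 2 [h3]; simp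
  rcases smul_eq_zero.1 h4 with h5 | h5
  · norm_num at h5
  · exact one_ne_zero h5

theorem twofold (hε : ∀ i, ε i * ε i = 1) (q : FrameProd ε g o L) :
    (D.theta ⁻¹' {q}).ncard = 2 := by
  obtain ⟨u, rfl⟩ := D.surjective hε q
  have : D.theta ⁻¹' {D.theta u} = {u, P.act u (negC ε)} := by
    ext v
    exact D.theta_eq_iff hε
  rw [this, Set.ncard_pair (act_negC_ne u).symm]

theorem continuous_theta (hε : ∀ i, ε i * ε i = 1) (hj : Topology.IsInducing j) :
    Continuous D.theta :=
  ((D.continuous_fr hε hj).prodMk (D.continuous_ci hj)).subtype_mk _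

/-- There is a local section of `theta` through every `u`. For `q` near `theta u`, take a local
section `s` through `u` and move it over the base of `q` by the group element `a q`, made of the
local section of `Ad` at the matrix `T q` and of a square root of the circle difference `z q`. Both
are continuous at `theta u`, and `a` is `1` there. -/
theorem isOpenMap (hε : ∀ i, ε i * ε i = 1) (hj : Topology.IsInducing j) :
    IsOpenMap D.theta := by
  refine IsOpenMap.of_nhds_le fun u => ?_
  obtain ⟨s, U, hs, hu, hsu⟩ := P.exists_section u
  have hU := hs.1.mem_nhds hu
  obtain ⟨c, hc1, hc⟩ := exists_smooth_section hε
  have hbase : Continuous fun q : FrameProd ε g o L => q.1.1.base := by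
    have : Continuous fun F : TangentTuple I j ι => F.base :=
      continuous_iff_continuousAt.2 fun F =>
        (TangentTuple.continuousAt_iff_tvec.1 continuousAt_id).1
    exact this.comp (continuous_fst.comp continuous_subtype_val)
  have hbu : (D.theta u).1.1.base = P.proj u := D.fr_base u
  have hbq : ∀ᶠ q : FrameProd ε g o L in nhds (D.theta u), q.1.1.base ∈ U :=
    hbase.continuousAt.eventually (show U ∈ nhds (D.theta u).1.1.base from by rw [hbu]; exact hU)
  have hex : ∀ q : FrameProd ε g o L, ∃ T, q.1.1.base ∈ U → IsIsom ε T ∧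
      q.1.1 = (D.fr (s q.1.1.base)).transform T := fun q => by
    by_cases h : q.1.1.base ∈ U
    · obtain ⟨T, hT, hd, hq⟩ := TangentTuple.exists_transform (D.fr_mem (s q.1.1.base)) q.2.1
        ((D.fr_base _).trans (hs.2.1 _ h))
      exact ⟨T, fun _ => ⟨hT, hq⟩⟩
    · exact ⟨0, fun h' => (h h').elim⟩
  choose T hT using hex
  have hsc : ContinuousAt (fun q : FrameProd ε g o L => s q.1.1.base) (D.theta u) :=
    ContinuousAt.comp (f := fun q : FrameProd ε g o L => q.1.1.base) (g := s)
      (by rw [hbu]; exact hs.continuousAt hj.continuous hu) hbase.continuousAt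
  have hTc : ContinuousAt (fun q => (T q).toContinuousLinearMap) (D.theta u) := by
    refine TangentTuple.continuousAt_matrix (ε := ε) (g := g) (o := o) hj.continuous
      (F := fun q : FrameProd ε g o L => D.fr (s q.1.1.base))
      (((D.continuous_fr hε hj).continuousAt).comp hsc)
      (Filter.Eventually.of_forall fun _ => D.fr_mem _) ?_
    refine ContinuousAt.congr
      (continuous_fst.comp continuous_subtype_val).continuousAt (hbq.mono fun q hq => ?_)
    exact (hT q hq).2
  have hT1 : (T (D.theta u)).toContinuousLinearMap = 1 := by
    have h1 := (hT (D.theta u) (by rw [hbu]; exact hu)).2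
    rw [hbu, hsu] at h1
    have h2 : (D.fr u).transform LinearMap.id = (D.fr u).transform (T (D.theta u)) := by
      rw [TangentTuple.transform_id]; exact h1
    rw [← TangentTuple.transform_injective (TangentTuple.lin_injective (D.fr_mem u)) h2]
    rfl
  have hTt : Filter.Tendsto (fun q => (T q).toContinuousLinearMap) (nhds (D.theta u)) (nhds 1) := by
    have h := hTc
    rwa [ContinuousAt, hT1] at h
  have hTn := hTt.eventually hc
  let z : FrameProd ε g o L → S1.El := fun q => L.diff (D.ci (s q.1.1.base)) q.1.2
  have hz1 : z (D.theta u) = 1 := by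
    change L.diff (D.ci (s (D.theta u).1.1.base)) (D.ci u) = 1
    rw [hbu, hsu]
    exact (diff_eq_iff rfl).2 (L.act_one _)
  have hzc : ContinuousAt z (D.theta u) := by
    refine continuousAt_diff ((D.continuous_ci hj).continuousAt.comp hsc)
      (continuous_snd.comp continuous_subtype_val).continuousAt (hbq.mono fun q hq => ?_)
    exact (D.proj_ci _).trans ((hs.2.1 _ hq).trans q.2.2)
  let a : FrameProd ε g o L → (SpinC ε).El := fun q =>
    SpinC.mk (c (T q).toContinuousLinearMap) (S1.sqrt (z q))
  have hac : ContinuousAt a (D.theta u) := by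
    have h1 : ∀ q, a q = SpinC.mk (c (T q).toContinuousLinearMap) 1 * circ ε (S1.sqrt (z q)) :=
      fun q => by rw [circ, SpinC.mk_mul, mul_one, one_mul]
    have h2 : ContinuousAt (fun q => SpinC.mk (c (T q).toContinuousLinearMap) 1) (D.theta u) := by
      refine continuousAt_el_iff.2 fun φ => ?_
      have h3 := (hc.self_of_nhds.1 ((show CCl ε →ₗ[ℝ] ℝ from φ) ∘ₗ
        TensorProduct.mk ℝ ℂ (Cl ε) 1)).continuousAt
      rw [← hT1] at h3
      refine (ContinuousAt.comp (f := fun q => (T q).toContinuousLinearMap) h3 hTc).congr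
        (Filter.Eventually.of_forall fun q => ?_)
      change φ _ = φ (SpinC.cval _)
      rw [SpinC.val_mk, S1.coe_one]
      rfl
    have h4 : ContinuousAt (fun q => circ ε (S1.sqrt (z q))) (D.theta u) := by
      have h5 : ContinuousAt (fun q => S1.sqrt (z q)) (D.theta u) :=
        ContinuousAt.comp (f := z) (g := S1.sqrt) (by rw [hz1]; exact S1.continuousAt_sqrt) hzc
      refine continuousAt_el_iff.2 fun φ => ?_
      have h6 := continuousAt_el_iff.1 h5 ((show CCl ε →ₗ[ℝ] ℝ from φ) ∘ₗ
        (TensorProduct.mk ℝ ℂ (Cl ε)).flip 1)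
      refine h6.congr (Filter.Eventually.of_forall fun q => ?_)
      change φ _ = φ (SpinC.cval _)
      rw [val_circ]
      rfl
    exact (h2.mul h4).congr (Filter.Eventually.of_forall fun q => (h1 q).symm)
  have hau : P.act (s (D.theta u).1.1.base) (a (D.theta u)) = u := by
    have : a (D.theta u) = 1 := by
      change SpinC.mk (c (T (D.theta u)).toContinuousLinearMap) (S1.sqrt (z (D.theta u))) = 1
      rw [hT1, hz1, S1.sqrt_one, hc1, SpinC.mk_one]
    rw [this, P.act_one, hbu, hsu]
  have hG : ContinuousAt (fun q => P.act (s q.1.1.base) (a q)) (D.theta u) :=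
    P.continuous_act.continuousAt.comp (hsc.prodMk hac)
  intro V hV
  rw [Filter.mem_map] at hV
  have hV' := hG.eventually (p := fun v => D.theta v ∈ V)
    (show D.theta ⁻¹' V ∈ nhds (P.act (s (D.theta u).1.1.base) (a (D.theta u))) by
      rw [hau]; exact hV)
  filter_upwards [hV', hbq, hTn] with q h1 h2 h3
  convert h1
  have h4 : adC (a q) = T q := by
    rw [adC_mk hε, h3.2 (hT q h2).1]
    rfl
  refine Subtype.ext (Prod.ext ?_ ?_)
  · change _ = D.fr _
    rw [D.fr_act, h4]
    exact (hT q h2).2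
  · change _ = D.ci _
    rw [D.ci_act, sqC_mk, S1.sqrt_sq]
    exact (act_diff ((D.proj_ci _).trans ((hs.2.1 _ h2).trans q.2.2))).symm

theorem mem_zpowers_negC {x : (SpinC ε).El} (hx : x ∈ Subgroup.zpowers (negC ε)) :
    x = 1 ∨ x = negC ε := by
  obtain ⟨n, rfl⟩ := hx
  have h2 : negC ε ^ (2 : ℤ) = 1 := by
    rw [zpow_ofNat, pow_two, negC_mul_self]
  rcases Int.even_or_odd' n with ⟨k, rfl | rfl⟩
  · left
    change negC ε ^ (2 * k) = 1
    rw [zpow_mul, h2, one_zpow]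
  · right
    change negC ε ^ (2 * k + 1) = negC ε
    rw [zpow_add, zpow_mul, h2, one_zpow, one_mul, zpow_one]

/-- `theta` is open and surjective and its fibres are the orbits of the group `±1`, so it is the
quotient by that group. It remains to see that the action is properly discontinuous. -/
theorem isCoveringMap (hε : ∀ i, ε i * ε i = 1) (hj : Topology.IsInducing j) :
    IsCoveringMap D.theta := by
  -- The inverse turns the right action into a left action.
  letI : MulAction (Subgroup.zpowers (negC ε)) P.Total :=
    { smul := fun x u => P.act u x.1⁻¹
      one_smul := fun u => by
        change P.act u (1 : (SpinC ε).El)⁻¹ = u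
        rw [inv_one, P.act_one]
      mul_smul := fun x y u => by
        change P.act u (x.1 * y.1)⁻¹ = P.act (P.act u y.1⁻¹) x.1⁻¹
        rw [mul_inv_rev, P.act_mul] }
  have hsm : ∀ (x : Subgroup.zpowers (negC ε)) (u : P.Total), x • u = P.act u x.1⁻¹ :=
    fun _ _ => rfl
  have hinv : (negC ε)⁻¹ = negC ε := inv_eq_of_mul_eq_one_right negC_mul_self
  have hq : IsQuotientCoveringMap D.theta (Subgroup.zpowers (negC ε)) :=
    { toIsQuotientMap := (D.isOpenMap hε hj).isQuotientMap (D.continuous_theta hε hj)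
        (D.surjective hε)
      continuous_const_smul := fun x =>
        P.continuous_act.comp (continuous_id.prodMk continuous_const)
      apply_eq_iff_mem_orbit := by
        intro u v
        rw [D.theta_eq_iff hε]
        constructor
        · rintro (rfl | rfl)
          · exact MulAction.mem_orbit_self _
          · exact ⟨⟨negC ε, Subgroup.mem_zpowers _⟩, by
              change P.act v (negC ε)⁻¹ = _
              rw [hinv]⟩
        · rintro ⟨⟨x, hx⟩, rfl⟩
          change P.act v x⁻¹ = v ∨ P.act v x⁻¹ = _
          rcases mem_zpowers_negC hx with rfl | rfl
          · left; rw [inv_one, P.act_one]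
          · right; rw [hinv]
      disjoint := by
        intro u
        obtain ⟨e, he, hu⟩ := P.exists_mem_atlas (P.proj u)
        have h0 : SpinC.cval (e u).2 ≠ 0 := fun h => by
          have := SpinC.cval_mul_inv (e u).2
          rw [h, zero_mul] at this
          exact zero_ne_one this
        have h1 : ¬ ∀ ψ : Module.Dual ℝ (CCl ε), ψ (SpinC.cval (e u).2) = 0 := fun h =>
          h0 ((Module.forall_dual_apply_eq_zero_iff ℝ _).1 h)
        push Not at h1
        obtain ⟨ψ, hψ⟩ := h1
        have h2 : ContinuousAt (fun v => (ψ (SpinC.cval (e u).2)) * ψ (SpinC.cval (e v).2)) u :=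
          continuousAt_const.mul (ContinuousAt.comp (f := fun v : P.Total => (e v).2)
            (continuous_functional (𝒢 := SpinC ε) ψ).continuousAt
            (continuousAt_triv (f := id) hu continuousAt_id))
        -- On this neighbourhood `ψ` of the group coordinate keeps the sign it has at `u`, whereas
        -- `negC ε` reverses that sign; so the two translates are disjoint.
        refine ⟨{v | P.proj v ∈ e.baseSet ∧
          0 < (ψ (SpinC.cval (e u).2)) * ψ (SpinC.cval (e v).2)}, ?_, ?_⟩
        · exact (P.continuous_proj.continuousAt.eventually (e.open_baseSet.mem_nhds hu)).and
            (h2.eventually (lt_mem_nhds (mul_self_pos.2 hψ)))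
        · rintro ⟨x, hx⟩ ⟨_, ⟨v, hv, rfl⟩, hv'⟩
          rcases mem_zpowers_negC hx with rfl | rfl
          · rfl
          · exfalso
            have h3 := hv'.2
            change 0 < _ * ψ (SpinC.cval (e (P.act v (negC ε)⁻¹)).2) at h3
            rw [hinv, P.atlas_act e he v hv.1] at h3
            have h4 : SpinC.cval ((e v).2 * negC ε) = -SpinC.cval (e v).2 := by
              rw [SpinC.cval_mul, val_negC]
              exact mul_neg_one (SpinC.cval (e v).2)
            rw [h4, map_neg, mul_neg] at h3
            linarith [hv.2] }
  exact hq.isCoveringMap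

/-- The `Spin^c` structure with the given equivariant maps. -/
def toSpinC (hε : ∀ i, ε i * ε i = 1) (hj : Topology.IsInducing j) : SpinCStructure ε g o where
  P := P
  L := L
  Θ := D.theta
  base_Θ := D.fr_base
  isCoveringMap := D.isCoveringMap hε hj
  twofold := D.twofold hε
  frame_act u x z := by
    change D.fr _ = (D.fr _).transform _
    rw [D.fr_act, adC_mk hε]
  circle_act u x z := by
    change D.ci _ = _
    rw [D.ci_act, sqC_mk]
    rfl
  smooth_frame s U hs i := D.smooth_fr hε hj hs i
  smooth_circle s U hs := D.smooth_ci hj hs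

end EquivariantData

end Construction

/-! ### `Spin^c` structures -/

namespace PrincipalBundle

variable {E H E' H' : Type*} [NormedAddCommGroup E] [NormedSpace ℝ E] [TopologicalSpace H]
  [NormedAddCommGroup E'] [NormedSpace ℝ E'] [TopologicalSpace H']
  {N N' : Type*} [TopologicalSpace N] [ChartedSpace H N] [TopologicalSpace N'] [ChartedSpace H' N']
  {B : Type u} [TopologicalSpace B] {I : ModelWithCorners ℝ E H} {j : B → N}
  {𝒢 ℋ : LinearGroup} {P Q : PrincipalBundle I j 𝒢}
  {B' : Type*} [TopologicalSpace B'] {I' : ModelWithCorners ℝ E' H'} {j' : B' → N'}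

/-- An isomorphism is only required to preserve smooth sections over the base itself. A smooth map
from another base is such a section, pulled back, times a smooth function to the group, so it is
preserved too. -/
theorem Iso.smoothInto [Module.Finite ℝ 𝒢.Alg] (f : P.Iso Q) (hj' : Topology.IsInducing j')
    {s : B' → P.Total} {U : Set B'} (hs : P.SmoothInto I' j' s U)
    (hb : SmoothAlong I' j' I (fun b => j (P.proj (s b))) U)
    (hc : ContinuousOn (fun b => P.proj (s b)) U) :
    Q.SmoothInto I' j' (fun b => f.equiv (s b)) U := by
  refine SmoothInto.of_local hj' fun b hbU => ?_
  obtain ⟨s₀, V, hs₀, hbV⟩ := P.exists_section_at (P.proj (s b))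
  have h1 := hc b hbU (hs₀.1.mem_nhds hbV)
  rw [Filter.mem_map, mem_nhdsWithin_iff_exists_mem_nhds_inter] at h1
  obtain ⟨W, hW, hWU⟩ := h1
  have hm : ∀ c ∈ U ∩ W, P.proj (s c) ∈ V := fun c hc => hWU ⟨hc.2, hc.1⟩
  have hp : ∀ c ∈ U ∩ W, P.proj (s₀ (P.proj (s c))) = P.proj (s c) := fun c hc =>
    hs₀.2.1 _ (hm c hc)
  have hb' := hb.mono (Set.inter_subset_left (t := W))
  have hd := (hs₀.2.2.precomp hb' hm).diff hj' (hs.mono Set.inter_subset_left) hp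
    ((hc.mono Set.inter_subset_left).congr hp)
  refine ⟨W, hW, (((f.smooth _ _ hs₀).2.2.precomp hb' hm).act hd).congr fun c hc => ?_⟩
  rw [← f.equiv_act, act_diff (hp c hc)]

end PrincipalBundle

open PrincipalBundle

namespace SpinCStructure

variable {E H : Type*} [NormedAddCommGroup E] [NormedSpace ℝ E] [TopologicalSpace H]
  {N : Type*} [TopologicalSpace N] [ChartedSpace H N]
  {B : Type u} [TopologicalSpace B] {I : ModelWithCorners ℝ E H} [IsManifold I ∞ N]
  {j : B → N} {ι : Type} [Fintype ι] [DecidableEq ι] {ε : ι → ℝ}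
  {g : ∀ b, LinearMap.BilinForm ℝ (TangentSpace I (j b))}
  {o : ∀ b, Orientation ℝ (TangentSpace I (j b)) ι} (σ τ : SpinCStructure ε g o)

theorem frame_mem (u : σ.P.Total) : σ.frame u ∈ PSO ε g o := (σ.Θ u).2.1

theorem frame_base (u : σ.P.Total) : (σ.frame u).base = σ.P.proj u := σ.base_Θ u

theorem proj_circle (u : σ.P.Total) : σ.L.proj (σ.circle u) = σ.P.proj u :=
  (σ.Θ u).2.2.symm.trans (σ.base_Θ u)

theorem frame_actC (hε : ∀ i, ε i * ε i = 1) (u : σ.P.Total) (a : (SpinC ε).El) :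
    σ.frame (σ.P.act u a) = (σ.frame u).transform (adC a) := by
  obtain ⟨x, z, rfl⟩ := SpinC.exists_mk a
  rw [adC_mk hε]
  exact σ.frame_act u x z

theorem circle_actC (u : σ.P.Total) (a : (SpinC ε).El) :
    σ.circle (σ.P.act u a) = σ.L.act (σ.circle u) (sqC a) := by
  obtain ⟨x, z, rfl⟩ := SpinC.exists_mk a
  rw [sqC_mk]
  exact σ.circle_act u x z

theorem frame_act_circ (hε : ∀ i, ε i * ε i = 1) (u : σ.P.Total) (z : S1.El) :
    σ.frame (σ.P.act u (circ ε z)) = σ.frame u := by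
  rw [σ.frame_actC hε, adC_circ hε, TangentTuple.transform_id]

theorem exists_frame_eq (hε : ∀ i, ε i * ε i = 1) {F : TangentTuple I j ι} (hF : F ∈ PSO ε g o) :
    ∃ u, σ.frame u = F ∧ σ.P.proj u = F.base := by
  obtain ⟨u, hu⟩ := σ.P.exists_proj_eq F.base
  obtain ⟨T, hT, hd, h⟩ := TangentTuple.exists_transform (σ.frame_mem u) hF
    ((σ.frame_base u).trans hu)
  obtain ⟨a, ha, -⟩ := exists_xi_eq hε hT hd 1
  exact ⟨σ.P.act u a, by rw [σ.frame_actC hε, ha, h], by rw [σ.P.proj_act, hu]⟩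

theorem adC_diff (hε : ∀ i, ε i * ε i = 1) {u v : σ.P.Total} (h : σ.P.proj u = σ.P.proj v) :
    (σ.frame u).transform (adC (σ.P.diff u v)) = σ.frame v := by
  rw [← σ.frame_actC hε, act_diff h]

theorem adC_injective (hε : ∀ i, ε i * ε i = 1) {u : σ.P.Total} {S T : (ι → ℝ) →ₗ[ℝ] (ι → ℝ)}
    (h : (σ.frame u).transform S = (σ.frame u).transform T) : S = T :=
  TangentTuple.transform_injective (TangentTuple.lin_injective (σ.frame_mem u)) h

theorem exists_circ_of_frame_eq (hε : ∀ i, ε i * ε i = 1) {u v : σ.P.Total}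
    (h : σ.frame u = σ.frame v) : ∃ z, v = σ.P.act u (circ ε z) := by
  have hp : σ.P.proj u = σ.P.proj v := by rw [← σ.frame_base, ← σ.frame_base, h]
  have h1 : adC (1 : (SpinC ε).El) = adC (σ.P.diff u v) := by
    refine σ.adC_injective hε (u := u) ?_
    rw [σ.adC_diff hε hp, adC_one hε, TangentTuple.transform_id, h]
  obtain ⟨z, hz⟩ := exists_circ_of_adC_eq hε h1
  exact ⟨z, by rw [← act_diff hp, hz, mul_one]⟩

theorem smooth_frame' {s : B → σ.P.Total} {U : Set B} (hs : σ.P.IsSmoothSection s U) :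
    TangentTuple.Smooth I j (fun b => σ.frame (s b)) U := σ.smooth_frame s U hs

theorem smooth_circle' {s : B → σ.P.Total} {U : Set B} (hs : σ.P.IsSmoothSection s U) :
    σ.L.IsSmoothSection (fun b => σ.circle (s b)) U := σ.smooth_circle s U hs

variable {σ τ}

/-- A smooth equivariant map that preserves frames gives an isomorphism of `Spin^c` structures. -/
theorem isomorphic_of_map (hj : Topology.IsInducing j)
    (F : σ.P.Total → τ.P.Total) (hp : ∀ u, τ.P.proj (F u) = σ.P.proj u)
    (hF : ∀ u a, F (σ.P.act u a) = τ.P.act (F u) a) (hfr : ∀ u, τ.frame (F u) = σ.frame u)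
    (hloc : ∀ b, ∃ s U, σ.P.IsSmoothSection s U ∧ b ∈ U ∧
      τ.P.IsSmoothSection (fun b => F (s b)) U) : σ.Isomorphic τ := by
  obtain ⟨f, hf⟩ := exists_iso hj F hp hF hloc
  choose s U hs hbU hFs using hloc
  -- The map of circle bundles is forced. The circle parts of the sections `s i` are sections of
  -- `σ.L` with transition functions `sqC (diff ..)`, and those of `F (s i)` have the same ones.
  obtain ⟨h, hh, hact⟩ := exists_equivariant (P := σ.L) (U := U) (fun b => ⟨b, hbU b⟩)
    (s := fun i b => σ.circle (s i b))
    (fun i b hb => (σ.proj_circle _).trans ((hs i).2.1 b hb)) τ.L.act τ.L.act_mul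
    (fun i b => τ.circle (F (s i b))) (fun i k b hi hk => by
      have h1 : σ.P.proj (s i b) = σ.P.proj (s k b) := by rw [(hs i).2.1 b hi, (hs k).2.1 b hk]
      have h2 : σ.L.diff (σ.circle (s i b)) (σ.circle (s k b)) =
          sqC (σ.P.diff (s i b) (s k b)) := by
        rw [diff_eq_iff (by rw [σ.proj_circle, σ.proj_circle, h1]), ← σ.circle_actC, act_diff h1]
      rw [h2, ← τ.circle_actC, ← hF, act_diff h1])
  have hcirc : ∀ u, τ.circle (F u) = h (σ.circle u) := fun u => by
    have hu := hbU (σ.P.proj u)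
    have h1 : σ.P.proj (s (σ.P.proj u) (σ.P.proj u)) = σ.P.proj u := (hs _).2.1 _ hu
    have h2 := hh (σ.P.proj u) (σ.P.proj u) hu
    rw [← act_diff h1, hF, τ.circle_actC, σ.circle_actC, hact, h2]
  have hhp : ∀ l, τ.L.proj (h l) = σ.L.proj l := fun l => by
    have hu := hbU (σ.L.proj l)
    have h1 : σ.L.proj (σ.circle (s (σ.L.proj l) (σ.L.proj l))) = σ.L.proj l :=
      (σ.proj_circle _).trans ((hs _).2.1 _ hu)
    conv_lhs => rw [← act_diff h1]
    rw [hact, hh _ _ hu, τ.L.proj_act, τ.proj_circle, hp]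
    exact (hs _).2.1 _ hu
  obtain ⟨k, hk⟩ := exists_iso hj h hhp hact fun b =>
    ⟨_, U b, σ.smooth_circle' (hs b), hbU b, (hs b).1, fun c hc => by
      rw [hhp, σ.proj_circle]; exact (hs b).2.1 c hc,
      (τ.smooth_circle' (hFs b)).2.2.congr fun c hc => hh b c hc⟩
  exact ⟨f, k, fun u => ⟨by rw [hf, hfr], by rw [hf, hk, hcirc]⟩⟩

theorem Isomorphic.symm (h : σ.Isomorphic τ) : τ.Isomorphic σ := (isoSetoid ε g o).iseqv.symm h

end SpinCStructure

/-! ### Restrictions and pull-backs -/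

section CylinderBasics

variable {E : Type*} [NormedAddCommGroup E] [NormedSpace ℝ E]
  {M : Type u} [TopologicalSpace M] [ChartedSpace E M] [IsManifold 𝓘(ℝ, E) ∞ M]
  {r s : ℕ} {J : Set ℝ} {g : MetricFamily E M r s J}
  {o : ManifoldOrientation E M (Fin r ⊕ Fin s)} {t : J}

omit [ChartedSpace E M] [IsManifold 𝓘(ℝ, E) ∞ M] in
theorem isInducing_cylMap : Topology.IsInducing (cylMap J M) :=
  Topology.IsInducing.subtypeVal.prodMap Topology.IsInducing.id

omit [IsManifold 𝓘(ℝ, E) ∞ M] in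
theorem smoothAlong_slice (t : J) (U : Set M) :
    SmoothAlong 𝓘(ℝ, E) (id : M → M) (cylModel E) (fun x => cylMap J M (t, x)) U :=
  smoothAlong_self.comp_contMDiff (G := fun x : M => ((t : ℝ), x))
    (contMDiff_const.prodMk contMDiff_id)

omit [IsManifold 𝓘(ℝ, E) ∞ M] in
theorem smoothAlong_snd (U : Set (J × M)) :
    SmoothAlong (cylModel E) (cylMap J M) 𝓘(ℝ, E) (fun z => id z.2) U :=
  smoothAlong_self.comp_contMDiff (G := fun z : ℝ × M => z.2) contMDiff_snd

omit [IsManifold 𝓘(ℝ, E) ∞ M] in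
theorem smoothAlong_fst (U : Set (J × M)) :
    SmoothAlong (cylModel E) (cylMap J M) 𝓘(ℝ, ℝ) (fun z => (z.1 : ℝ)) U :=
  smoothAlong_self.comp_contMDiff (G := fun z : ℝ × M => z.1) contMDiff_fst

theorem cylTuple_injective {ι : Type} [Fintype ι] [DecidableEq ι] (t : J) :
    Function.Injective (cylTuple (E := E) (M := M) (ι := ι) t) := by
  intro F G h
  have hb : F.base = G.base := congrArg (fun q => q.base.2) h
  refine TangentTuple.ext_base hb fun i => ?_
  have := congrArg (fun q : TangentTuple (cylModel E) (cylMap J M) (Option ι) =>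
    (show ℝ × E from q.vec (some i)).2) h
  exact this

theorem spinCIncl_circ {ι : Type} [Fintype ι] [DecidableEq ι] (ε : ι → ℝ) (z : S1.El) :
    spinCIncl ε (circ ε z) = circ (ext ε) z := by
  rw [circ, spinCIncl_mk, map_one, circ]

/-- A pull-back restricts to the given structure. -/
theorem IsPullback.isRestriction {σ : SpinCOn g o t} {τ : SpinCOnCyl g o}
    (h : IsPullback t σ τ) : IsRestriction t τ σ := by
  obtain ⟨F, f, h1, h2, h3, h4, h5, h6, -, h7, h8⟩ := h
  refine ⟨fun u => F (t, u), fun l => f (t, l), h1 t, h2 t, h3 t, h4 t, fun p U hp => ?_,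
    fun l U hl => ?_, h7, h8 t⟩
  · exact SmoothInto.precomp (h5 p U hp) (smoothAlong_slice t U) fun x hx => hx
  · exact SmoothInto.precomp (h6 l U hl) (smoothAlong_slice t U) fun x hx => hx

theorem IsRestriction.congr {σ σ' : SpinCOn g o t} {τ τ' : SpinCOnCyl g o}
    (h : IsRestriction t τ σ) (hσ : σ.Isomorphic σ') (hτ : τ.Isomorphic τ') :
    IsRestriction t τ' σ' := by
  obtain ⟨F, f, h1, h2, h3, h4, h5, h6, h7, h8⟩ := h
  obtain ⟨p, q, hpq⟩ := hσ.symm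
  obtain ⟨a, b, hab⟩ := hτ
  have hcont : ContinuousOn (fun x : M => ((t, x) : J × M)) Set.univ :=
    (continuous_const.prodMk continuous_id).continuousOn
  refine ⟨fun u => a.equiv (F (p.equiv u)), fun l => b.equiv (f (q.equiv l)),
    fun u => ?_, fun l => ?_, fun u c => ?_, fun l z => ?_, fun s U hs => ?_, fun l U hl => ?_,
    fun u => ?_, fun u => ?_⟩
  · beta_reduce
    rw [a.proj_equiv, h1, p.proj_equiv]
  · beta_reduce
    rw [b.proj_equiv, h2, q.proj_equiv]
  · beta_reduce
    rw [p.equiv_act, h3, a.equiv_act]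
  · beta_reduce
    rw [q.equiv_act, h4, b.equiv_act]
  · have hs' := p.smooth s U hs
    have hb : ∀ x ∈ U, τ.P.proj (F (p.equiv (s x))) = (t, x) := fun x hx => by
      rw [h1, hs'.2.1 x hx]
    exact a.smoothInto Topology.IsInducing.id (h5 _ U hs')
      ((smoothAlong_slice t U).congr fun x hx => by rw [hb x hx])
      ((hcont.mono (Set.subset_univ _)).congr hb)
  · have hs' := q.smooth l U hl
    have hb : ∀ x ∈ U, τ.L.proj (f (q.equiv (l x))) = (t, x) := fun x hx => by
      rw [h2, hs'.2.1 x hx]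
    exact b.smoothInto Topology.IsInducing.id (h6 _ U hs')
      ((smoothAlong_slice t U).congr fun x hx => by rw [hb x hx])
      ((hcont.mono (Set.subset_univ _)).congr hb)
  · beta_reduce
    rw [(hab _).1, h7, (hpq _).1]
  · beta_reduce
    rw [(hab _).2, h8, (hpq _).2]

theorem IsPullback.congr {σ : SpinCOn g o t} {τ τ' : SpinCOnCyl g o}
    (h : IsPullback t σ τ) (hτ : τ.Isomorphic τ') : IsPullback t σ τ' := by
  obtain ⟨F, f, h1, h2, h3, h4, h5, h6, h9, h7, h8⟩ := h
  obtain ⟨a, b, hab⟩ := hτ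
  refine ⟨fun u => a.equiv (F u), fun l => b.equiv (f l),
    fun t u => ?_, fun t l => ?_, fun t u c => ?_, fun t l z => ?_, fun s U hs => ?_,
    fun l U hl => ?_, fun t u => ?_, fun u => ?_, fun t u => ?_⟩
  · beta_reduce
    rw [a.proj_equiv, h1]
  · beta_reduce
    rw [b.proj_equiv, h2]
  · beta_reduce
    rw [h3, a.equiv_act]
  · beta_reduce
    rw [h4, b.equiv_act]
  · have hb : ∀ z ∈ {z : J × M | z.2 ∈ U}, τ.P.proj (F (z.1, s z.2)) = z := fun z hz => by
      rw [h1, hs.2.1 _ hz]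
    exact a.smoothInto isInducing_cylMap (h5 _ U hs)
      (smoothAlong_self.congr fun z hz => by rw [hb z hz]) (continuousOn_id.congr hb)
  · have hb : ∀ z ∈ {z : J × M | z.2 ∈ U}, τ.L.proj (f (z.1, l z.2)) = z := fun z hz => by
      rw [h2, hl.2.1 _ hz]
    exact b.smoothInto isInducing_cylMap (h6 _ U hl)
      (smoothAlong_self.congr fun z hz => by rw [hb z hz]) (continuousOn_id.congr hb)
  · beta_reduce
    rw [(hab _).1]; exact h9 t u
  · beta_reduce
    rw [(hab _).1, h7]
  · beta_reduce
    rw [(hab _).2, h8]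

/-- The restriction is unique up to isomorphism. -/
theorem IsRestriction.unique {σ σ' : SpinCOn g o t} {τ : SpinCOnCyl g o}
    (h : IsRestriction t τ σ) (h' : IsRestriction t τ σ') : σ.Isomorphic σ' := by
  have hε := sig_sign r s
  have hε' := ext_sign hε
  obtain ⟨F, f, h1, h2, h3, h4, h5, h6, h7, h8⟩ := h
  obtain ⟨F', f', h1', h2', h3', h4', h5', h6', h7', h8'⟩ := h'
  -- `F'` reaches every frame `(∂_t, e)` up to a circle factor, and the circle lies in the smaller
  -- group. Hence `F` and `F'` have the same image.
  have hex : ∀ u, ∃ u', F' u' = F u := fun u => by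
    obtain ⟨u', hu', -⟩ := σ'.exists_frame_eq hε (σ.frame_mem u)
    obtain ⟨z, hz⟩ := τ.exists_circ_of_frame_eq hε' (u := F' u') (v := F u)
      (by rw [h7, h7', hu'])
    exact ⟨σ'.P.act u' (circ _ z), by rw [h3', spinCIncl_circ, hz]⟩
  have hpe : ∀ u u', F' u' = F u → σ'.P.proj u' = σ.P.proj u := fun u u' h => by
    have := h1 u
    rw [← h, h1'] at this
    exact congrArg Prod.snd this
  have hinj : Function.Injective F' := fun u v huv => by
    have hp : σ'.P.proj u = σ'.P.proj v := by
      have := h1' u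
      rw [huv, h1'] at this
      exact (congrArg Prod.snd this).symm
    have h9 : τ.P.act (F' u) (spinCIncl _ (σ'.P.diff u v)) = τ.P.act (F' u) (spinCIncl _ 1) := by
      rw [← h3', act_diff hp, map_one, τ.P.act_one, huv]
    rw [← act_diff hp, spinCIncl_injective (τ.P.act_injective h9), σ'.P.act_one]
  choose Ψ hΨ using hex
  have hproj : ∀ u, σ'.P.proj (Ψ u) = σ.P.proj u := fun u => hpe _ _ (hΨ u)
  have hact : ∀ u a, Ψ (σ.P.act u a) = σ'.P.act (Ψ u) a := fun u a =>
    hinj (by rw [h3', hΨ, hΨ, h3])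
  refine SpinCStructure.isomorphic_of_map Topology.IsInducing.id Ψ hproj hact
    (fun u => cylTuple_injective t (by rw [← h7, ← h7', hΨ])) fun x => ?_
  obtain ⟨s₁, U, hs, hx⟩ := σ.P.exists_section_at x
  obtain ⟨s', U', hs', hx'⟩ := σ'.P.exists_section_at x
  have hUU : IsOpen (U ∩ U') := hs.1.inter hs'.1
  have hs2 := hs.mono hUU Set.inter_subset_left
  have hs2' := hs'.mono hUU Set.inter_subset_right
  refine ⟨s₁, U ∩ U', hs2, ⟨hx, hx'⟩, hUU, fun y hy => (hproj _).trans (hs2.2.1 y hy), ?_⟩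
  have hb : ∀ y ∈ U ∩ U', τ.P.proj (F' (s' y)) = (t, y) := fun y hy => by rw [h1', hs2'.2.1 y hy]
  have hd := (h5' _ _ hs2').diff Topology.IsInducing.id (h5 _ _ hs2)
    (fun y hy => by rw [hb y hy, h1, hs2.2.1 y hy])
    ((continuous_const.prodMk continuous_id).continuousOn.congr hb)
  -- The difference taken in `τ` is the included difference taken in `σ'`; the linear retraction of
  -- Clifford algebras recovers the latter smoothly.
  have hd2 : SmoothAlg 𝓘(ℝ, E) (id : M → M)
      (fun y => LinearGroup.val (σ'.P.diff (s' y) (Ψ (s₁ y)))) (U ∩ U') := by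
    refine SmoothAlg.congr (A := CCl (sig r s))
      (SmoothAlg.map (A := CCl (ext (sig r s))) (A' := CCl (sig r s)) hd (cclRetr (sig r s)))
      fun y hy => ?_
    have hp : σ'.P.proj (s' y) = σ'.P.proj (Ψ (s₁ y)) := by
      rw [hproj, hs2'.2.1 y hy, hs2.2.1 y hy]
    have h9 : τ.P.diff (F' (s' y)) (F (s₁ y)) = spinCIncl _ (σ'.P.diff (s' y) (Ψ (s₁ y))) := by
      rw [diff_eq_iff (by rw [hb y hy, h1, hs2.2.1 y hy]), ← h3', act_diff hp, hΨ]
    rw [h9]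
    exact (cclRetr_cclIncl (SpinC.cval (σ'.P.diff (s' y) (Ψ (s₁ y))))).symm
  refine (hs2'.2.2.act hd2).congr fun y hy => ?_
  rw [act_diff]
  rw [hproj, hs2'.2.1 y hy, hs2.2.1 y hy]

end CylinderBasics

/-! ### Tuples on the cylinder -/

section CylinderTuples

variable {ι : Type} [Fintype ι] [DecidableEq ι]

theorem det_diagOne (T : (ι → ℝ) →ₗ[ℝ] (ι → ℝ)) : LinearMap.det (diagOne T) = LinearMap.det T := by
  let e : (Option ι → ℝ) ≃ₗ[ℝ] ℝ × (ι → ℝ) := LinearEquiv.piOptionEquivProd ℝ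
  have h : diagOne T = e.symm.toLinearMap ∘ₗ (LinearMap.id.prodMap T) ∘ₗ e.toLinearMap := by
    apply LinearMap.ext
    intro v
    rw [LinearMap.comp_apply, LinearMap.comp_apply]
    change _ = e.symm _
    rw [LinearEquiv.eq_symm_apply]
    rfl
  rw [h]
  have := LinearMap.det_conj (LinearMap.id.prodMap T) e.symm
  rw [LinearEquiv.symm_symm] at this
  rw [this, LinearMap.det_prodMap, LinearMap.det_id, one_mul]

variable {E : Type*} [NormedAddCommGroup E] [NormedSpace ℝ E]
  {M : Type u} [TopologicalSpace M] [ChartedSpace E M] [IsManifold 𝓘(ℝ, E) ∞ M] {J : Set ℝ}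

omit [DecidableEq ι] in
theorem linearCombination_option {V : Type*} [AddCommGroup V] [Module ℝ V] (w : ι → V)
    (v : Option ι → ℝ) : Fintype.linearCombination ℝ
      (fun i : Option ι => (i.elim (1, 0) fun k => (0, w k) : ℝ × V)) v =
      (v none, Fintype.linearCombination ℝ w fun k => v (some k)) := by
  rw [Fintype.linearCombination_apply, Fintype.linearCombination_apply, Fintype.sum_option]
  refine Prod.ext ?_ ?_
  · simp [Prod.fst_sum]
  · simp [Prod.snd_sum]

theorem cylTuple_lin (t : J) (F : TangentTuple 𝓘(ℝ, E) (id : M → M) ι) (v : Option ι → ℝ) :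
    (show ℝ × E from (cylTuple t F).lin v) =
      (v none, (show E from F.lin fun k => v (some k))) :=
  linearCombination_option (V := E) F.vec v

theorem cylTuple_transform (t : J) (F : TangentTuple 𝓘(ℝ, E) (id : M → M) ι)
    (T : (ι → ℝ) →ₗ[ℝ] (ι → ℝ)) :
    (cylTuple t F).transform (diagOne T) = cylTuple t (F.transform T) := by
  refine TangentTuple.ext_base rfl fun k => ?_
  refine (cylTuple_lin t F (diagOne T (Pi.single k 1))).trans ?_
  rw [← TangentTuple.lin_single (cylTuple t (F.transform T)) k]
  refine Eq.trans ?_ (cylTuple_lin t (F.transform T) (Pi.single k 1)).symm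
  rw [TangentTuple.lin_transform]
  rfl

omit [Fintype ι] [DecidableEq ι] in
theorem consBasis_none {V : Type*} [AddCommGroup V] [Module ℝ V] (b : Module.Basis ι ℝ V) :
    consBasis b none = (1, 0) := by
  simp [consBasis]

omit [Fintype ι] [DecidableEq ι] in
theorem consBasis_some {V : Type*} [AddCommGroup V] [Module ℝ V] (b : Module.Basis ι ℝ V) (k : ι) :
    consBasis b (some k) = (0, b k) := by
  simp [consBasis]

/-- A positive basis extends to a positive basis of the tangent space of the cylinder. -/
theorem isPositiveBasis_cylTuple (o : ManifoldOrientation E M ι) (t : J)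
    {F : TangentTuple 𝓘(ℝ, E) (id : M → M) ι} (hF : IsPositiveBasis (o.at_ F.base) F.vec) :
    IsPositiveBasis (cylOrientation o (t, F.base)) (cylTuple t F).vec := by
  -- This is the existence statement inside `cylOrientation`, so by proof irrelevance `h.choose` is
  -- the basis chosen there.
  have h : ∃ b : Module.Basis ι ℝ (TangentSpace 𝓘(ℝ, E) F.base), b.orientation = o.at_ F.base := by
    obtain ⟨b, -, hb⟩ := hF
    exact ⟨b, hb⟩
  have h0 : IsPositiveBasis (o.at_ F.base) ⇑h.choose := ⟨_, rfl, h.choose_spec⟩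
  obtain ⟨T, hT, hv⟩ := h0.exists_transform hF
  let F0 : TangentTuple 𝓘(ℝ, E) (id : M → M) ι := ⟨F.base, h.choose⟩
  have h1 : IsPositiveBasis (cylOrientation o (t, F.base)) (cylTuple t F0).vec := by
    refine ⟨(consBasis h.choose).map (cylTangentEquiv (t, F.base)).symm, ?_, rfl⟩
    ext1 k
    rw [Module.Basis.map_apply]
    cases k with
    | none => rw [consBasis_none]; rfl
    | some k => rw [consBasis_some]; rfl
  have h2 := h1.transform (T := diagOne T) (by rw [det_diagOne]; exact hT)
  have h3 : F = F0.transform T := TangentTuple.ext_base rfl fun k => congrFun hv k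
  rw [h3, ← cylTuple_transform]
  exact h2

variable {r s : ℕ} {g : MetricFamily E M r s J} {o : ManifoldOrientation E M (Fin r ⊕ Fin s)}

theorem cylMetric_apply (g : MetricFamily E M r s J) (z : J × M)
    (a b : ℝ × TangentSpace 𝓘(ℝ, E) z.2) :
    cylMetric g z ((cylTangentEquiv z).symm a) ((cylTangentEquiv z).symm b) =
      a.1 * b.1 + g.g z.1 z.2 a.2 b.2 := rfl

theorem cylTuple_mem {t : J} {F : TangentTuple 𝓘(ℝ, E) (id : M → M) (Fin r ⊕ Fin s)}
    (hF : F ∈ PSO (sig r s) (g.g t) o.at_) :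
    cylTuple t F ∈ PSO (ext (sig r s)) (cylMetric g) (cylOrientation o) := by
  refine ⟨?_, isPositiveBasis_cylTuple o t hF.2⟩
  intro i k
  refine (cylMetric_apply g (t, F.base) _ _).trans ?_
  cases i with
  | none => cases k <;> simp [ext]
  | some i =>
    cases k with
    | none => simp
    | some k =>
      refine Eq.trans ?_ ((hF.1 i k).trans ?_)
      · exact (congrArg (· + _) (mul_zero (0 : ℝ))).trans (zero_add _)
      · simp only [Option.some.injEq]; rfl

/-- The signature provides an orthonormal basis. If its orientation is wrong, it is transformed by
the reflection in a standard basis vector, which keeps the signs `ε` in their order. -/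
theorem exists_frame (g : MetricFamily E M r s J) (o : ManifoldOrientation E M (Fin r ⊕ Fin s))
    (t : J) (x : M) : ∃ F : TangentTuple 𝓘(ℝ, E) (id : M → M) (Fin r ⊕ Fin s),
      F.base = x ∧ F ∈ PSO (sig r s) (g.g t) o.at_ := by
  obtain ⟨b, hb⟩ := g.signature t x
  obtain ⟨U, -, hx, X, -, hX⟩ := o.exists_frame x
  have hv := hX x hx
  obtain ⟨b', hb', ho⟩ := hv
  let T : ((Fin r ⊕ Fin s) → ℝ) →ₗ[ℝ] ((Fin r ⊕ Fin s) → ℝ) :=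
    b'.equivFun.toLinearMap ∘ₗ Fintype.linearCombination ℝ b
  have hT : ⇑b = fun k => Fintype.linearCombination ℝ b' (T (Pi.single k 1)) := by
    ext k
    rw [LinearMap.comp_apply, linearCombination_single, Fintype.linearCombination_apply]
    exact (b'.sum_equivFun (b k)).symm
  have hd : LinearMap.det T ≠ 0 := by
    rw [← basis_det_eq b', ← hT]
    exact (b'.isUnit_det b).ne_zero
  rcases lt_or_gt_of_ne hd with h | h
  -- A reflection needs a basis vector; in dimension zero the determinant is `1` and this case does
  -- not arise.
  · have hne : Nonempty (Fin r ⊕ Fin s) := by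
      by_contra hne
      rw [not_nonempty_iff] at hne
      have : T = LinearMap.id := LinearMap.ext fun v => Subsingleton.elim _ _
      rw [this, LinearMap.det_id] at h
      linarith
    obtain ⟨k⟩ := hne
    have hk : innerSq (sig r s) (Pi.single k 1) ≠ 0 := by
      rw [innerSq_single]
      intro h0
      have := sig_sign r s k
      rw [h0] at this
      simp at this
    have hR : IsIsom (sig r s) (hypRefl (sig r s) (Pi.single k 1)) := isIsom_hypRefl hk
    refine ⟨⟨x, fun l => Fintype.linearCombination ℝ b
      (hypRefl (sig r s) (Pi.single k 1) (Pi.single l 1))⟩, rfl, hb.transform hR, ?_⟩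
    have h1 : IsPositiveBasis (o.at_ x) ⇑b' := ⟨b', rfl, ho⟩
    have h2 := h1.transform (T := T ∘ₗ hypRefl (sig r s) (Pi.single k 1)) (by
      rw [LinearMap.det_comp, det_hypRefl hk]; linarith)
    have h3 : Fintype.linearCombination ℝ b = Fintype.linearCombination ℝ b' ∘ₗ T := by
      rw [hT, linearCombination_transform]
    rw [h3]
    exact h2
  · have h1 : IsPositiveBasis (o.at_ x) ⇑b' := ⟨b', rfl, ho⟩
    refine ⟨⟨x, b⟩, rfl, hb, ?_⟩
    rw [hT]
    exact h1.transform h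

/-- Compared with any adapted frame at the same point, the matrix of `G` fixes the first basis
vector, hence has the form `diagOne T'`. -/
theorem exists_eq_cylTuple {G : TangentTuple (cylModel E) (cylMap J M) (Option (Fin r ⊕ Fin s))}
    (hG : G ∈ PSO (ext (sig r s)) (cylMetric g) (cylOrientation o))
    (h : (show ℝ × E from G.vec none) = (1, 0)) :
    ∃ F, G = cylTuple G.base.1 F ∧ F ∈ PSO (sig r s) (g.g G.base.1) o.at_ := by
  obtain ⟨F, hb, hF⟩ := exists_frame g o G.base.1 G.base.2
  have hbase : (cylTuple G.base.1 F).base = G.base := Prod.ext rfl hb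
  obtain ⟨T, hT, hd, hGT⟩ := TangentTuple.exists_transform (cylTuple_mem hF) hG hbase
  have h1 : T (Pi.single none 1) = Pi.single none 1 := by
    refine TangentTuple.lin_injective (cylTuple_mem (o := o) hF) ?_
    rw [TangentTuple.lin_single]
    have h2 := congrArg (fun q : TangentTuple (cylModel E) (cylMap J M)
      (Option (Fin r ⊕ Fin s)) => (show ℝ × E from q.vec none)) hGT
    exact h2.symm.trans h
  obtain ⟨T', hT', rfl⟩ := eq_diagOne hT h1
  rw [det_diagOne] at hd
  refine ⟨F.transform T', ?_, TangentTuple.transform_mem hF hT' hd⟩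
  rw [← cylTuple_transform]
  exact hGT

variable {E' H' : Type*} [NormedAddCommGroup E'] [NormedSpace ℝ E'] [TopologicalSpace H']
  {N' : Type*} [TopologicalSpace N'] [ChartedSpace H' N']
  {B' : Type*} {I' : ModelWithCorners ℝ E' H'} {j' : B' → N'}

theorem contMDiff_const_field (c : ℝ) : ContMDiff 𝓘(ℝ, ℝ) 𝓘(ℝ, ℝ).tangent ∞
    (fun t : ℝ => (⟨t, c⟩ : TangentBundle 𝓘(ℝ, ℝ) ℝ)) :=
  contMDiff_vectorSpace_iff_contDiff.2 contDiff_const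

theorem smooth_cylTuple {F : B' → TangentTuple 𝓘(ℝ, E) (id : M → M) ι} {U : Set B'} {t : B' → J}
    (ht : SmoothAlong I' j' 𝓘(ℝ, ℝ) (fun b => (t b : ℝ)) U)
    (hb : SmoothAlong I' j' 𝓘(ℝ, E) (fun b => (F b).base) U)
    (hF : TangentTuple.Smooth I' j' F U) :
    TangentTuple.Smooth I' j' (fun b => cylTuple (t b) (F b)) U := by
  have hM : IsManifold 𝓘(ℝ, E) 1 M := IsManifold.of_le (n := ∞) (by norm_num)
  intro i
  have h2 := contMDiff_equivTangentBundleProd_symm (n := ∞) (I := 𝓘(ℝ, ℝ)) (M := ℝ)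
    (I' := 𝓘(ℝ, E)) (M' := M)
  cases i with
  | none =>
    have h1 := (ht.comp_contMDiff (contMDiff_const_field 1)).prodMk (hb.comp_contMDiff
      (Bundle.contMDiff_zeroSection ℝ (TangentSpace 𝓘(ℝ, E)) (IB := 𝓘(ℝ, E)) (F := E) (n := ∞)))
    exact h1.comp_contMDiff h2
  | some k =>
    have h1 := (ht.comp_contMDiff (contMDiff_const_field 0)).prodMk (hF k)
    exact h1.comp_contMDiff h2

theorem smooth_of_cylTuple {F : B' → TangentTuple 𝓘(ℝ, E) (id : M → M) ι} {U : Set B'} {t : B' → J}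
    (hF : TangentTuple.Smooth I' j' (fun b => cylTuple (t b) (F b)) U) :
    TangentTuple.Smooth I' j' F U := by
  have hM : IsManifold 𝓘(ℝ, E) 1 M := IsManifold.of_le (n := ∞) (by norm_num)
  intro i
  have h2 := contMDiff_equivTangentBundleProd (n := ∞) (I := 𝓘(ℝ, ℝ)) (M := ℝ)
    (I' := 𝓘(ℝ, E)) (M' := M)
  exact (hF (some i)).comp_contMDiff (contMDiff_snd.comp h2)

end CylinderTuples

namespace TangentTuple

variable {E H E' H' : Type*} [NormedAddCommGroup E] [NormedSpace ℝ E] [TopologicalSpace H]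
  [NormedAddCommGroup E'] [NormedSpace ℝ E'] [TopologicalSpace H']
  {N N' : Type*} [TopologicalSpace N] [ChartedSpace H N] [TopologicalSpace N'] [ChartedSpace H' N']
  {B : Type u} [TopologicalSpace B] {I : ModelWithCorners ℝ E H} [IsManifold I ∞ N] {j : B → N}
  {ι : Type} [Fintype ι] [DecidableEq ι] {ε : ι → ℝ}
  {g : ∀ b, LinearMap.BilinForm ℝ (TangentSpace I (j b))}
  {o : ∀ b, Orientation ℝ (TangentSpace I (j b)) ι}
  {B' : Type*} [TopologicalSpace B'] {I' : ModelWithCorners ℝ E' H'} {j' : B' → N'}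

/-- The components of a smooth vector field in a smooth frame are smooth. -/
theorem Smooth.components [Nonempty ι] (hj' : Topology.IsInducing j')
    {F : B' → TangentTuple I j ι} {U : Set B'} (h : Smooth I' j' F U)
    (hb : SmoothAlong I' j' I (fun b => j (F b).base) U) (hF : ∀ b ∈ U, F b ∈ PSO ε g o)
    {w : B' → ι → ℝ} (hw : SmoothAlong I' j' I.tangent
      (fun b => (⟨j (F b).base, (F b).lin (w b)⟩ : TangentBundle I N)) U) :
    SmoothAlong I' j' 𝓘(ℝ, ι → ℝ) w U := by
  -- The endomorphism all of whose columns are `w` transforms the frame into copies of the vector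
  -- field, which reduces the claim to `Smooth.matrix`.
  let S : (ι → ℝ) →ₗ[ℝ] ℝ := Fintype.linearCombination ℝ fun _ => (1 : ℝ)
  have hS : ∀ k, S (Pi.single k 1) = 1 := fun k => linearCombination_single _ k
  have h1 := h.matrix (ε := ε) (g := g) (o := o) hj' hb hF (T := fun b => S.smulRight (w b))
    fun k => hw.congr fun b _ => by
      have : (F b).lin ((S.smulRight (w b)) (Pi.single k 1)) = (F b).lin (w b) := by
        rw [LinearMap.smulRight_apply, hS, one_smul]
      exact congrArg (fun v => (⟨j (F b).base, v⟩ : TangentBundle I N)) this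
  refine SmoothAlong.pi fun i => (h1.entry (Pi.single (Classical.arbitrary ι) 1) i).congr
    fun b _ => ?_
  rw [LinearMap.smulRight_apply, hS, one_smul]

end TangentTuple

/-! ### Existence of restrictions -/

section Restriction

open PrincipalBundle

variable {E : Type*} [NormedAddCommGroup E] [NormedSpace ℝ E]
  {M : Type u} [TopologicalSpace M] [ChartedSpace E M] [IsManifold 𝓘(ℝ, E) ∞ M]
  {r s : ℕ} {J : Set ℝ} {g : MetricFamily E M r s J}
  {o : ManifoldOrientation E M (Fin r ⊕ Fin s)}

/-- Near each point of a slice there is a smooth section whose frames begin with `∂_t`. -/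
theorem exists_adapted_section (τ : SpinCOnCyl g o) (t : J) (x₀ : M) :
    ∃ (V : Set M) (p : M → τ.P.Total) (e : M → TangentTuple 𝓘(ℝ, E) (id : M → M) (Fin r ⊕ Fin s)),
      IsOpen V ∧ x₀ ∈ V ∧ τ.P.SmoothInto 𝓘(ℝ, E) (id : M → M) p V ∧
      τ.L.SmoothInto 𝓘(ℝ, E) (id : M → M) (fun x => τ.circle (p x)) V ∧
      (∀ x ∈ V, τ.P.proj (p x) = (t, x)) ∧ (∀ x ∈ V, τ.frame (p x) = cylTuple t (e x)) ∧
      (∀ x ∈ V, e x ∈ PSO (sig r s) (g.g t) o.at_) ∧ (∀ x ∈ V, (e x).base = x) ∧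
      TangentTuple.Smooth 𝓘(ℝ, E) (id : M → M) e V := by
  have hε := sig_sign r s
  have hε' := ext_sign hε
  have hid : Topology.IsInducing (id : M → M) := Topology.IsInducing.id
  obtain ⟨F₀, hF₀b, hF₀⟩ := exists_frame g o t x₀
  obtain ⟨u₀, hu₀, hu₀p⟩ := τ.exists_frame_eq hε' (cylTuple_mem hF₀)
  have hu₀p' : τ.P.proj u₀ = (t, x₀) := by rw [hu₀p, ← hF₀b]; rfl
  obtain ⟨q, U, hq, hqU, hqu⟩ := τ.P.exists_section u₀
  rw [hu₀p'] at hqU hqu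
  let V₀ : Set M := {x | (t, x) ∈ U}
  have hV₀ : IsOpen V₀ := hq.1.preimage (continuous_const.prodMk continuous_id)
  have hsl := smoothAlong_slice (E := E) t V₀
  let G : M → TangentTuple (cylModel E) (cylMap J M) (Option (Fin r ⊕ Fin s)) :=
    fun x => τ.frame (q (t, x))
  have hGb : ∀ x ∈ V₀, (G x).base = (t, x) := fun x hx => (τ.frame_base _).trans (hq.2.1 _ hx)
  have hG : TangentTuple.Smooth 𝓘(ℝ, E) (id : M → M) G V₀ := fun i =>
    SmoothAlong.precomp hsl (τ.smooth_frame' hq i) fun x hx => hx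
  have hGs : SmoothAlong 𝓘(ℝ, E) (id : M → M) (cylModel E) (fun x => cylMap J M (G x).base) V₀ :=
    hsl.congr fun x hx => by rw [hGb x hx]
  -- `w x` is the coordinate vector of `∂_t` in the frame `G x`.
  have hex : ∀ x, ∃ w : Option (Fin r ⊕ Fin s) → ℝ, x ∈ V₀ →
      (show ℝ × E from (G x).lin w) = (1, 0) ∧ innerSq (ext (sig r s)) w = 1 := fun x => by
    by_cases hx : x ∈ V₀
    · obtain ⟨F, hFb, hF⟩ := exists_frame g o t x
      obtain ⟨T, hT, -, h⟩ := TangentTuple.exists_transform (τ.frame_mem (q (t, x)))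
        (cylTuple_mem hF) ((hGb x hx).trans (by rw [← hFb]; rfl))
      refine ⟨T (Pi.single none 1), fun _ => ⟨?_, ?_⟩⟩
      · exact (congrArg (fun A : TangentTuple (cylModel E) (cylMap J M) (Option (Fin r ⊕ Fin s)) =>
          (show ℝ × E from A.vec none)) h).symm
      · rw [innerSq_eq_ip, hT, ← innerSq_eq_ip, innerSq_single]
        rfl
    · exact ⟨0, fun h => (hx h).elim⟩
  choose w hw using hex
  have hws : SmoothAlong 𝓘(ℝ, E) (id : M → M) 𝓘(ℝ, Option (Fin r ⊕ Fin s) → ℝ) w V₀ := by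
    refine hG.components (ε := ext (sig r s)) (g := cylMetric g) (o := cylOrientation o) hid hGs
      (fun x _ => τ.frame_mem _) ?_
    -- `∂_t` is a smooth field, being the first vector of `cylTuple` of the empty tuple.
    have h1 := smooth_cylTuple (I' := 𝓘(ℝ, E)) (j' := (id : M → M)) (U := V₀) (t := fun _ => t)
      (F := fun x : M => (⟨x, Empty.elim⟩ : TangentTuple 𝓘(ℝ, E) (id : M → M) Empty))
      (smoothAlong_const _) smoothAlong_self (fun i => i.elim) none
    refine h1.congr fun x hx => ?_
    have h2 : (⟨cylMap J M (G x).base, (show ℝ × E from (G x).lin (w x))⟩ :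
        TangentBundle (cylModel E) (ℝ × M)) = ⟨cylMap J M (t, x), ((1, 0) : ℝ × E)⟩ := by
      have h3 : (show ℝ × E from (G x).lin (w x)) = (1, 0) := (hw x hx).1
      rw [hGb x hx]
      exact congrArg (fun v => (⟨cylMap J M (t, x), v⟩ : TangentBundle (cylModel E) (ℝ × M))) h3
    exact h2
  have hx₀ : x₀ ∈ V₀ := hqU
  -- The section `q` was chosen through a point whose frame already begins with `∂_t`. So `w` stays
  -- near the first basis vector around `x₀`, where the explicit rotation `rot` is defined and
  -- smooth.
  have hw₀ : w x₀ = Pi.single none 1 := by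
    refine TangentTuple.lin_injective (τ.frame_mem (q (t, x₀))) ?_
    refine (hw x₀ hx₀).1.trans ?_
    rw [TangentTuple.lin_single]
    have : τ.frame (q (t, x₀)) = cylTuple t F₀ := by rw [hqu, hu₀]
    exact (congrArg (fun A : TangentTuple (cylModel E) (cylMap J M) (Option (Fin r ⊕ Fin s)) =>
      (show ℝ × E from A.vec none)) this).symm
  have hcpos : Continuous fun v : Option (Fin r ⊕ Fin s) → ℝ =>
      ext (sig r s) none * innerSq (ext (sig r s)) (v + Pi.single none 1) :=
    continuous_const.mul ((contDiff_innerSq (ε := ext (sig r s))).continuous.comp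
      (continuous_id.add continuous_const))
  have hpos : ∀ᶠ x in nhds x₀, x ∈ V₀ ∧
      0 < ext (sig r s) none * innerSq (ext (sig r s)) (w x + Pi.single none 1) := by
    refine Filter.Eventually.and (hV₀.mem_nhds hx₀) ?_
    have h1 : ContinuousAt w x₀ := (hws.continuousOn continuous_id).continuousAt (hV₀.mem_nhds hx₀)
    have h2 : ContinuousAt (fun x => ext (sig r s) none *
        innerSq (ext (sig r s)) (w x + Pi.single none 1)) x₀ :=
      ContinuousAt.comp (f := w) hcpos.continuousAt h1
    refine h2.eventually (lt_mem_nhds ?_)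
    beta_reduce
    rw [hw₀, innerSq_double hε']
    norm_num
  obtain ⟨V, hV, hVo, hxV⟩ := mem_nhds_iff.1 hpos
  have hVV : V ⊆ V₀ := fun x hx => (hV hx).1
  let a : M → (SpinC (ext (sig r s))).El := fun x => SpinC.mk (rot hε' none (w x)) 1
  have ha : SmoothAlg 𝓘(ℝ, E) (id : M → M) (fun x => LinearGroup.val (a x)) V := fun φ => by
    refine ((hws.mono hVV).comp_contDiffOn (G := fun v => ((show CCl _ →ₗ[ℝ] ℝ from φ) ∘ₗ
      TensorProduct.mk ℝ ℂ (Cl (ext (sig r s))) 1) (rot hε' none v : (Cl (ext (sig r s)))ˣ))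
      fun x hx => ?_).congr fun x hx => ?_
    · filter_upwards [hcpos.continuousAt.eventually (lt_mem_nhds (hV hx).2)] with v hv
      exact contDiffAt_rot hε' none hv _
    · change φ (SpinC.cval _) = _
      rw [SpinC.val_mk, S1.coe_one]
      rfl
  have hp := (SmoothInto.precomp hq.2.2 (smoothAlong_slice (E := E) t V) hVV)
  have hci := (SmoothInto.precomp (τ.smooth_circle' hq).2.2 (smoothAlong_slice (E := E) t V) hVV)
  have hfr : ∀ x ∈ V, ∃ e, τ.frame (τ.P.act (q (t, x)) (a x)) = cylTuple t e ∧
      e ∈ PSO (sig r s) (g.g t) o.at_ ∧ e.base = x := fun x hx => by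
    have h1 : (show ℝ × E from (τ.frame (τ.P.act (q (t, x)) (a x))).vec none) = (1, 0) := by
      rw [τ.frame_actC hε', adC_mk hε', TangentTuple.transform_vec]
      beta_reduce
      rw [ad_rot_single hε' none (hw x (hVV hx)).2 (hV hx).2]
      exact (hw x (hVV hx)).1
    obtain ⟨e, he, hep⟩ := exists_eq_cylTuple (τ.frame_mem (τ.P.act (q (t, x)) (a x))) h1
    have hb : (τ.frame (τ.P.act (q (t, x)) (a x))).base = (t, x) := by
      rw [τ.frame_base, τ.P.proj_act, hq.2.1 _ (hVV hx)]
    rw [hb] at he hep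
    refine ⟨e, he, hep, ?_⟩
    rw [he] at hb
    exact congrArg Prod.snd hb
  have hfr' : ∀ x, ∃ e, x ∈ V → τ.frame (τ.P.act (q (t, x)) (a x)) = cylTuple t e ∧
      e ∈ PSO (sig r s) (g.g t) o.at_ ∧ e.base = x := fun x => by
    by_cases hx : x ∈ V
    · obtain ⟨e, he⟩ := hfr x hx
      exact ⟨e, fun _ => he⟩
    · exact ⟨F₀, fun h => (hx h).elim⟩
  choose e he using hfr'
  refine ⟨V, fun x => τ.P.act (q (t, x)) (a x), e, hVo, hxV, hp.act ha,
    (hci.act (smoothAlg_sqC ha)).congr fun x _ => τ.circle_actC _ _, fun x hx => ?_,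
    fun x hx => (he x hx).1, fun x hx => (he x hx).2.1, fun x hx => (he x hx).2.2, ?_⟩
  · rw [τ.P.proj_act, hq.2.1 _ (hVV hx)]
  · refine smooth_of_cylTuple (t := fun _ => t) (((hG.mono hVV).transform hid (hGs.mono hVV)
      (smoothAlg_adC hε' ha)).congr fun x hx => ?_)
    rw [← (he x hx).1, τ.frame_actC hε']

/-- The adapted sections `p i` differ by elements that fix `∂_t`, that is by a cocycle `c` in the
smaller group. The bundles `P` and `L` are glued from `c` and from the transition functions of the
circle parts of the `p i`; all maps are prescribed on the resulting sections and extended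
equivariantly. -/
theorem exists_restriction (τ : SpinCOnCyl g o) (t : J) : ∃ σ : SpinCOn g o t,
    IsRestriction t τ σ := by
  have hε := sig_sign r s
  have hε' := ext_sign hε
  have hid : Topology.IsInducing (id : M → M) := Topology.IsInducing.id
  choose V p e hVo hxV hp hci hpr hfr hPSO heb hes using exists_adapted_section τ t
  have hcov : ∀ x, ∃ i, x ∈ V i := fun x => ⟨x, hxV x⟩
  have hpp : ∀ i k x, x ∈ V i → x ∈ V k → τ.P.proj (p i x) = τ.P.proj (p k x) :=
    fun i k x hi hk => by rw [hpr i x hi, hpr k x hk]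
  have hcc : ∀ i k x, x ∈ V i → x ∈ V k →
      τ.L.proj (τ.circle (p i x)) = τ.L.proj (τ.circle (p k x)) :=
    fun i k x hi hk => by rw [τ.proj_circle, τ.proj_circle, hpp i k x hi hk]
  have hcont : ∀ U : Set M, ContinuousOn (fun x : M => ((t, x) : J × M)) U := fun U =>
    (continuous_const.prodMk continuous_id).continuousOn
  have hex : ∀ i k x, ∃ c, x ∈ V i → x ∈ V k →
      spinCIncl (sig r s) c = τ.P.diff (p i x) (p k x) := fun i k x => by
    by_cases hx : x ∈ V i ∧ x ∈ V k
    · have h1 : adC (τ.P.diff (p i x) (p k x)) (Pi.single none 1) = Pi.single none 1 := by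
        refine TangentTuple.lin_injective (τ.frame_mem (p i x)) ?_
        have h2 := τ.adC_diff hε' (hpp i k x hx.1 hx.2)
        have h3 := congrArg (fun A : TangentTuple (cylModel E) (cylMap J M)
          (Option (Fin r ⊕ Fin s)) => (show ℝ × E from A.vec none)) h2
        have h4 := congrArg (fun A : TangentTuple (cylModel E) (cylMap J M)
          (Option (Fin r ⊕ Fin s)) => (show ℝ × E from A.vec none)) (hfr k x hx.2)
        have h5 := congrArg (fun A : TangentTuple (cylModel E) (cylMap J M)
          (Option (Fin r ⊕ Fin s)) => (show ℝ × E from A.vec none)) (hfr i x hx.1)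
        rw [TangentTuple.lin_single]
        exact h3.trans (h4.trans h5.symm)
      obtain ⟨c, hc⟩ := exists_spinCIncl_eq hε h1
      exact ⟨c, fun _ _ => hc⟩
    · exact ⟨1, fun h1 h2 => (hx ⟨h1, h2⟩).elim⟩
  choose c hc using hex
  have hsmP : ∀ i k, SmoothAlg 𝓘(ℝ, E) (id : M → M)
      (fun x => LinearGroup.val (τ.P.diff (p i x) (p k x))) (V i ∩ V k) := fun i k =>
    ((hp i).mono Set.inter_subset_left).diff hid ((hp k).mono Set.inter_subset_right)
      (fun x hx => hpp i k x hx.1 hx.2) ((hcont _).congr fun x hx => hpr i x hx.1)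
  obtain ⟨P, q, hq, hqc⟩ := exists_of_cocycle (I := 𝓘(ℝ, E)) (j := (id : M → M))
    (𝒢 := SpinC (sig r s)) continuous_id hVo hcov c
    (fun i k l x hi hk hl => spinCIncl_injective (by
      rw [map_mul, hc i k x hi hk, hc k l x hk hl, hc i l x hi hl,
        diff_mul_diff (hpp i k x hi hk) (hpp k l x hk hl)]))
    (fun i k => by
      -- The retraction of Clifford algebras expresses `c` through the smooth transition functions
      -- in `τ`.
      refine SmoothAlg.congr (A := CCl (sig r s)) (SmoothAlg.map (A := CCl (ext (sig r s)))
        (A' := CCl (sig r s)) (hsmP i k) (cclRetr (sig r s))) fun x hx => ?_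
      rw [← hc i k x hx.1 hx.2]
      exact (cclRetr_cclIncl (SpinC.cval (c i k x))).symm)
  obtain ⟨L, l, hl, hlc⟩ := exists_of_cocycle (I := 𝓘(ℝ, E)) (j := (id : M → M))
    (𝒢 := S1) continuous_id hVo hcov
    (fun i k x => τ.L.diff (τ.circle (p i x)) (τ.circle (p k x)))
    (fun i k l x hi hk hl => diff_mul_diff (hcc i k x hi hk) (hcc k l x hk hl))
    (fun i k => ((hci i).mono Set.inter_subset_left).diff hid ((hci k).mono Set.inter_subset_right)
      (fun x hx => hcc i k x hx.1 hx.2)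
      ((hcont _).congr fun x hx => by rw [τ.proj_circle, hpr i x hx.1]))
  have hqp : ∀ i, ∀ x ∈ V i, P.proj (q i x) = x := fun i => (hq i).2.1
  have hlp : ∀ i, ∀ x ∈ V i, L.proj (l i x) = x := fun i => (hl i).2.1
  have hqd : ∀ i k x, x ∈ V i → x ∈ V k → P.diff (q i x) (q k x) = c i k x :=
    fun i k x hi hk => (diff_eq_iff (by rw [hqp i x hi, hqp k x hk])).2 (hqc i k x hi hk).symm
  have hld : ∀ i k x, x ∈ V i → x ∈ V k →
      L.diff (l i x) (l k x) = τ.L.diff (τ.circle (p i x)) (τ.circle (p k x)) :=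
    fun i k x hi hk => (diff_eq_iff (by rw [hlp i x hi, hlp k x hk])).2 (hlc i k x hi hk).symm
  have hpc : ∀ i k x, x ∈ V i → x ∈ V k → p k x = τ.P.act (p i x) (spinCIncl _ (c i k x)) :=
    fun i k x hi hk => by rw [hc i k x hi hk, act_diff (hpp i k x hi hk)]
  have hsq : ∀ i k x, x ∈ V i → x ∈ V k →
      τ.L.diff (τ.circle (p i x)) (τ.circle (p k x)) = sqC (c i k x) := fun i k x hi hk => by
    rw [diff_eq_iff (hcc i k x hi hk), hpc i k x hi hk, τ.circle_actC, sqC_spinCIncl]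
  obtain ⟨fr, hfr1, hfr2⟩ := exists_equivariant hcov hqp
    (fun (A : TangentTuple 𝓘(ℝ, E) (id : M → M) (Fin r ⊕ Fin s)) a => A.transform (adC a))
    (fun A a b => by rw [adC_mul hε, TangentTuple.transform_transform]) e
    (fun i k x hi hk => cylTuple_injective t (by
      rw [hqd i k x hi hk, ← cylTuple_transform, ← adC_spinCIncl hε, ← hfr i x hi,
        ← τ.frame_actC hε', ← hpc i k x hi hk, hfr k x hk]))
  obtain ⟨ci, hci1, hci2⟩ := exists_equivariant hcov hqp
    (fun (A : L.Total) a => L.act A (sqC a))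
    (fun A a b => by rw [sqC_mul, L.act_mul]) l
    (fun i k x hi hk => by rw [hqd i k x hi hk, ← hsq i k x hi hk, ← hlc i k x hi hk])
  obtain ⟨F, hF1, hF2⟩ := exists_equivariant hcov hqp
    (fun (A : τ.P.Total) a => τ.P.act A (spinCIncl (sig r s) a))
    (fun A a b => by rw [map_mul, τ.P.act_mul]) p
    (fun i k x hi hk => by rw [hqd i k x hi hk, ← hpc i k x hi hk])
  obtain ⟨f, hf1, hf2⟩ := exists_equivariant hcov hlp
    (fun (A : τ.L.Total) a => τ.L.act A a) τ.L.act_mul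
    (fun i x => τ.circle (p i x))
    (fun i k x hi hk => by rw [hld i k x hi hk, act_diff (hcc i k x hi hk)])
  have hP : ∀ u, ∃ i a, P.proj u ∈ V i ∧ u = P.act (q i (P.proj u)) a := fun u =>
    ⟨_, _, hxV (P.proj u), (act_diff (hqp _ _ (hxV (P.proj u)))).symm⟩
  have hL : ∀ u, ∃ i a, L.proj u ∈ V i ∧ u = L.act (l i (L.proj u)) a := fun u =>
    ⟨_, _, hxV (L.proj u), (act_diff (hlp _ _ (hxV (L.proj u)))).symm⟩
  let D : EquivariantData (ε := sig r s) P L (g.g t) o.at_ :=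
    { fr := fr
      ci := ci
      fr_mem := fun u => by
        obtain ⟨i, a, hi, hu⟩ := hP u
        rw [hu, hfr2, hfr1 i _ hi]
        exact TangentTuple.transform_mem (hPSO i _ hi) (isIsom_adC hε a)
          (by rw [det_adC hε]; norm_num)
      fr_base := fun u => by
        obtain ⟨i, a, hi, hu⟩ := hP u
        conv_lhs => rw [hu, hfr2, hfr1 i _ hi]
        exact heb i _ hi
      proj_ci := fun u => by
        obtain ⟨i, a, hi, hu⟩ := hP u
        conv_lhs => rw [hu, hci2, hci1 i _ hi]
        rw [L.proj_act, hlp i _ hi]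
      fr_act := hfr2
      ci_act := hci2
      exists_smooth := fun x => ⟨q x, V x, hq x, hxV x,
        (hes x).congr fun y hy => hfr1 x y hy,
        (hl x).1, fun y hy => by
          beta_reduce
          rw [hci1 x y hy, hlp x y hy],
        (hl x).2.2.congr fun y hy => hci1 x y hy⟩ }
  refine ⟨D.toSpinC hε hid, F, f, fun u => ?_, fun u => ?_, hF2, hf2, fun s' U hs' => ?_,
    fun s' U hs' => ?_, fun u => ?_, fun u => ?_⟩
  · obtain ⟨i, a, hi, hu⟩ := hP u
    conv_lhs => rw [hu, hF2, hF1 i _ hi]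
    rw [τ.P.proj_act, hpr i _ hi]
    rfl
  · obtain ⟨i, a, hi, hu⟩ := hL u
    conv_lhs => rw [hu, hf2, hf1 i _ hi]
    rw [τ.L.proj_act, τ.proj_circle, hpr i _ hi]
    rfl
  · refine smoothInto_map (I' := 𝓘(ℝ, E)) (j' := (id : M → M)) hid hid continuous_id
      smoothAlong_self (π := id) (F := fun _ => F) (ρ := spinCIncl (sig r s))
      (cclIncl (sig r s)).toLinearMap (fun _ => rfl) (fun _ => hF2) (fun x => ?_) hs'
    exact ⟨q x, V x, hq x, hxV x, V x, (hVo x).mem_nhds (hxV x), (hp x).congr fun y hy => hF1 x y hy⟩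
  · refine smoothInto_map (I' := 𝓘(ℝ, E)) (j' := (id : M → M)) hid hid continuous_id
      smoothAlong_self (π := id) (F := fun _ => f) (ρ := id)
      LinearMap.id (fun _ => rfl) (fun _ => hf2) (fun x => ?_) hs'
    exact ⟨l x, V x, hl x, hxV x, V x, (hVo x).mem_nhds (hxV x),
      (hci x).congr fun y hy => hf1 x y hy⟩
  · change _ = cylTuple t (fr u)
    obtain ⟨i, a, hi, hu⟩ := hP u
    rw [hu, hF2, hfr2, hF1 i _ hi, hfr1 i _ hi, τ.frame_actC hε', adC_spinCIncl hε,
      hfr i _ hi, cylTuple_transform]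
  · change _ = f (ci u)
    obtain ⟨i, a, hi, hu⟩ := hP u
    rw [hu, hF2, hci2, hf2, hF1 i _ hi, hci1 i _ hi, hf1 i _ hi, τ.circle_actC, sqC_spinCIncl]

end Restriction

/-! ### Smooth partitions of unity along a subspace -/

section Partition

variable {E H E' H' : Type*} [NormedAddCommGroup E] [NormedSpace ℝ E] [TopologicalSpace H]
  [NormedAddCommGroup E'] [NormedSpace ℝ E'] [TopologicalSpace H']
  {N N' : Type*} [TopologicalSpace N] [ChartedSpace H N] [TopologicalSpace N'] [ChartedSpace H' N']
  {B : Type*} [TopologicalSpace B] {I : ModelWithCorners ℝ E H} {j : B → N}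
  {I' : ModelWithCorners ℝ E' H'}

/-- Partitions of unity are taken on an open neighbourhood of the image of `j`, and this brings the
functions back to `B`. It handles cylinders over arbitrary intervals. -/
theorem smoothAlong_of_opens {O : TopologicalSpace.Opens N} {F : O → N'} (hF : ContMDiff I I' ∞ F)
    {k : B → O} (hk : ∀ b, (k b : N) = j b) : SmoothAlong I j I' (fun b => F (k b)) Set.univ := by
  intro b _
  classical
  let G : N → N' := fun x => if h : x ∈ O then F ⟨x, h⟩ else F (k b)
  have hG : ∀ x : O, G x = F x := fun x => by simp only [G, dif_pos x.2]
  refine ⟨O, O.isOpen, hk b ▸ (k b).2, G, fun x hx => ?_, fun c _ _ => ?_⟩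
  · have h : ContMDiffAt I I' ∞ (fun y : O => G y) ⟨x, hx⟩ := by
      rw [funext hG]; exact hF _
    exact (contMDiffAt_subtype_iff.1 h).contMDiffWithinAt
  · rw [← hk c]; exact hG _

variable [FiniteDimensional ℝ E] [IsManifold I ∞ N] [T2Space N] [SecondCountableTopology N]

theorem sigmaCompact_opens (O : TopologicalSpace.Opens N) (I : ModelWithCorners ℝ E H) :
    SigmaCompactSpace O := by
  have : LocallyCompactSpace H := I.locallyCompactSpace
  have : LocallyCompactSpace N := ChartedSpace.locallyCompactSpace H N
  have : LocallyCompactSpace O := O.isOpen.locallyCompactSpace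
  infer_instance

/-- A smooth map with values in convex sets that are locally met by constants. -/
theorem exists_smoothAlong_mem_convex (hj : Topology.IsInducing j) {V : Type*}
    [NormedAddCommGroup V] [NormedSpace ℝ V] {t : B → Set V} (ht : ∀ b, Convex ℝ (t b))
    (hloc : ∀ b, ∃ c : V, ∀ᶠ b' in nhds b, c ∈ t b') :
    ∃ f : B → V, SmoothAlong I j 𝓘(ℝ, V) f Set.univ ∧ ∀ b, f b ∈ t b := by
  choose c hc using hloc
  have hW : ∀ b, ∃ W : Set N, IsOpen W ∧ j b ∈ W ∧ ∀ b', j b' ∈ W → c b ∈ t b' := fun b => by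
    have h := hc b
    rw [hj.nhds_eq_comap, Filter.eventually_comap] at h
    obtain ⟨W, hW, hWo, hb⟩ := mem_nhds_iff.1 h
    exact ⟨W, hWo, hb, fun b' hb' => hW hb' b' rfl⟩
  choose W hWo hbW hWt using hW
  let O : TopologicalSpace.Opens N := ⟨⋃ b, W b, isOpen_iUnion hWo⟩
  have := sigmaCompact_opens O I
  -- At a point outside the image of `j` there is no condition: the intersection is everything.
  let t' : O → Set V := fun x => ⋂ (b : B) (_ : j b = x), t b
  obtain ⟨f, hf⟩ := exists_contMDiffMap_forall_mem_convex_of_local_const (n := ⊤) I (t := t')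
    (fun x => convex_iInter₂ fun b _ => ht b) (fun x => by
      obtain ⟨b, hb⟩ := Set.mem_iUnion.1 x.2
      refine ⟨c b, ?_⟩
      filter_upwards [((hWo b).preimage continuous_subtype_val).mem_nhds hb] with y hy
      exact Set.mem_iInter₂.2 fun b' hb' => hWt b b' (hb' ▸ hy))
  let k : B → O := fun b => ⟨j b, Set.mem_iUnion.2 ⟨b, hbW b⟩⟩
  exact ⟨fun b => f (k b), smoothAlong_of_opens f.contMDiff fun _ => rfl,
    fun b => Set.mem_iInter₂.1 (hf (k b)) b rfl⟩

/-- A smooth partition of unity on a subspace. -/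
theorem exists_partition (hj : Topology.IsInducing j) {κ : Type*} {U : κ → Set B}
    (hU : ∀ i, IsOpen (U i)) (hcov : ∀ b, ∃ i, b ∈ U i) :
    ∃ ρ : κ → B → ℝ, (∀ i, SmoothAlong I j 𝓘(ℝ, ℝ) (ρ i) Set.univ) ∧ (∀ i b, 0 ≤ ρ i b) ∧
      ∃ K : B → Finset κ, (∀ b, ∀ i ∈ K b, b ∈ U i) ∧
        (∀ b, ∀ᶠ b' in nhds b, K b' ⊆ K b) ∧ (∀ b, ∀ i ∉ K b, ρ i b = 0) ∧
        (∀ b, ∑ i ∈ K b, ρ i b = 1) := by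
  have hW : ∀ i, ∃ W : Set N, IsOpen W ∧ j ⁻¹' W = U i := fun i => hj.isOpen_iff.1 (hU i)
  choose W hWo hWU using hW
  let O : TopologicalSpace.Opens N := ⟨⋃ b, W b, isOpen_iUnion hWo⟩
  have := sigmaCompact_opens O I
  obtain ⟨ρ, hρ⟩ := SmoothPartitionOfUnity.exists_isSubordinate I (isClosed_univ (X := O))
    (fun i => Subtype.val ⁻¹' W i) (fun i => (hWo i).preimage continuous_subtype_val)
    (fun x _ => by
      obtain ⟨i, hi⟩ := Set.mem_iUnion.1 x.2
      exact Set.mem_iUnion.2 ⟨i, hi⟩)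
  let k : B → O := fun b => ⟨j b, Set.mem_iUnion.2 (by
    obtain ⟨i, hi⟩ := hcov b
    exact ⟨i, by rw [← Set.mem_preimage, hWU]; exact hi⟩)⟩
  have hk : Continuous k := hj.continuous.subtype_mk _
  -- `K b` collects the functions whose closed support contains the point. Closed supports ensure
  -- that no new index appears near `b`.
  refine ⟨fun i b => ρ i (k b), fun i => smoothAlong_of_opens (ρ i).contMDiff fun _ => rfl,
    fun i b => ρ.nonneg i _, fun b => ρ.fintsupport (k b), fun b i hi => ?_,
    fun b => hk.continuousAt.eventually (ρ.eventually_fintsupport_subset (k b)),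
    fun b i hi => ?_, fun b => ρ.sum_finsupport' _ (Set.mem_univ _)
      (ρ.finsupport_subset_fintsupport _)⟩
  · have h := hρ i ((ρ.mem_fintsupport_iff _ i).1 hi)
    rw [← hWU]; exact h
  · by_contra h0
    exact hi (ρ.finsupport_subset_fintsupport _ ((ρ.mem_finsupport _).2 h0))

end Partition

/-! ### Transport along the lines of a cylinder -/

section Transport

open Filter Topology

variable {E : Type*} [NormedAddCommGroup E] [NormedSpace ℝ E] [FiniteDimensional ℝ E]
  {M : Type u} [TopologicalSpace M] [T2Space M] [SecondCountableTopology M] [ChartedSpace E M]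
  [IsManifold 𝓘(ℝ, E) ∞ M] {J : Set ℝ}

/-- The point `t₀ + λ(s) (t - t₀)` of an interval, for the smooth step function `λ`. -/
def stepPoint (hJ : J.OrdConnected) (t₀ t : J) (s : ℝ) : J :=
  ⟨t₀ + Real.smoothTransition s * (t - t₀), by
    have h : Convex ℝ J := hJ.convex
    have := h t₀.2 t.2 (a := 1 - Real.smoothTransition s) (b := Real.smoothTransition s)
      (sub_nonneg.2 (Real.smoothTransition.le_one s)) (Real.smoothTransition.nonneg s) (by ring)
    simp only [smul_eq_mul] at this
    convert this using 1
    ring⟩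

theorem stepPoint_zero (hJ : J.OrdConnected) (t₀ t : J) : stepPoint hJ t₀ t 0 = t₀ :=
  Subtype.ext (by simp [stepPoint])

theorem stepPoint_of_one_le (hJ : J.OrdConnected) (t₀ t : J) {s : ℝ} (hs : 1 ≤ s) :
    stepPoint hJ t₀ t s = t :=
  Subtype.ext (by simp [stepPoint, Real.smoothTransition.one_of_one_le hs])

theorem stepPoint_self (hJ : J.OrdConnected) (t : J) (s : ℝ) : stepPoint hJ t t s = t :=
  Subtype.ext (by simp [stepPoint])

theorem continuous_stepPoint (hJ : J.OrdConnected) (t₀ : J) :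
    Continuous fun q : J × ℝ => stepPoint hJ t₀ q.1 q.2 := by
  refine Continuous.subtype_mk ?_ _
  have := Real.smoothTransition.continuous
  fun_prop

theorem smoothAlong_time : SmoothAlong (cylModel E) (cylMap J M) 𝓘(ℝ, ℝ)
    (fun z => (z.1 : ℝ)) Set.univ := by
  intro b _
  exact ⟨Set.univ, isOpen_univ, trivial, Prod.fst, contMDiff_fst.contMDiffOn, fun _ _ _ => rfl⟩

theorem smoothAlong_stepPoint (hJ : J.OrdConnected) (t₀ : J) {s : J × M → ℝ}
    (hs : SmoothAlong (cylModel E) (cylMap J M) 𝓘(ℝ, ℝ) s Set.univ) :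
    SmoothAlong (cylModel E) (cylMap J M) 𝓘(ℝ, ℝ)
      (fun z => (stepPoint hJ t₀ z.1 (s z) : ℝ)) Set.univ :=
  (smoothAlong_const (t₀ : ℝ)).add ((hs.comp_contDiff Real.smoothTransition.contDiff).mul
    (smoothAlong_time.sub (smoothAlong_const (t₀ : ℝ))))

/-- A positive smooth function `δ` on the cylinder such that steps of relative size at most `δ` stay
in a given neighbourhood of the diagonal. -/
theorem exists_step (hJ : J.OrdConnected) (t₀ : J) {Ω : J → J → M → Prop}
    (hΩ : ∀ t x, ∀ᶠ q : J × J × M in 𝓝 (t, t, x), Ω q.1 q.2.1 q.2.2) :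
    ∃ δ : J × M → ℝ, SmoothAlong (cylModel E) (cylMap J M) 𝓘(ℝ, ℝ) δ Set.univ ∧
      ∀ z, 0 < δ z ∧ ∀ s ≥ 0, ∀ e ∈ Set.Icc 0 (δ z),
        Ω (stepPoint hJ t₀ z.1 s) (stepPoint hJ t₀ z.1 (s + e)) z.2 := by
  refine exists_smoothAlong_mem_convex (isInducing_cylMap)
    (t := fun z => {δ | 0 < δ ∧ ∀ s ≥ 0, ∀ e ∈ Set.Icc 0 δ,
        Ω (stepPoint hJ t₀ z.1 s) (stepPoint hJ t₀ z.1 (s + e)) z.2}) (fun z => ?_) fun z => ?_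
  · refine Set.OrdConnected.convex ⟨fun a ha b hb c hc => ⟨ha.1.trans_le hc.1, fun s hs e he => ?_⟩⟩
    exact hb.2 s hs e ⟨he.1, he.2.trans hc.2⟩
  -- Compactness of `[0, 1]` gives a step size that works for all `s ≤ 1` and all nearby points at
  -- once. For `s > 1` the path rests and both points coincide.
  · have h : ∀ s ∈ Set.Icc (0 : ℝ) 1, ∀ᶠ q : ((J × M) × ℝ) × ℝ in 𝓝 (z, 0) ×ˢ 𝓝 s,
        Ω (stepPoint hJ t₀ q.1.1.1 q.2) (stepPoint hJ t₀ q.1.1.1 (q.2 + q.1.2)) q.1.1.2 := by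
      intro s _
      rw [← nhds_prod_eq]
      have hc := continuous_stepPoint hJ t₀
      have hcont : Continuous fun q : ((J × M) × ℝ) × ℝ =>
          ((stepPoint hJ t₀ q.1.1.1 q.2, stepPoint hJ t₀ q.1.1.1 (q.2 + q.1.2), q.1.1.2) :
            J × J × M) :=
        (hc.comp (f := fun q : ((J × M) × ℝ) × ℝ => (q.1.1.1, q.2)) (by fun_prop)).prodMk
          ((hc.comp (f := fun q : ((J × M) × ℝ) × ℝ => (q.1.1.1, q.2 + q.1.2))
            (by fun_prop)).prodMk (by fun_prop))
      have h2 : ∀ᶠ q : J × J × M in 𝓝 (stepPoint hJ t₀ z.1 s, stepPoint hJ t₀ z.1 (s + 0), z.2),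
          Ω q.1 q.2.1 q.2.2 := by
        rw [add_zero]; exact hΩ _ _
      exact (hcont.continuousAt (x := ((z, 0), s))).eventually h2
    have h1 := isCompact_Icc.eventually_forall_of_forall_eventually
      (x₀ := ((z, (0 : ℝ)))) (K := Set.Icc (0 : ℝ) 1)
      (P := fun (q : (J × M) × ℝ) (s : ℝ) =>
        Ω (stepPoint hJ t₀ q.1.1 s) (stepPoint hJ t₀ q.1.1 (s + q.2)) q.1.2)
      (fun s hs => by rw [nhds_prod_eq]; exact h s hs)
    rw [nhds_prod_eq, eventually_prod_iff] at h1
    obtain ⟨p, hp, p', hp', hpp⟩ := h1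
    obtain ⟨c, hc, hcp⟩ := Metric.eventually_nhds_iff.1 hp'
    refine ⟨c / 2, ?_⟩
    filter_upwards [hp] with z' hz'
    refine ⟨half_pos hc, fun s hs e he => ?_⟩
    rcases le_or_gt s 1 with h' | h'
    · refine hpp hz' (hcp ?_) s ⟨hs, h'⟩
      rw [Real.dist_eq, sub_zero, abs_of_nonneg he.1]
      linarith [he.2]
    · rw [stepPoint_of_one_le hJ _ _ h'.le,
        stepPoint_of_one_le hJ _ _ (h'.le.trans (le_add_of_nonneg_right he.1))]
      exact (hΩ z'.1 z'.2).self_of_nhds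

/-- Local transports `B t t' x` along the lines of a cylinder compose to a global transport. -/
theorem exists_transport (hJ : J.OrdConnected) (t₀ : J) {X : Type*} {Ω : J → J → M → Prop}
    (hΩ : ∀ t x, ∀ᶠ q : J × J × M in 𝓝 (t, t, x), Ω q.1 q.2.1 q.2.2)
    (B : J → J → M → X → X) (S : (J × M → J) → (J × M → X) → Prop)
    (hS : ∀ α y, (∀ z, ∃ α' y', S α' y' ∧ ∀ᶠ w in 𝓝 z, α w = α' w ∧ y w = y' w) → S α y)
    (hB : ∀ α y, S α y → ∀ z, B (α z) (α z) z.2 (y z) = y z)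
    (hstep : ∀ α β y, S α y →
      SmoothAlong (cylModel E) (cylMap J M) 𝓘(ℝ, ℝ) (fun z => (α z : ℝ)) Set.univ →
      SmoothAlong (cylModel E) (cylMap J M) 𝓘(ℝ, ℝ) (fun z => (β z : ℝ)) Set.univ →
      (∀ z, Ω (α z) (β z) z.2) → S β (fun z => B (α z) (β z) z.2 (y z)))
    (y₀ : M → X) (h₀ : S (fun _ => t₀) (fun z => y₀ z.2)) :
    ∃ y, S Prod.fst y ∧ ∀ x, y (t₀, x) = y₀ x := by
  -- One smooth `δ` controls the steps at all points, so the data after any fixed number of steps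
  -- are smooth on the whole cylinder.
  obtain ⟨δ, hδ, hδΩ⟩ := exists_step (E := E) hJ t₀ hΩ
  let p : ℕ → J × M → J := fun k z => stepPoint hJ t₀ z.1 (k * δ z)
  let Y : ℕ → J × M → X := fun k => Nat.rec (fun z => y₀ z.2)
    (fun k y z => B (p k z) (p (k + 1) z) z.2 (y z)) k
  have hY0 : Y 0 = fun z => y₀ z.2 := rfl
  have hYs : ∀ k z, Y (k + 1) z = B (p k z) (p (k + 1) z) z.2 (Y k z) := fun k z => rfl
  have hp : ∀ k, SmoothAlong (cylModel E) (cylMap J M) 𝓘(ℝ, ℝ) (fun z => (p k z : ℝ)) Set.univ :=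
    fun k => smoothAlong_stepPoint hJ t₀ ((smoothAlong_const (k : ℝ)).mul hδ)
  have hSk : ∀ k, S (p k) (Y k) := by
    intro k
    induction k with
    | zero =>
      have : p 0 = fun _ => t₀ := funext fun z => by
        simp only [p, Nat.cast_zero, zero_mul, stepPoint_zero]
      rw [this, hY0]; exact h₀
    | succ k ih =>
      refine hstep _ _ _ ih (hp k) (hp (k + 1)) fun z => ?_
      have h := (hδΩ z).2 (k * δ z) (by have := (hδΩ z).1; positivity) (δ z)
        ⟨(hδΩ z).1.le, le_rfl⟩
      have h2 : ((k + 1 : ℕ) : ℝ) * δ z = k * δ z + δ z := by push_cast; ring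
      simp only [p, h2]; exact h
  have hpt : ∀ (k : ℕ) z, 1 ≤ k * δ z → p k z = z.1 := fun k z h => stepPoint_of_one_le hJ _ _ h
  -- Once `n * δ z ≥ 1` the path rests at the time of `z`, and by `hB` a step of length zero changes
  -- nothing.
  have hconst : ∀ z (n k : ℕ), 1 ≤ n * δ z → n ≤ k → Y k z = Y n z := by
    intro z n k hn hk
    induction k, hk using Nat.le_induction with
    | base => rfl
    | succ k hk ih =>
      have h1 : p (k + 1) z = p k z := by
        have hd := (hδΩ z).1
        have h2 : (n : ℝ) ≤ k := by exact_mod_cast hk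
        rw [hpt k z (hn.trans (by gcongr)), hpt (k + 1) z (hn.trans (by push_cast; gcongr; linarith))]
      rw [hYs, h1, hB _ _ (hSk k), ih]
  -- The number of steps varies from point to point, but near `z` a fixed `n > 1 / δ z` gives the
  -- same value; so `y` satisfies the local condition `S`.
  let y : J × M → X := fun z => Y ⌈1 / δ z⌉₊ z
  have hceil : ∀ z, 1 ≤ (⌈1 / δ z⌉₊ : ℝ) * δ z := fun z => by
    rw [← div_le_iff₀ (hδΩ z).1]; exact Nat.le_ceil _
  refine ⟨y, hS _ _ fun z => ?_, fun x => ?_⟩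
  · obtain ⟨n, hn⟩ := exists_nat_gt (1 / δ z)
    rw [div_lt_iff₀ (hδΩ z).1] at hn
    refine ⟨p n, Y n, hSk n, ?_⟩
    have hc : ContinuousAt (fun w => n * δ w) z :=
      continuousAt_const.mul ((hδ.continuousOn isInducing_cylMap.continuous).continuousAt
        Filter.univ_mem)
    filter_upwards [hc.eventually (lt_mem_nhds hn)] with w hw
    refine ⟨(hpt n w hw.le).symm, ?_⟩
    refine (hconst w _ _ (hceil w) ?_).symm
    exact Nat.ceil_le.2 ((div_le_iff₀ (hδΩ w).1).2 hw.le)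
  · have : ∀ k, Y k (t₀, x) = y₀ x := by
      intro k
      induction k with
      | zero => rfl
      | succ k ih =>
        have h1 : ∀ k, p k (t₀, x) = t₀ := fun k => stepPoint_self hJ _ _
        have h2 := hB _ _ (hSk k) (t₀, x)
        rw [h1] at h2
        rw [hYs, h1, h1, h2, ih]
    exact this _

end Transport

/-! ### Extension of sections of circle bundles along a cylinder -/

/-- The direction of a complex number. -/
def S1.dir (w : ℂ) : S1.El :=
  open Classical in
  if h : w = 0 then 1 else S1.ofNorm ((‖w‖⁻¹ : ℝ) • w) (by
    rw [norm_smul, norm_inv, norm_norm, inv_mul_cancel₀ (norm_ne_zero_iff.2 h)])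

theorem S1.coe_dir {w : ℂ} (h : w ≠ 0) : S1.coe (S1.dir w) = (‖w‖⁻¹ : ℝ) • w := by
  rw [S1.dir, dif_neg h]; rfl

theorem S1.dir_coe (z : S1.El) : S1.dir (S1.coe z) = z :=
  S1.coe_injective (by rw [S1.coe_dir (S1.coe_ne_zero z), S1.norm_coe, inv_one, one_smul])

theorem S1.dir_mul (z : S1.El) {w : ℂ} (h : w ≠ 0) : S1.dir (S1.coe z * w) = z * S1.dir w :=
  S1.coe_injective (by
    rw [S1.coe_mul, S1.coe_dir h, S1.coe_dir (mul_ne_zero (S1.coe_ne_zero z) h), norm_mul,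
      S1.norm_coe, one_mul, mul_smul_comm])

section SmoothCircle

variable {E H : Type*} [NormedAddCommGroup E] [NormedSpace ℝ E] [TopologicalSpace H]
  {N : Type*} [TopologicalSpace N] [ChartedSpace H N] {B : Type*} {I : ModelWithCorners ℝ E H}
  {j : B → N} {U : Set B}

theorem smoothAlg_val_iff {z : B → S1.El} : SmoothAlg I j (fun b => LinearGroup.val (z b)) U ↔
    SmoothAlong I j 𝓘(ℝ, ℂ) (fun b => S1.coe (z b)) U :=
  ⟨fun h => SmoothAlg.toSpace (V := ℂ) fun φ => h φ, fun h φ => h.toAlg (show ℂ →ₗ[ℝ] ℝ from φ)⟩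

theorem smoothAlong_dir {w : B → ℂ} (hw : SmoothAlong I j 𝓘(ℝ, ℂ) w U) (h : ∀ b ∈ U, w b ≠ 0) :
    SmoothAlong I j 𝓘(ℝ, ℂ) (fun b => S1.coe (S1.dir (w b))) U :=
  (hw.comp_contDiffOn (G := fun w : ℂ => (‖w‖⁻¹ : ℝ) • w) fun b hb => by
    filter_upwards [isOpen_ne.mem_nhds (h b hb)] with v hv
    exact ((contDiffAt_norm ℝ hv).inv (norm_ne_zero_iff.2 hv)).smul contDiffAt_id).congr
    fun b hb => S1.coe_dir (h b hb)

end SmoothCircle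

section CircleExtension

open Filter Topology

variable {E : Type*} [NormedAddCommGroup E] [NormedSpace ℝ E] [FiniteDimensional ℝ E]
  {M : Type u} [TopologicalSpace M] [T2Space M] [SecondCountableTopology M] [ChartedSpace E M]
  [IsManifold 𝓘(ℝ, E) ∞ M] {J : Set ℝ}

theorem smoothAlong_cylMap_mk {α : J × M → J}
    (hα : SmoothAlong (cylModel E) (cylMap J M) 𝓘(ℝ, ℝ) (fun z => (α z : ℝ)) Set.univ) :
    SmoothAlong (cylModel E) (cylMap J M) (cylModel E) (fun z => cylMap J M (α z, z.2)) Set.univ :=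
  hα.prodMk (smoothAlong_snd _)

theorem continuous_of_smoothAlong {α : J × M → J}
    (hα : SmoothAlong (cylModel E) (cylMap J M) 𝓘(ℝ, ℝ) (fun z => (α z : ℝ)) Set.univ) :
    Continuous fun z => (α z, z.2) := by
  refine Continuous.prodMk ?_ continuous_snd
  exact Topology.IsInducing.subtypeVal.continuous_iff.2
    (continuousOn_univ.1 (hα.continuousOn isInducing_cylMap.continuous))

/-- A trivialisation over a slice of a cocycle of circles on the cylinder extends to the cylinder. -/
theorem exists_circle_extension (hJ : J.OrdConnected) (t₀ : J) {K : Type*} {U : K → Set (J × M)}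
    (hU : ∀ i, IsOpen (U i)) (hcov : ∀ z, ∃ i, z ∈ U i) {c : K → K → J × M → S1.El}
    (hc : ∀ i k l z, z ∈ U i → z ∈ U k → z ∈ U l → c i k z * c k l z = c i l z)
    (hcs : ∀ i k, SmoothAlong (cylModel E) (cylMap J M) 𝓘(ℝ, ℂ) (fun z => S1.coe (c i k z))
      (U i ∩ U k)) {y₀ : K → M → S1.El}
    (hy₀ : ∀ i k x, (t₀, x) ∈ U i → (t₀, x) ∈ U k → y₀ i x = c i k (t₀, x) * y₀ k x)
    (hy₀s : ∀ i, SmoothAlong 𝓘(ℝ, E) (id : M → M) 𝓘(ℝ, ℂ) (fun x => S1.coe (y₀ i x))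
      {x | (t₀, x) ∈ U i}) :
    ∃ y : K → J × M → S1.El, (∀ i k z, z ∈ U i → z ∈ U k → y i z = c i k z * y k z) ∧
      ∀ i, SmoothAlong (cylModel E) (cylMap J M) 𝓘(ℝ, ℂ) (fun z => S1.coe (y i z)) (U i) := by
  classical
  have hind : Topology.IsInducing (cylMap J M) := isInducing_cylMap
  have hone : ∀ i k z, z ∈ U i → z ∈ U k → c i k z * c k i z = 1 := fun i k z hi hk => by
    have h1 := hc i i i z hi hi hi
    rw [hc i k i z hi hk hi]
    exact mul_eq_left.1 h1
  obtain ⟨ρ, hρs, hρ0, Kf, hKU, hKsub, hK0, hK1⟩ :=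
    exists_partition (I := cylModel E) hind hU hcov
  -- In each chart `k` the value `y k` is kept constant from `t` to `t'`; the results are rewritten
  -- in chart `i` and averaged with the weights at `(t, x)`.
  let W : J → J → M → (K → S1.El) → K → ℂ := fun t t' x y i =>
    ∑ k ∈ Kf (t, x), ρ k (t, x) • S1.coe (c i k (t', x) * y k)
  -- Relative to the value in one chart `l`, all terms of the average have positive real part; so
  -- the average is not zero and has a direction.
  let Ω : J → J → M → Prop := fun t t' x => ∃ l, (t, x) ∈ U l ∧ (t', x) ∈ U l ∧
    ∀ k ∈ Kf (t, x), (t', x) ∈ U k ∧ 0 < (S1.coe (c l k (t', x) * c k l (t, x))).re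
  -- The value `1` off the chart is a convention, recorded in the last clause of `S`; with it a step
  -- of length zero fixes the whole family.
  let B : J → J → M → (K → S1.El) → K → S1.El := fun t t' x y i =>
    if (t', x) ∈ U i then S1.dir (W t t' x y i) else 1
  let S : (J × M → J) → (J × M → K → S1.El) → Prop := fun α y =>
    (∀ i, SmoothAlong (cylModel E) (cylMap J M) 𝓘(ℝ, ℂ) (fun z => S1.coe (y z i))
      {z | (α z, z.2) ∈ U i}) ∧
    (∀ z i k, (α z, z.2) ∈ U i → (α z, z.2) ∈ U k → y z i = c i k (α z, z.2) * y z k) ∧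
    ∀ z i, (α z, z.2) ∉ U i → y z i = 1
  have hWmul : ∀ t t' x y i m, (∀ k ∈ Kf (t, x), (t', x) ∈ U k) → (t', x) ∈ U i →
      (t', x) ∈ U m → W t t' x y i = S1.coe (c i m (t', x)) * W t t' x y m := by
    intro t t' x y i m hk hi hm
    simp only [W, Finset.mul_sum]
    refine Finset.sum_congr rfl fun k hkK => ?_
    rw [mul_smul_comm, ← S1.coe_mul, ← mul_assoc, hc i m k _ hi hm (hk k hkK)]
  have hWne : ∀ t t' x y i, Ω t t' x → (t', x) ∈ U i →
      (∀ i k, (t, x) ∈ U i → (t, x) ∈ U k → y i = c i k (t, x) * y k) → W t t' x y i ≠ 0 := by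
    rintro t t' x y i ⟨l, hl, hl', hΩ⟩ hi hy
    rw [hWmul t t' x y i l (fun k hk => (hΩ k hk).1) hi hl']
    refine mul_ne_zero (S1.coe_ne_zero _) ?_
    have h1 : W t t' x y l = (∑ k ∈ Kf (t, x), ρ k (t, x) •
        S1.coe (c l k (t', x) * c k l (t, x))) * S1.coe (y l) := by
      simp only [W, Finset.sum_mul]
      refine Finset.sum_congr rfl fun k hk => ?_
      rw [smul_mul_assoc, ← S1.coe_mul, mul_assoc, ← hy k l (hKU _ k hk) hl]
    rw [h1]
    refine mul_ne_zero (fun h0 => ?_) (S1.coe_ne_zero _)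
    have h2 := congrArg Complex.re h0
    rw [Complex.re_sum, Complex.zero_re] at h2
    have h3 : 0 < ∑ k ∈ Kf (t, x), (ρ k (t, x) • S1.coe (c l k (t', x) * c k l (t, x))).re := by
      have hnn : ∀ k ∈ Kf (t, x),
          0 ≤ (ρ k (t, x) • S1.coe (c l k (t', x) * c k l (t, x))).re := fun k hk => by
        rw [Complex.smul_re]
        exact mul_nonneg (hρ0 _ _) (hΩ k hk).2.le
      refine (Finset.sum_nonneg hnn).lt_of_ne' fun h4 => ?_
      have h5 := (Finset.sum_eq_zero_iff_of_nonneg hnn).1 h4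
      have h6 : ∑ k ∈ Kf (t, x), ρ k (t, x) = 0 := Finset.sum_eq_zero fun k hk => by
        have := h5 k hk
        rw [Complex.smul_re, smul_eq_mul] at this
        exact (mul_eq_zero.1 this).resolve_right (hΩ k hk).2.ne'
      rw [hK1] at h6
      exact one_ne_zero h6
    exact h3.ne' h2
  have hΩ : ∀ t x, ∀ᶠ q : J × J × M in 𝓝 (t, t, x), Ω q.1 q.2.1 q.2.2 := by
    intro t x
    obtain ⟨l, hl⟩ := hcov (t, x)
    have c1 : Continuous fun q : J × J × M => (q.1, q.2.2) := by fun_prop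
    have c2 : Continuous fun q : J × J × M => (q.2.1, q.2.2) := by fun_prop
    have e1 : ∀ k, (t, x) ∈ U k → ∀ᶠ q : J × J × M in 𝓝 (t, t, x), (q.1, q.2.2) ∈ U k :=
      fun k hk => c1.continuousAt.eventually ((hU k).mem_nhds hk)
    have e2 : ∀ k, (t, x) ∈ U k → ∀ᶠ q : J × J × M in 𝓝 (t, t, x), (q.2.1, q.2.2) ∈ U k :=
      fun k hk => c2.continuousAt.eventually ((hU k).mem_nhds hk)
    have e3 : ∀ᶠ q : J × J × M in 𝓝 (t, t, x), Kf (q.1, q.2.2) ⊆ Kf (t, x) :=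
      (c1.continuousAt (x := (t, t, x))).eventually (hKsub (t, x))
    have e4 : ∀ k, (t, x) ∈ U k → ∀ᶠ q : J × J × M in 𝓝 (t, t, x),
        0 < (S1.coe (c l k (q.2.1, q.2.2) * c k l (q.1, q.2.2))).re := by
      intro k hk
      have h1 : ContinuousAt (fun z => S1.coe (c l k z)) (t, x) :=
        ((hcs l k).continuousOn hind.continuous).continuousAt
          (((hU l).inter (hU k)).mem_nhds ⟨hl, hk⟩)
      have h2 : ContinuousAt (fun z => S1.coe (c k l z)) (t, x) :=
        ((hcs k l).continuousOn hind.continuous).continuousAt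
          (((hU k).inter (hU l)).mem_nhds ⟨hk, hl⟩)
      have h3 : ContinuousAt (fun q : J × J × M => S1.coe (c l k (q.2.1, q.2.2))) (t, t, x) :=
        ContinuousAt.comp (f := fun q : J × J × M => (q.2.1, q.2.2)) (x := (t, t, x)) h1
          c2.continuousAt
      have h4 : ContinuousAt (fun q : J × J × M => S1.coe (c k l (q.1, q.2.2))) (t, t, x) :=
        ContinuousAt.comp (f := fun q : J × J × M => (q.1, q.2.2)) (x := (t, t, x)) h2
          c1.continuousAt
      have h5 := Complex.continuous_re.continuousAt.comp (h3.mul h4)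
      refine h5.eventually (lt_mem_nhds ?_)
      change 0 < (S1.coe (c l k (t, x)) * S1.coe (c k l (t, x))).re
      rw [← S1.coe_mul, hone l k _ hl hk, S1.coe_one, Complex.one_re]
      exact one_pos
    have e5 : ∀ᶠ q : J × J × M in 𝓝 (t, t, x), ∀ k ∈ Kf (t, x), (q.2.1, q.2.2) ∈ U k ∧
        0 < (S1.coe (c l k (q.2.1, q.2.2) * c k l (q.1, q.2.2))).re :=
      (Filter.eventually_all_finset _).2 fun k hk =>
        (e2 k (hKU _ k hk)).and (e4 k (hKU _ k hk))
    filter_upwards [e1 l hl, e2 l hl, e3, e5] with q h1 h2 h3 h5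
    exact ⟨l, h1, h2, fun k hk => h5 k (h3 hk)⟩
  have hS : ∀ α y, (∀ z, ∃ α' y', S α' y' ∧ ∀ᶠ w in 𝓝 z, α w = α' w ∧ y w = y' w) → S α y := by
    intro α y h
    refine ⟨fun i => SmoothAlong.of_local hind fun z hz => ?_, fun z i k hi hk => ?_,
      fun z i hi => ?_⟩
    · obtain ⟨α', y', hS', he⟩ := h z
      refine ⟨_, he, ((hS'.1 i).mono fun w hw => ?_).congr fun w hw => by rw [hw.2.2]⟩
      have h1 : (α w, w.2) ∈ U i := hw.1
      rwa [hw.2.1] at h1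
    · obtain ⟨α', y', hS', he⟩ := h z
      obtain ⟨h1, h2⟩ := he.self_of_nhds
      rw [h1] at hi hk ⊢
      rw [h2]
      exact hS'.2.1 z i k hi hk
    · obtain ⟨α', y', hS', he⟩ := h z
      obtain ⟨h1, h2⟩ := he.self_of_nhds
      rw [h1] at hi
      rw [h2]
      exact hS'.2.2 z i hi
  have hB : ∀ α y, S α y → ∀ z, B (α z) (α z) z.2 (y z) = y z := by
    intro α y hS z
    funext i
    by_cases hi : (α z, z.2) ∈ U i
    · have h1 : W (α z) (α z) z.2 (y z) i = S1.coe (y z i) := by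
        simp only [W]
        rw [Finset.sum_congr rfl fun k hk => by rw [← hS.2.1 z i k hi (hKU _ k hk)],
          ← Finset.sum_smul, hK1, one_smul]
      simp only [B, if_pos hi, h1, S1.dir_coe]
    · simp only [B, if_neg hi, hS.2.2 z i hi]
  have hstep : ∀ α β y, S α y →
      SmoothAlong (cylModel E) (cylMap J M) 𝓘(ℝ, ℝ) (fun z => (α z : ℝ)) Set.univ →
      SmoothAlong (cylModel E) (cylMap J M) 𝓘(ℝ, ℝ) (fun z => (β z : ℝ)) Set.univ →
      (∀ z, Ω (α z) (β z) z.2) → S β (fun z => B (α z) (β z) z.2 (y z)) := by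
    intro α β y hS hα hβ hΩ
    have hne : ∀ z i, (β z, z.2) ∈ U i → W (α z) (β z) z.2 (y z) i ≠ 0 := fun z i hi =>
      hWne _ _ _ _ _ (hΩ z) hi (hS.2.1 z)
    refine ⟨fun i => ?_, fun z i k hi hk => ?_, fun z i hi => if_neg hi⟩
    · refine (smoothAlong_dir (w := fun z => W (α z) (β z) z.2 (y z) i) ?_
        fun z hz => hne z i hz).congr fun z hz => by simp only [B, if_pos (show _ ∈ U i from hz)]
      refine SmoothAlong.of_local hind fun z₁ hz₁ => ?_
      have cα := continuous_of_smoothAlong hα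
      have cβ := continuous_of_smoothAlong hβ
      obtain ⟨l, -, -, hΩ1⟩ := hΩ z₁
      have e1 : ∀ᶠ z in 𝓝 z₁, Kf (α z, z.2) ⊆ Kf (α z₁, z₁.2) :=
        cα.continuousAt.eventually (hKsub _)
      have e2 : ∀ᶠ z in 𝓝 z₁, ∀ k ∈ Kf (α z₁, z₁.2), (α z, z.2) ∈ U k ∧ (β z, z.2) ∈ U k :=
        (Filter.eventually_all_finset _).2 fun k hk =>
          (cα.continuousAt.eventually ((hU k).mem_nhds (hKU _ k hk))).and
            (cβ.continuousAt.eventually ((hU k).mem_nhds (hΩ1 k hk).1))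
      refine ⟨_, e1.and e2, ?_⟩
      -- The index set of the average varies with `z`. Near `z₁` it can be enlarged to the one at
      -- `z₁`, since the added terms have weight zero.
      refine (SmoothAlong.sum (s := Kf (α z₁, z₁.2))
        (f := fun k z => ρ k (α z, z.2) • (S1.coe (c i k (β z, z.2)) * S1.coe (y z k)))
        fun k hk => ?_).congr fun z hz => ?_
      · refine SmoothAlong.smul ?_ (SmoothAlong.comp₂ (G := fun p : ℂ × ℂ => p.1 * p.2) ?_ ?_
          (contDiff_fst.mul contDiff_snd))
        · exact SmoothAlong.precomp ((smoothAlong_cylMap_mk hα).mono (Set.subset_univ _)) (hρs k)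
            fun _ _ => Set.mem_univ _
        · exact SmoothAlong.precomp ((smoothAlong_cylMap_mk hβ).mono (Set.subset_univ _)) (hcs i k)
            fun z hz => ⟨hz.1, (hz.2.2 k hk).2⟩
        · exact (hS.1 k).mono fun z hz => (hz.2.2 k hk).1
      · exact Finset.sum_subset hz.2.1 fun k _ hk => by rw [hK0 _ k hk, zero_smul]
    · obtain ⟨l, -, -, hΩ1⟩ := hΩ z
      simp only [B, if_pos hi, if_pos hk]
      rw [hWmul _ _ _ _ i k (fun k hk => (hΩ1 k hk).1) hi hk, S1.dir_mul _ (hne z k hk)]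
  obtain ⟨y, hy, -⟩ := exists_transport (E := E) hJ t₀ hΩ B S hS hB hstep
    (fun x i => if (t₀, x) ∈ U i then y₀ i x else 1)
    ⟨fun i => (SmoothAlong.precomp (smoothAlong_snd _) (hy₀s i) fun z hz => hz).congr
        fun z hz => congrArg S1.coe (if_pos hz),
      fun z i k hi hk => by
        beta_reduce at hi hk ⊢
        rw [if_pos hi, if_pos hk]
        exact hy₀ i k z.2 hi hk,
      fun z i hi => if_neg hi⟩
  exact ⟨fun i z => y z i, fun i k z hi hk => hy.2.1 z i k hi hk, fun i => hy.1 i⟩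

end CircleExtension

/-! ### Uniqueness of extensions to the cylinder -/

namespace SpinCStructure

open PrincipalBundle

variable {E H : Type*} [NormedAddCommGroup E] [NormedSpace ℝ E] [TopologicalSpace H]
  {N : Type*} [TopologicalSpace N] [ChartedSpace H N] {B : Type u} [TopologicalSpace B]
  {I : ModelWithCorners ℝ E H} [IsManifold I ∞ N] {j : B → N} {ι : Type} [Fintype ι] [DecidableEq ι]
  {ε : ι → ℝ} {g : ∀ b, LinearMap.BilinForm ℝ (TangentSpace I (j b))}
  {o : ∀ b, Orientation ℝ (TangentSpace I (j b)) ι}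

/-- Two `Spin^c` structures have local sections with the same frames. -/
theorem exists_sections_frame_eq (hε : ∀ i, ε i * ε i = 1) (hj : Topology.IsInducing j)
    (σ τ : SpinCStructure ε g o) (b : B) : ∃ s s' U, σ.P.IsSmoothSection s U ∧
      τ.P.IsSmoothSection s' U ∧ b ∈ U ∧ ∀ c ∈ U, τ.frame (s' c) = σ.frame (s c) := by
  obtain ⟨s, U, hs, hbU⟩ := σ.P.exists_section_at b
  obtain ⟨v, hv, hvp⟩ := τ.exists_frame_eq hε (σ.frame_mem (s b))
  rw [σ.frame_base, hs.2.1 b hbU] at hvp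
  obtain ⟨s', U', hs', hbU', hsv⟩ := τ.P.exists_section v
  rw [hvp] at hbU' hsv
  have hUU : IsOpen (U ∩ U') := hs.1.inter hs'.1
  have hb : b ∈ U ∩ U' := ⟨hbU, hbU'⟩
  have hs2 := hs.mono hUU Set.inter_subset_left
  have hs2' := hs'.mono hUU Set.inter_subset_right
  have hex : ∀ c, ∃ T : (ι → ℝ) →ₗ[ℝ] (ι → ℝ), c ∈ U ∩ U' → IsIsom ε T ∧
      σ.frame (s c) = (τ.frame (s' c)).transform T := fun c => by
    by_cases hc : c ∈ U ∩ U'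
    · obtain ⟨T, hT, -, h⟩ := TangentTuple.exists_transform (τ.frame_mem (s' c)) (σ.frame_mem (s c))
        (by rw [τ.frame_base, σ.frame_base, hs2.2.1 c hc, hs2'.2.1 c hc])
      exact ⟨T, fun _ => ⟨hT, h⟩⟩
    · exact ⟨0, fun h => (hc h).elim⟩
  choose T hT using hex
  have hTs : SmoothAlg I j T (U ∩ U') :=
    (τ.smooth_frame' hs2').matrix hj
      (smoothAlong_self.congr fun c hc => by rw [τ.frame_base, hs2'.2.1 c hc])
      (fun c _ => τ.frame_mem _)
      ((σ.smooth_frame' hs2).congr fun c hc => (hT c hc).2.symm)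
  have hTs' : SmoothAlong I j 𝓘(ℝ, (ι → ℝ) →L[ℝ] (ι → ℝ))
      (fun c => (T c).toContinuousLinearMap) (U ∩ U') :=
    SmoothAlg.toSpace (V := (ι → ℝ) →L[ℝ] (ι → ℝ)) fun φ =>
      hTs (φ ∘ₗ LinearMap.toContinuousLinearMap.toLinearMap)
  have hTb : T b = LinearMap.id := by
    refine τ.adC_injective hε (u := s' b) ?_
    rw [← (hT b hb).2, TangentTuple.transform_id, hsv, hv]
  -- The frames agree at `b`, so near `b` the matrix `T` lies in the domain of the local section of
  -- `Ad`; acting by its lift makes the frames agree nearby.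
  obtain ⟨k, -, hk⟩ := exists_smooth_section hε
  obtain ⟨V', hV', hV'o, h1V'⟩ := mem_nhds_iff.1 hk
  have hcont := (hTs'.continuousOn hj.continuous).continuousAt (hUU.mem_nhds hb)
  have h1 : (T b).toContinuousLinearMap = 1 := by rw [hTb]; rfl
  have hpre : ∀ᶠ c in nhds b, (T c).toContinuousLinearMap ∈ V' :=
    hcont.eventually (hV'o.mem_nhds (by beta_reduce; rw [h1]; exact h1V'))
  obtain ⟨W, hW, hWo, hbW⟩ := mem_nhds_iff.1 (Filter.inter_mem (hUU.mem_nhds hb) hpre)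
  have hWU : W ⊆ U ∩ U' := fun c hc => (hW hc).1
  let a : B → (SpinC ε).El := fun c => SpinC.mk (k (T c).toContinuousLinearMap) 1
  have ha : SmoothAlg I j (fun c => LinearGroup.val (a c)) W := fun φ => by
    refine ((hTs'.mono hWU).comp_contDiffOn (G := fun S => ((show CCl ε →ₗ[ℝ] ℝ from φ) ∘ₗ
      TensorProduct.mk ℝ ℂ (Cl ε) 1) (k S : (Cl ε)ˣ)) fun c hc => ?_).congr fun c hc => ?_
    · filter_upwards [hV'o.mem_nhds (hW hc).2] with S hS
      exact (hV' hS).1 _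
    · change φ (SpinC.cval _) = _
      rw [SpinC.val_mk, S1.coe_one]
      rfl
  refine ⟨s, fun c => τ.P.act (s' c) (a c), W, hs2.mono hWo hWU, (hs2'.mono hWo hWU).act ha, hbW,
    fun c hc => ?_⟩
  rw [τ.frame_actC hε, adC_mk hε, (hT c (hWU hc)).2, (hV' (hW hc).2).2 (hT c (hWU hc)).1]
  rfl

end SpinCStructure

section CircVal

variable {E H : Type*} [NormedAddCommGroup E] [NormedSpace ℝ E] [TopologicalSpace H]
  {N : Type*} [TopologicalSpace N] [ChartedSpace H N] {B : Type*} {I : ModelWithCorners ℝ E H}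
  {j : B → N} {U : Set B} {ι : Type} [Fintype ι] [DecidableEq ι] {ε : ι → ℝ}

theorem smoothAlong_of_circ {z : B → S1.El}
    (h : SmoothAlg I j (fun b => LinearGroup.val (circ ε (z b))) U) :
    SmoothAlong I j 𝓘(ℝ, ℂ) (fun b => S1.coe (z b)) U := by
  refine smoothAlg_val_iff.1 fun φ => ?_
  obtain ⟨ψ, hψ⟩ := exists_scalar_functional ε
  let χ : ℂ →ₗ[ℝ] ℝ := φ
  refine (h (ψ ∘ₗ tensorEval ε χ)).congr fun b _ => ?_
  have h2 : (ψ ∘ₗ tensorEval ε χ) (S1.coe (z b) ⊗ₜ[ℝ] (1 : Cl ε)) = χ (S1.coe (z b)) := by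
    rw [LinearMap.comp_apply, tensorEval_tmul, map_smul, hψ, smul_eq_mul, mul_one]
  exact h2.symm.trans (congrArg (ψ ∘ₗ tensorEval ε χ) (val_circ (ε := ε) (z b)).symm)

end CircVal

section CylinderUnique

open PrincipalBundle

variable {E : Type*} [NormedAddCommGroup E] [NormedSpace ℝ E] [FiniteDimensional ℝ E]
  {M : Type u} [TopologicalSpace M] [T2Space M] [SecondCountableTopology M] [ChartedSpace E M]
  [IsManifold 𝓘(ℝ, E) ∞ M] {r s : ℕ} {J : Set ℝ} {g : MetricFamily E M r s J}
  {o : ManifoldOrientation E M (Fin r ⊕ Fin s)} {t : J}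

/-- A `Spin^c` structure on the cylinder is determined by its restriction. -/
theorem IsRestriction.unique_cyl (hJ : J.OrdConnected) {σ : SpinCOn g o t} {τ τ' : SpinCOnCyl g o}
    (h : IsRestriction t τ σ) (h' : IsRestriction t τ' σ) : τ.Isomorphic τ' := by
  have hε := ext_sign (sig_sign r s)
  have hind : Topology.IsInducing (cylMap J M) := isInducing_cylMap
  obtain ⟨F, f, h1, h2, h3, h4, h5, h6, h7, h8⟩ := h
  obtain ⟨F', f', h1', h2', h3', h4', h5', h6', h7', h8'⟩ := h'
  choose p p' U hp hp' hzU hfr using SpinCStructure.exists_sections_frame_eq hε hind τ τ'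
  -- With equal frames, both transition functions have the same image under `adC`, so they differ by
  -- a factor in the circle. As the circle is central, these factors form a cocycle `c`.
  have hcirc : ∀ i k z, ∃ w, z ∈ U i → z ∈ U k → τ'.P.diff (p' i z) (p' k z) =
      circ _ w * τ.P.diff (p i z) (p k z) := fun i k z => by
    by_cases hz : z ∈ U i ∧ z ∈ U k
    · have hq : τ.P.proj (p i z) = τ.P.proj (p k z) := by
        rw [(hp i).2.1 z hz.1, (hp k).2.1 z hz.2]
      have hq' : τ'.P.proj (p' i z) = τ'.P.proj (p' k z) := by
        rw [(hp' i).2.1 z hz.1, (hp' k).2.1 z hz.2]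
      have h9 : adC (τ.P.diff (p i z) (p k z)) = adC (τ'.P.diff (p' i z) (p' k z)) := by
        refine τ.adC_injective hε (u := p i z) ?_
        rw [τ.adC_diff hε hq, ← hfr i z hz.1, τ'.adC_diff hε hq', hfr k z hz.2]
      obtain ⟨w, hw⟩ := exists_circ_of_adC_eq hε h9
      exact ⟨w, fun _ _ => hw⟩
    · exact ⟨1, fun h h' => (hz ⟨h, h'⟩).elim⟩
  choose c hc using hcirc
  have hcs : ∀ i k, SmoothAlong (cylModel E) (cylMap J M) 𝓘(ℝ, ℂ) (fun z => S1.coe (c i k z))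
      (U i ∩ U k) := fun i k => by
    have hUU : IsOpen (U i ∩ U k) := (hp i).1.inter (hp k).1
    have hd := ((hp i).mono hUU Set.inter_subset_left).diff hind
      ((hp k).mono hUU Set.inter_subset_right)
    have hd' := ((hp' i).mono hUU Set.inter_subset_left).diff hind
      ((hp' k).mono hUU Set.inter_subset_right)
    refine smoothAlong_of_circ (ε := ext (sig r s)) ?_
    refine SmoothAlg.congr (A := CCl (ext (sig r s)))
      (SmoothAlg.mul (A := CCl (ext (sig r s))) hd' (smoothAlg_val_inv' hd)) fun z hz => ?_
    exact congrArg LinearGroup.val (eq_mul_inv_of_mul_eq (hc i k z hz.1 hz.2).symm)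
  have hcc : ∀ i k l z, z ∈ U i → z ∈ U k → z ∈ U l → c i k z * c k l z = c i l z := by
    intro i k l z hi hk hl
    have e1 : ∀ i k, z ∈ U i → z ∈ U k → τ.P.proj (p i z) = τ.P.proj (p k z) := fun i k hi hk => by
      rw [(hp i).2.1 z hi, (hp k).2.1 z hk]
    have e2 : ∀ i k, z ∈ U i → z ∈ U k → τ'.P.proj (p' i z) = τ'.P.proj (p' k z) :=
      fun i k hi hk => by rw [(hp' i).2.1 z hi, (hp' k).2.1 z hk]
    have e3 := diff_mul_diff (e2 i k hi hk) (e2 k l hk hl)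
    have e4 := diff_mul_diff (e1 i k hi hk) (e1 k l hk hl)
    rw [hc i k z hi hk, hc k l z hk hl, hc i l z hi hl, ← e4] at e3
    refine circ_injective (ε := ext (sig r s)) ?_
    rw [circ_mul]
    refine mul_right_cancel (b := τ.P.diff (p i z) (p k z) * τ.P.diff (p k z) (p l z)) ?_
    rw [← e3]
    exact (show Commute _ _ from circ_comm _ _).mul_mul_mul_comm _ _
  -- Over the slice, `F u` and `F' u` have equal frames, so their coordinates differ by a circle
  -- factor. It is the same for the whole fibre because `F` and `F'` are equivariant in the same
  -- way. This trivialises `c` over the slice.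
  have hinit : ∀ i x, ∃ w, (t, x) ∈ U i → ∀ u, σ.P.proj u = x →
      τ'.P.diff (p' i (t, x)) (F' u) = circ _ w * τ.P.diff (p i (t, x)) (F u) := fun i x => by
    by_cases hx : (t, x) ∈ U i
    · obtain ⟨v, hv⟩ := σ.P.exists_proj_eq x
      have hq : ∀ u, σ.P.proj u = x → τ.P.proj (p i (t, x)) = τ.P.proj (F u) := fun u hu => by
        rw [(hp i).2.1 _ hx, h1, hu]
      have hq' : ∀ u, σ.P.proj u = x → τ'.P.proj (p' i (t, x)) = τ'.P.proj (F' u) := fun u hu => by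
        rw [(hp' i).2.1 _ hx, h1', hu]
      have h9 : adC (τ.P.diff (p i (t, x)) (F v)) = adC (τ'.P.diff (p' i (t, x)) (F' v)) := by
        refine τ.adC_injective hε (u := p i (t, x)) ?_
        rw [τ.adC_diff hε (hq v hv), ← hfr i _ hx, τ'.adC_diff hε (hq' v hv), h7, h7']
      obtain ⟨w, hw⟩ := exists_circ_of_adC_eq hε h9
      refine ⟨w, fun _ u hu => ?_⟩
      have hvu : σ.P.proj v = σ.P.proj u := hv.trans hu.symm
      rw [← act_diff hvu, h3, h3', diff_act_right (hq v hv), diff_act_right (hq' v hv), hw,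
        mul_assoc]
    · exact ⟨1, fun h => (hx h).elim⟩
  choose y₀ hy₀ using hinit
  have hy₀c : ∀ i k x, (t, x) ∈ U i → (t, x) ∈ U k → y₀ i x = c i k (t, x) * y₀ k x := by
    intro i k x hi hk
    obtain ⟨v, hv⟩ := σ.P.exists_proj_eq x
    have e1 : τ.P.proj (p i (t, x)) = τ.P.proj (p k (t, x)) := by
      rw [(hp i).2.1 _ hi, (hp k).2.1 _ hk]
    have e2 : τ'.P.proj (p' i (t, x)) = τ'.P.proj (p' k (t, x)) := by
      rw [(hp' i).2.1 _ hi, (hp' k).2.1 _ hk]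
    have e3 : τ.P.proj (p k (t, x)) = τ.P.proj (F v) := by rw [(hp k).2.1 _ hk, h1, hv]
    have e4 : τ'.P.proj (p' k (t, x)) = τ'.P.proj (F' v) := by rw [(hp' k).2.1 _ hk, h1', hv]
    have e5 := hy₀ i x hi v hv
    rw [← diff_mul_diff e1 e3, ← diff_mul_diff e2 e4, hc i k _ hi hk, hy₀ k x hk v hv] at e5
    refine circ_injective (ε := ext (sig r s)) ?_
    rw [circ_mul]
    refine mul_right_cancel
      (b := τ.P.diff (p i (t, x)) (p k (t, x)) * τ.P.diff (p k (t, x)) (F v)) ?_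
    rw [← e5]
    exact (Commute.mul_mul_mul_comm (circ_comm (y₀ k x) (τ.P.diff (p i (t, x)) (p k (t, x)))) _ _).symm
  have hy₀s : ∀ i, SmoothAlong 𝓘(ℝ, E) (id : M → M) 𝓘(ℝ, ℂ) (fun x => S1.coe (y₀ i x))
      {x | (t, x) ∈ U i} := fun i => by
    have hcont : Continuous fun x : M => (t, x) := by fun_prop
    refine SmoothAlong.of_local Topology.IsInducing.id fun x hx => ?_
    obtain ⟨q, V, hq, hxV⟩ := σ.P.exists_section_at x
    refine ⟨V, hq.1.mem_nhds hxV, ?_⟩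
    have hWo : IsOpen ({x | (t, x) ∈ U i} ∩ V) := ((hp i).1.preimage hcont).inter hq.1
    have hq2 := hq.mono hWo Set.inter_subset_right
    have hsl := smoothAlong_slice (E := E) t ({x | (t, x) ∈ U i} ∩ V)
    have g1 := SmoothInto.precomp (hp i).2.2 hsl fun x hx => hx.1
    have g1' := SmoothInto.precomp (hp' i).2.2 hsl fun x hx => hx.1
    have hb : ∀ x ∈ {x | (t, x) ∈ U i} ∩ V, τ.P.proj (p i (t, x)) = (t, x) := fun x hx =>
      (hp i).2.1 _ hx.1
    have hb' : ∀ x ∈ {x | (t, x) ∈ U i} ∩ V, τ'.P.proj (p' i (t, x)) = (t, x) := fun x hx =>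
      (hp' i).2.1 _ hx.1
    have d1 := SmoothInto.diff Topology.IsInducing.id g1 (h5 _ _ hq2)
      (fun x hx => by rw [hb x hx, h1, hq2.2.1 x hx]) (hcont.continuousOn.congr hb)
    have d2 := SmoothInto.diff Topology.IsInducing.id g1' (h5' _ _ hq2)
      (fun x hx => by rw [hb' x hx, h1', hq2.2.1 x hx]) (hcont.continuousOn.congr hb')
    refine smoothAlong_of_circ (ε := ext (sig r s)) ?_
    refine SmoothAlg.congr (A := CCl (ext (sig r s)))
      (SmoothAlg.mul (A := CCl (ext (sig r s))) d2 (smoothAlg_val_inv' d1)) fun x hx => ?_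
    exact congrArg LinearGroup.val (eq_mul_inv_of_mul_eq (hy₀ i x hx.1 _ (hq2.2.1 x hx)).symm)
  obtain ⟨y, hy, hys⟩ := exists_circle_extension hJ t (fun i => (hp i).1) (fun z => ⟨z, hzU z⟩)
    hcc hcs hy₀c hy₀s
  -- The factors `y i` compensate the difference of the cocycles and, being in the kernel of `adC`,
  -- do not change frames.
  obtain ⟨Φ, hΦ, hact⟩ := exists_equivariant (P := τ.P) (U := U) (fun z => ⟨z, hzU z⟩)
    (fun i z hz => (hp i).2.1 z hz) τ'.P.act τ'.P.act_mul
    (fun i z => τ'.P.act (p' i z) (circ _ (y i z))) (fun i k z hi hk => by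
      have e2 : τ'.P.proj (p' i z) = τ'.P.proj (p' k z) := by
        rw [(hp' i).2.1 _ hi, (hp' k).2.1 _ hk]
      rw [← act_diff e2, ← τ'.P.act_mul, ← τ'.P.act_mul, hc i k z hi hk, hy i k z hi hk, circ_mul]
      congr 1
      rw [mul_assoc, ← circ_comm, ← mul_assoc])
  have hproj : ∀ u, τ'.P.proj (Φ u) = τ.P.proj u := fun u => by
    have e1 : τ.P.proj (p (τ.P.proj u) (τ.P.proj u)) = τ.P.proj u := (hp _).2.1 _ (hzU _)
    conv_lhs => rw [← act_diff e1]
    rw [hact, hΦ _ _ (hzU _), τ'.P.proj_act, τ'.P.proj_act, (hp' _).2.1 _ (hzU _)]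
  refine SpinCStructure.isomorphic_of_map hind Φ hproj hact (fun u => ?_) fun z => ?_
  · have e1 : τ.P.proj (p (τ.P.proj u) (τ.P.proj u)) = τ.P.proj u := (hp _).2.1 _ (hzU _)
    rw [← act_diff e1, hact, τ'.frame_actC hε, τ.frame_actC hε, hΦ _ _ (hzU _),
      τ'.frame_act_circ hε, hfr _ _ (hzU _)]
  · refine ⟨p z, U z, hp z, hzU z, ?_⟩
    have ha := (hp' z).act (a := fun w => circ _ (y z w))
      (smoothAlg_circ (smoothAlg_val_iff.2 (hys z)))
    exact ⟨ha.1, fun w hw => (hproj _).trans ((hp z).2.1 w hw), ha.2.2.congr fun w hw => hΦ z w hw⟩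

end CylinderUnique

/-! ### The inverse square root `(1 + Y) ^ (-1/2)` in a Banach algebra -/

section InvSqrt

open Filter Topology

variable {𝔸 : Type*} [NormedRing 𝔸] [NormedAlgebra ℝ 𝔸]

theorem hasSum_of_eq {V : Type*} [AddCommMonoid V] [TopologicalSpace V] {f k : ℕ → V} {a : V}
    (hfk : ∀ n, f n = k n) (h : HasSum k a) : HasSum f a := by
  rwa [funext hfk]

/-- The coefficients of the binomial series of exponent `-1/2`. -/
def invSqrtCoeff (n : ℕ) : ℝ := Ring.choose (-(1 / 2) : ℝ) n

/-- The binomial series `∑ₙ choose (-1/2) n • Yⁿ`. -/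
def invSqrt (Y : 𝔸) : 𝔸 := FormalMultilinearSeries.ofScalarsSum invSqrtCoeff Y

theorem summable_invSqrtCoeff {x : ℝ} (hx0 : 0 ≤ x) (hx : x < 1) :
    Summable fun n => ‖invSqrtCoeff n‖ * x ^ n := by
  lift x to NNReal using hx0
  have h1 : (x : ENNReal) < (binomialSeries ℝ (-(1 / 2) : ℝ)).radius :=
    lt_of_lt_of_le (by exact_mod_cast hx) binomialSeries_radius_ge_one
  refine ((binomialSeries ℝ (-(1 / 2) : ℝ)).summable_norm_mul_pow h1).congr fun n => ?_
  rw [binomialSeries, FormalMultilinearSeries.ofScalars_norm]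
  rfl

/-- The norm of `1` is not assumed to be `1`; the extra factor takes care of `n = 0`. -/
theorem norm_pow_le_mul (Y : 𝔸) (n : ℕ) : ‖Y ^ n‖ ≤ (1 + ‖(1 : 𝔸)‖) * ‖Y‖ ^ n := by
  have h1 := norm_nonneg (1 : 𝔸)
  rcases Nat.eq_zero_or_pos n with rfl | hn
  · simp
  · have h2 := norm_pow_le' Y hn
    have h3 := pow_nonneg (norm_nonneg Y) n
    nlinarith

theorem summable_norm_invSqrt {Y : 𝔸} (hY : ‖Y‖ < 1) :
    Summable fun n => ‖invSqrtCoeff n • Y ^ n‖ := by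
  refine Summable.of_nonneg_of_le (fun _ => norm_nonneg _) (fun n => ?_)
    ((summable_invSqrtCoeff (norm_nonneg Y) hY).mul_left (1 + ‖(1 : 𝔸)‖))
  rw [norm_smul]
  calc ‖invSqrtCoeff n‖ * ‖Y ^ n‖ ≤ ‖invSqrtCoeff n‖ * ((1 + ‖(1 : 𝔸)‖) * ‖Y‖ ^ n) := by
        gcongr; exact norm_pow_le_mul Y n
    _ = _ := by ring

/-- Elements that are conjugate to an element of the open unit ball. -/
def SimSmall (Y : 𝔸) : Prop := ∃ T : 𝔸ˣ, ‖(T : 𝔸) * Y * (T⁻¹ : 𝔸ˣ)‖ < 1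

theorem SimSmall.of_norm {Y : 𝔸} (h : ‖Y‖ < 1) : SimSmall Y := ⟨1, by simpa using h⟩

theorem SimSmall.conj {Y : 𝔸} (h : SimSmall Y) (S : 𝔸ˣ) :
    SimSmall ((S⁻¹ : 𝔸ˣ) * Y * (S : 𝔸)) := by
  obtain ⟨T, hT⟩ := h
  refine ⟨T * S, ?_⟩
  have : ((T * S : 𝔸ˣ) : 𝔸) * ((S⁻¹ : 𝔸ˣ) * Y * (S : 𝔸)) * ((T * S)⁻¹ : 𝔸ˣ) =
      T * Y * (T⁻¹ : 𝔸ˣ) := by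
    rw [mul_inv_rev]
    push_cast
    simp only [mul_assoc, Units.mul_inv_cancel_left]
  rwa [this]

theorem SimSmall.smul {Y : 𝔸} (h : SimSmall Y) {c : ℝ} (hc : c ∈ Set.Icc (0 : ℝ) 1) :
    SimSmall (c • Y) := by
  obtain ⟨T, hT⟩ := h
  refine ⟨T, ?_⟩
  rw [mul_smul_comm, smul_mul_assoc, norm_smul, Real.norm_of_nonneg hc.1]
  exact (mul_le_of_le_one_left (norm_nonneg _) hc.2).trans_lt hT

theorem SimSmall.eventually {Y : 𝔸} (h : SimSmall Y) : ∀ᶠ Z in 𝓝 Y, SimSmall Z := by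
  obtain ⟨T, hT⟩ := h
  have : Continuous fun Z : 𝔸 => ‖(T : 𝔸) * Z * (T⁻¹ : 𝔸ˣ)‖ := by fun_prop
  filter_upwards [this.continuousAt.eventually (gt_mem_nhds hT)] with Z hZ
  exact ⟨T, hZ⟩

theorem conj_pow_eq (T : 𝔸ˣ) (Y : 𝔸) (n : ℕ) :
    ((T⁻¹ : 𝔸ˣ) * Y * (T : 𝔸)) ^ n = (T⁻¹ : 𝔸ˣ) * Y ^ n * (T : 𝔸) := by
  have := Units.conj_pow' T Y n
  exact this

variable [CompleteSpace 𝔸]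

/-- The series converges absolutely at a conjugate of `Y` in the unit ball, and conjugation passes
through powers and sums. -/
theorem SimSmall.hasSum {Y : 𝔸} (h : SimSmall Y) :
    HasSum (fun n => invSqrtCoeff n • Y ^ n) (invSqrt Y) := by
  rw [invSqrt, FormalMultilinearSeries.ofScalars_sum_eq]
  obtain ⟨T, hT⟩ := h
  refine Summable.hasSum ?_
  have h1 := ((summable_norm_invSqrt hT).of_norm.mul_left ((T⁻¹ : 𝔸ˣ) : 𝔸)).mul_right (T : 𝔸)
  refine h1.congr fun n => ?_
  rw [mul_smul_comm, smul_mul_assoc, ← conj_pow_eq]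
  simp only [mul_assoc, Units.inv_mul_cancel_left, Units.inv_mul, mul_one]

theorem invSqrt_conj {Y : 𝔸} (h : SimSmall Y) (T : 𝔸ˣ) :
    invSqrt ((T⁻¹ : 𝔸ˣ) * Y * (T : 𝔸)) = (T⁻¹ : 𝔸ˣ) * invSqrt Y * (T : 𝔸) := by
  refine (h.conj T).hasSum.unique ?_
  refine hasSum_of_eq (fun n => ?_) ((h.hasSum.mul_left ((T⁻¹ : 𝔸ˣ) : 𝔸)).mul_right (T : 𝔸))
  rw [mul_smul_comm, smul_mul_assoc, ← conj_pow_eq]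

theorem invSqrt_zero : invSqrt (0 : 𝔸) = 1 := by
  rw [invSqrt, FormalMultilinearSeries.ofScalarsSum_zero, invSqrtCoeff, Ring.choose_zero_right,
    one_smul]

/-- Vandermonde's identity gives `choose (-1) n`: the square of the series is the geometric series
of `(1 + Y)⁻¹`. -/
theorem sum_invSqrtCoeff (n : ℕ) :
    ∑ p ∈ Finset.HasAntidiagonal.antidiagonal n, invSqrtCoeff p.1 * invSqrtCoeff p.2 = (-1) ^ n := by
  have h := Ring.add_choose_eq (r := (-(1 / 2) : ℝ)) (s := (-(1 / 2) : ℝ)) n (Commute.refl _)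
  have h1 : (-(1 / 2) : ℝ) + -(1 / 2) = -1 := by norm_num
  rw [h1, Ring.choose_neg, add_sub_cancel_left, Ring.choose_natCast, Nat.choose_self] at h
  have h2 : Int.negOnePow n • ((1 : ℕ) : ℝ) = (-1) ^ n := by
    rw [Units.smul_def, Int.coe_negOnePow_natCast, Nat.cast_one, zsmul_one]
    push_cast
    rfl
  exact h.symm.trans h2

theorem invSqrt_mul_self_of_norm {Y : 𝔸} (h : ‖Y‖ < 1) : invSqrt Y * invSqrt Y * (1 + Y) = 1 := by
  have h1 := summable_norm_invSqrt h
  have h2 : invSqrt Y = ∑' n, invSqrtCoeff n • Y ^ n :=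
    FormalMultilinearSeries.ofScalars_sum_eq _ _
  rw [h2, tsum_mul_tsum_eq_tsum_sum_antidiagonal_of_summable_norm h1 h1]
  have h3 : ∀ n, ∑ p ∈ Finset.HasAntidiagonal.antidiagonal n, invSqrtCoeff p.1 • Y ^ p.1 * invSqrtCoeff p.2 •
      Y ^ p.2 = (-Y) ^ n := fun n => by
    rw [neg_pow, ← map_one (algebraMap ℝ 𝔸), ← map_neg, ← map_pow, ← sum_invSqrtCoeff,
      ← Algebra.smul_def, Finset.sum_smul]
    refine Finset.sum_congr rfl fun p hp => ?_
    rw [smul_mul_smul_comm, ← pow_add, Finset.HasAntidiagonal.mem_antidiagonal.1 hp]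
  simp only [h3]
  have h4 := geom_series_mul_neg (-Y) (by rwa [norm_neg])
  rwa [sub_neg_eq_add] at h4

theorem SimSmall.invSqrt_mul_self {Y : 𝔸} (h : SimSmall Y) :
    invSqrt Y * invSqrt Y * (1 + Y) = 1 := by
  obtain ⟨T, hT⟩ := h
  have h1 := invSqrt_mul_self_of_norm hT
  have h2 := invSqrt_conj (SimSmall.of_norm hT) T
  have h3 : ((T⁻¹ : 𝔸ˣ) : 𝔸) * (T * Y * (T⁻¹ : 𝔸ˣ)) * (T : 𝔸) = Y := by
    simp only [mul_assoc, Units.inv_mul_cancel_left, Units.inv_mul, mul_one]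
  rw [h3] at h2
  have h4 : (1 : 𝔸) + Y = (T⁻¹ : 𝔸ˣ) * (1 + T * Y * (T⁻¹ : 𝔸ˣ)) * T := by
    rw [mul_add, add_mul, h3, mul_one, Units.inv_mul]
  rw [h2, h4]
  generalize invSqrt ((T : 𝔸) * Y * (T⁻¹ : 𝔸ˣ)) = A at h1
  generalize 1 + (T : 𝔸) * Y * (T⁻¹ : 𝔸ˣ) = Z at h1
  simp only [mul_assoc, Units.mul_inv_cancel_left]
  rw [← mul_assoc A Z, ← mul_assoc A (A * Z), ← mul_assoc A A, h1, one_mul, Units.inv_mul]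

theorem SimSmall.commute {Y : 𝔸} (h : SimSmall Y) : invSqrt Y * Y = Y * invSqrt Y := by
  refine (h.hasSum.mul_right Y).unique ?_
  refine hasSum_of_eq (fun n => ?_) (h.hasSum.mul_left Y)
  rw [mul_smul_comm, smul_mul_assoc, pow_mul_comm']

theorem SimSmall.isUnit {Y : 𝔸} (h : SimSmall Y) : IsUnit (invSqrt Y) := by
  have h1 := h.invSqrt_mul_self
  have hc : (1 + Y) * invSqrt Y = invSqrt Y * (1 + Y) := by
    rw [add_mul, mul_add, h.commute, one_mul, mul_one]
  refine ⟨⟨invSqrt Y, invSqrt Y * (1 + Y), by rw [← mul_assoc, h1], ?_⟩, rfl⟩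
  rw [mul_assoc, hc, ← mul_assoc, h1]

/-- The transformation `(1 + Y) ^ (-1/2)` turns the form `1 + Y` into the form `1`. -/
theorem SimSmall.invSqrt_conj_one_add {Y : 𝔸} (h : SimSmall Y) :
    invSqrt Y * (1 + Y) * invSqrt Y = 1 := by
  have hc : (1 + Y) * invSqrt Y = invSqrt Y * (1 + Y) := by
    rw [add_mul, mul_add, h.commute, one_mul, mul_one]
  rw [mul_assoc, hc, ← mul_assoc, h.invSqrt_mul_self]

/-- An anti-automorphism reverses products but fixes the powers of a fixed element, hence the
series. -/
theorem SimSmall.map_invSqrt {Y : 𝔸} (h : SimSmall Y) {adj : 𝔸 →L[ℝ] 𝔸}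
    (hadj : ∀ a b, adj (a * b) = adj b * adj a) (hone : adj 1 = 1) (hY : adj Y = Y) :
    adj (invSqrt Y) = invSqrt Y := by
  have hp : ∀ n : ℕ, adj (Y ^ n) = Y ^ n := fun n => by
    induction n with
    | zero => rw [pow_zero, hone]
    | succ n ih => rw [pow_succ, hadj, ih, hY, ← pow_succ']; exact (pow_succ Y n)
  refine (h.hasSum.mapL adj).unique ?_
  refine hasSum_of_eq (fun n => ?_) h.hasSum
  rw [map_smul, hp]

theorem contDiffAt_invSqrt_of_norm {Y : 𝔸} (h : ‖Y‖ < 1) : ContDiffAt ℝ ∞ (invSqrt : 𝔸 → 𝔸) Y := by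
  let p := FormalMultilinearSeries.ofScalars 𝔸 invSqrtCoeff
  have hr : 1 ≤ p.radius := by
    refine ENNReal.le_of_forall_nnreal_lt fun x hx => ?_
    have hx1 : (x : ℝ) < 1 := by exact_mod_cast hx
    have h1 := (summable_invSqrtCoeff x.2 hx1)
    refine p.le_radius_of_summable_norm ?_
    -- The term `n = 0` is dropped, as the bound on the norms of the coefficients holds only for `n
    -- > 0`.
    rw [← summable_nat_add_iff 1]
    refine Summable.of_nonneg_of_le (fun _ => by positivity) (fun n => ?_)
      ((summable_nat_add_iff 1).2 h1)
    exact mul_le_mul_of_nonneg_right (FormalMultilinearSeries.ofScalars_norm_le 𝔸 _ _ n.succ_pos)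
      (by positivity)
  have hp : HasFPowerSeriesOnBall (invSqrt : 𝔸 → 𝔸) p 0 p.radius :=
    p.hasFPowerSeriesOnBall (one_pos.trans_le hr)
  refine (hp.analyticAt_of_mem ?_).contDiffAt
  rw [Metric.mem_eball, edist_zero_right]
  refine lt_of_lt_of_le ?_ hr
  rw [← ofReal_norm, ← ENNReal.ofReal_one]
  exact (ENNReal.ofReal_lt_ofReal_iff one_pos).2 h

theorem SimSmall.contDiffAt {Y : 𝔸} (h : SimSmall Y) : ContDiffAt ℝ ∞ (invSqrt : 𝔸 → 𝔸) Y := by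
  have hY := h
  obtain ⟨T, hT⟩ := h
  have h1 : ContDiff ℝ ∞ fun Z : 𝔸 => (T : 𝔸) * Z * (T⁻¹ : 𝔸ˣ) :=
    (contDiff_const.mul contDiff_id).mul contDiff_const
  have h2 : ContDiffAt ℝ ∞ (fun Z : 𝔸 => ((T⁻¹ : 𝔸ˣ) : 𝔸) *
      invSqrt ((T : 𝔸) * Z * (T⁻¹ : 𝔸ˣ)) * (T : 𝔸)) Y :=
    (contDiffAt_const.mul ((contDiffAt_invSqrt_of_norm hT).comp Y h1.contDiffAt)).mul
      contDiffAt_const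
  refine h2.congr_of_eventuallyEq ?_
  filter_upwards [hY.eventually] with Z hZ
  have h3 := invSqrt_conj hZ T⁻¹
  rw [inv_inv] at h3
  rw [h3]
  simp only [mul_assoc, Units.inv_mul_cancel_left, Units.inv_mul, mul_one]

/-- Along `c • Y`, `0 ≤ c ≤ 1`, the continuous function `χ (invSqrt (c • Y))` starts at `1` and does
not vanish. With `χ` the determinant, transported frames keep their orientation. -/
theorem SimSmall.pos {Y : 𝔸} (h : SimSmall Y) {χ : 𝔸 →* ℝ} (hχ : Continuous χ) :
    0 < χ (invSqrt Y) := by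
  have h1 : ContinuousOn (fun c : ℝ => χ (invSqrt (c • Y))) (Set.Icc 0 1) := fun c hc => by
    have h2 : ContinuousAt (fun c : ℝ => invSqrt (c • Y)) c :=
      ContinuousAt.comp (f := fun c : ℝ => c • Y) (h.smul hc).contDiffAt.continuousAt (by fun_prop)
    exact (hχ.continuousAt.comp h2).continuousWithinAt
  by_contra hneg
  have h0 : χ (invSqrt ((0 : ℝ) • Y)) = 1 := by rw [zero_smul, invSqrt_zero, map_one]
  have h3 := intermediate_value_Icc' (zero_le_one' ℝ) h1
  obtain ⟨c, hc, hc0⟩ := h3 (show (0 : ℝ) ∈ _ from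
    ⟨by simpa using not_lt.1 hneg, by beta_reduce; rw [h0]; exact zero_le_one⟩)
  exact ((h.smul hc).isUnit.map χ).ne_zero hc0

end InvSqrt

/-! ### Smooth families of isometries on the cylinder -/

section IsometryFamily

open Filter Topology

variable {E : Type*} [NormedAddCommGroup E] [NormedSpace ℝ E] [FiniteDimensional ℝ E]
  {M : Type u} [TopologicalSpace M] [T2Space M] [SecondCountableTopology M] [ChartedSpace E M]
  [IsManifold 𝓘(ℝ, E) ∞ M] {J : Set ℝ}
  {𝔸 : Type*} [NormedRing 𝔸] [NormedAlgebra ℝ 𝔸] [FiniteDimensional ℝ 𝔸]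

/-- For `C` orthogonal with respect to `adj`, pulling back a form commutes with conjugation by `C`;
so the transport step is independent of the chart. -/
theorem conj_form {adj : 𝔸 →L[ℝ] 𝔸} (hadj : ∀ a b, adj (a * b) = adj b * adj a)
    (hinv : ∀ a, adj (adj a) = a) {C : 𝔸ˣ} (hC : adj C = (C⁻¹ : 𝔸ˣ)) (y Q : 𝔸) :
    adj ((C⁻¹ : 𝔸ˣ) * y * C) * ((C⁻¹ : 𝔸ˣ) * Q * C) * ((C⁻¹ : 𝔸ˣ) * y * C) =
      (C⁻¹ : 𝔸ˣ) * (adj y * Q * y) * C := by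
  have h1 : adj (C⁻¹ : 𝔸ˣ) = C := by rw [← hC, hinv]
  rw [hadj, hadj, hC, h1]
  simp only [mul_assoc, Units.mul_inv_cancel_left]

/-- Let `Q i (t, x)` be local matrices of a family of forms that are the identity for `t = t₀`.
Then there are isometries `y i (t, x)` from the form at `t₀` to the form at `t`. -/
theorem exists_isometry_family (hJ : J.OrdConnected) (t₀ : J) {adj : 𝔸 →L[ℝ] 𝔸}
    (hadj : ∀ a b, adj (a * b) = adj b * adj a) (hone : adj 1 = 1) (hinv : ∀ a, adj (adj a) = a)
    {χ : 𝔸 →* ℝ} (hχ : Continuous χ) {K : Type*} {U : K → Set M} (hU : ∀ i, IsOpen (U i))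
    (hcov : ∀ x, ∃ i, x ∈ U i) {C : K → K → M → 𝔸ˣ}
    (hC : ∀ i k x, x ∈ U i → x ∈ U k → adj (C i k x) = ((C i k x)⁻¹ : 𝔸ˣ)) {Q : K → J × M → 𝔸}
    (hQs : ∀ i, SmoothAlong (cylModel E) (cylMap J M) 𝓘(ℝ, 𝔸) (Q i) {z | z.2 ∈ U i})
    (hQadj : ∀ i z, z.2 ∈ U i → adj (Q i z) = Q i z) (hQu : ∀ i z, z.2 ∈ U i → IsUnit (Q i z))
    (hQC : ∀ i k z, z.2 ∈ U i → z.2 ∈ U k →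
      Q k z = ((C i k z.2)⁻¹ : 𝔸ˣ) * Q i z * (C i k z.2 : 𝔸))
    (hQ₀ : ∀ i x, x ∈ U i → Q i (t₀, x) = 1) :
    ∃ y : K → J × M → 𝔸,
      (∀ i, SmoothAlong (cylModel E) (cylMap J M) 𝓘(ℝ, 𝔸) (y i) {z | z.2 ∈ U i}) ∧
      (∀ i k z, z.2 ∈ U i → z.2 ∈ U k →
        y k z = ((C i k z.2)⁻¹ : 𝔸ˣ) * y i z * (C i k z.2 : 𝔸)) ∧
      (∀ i z, z.2 ∈ U i → adj (y i z) * Q i z * y i z = 1 ∧ 0 < χ (y i z)) ∧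
      ∀ i x, y i (t₀, x) = 1 := by
  classical
  have : CompleteSpace 𝔸 := FiniteDimensional.complete ℝ 𝔸
  have hind : Topology.IsInducing (cylMap J M) := isInducing_cylMap
  -- `1 + R` is the form at `t'` pulled back by `y i`. The step multiplies `y i` by `(1 + R) ^
  -- (-1/2)`, after which the pulled-back form is `1`.
  let R : J → M → (K → 𝔸) → K → 𝔸 := fun t' x y i => adj (y i) * Q i (t', x) * y i - 1
  let B : J → J → M → (K → 𝔸) → K → 𝔸 := fun _ t' x y i =>
    if x ∈ U i then y i * invSqrt (R t' x y i) else 1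
  -- Smallness is required in one chart only. Changes of chart conjugate `R` and need not preserve
  -- norms, which is why the series is used for all conjugates of small elements.
  let Ω : J → J → M → Prop := fun t t' x => ∃ i, x ∈ U i ∧
    ‖Ring.inverse (Q i (t, x)) * Q i (t', x) - 1‖ < 1
  let S : (J × M → J) → (J × M → K → 𝔸) → Prop := fun α y =>
    (∀ i, SmoothAlong (cylModel E) (cylMap J M) 𝓘(ℝ, 𝔸) (fun z => y z i) {z | z.2 ∈ U i}) ∧
    (∀ z i k, z.2 ∈ U i → z.2 ∈ U k →
      y z k = ((C i k z.2)⁻¹ : 𝔸ˣ) * y z i * (C i k z.2 : 𝔸)) ∧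
    (∀ z i, z.2 ∈ U i → adj (y z i) * Q i (α z, z.2) * y z i = 1 ∧ IsUnit (y z i) ∧
      0 < χ (y z i)) ∧
    ∀ z i, z.2 ∉ U i → y z i = 1
  have hΩ : ∀ t x, ∀ᶠ q : J × J × M in 𝓝 (t, t, x), Ω q.1 q.2.1 q.2.2 := by
    intro t x
    obtain ⟨i, hi⟩ := hcov x
    have c1 : Continuous fun q : J × J × M => (q.1, q.2.2) := by fun_prop
    have c2 : Continuous fun q : J × J × M => (q.2.1, q.2.2) := by fun_prop
    have hQc : ContinuousAt (Q i) (t, x) := ((hQs i).continuousOn hind.continuous).continuousAt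
      (((hU i).preimage continuous_snd).mem_nhds hi)
    obtain ⟨v, hv⟩ := hQu i (t, x) hi
    have h1 : ContinuousAt (fun q : J × J × M => Q i (q.1, q.2.2)) (t, t, x) :=
      ContinuousAt.comp (f := fun q : J × J × M => (q.1, q.2.2)) (x := (t, t, x)) hQc
        c1.continuousAt
    have h2 : ContinuousAt (fun q : J × J × M => Q i (q.2.1, q.2.2)) (t, t, x) :=
      ContinuousAt.comp (f := fun q : J × J × M => (q.2.1, q.2.2)) (x := (t, t, x)) hQc
        c2.continuousAt
    have h3 : ContinuousAt (fun q : J × J × M => Ring.inverse (Q i (q.1, q.2.2))) (t, t, x) :=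
      ContinuousAt.comp (g := Ring.inverse) (f := fun q : J × J × M => Q i (q.1, q.2.2))
        (x := (t, t, x)) (by beta_reduce; rw [← hv]; exact NormedRing.inverse_continuousAt v) h1
    have h4 := ((h3.mul h2).sub (continuousAt_const (y := (1 : 𝔸)))).norm
    have h5 : ∀ᶠ q : J × J × M in 𝓝 (t, t, x), q.2.2 ∈ U i :=
      (continuous_snd.comp continuous_snd).continuousAt.eventually ((hU i).mem_nhds hi)
    have h6 : ‖Ring.inverse (Q i (t, x)) * Q i (t, x) - 1‖ < 1 := by
      rw [Ring.inverse_mul_cancel _ (hQu i (t, x) hi), sub_self, norm_zero]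
      exact one_pos
    filter_upwards [h5, h4.eventually (gt_mem_nhds h6)] with q hq hq'
    exact ⟨i, hq, hq'⟩
  have hS : ∀ α y, (∀ z, ∃ α' y', S α' y' ∧ ∀ᶠ w in 𝓝 z, α w = α' w ∧ y w = y' w) → S α y := by
    intro α y h
    refine ⟨fun i => SmoothAlong.of_local hind fun z hz => ?_, fun z => ?_, fun z => ?_,
      fun z => ?_⟩
    · obtain ⟨α', y', hS', he⟩ := h z
      exact ⟨_, he, ((hS'.1 i).mono Set.inter_subset_left).congr fun w hw => by rw [hw.2.2]⟩
    all_goals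
      obtain ⟨α', y', hS', he⟩ := h z
      obtain ⟨h1, h2⟩ := he.self_of_nhds
      rw [h2]
    · exact hS'.2.1 z
    · rw [h1]; exact hS'.2.2.1 z
    · exact hS'.2.2.2 z
  have hB : ∀ α y, S α y → ∀ z, B (α z) (α z) z.2 (y z) = y z := by
    intro α y hS z
    funext i
    by_cases hi : z.2 ∈ U i
    · simp only [B, if_pos hi, R, (hS.2.2.1 z i hi).1, sub_self, invSqrt_zero, mul_one]
    · simp only [B, if_neg hi, hS.2.2.2 z i hi]
  have hstep : ∀ α β y, S α y →
      SmoothAlong (cylModel E) (cylMap J M) 𝓘(ℝ, ℝ) (fun z => (α z : ℝ)) Set.univ →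
      SmoothAlong (cylModel E) (cylMap J M) 𝓘(ℝ, ℝ) (fun z => (β z : ℝ)) Set.univ →
      (∀ z, Ω (α z) (β z) z.2) → S β (fun z => B (α z) (β z) z.2 (y z)) := by
    intro α β y hS hα hβ hΩ
    have hconj : ∀ z i k, z.2 ∈ U i → z.2 ∈ U k → R (β z) z.2 (y z) k =
        ((C i k z.2)⁻¹ : 𝔸ˣ) * R (β z) z.2 (y z) i * (C i k z.2 : 𝔸) := by
      intro z i k hi hk
      simp only [R]
      rw [hS.2.1 z i k hi hk, hQC i k (β z, z.2) hi hk, conj_form hadj hinv (hC i k z.2 hi hk),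
        mul_sub, sub_mul, mul_one, Units.inv_mul]
    have hsmall : ∀ z i, z.2 ∈ U i → SimSmall (R (β z) z.2 (y z) i) := by
      intro z i hi
      obtain ⟨l, hl, hlt⟩ := hΩ z
      rw [hconj z l i hl hi]
      refine SimSmall.conj ?_ _
      obtain ⟨h1, ⟨v, hv⟩, -⟩ := hS.2.2.1 z l hl
      -- Since `v` carries the form at `α z` to `1`, `adj v * Q` is `v⁻¹`. So `R` is conjugate by
      -- `v` to the element bounded in `Ω`, however large `v` has become.
      have h2 : ((v⁻¹ : 𝔸ˣ) : 𝔸) * (Ring.inverse (Q l (α z, z.2)) * Q l (β z, z.2) - 1) * v =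
          R (β z) z.2 (y z) l := by
        simp only [R]
        rw [← hv] at h1 ⊢
        have h3 : adj (v : 𝔸) * Q l (α z, z.2) = (v⁻¹ : 𝔸ˣ) :=
          Units.eq_inv_of_mul_eq_one_right h1
        rw [← h3, mul_sub, sub_mul, mul_assoc (adj (v : 𝔸)), ← mul_assoc (Q l (α z, z.2)),
          Ring.mul_inverse_cancel _ (hQu l (α z, z.2) hl), one_mul, mul_one, h1]
      rw [← h2]
      exact (SimSmall.of_norm hlt).conj v
    refine ⟨fun i => ?_, fun z i k hi hk => ?_, fun z i hi => ?_, fun z i hi => if_neg hi⟩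
    · have hR : SmoothAlong (cylModel E) (cylMap J M) 𝓘(ℝ, 𝔸) (fun z => R (β z) z.2 (y z) i)
          {z | z.2 ∈ U i} := by
        have h1 : SmoothAlong (cylModel E) (cylMap J M) 𝓘(ℝ, 𝔸) (fun z => Q i (β z, z.2))
            {z | z.2 ∈ U i} :=
          SmoothAlong.precomp ((smoothAlong_cylMap_mk hβ).mono (Set.subset_univ _)) (hQs i)
            fun z hz => hz
        have h2 := (hS.1 i).comp_contDiff adj.contDiff
        have h3 := h2.comp₂ h1 (contDiff_fst.mul contDiff_snd)
        exact (h3.comp₂ (hS.1 i) (contDiff_fst.mul contDiff_snd)).sub (smoothAlong_const 1)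
      have hΦ := hR.comp_contDiffOn (G := invSqrt) fun z hz =>
        (hsmall z i hz).eventually.mono fun Z hZ => hZ.contDiffAt
      exact ((hS.1 i).comp₂ hΦ (contDiff_fst.mul contDiff_snd)).congr fun z hz => if_pos hz
    · simp only [B, if_pos hi, if_pos hk]
      rw [hconj z i k hi hk, invSqrt_conj (hsmall z i hi), hS.2.1 z i k hi hk]
      simp only [mul_assoc, Units.mul_inv_cancel_left]
    · obtain ⟨h1, h2, h3⟩ := hS.2.2.1 z i hi
      have hsm := hsmall z i hi
      simp only [B, if_pos hi]
      have hself : adj (R (β z) z.2 (y z) i) = R (β z) z.2 (y z) i := by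
        simp only [R]
        rw [map_sub, hadj, hadj, hinv, hone, hQadj i (β z, z.2) hi, mul_assoc]
      refine ⟨?_, h2.mul hsm.isUnit, by rw [map_mul]; exact mul_pos h3 (hsm.pos hχ)⟩
      have h4 := hsm.invSqrt_conj_one_add
      have h5 : 1 + R (β z) z.2 (y z) i = adj (y z i) * Q i (β z, z.2) * y z i := by
        simp only [R]; abel
      rw [hadj, hsm.map_invSqrt hadj hone hself]
      conv_rhs => rw [← h4]
      rw [h5]
      simp only [mul_assoc]
  obtain ⟨y, hy, hy0⟩ := exists_transport (E := E) hJ t₀ hΩ B S hS hB hstep (fun _ _ => 1)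
    ⟨fun i => smoothAlong_const 1, fun z i k _ _ => by simp, fun z i hi => by
      beta_reduce
      rw [hone, hQ₀ i z.2 hi, map_one]
      exact ⟨by simp, isUnit_one, one_pos⟩, fun _ _ _ => rfl⟩
  exact ⟨fun i z => y z i, hy.1, fun i k z hi hk => hy.2.1 z i k hi hk,
    fun i z hi => ⟨(hy.2.2.1 z i hi).1, (hy.2.2.1 z i hi).2.2⟩,
    fun i x => congrFun (hy0 x) i⟩

end IsometryFamily

/-! ### Adjoints with respect to the standard form -/

section Adjoint

variable {ι : Type} [Fintype ι] [DecidableEq ι] {ε : ι → ℝ}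

theorem eq_of_ip_eq (hε : ∀ i, ε i * ε i = 1) {v v' : ι → ℝ} (h : ∀ w, ip ε w v = ip ε w v') :
    v = v' := by
  ext i
  have h1 := h (Pi.single i 1)
  rw [ip_single_left, ip_single_left] at h1
  calc v i = ε i * (ε i * v i) := by rw [← mul_assoc, hε, one_mul]
    _ = v' i := by rw [h1, ← mul_assoc, hε, one_mul]

/-- The endomorphism `Q` with `⟨w, Q v⟩ = β w v`. -/
def formEnd (ε : ι → ℝ) (β : LinearMap.BilinForm ℝ (ι → ℝ)) : (ι → ℝ) →L[ℝ] (ι → ℝ) :=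
  (LinearMap.pi fun i => ε i • β (Pi.single i 1)).toContinuousLinearMap

theorem formEnd_apply (β : LinearMap.BilinForm ℝ (ι → ℝ)) (v : ι → ℝ) (i : ι) :
    formEnd ε β v i = ε i * β (Pi.single i 1) v := rfl

theorem ip_formEnd (hε : ∀ i, ε i * ε i = 1) (β : LinearMap.BilinForm ℝ (ι → ℝ)) (w v : ι → ℝ) :
    ip ε w (formEnd ε β v) = β w v := by
  have h : ∀ i, ε i * (w i * formEnd ε β v i) = w i * β (Pi.single i 1) v := fun i => by
    have := hε i
    rw [formEnd_apply]
    linear_combination (w i * β (Pi.single i 1) v) * this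
  rw [ip, Finset.sum_congr rfl fun i _ => h i]
  conv_rhs => rw [pi_eq_sum_univ' w]
  simp [LinearMap.sum_apply]

/-- The bilinear form of the standard form. -/
def ipForm (ε : ι → ℝ) : LinearMap.BilinForm ℝ (ι → ℝ) :=
  LinearMap.mk₂ ℝ (ip ε) ip_add_left ip_smul_left ip_add_right ip_smul_right

/-- The adjoint of an endomorphism with respect to the standard form. -/
def adj (ε : ι → ℝ) :
    ((ι → ℝ) →L[ℝ] (ι → ℝ)) →L[ℝ] ((ι → ℝ) →L[ℝ] (ι → ℝ)) :=
  LinearMap.toContinuousLinearMap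
    { toFun := fun T => formEnd ε ((ipForm ε).compl₁₂ T.toLinearMap LinearMap.id)
      map_add' := fun S T => by
        ext v i
        simp only [ContinuousLinearMap.add_apply, Pi.add_apply, formEnd_apply, ipForm,
          LinearMap.compl₁₂_apply, LinearMap.mk₂_apply, ContinuousLinearMap.coe_coe, ip_add_left,
          mul_add]
      map_smul' := fun c T => by
        ext v i
        simp only [ContinuousLinearMap.smul_apply, Pi.smul_apply, formEnd_apply, ipForm,
          LinearMap.compl₁₂_apply, LinearMap.mk₂_apply, ContinuousLinearMap.coe_coe, ip_smul_left,
          smul_eq_mul, RingHom.id_apply]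
        ring }

theorem ip_adj (hε : ∀ i, ε i * ε i = 1) (T : (ι → ℝ) →L[ℝ] (ι → ℝ)) (w v : ι → ℝ) :
    ip ε w (adj ε T v) = ip ε (T w) v :=
  ip_formEnd hε _ w v

theorem adj_mul (hε : ∀ i, ε i * ε i = 1) (S T : (ι → ℝ) →L[ℝ] (ι → ℝ)) :
    adj ε (S * T) = adj ε T * adj ε S :=
  ContinuousLinearMap.ext fun v => eq_of_ip_eq hε fun w => by
    rw [ip_adj hε, ContinuousLinearMap.mul_apply, ContinuousLinearMap.mul_apply, ip_adj hε,
      ip_adj hε]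

theorem adj_one (hε : ∀ i, ε i * ε i = 1) : adj ε 1 = 1 :=
  ContinuousLinearMap.ext fun v => eq_of_ip_eq hε fun w => by rw [ip_adj hε]; rfl

theorem adj_adj (hε : ∀ i, ε i * ε i = 1) (T : (ι → ℝ) →L[ℝ] (ι → ℝ)) : adj ε (adj ε T) = T :=
  ContinuousLinearMap.ext fun v => eq_of_ip_eq hε fun w => by
    rw [ip_adj hε, ip_comm, ip_adj hε, ip_comm]

theorem adj_formEnd (hε : ∀ i, ε i * ε i = 1) {β : LinearMap.BilinForm ℝ (ι → ℝ)}
    (hβ : ∀ v w, β v w = β w v) : adj ε (formEnd ε β) = formEnd ε β :=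
  ContinuousLinearMap.ext fun v => eq_of_ip_eq hε fun w => by
    rw [ip_adj hε, ip_formEnd hε, ip_comm, ip_formEnd hε, hβ]

theorem isUnit_of_injective {T : (ι → ℝ) →L[ℝ] (ι → ℝ)} (hT : Function.Injective T) : IsUnit T :=
  ContinuousLinearMap.isUnit_iff_bijective.2
    ⟨hT, (LinearMap.injective_iff_surjective (f := T.toLinearMap)).1 hT⟩

/-- `adC` as an invertible continuous linear map. -/
def adU (hε : ∀ i, ε i * ε i = 1) (a : (SpinC ε).El) : ((ι → ℝ) →L[ℝ] (ι → ℝ))ˣ where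
  val := (adC a).toContinuousLinearMap
  inv := (adC a⁻¹).toContinuousLinearMap
  val_inv := ContinuousLinearMap.ext fun v => by
    change (adC a ∘ₗ adC a⁻¹) v = v
    rw [← adC_mul hε, mul_inv_cancel, adC_one hε]
    rfl
  inv_val := ContinuousLinearMap.ext fun v => by
    change (adC a⁻¹ ∘ₗ adC a) v = v
    rw [← adC_mul hε, inv_mul_cancel, adC_one hε]
    rfl

theorem adj_adU (hε : ∀ i, ε i * ε i = 1) (a : (SpinC ε).El) :
    adj ε (adU hε a) = ((adU hε a)⁻¹ : ((ι → ℝ) →L[ℝ] (ι → ℝ))ˣ) := by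
  refine eq_comm.1 (Units.inv_eq_of_mul_eq_one_left (ContinuousLinearMap.ext fun v => eq_of_ip_eq hε
    fun w => ?_))
  rw [ContinuousLinearMap.mul_apply, ip_adj hε]
  exact isIsom_adC hε a w v

end Adjoint

/-! ### Extension of frames to the cylinder -/

section FrameExtension

variable {E : Type*} [NormedAddCommGroup E] [NormedSpace ℝ E]
  {M : Type u} [TopologicalSpace M] [ChartedSpace E M] [IsManifold 𝓘(ℝ, E) ∞ M]
  {r s : ℕ} {J : Set ℝ} {g : MetricFamily E M r s J}
  {o : ManifoldOrientation E M (Fin r ⊕ Fin s)} {t₀ : J}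

/-- The metric `g t` in the coordinates of a tuple. -/
def pulledForm (g : MetricFamily E M r s J) (t : J)
    (F : TangentTuple 𝓘(ℝ, E) (id : M → M) (Fin r ⊕ Fin s)) :
    LinearMap.BilinForm ℝ ((Fin r ⊕ Fin s) → ℝ) :=
  (g.g t F.base).compl₁₂ F.lin F.lin

/-- Symmetry and nondegeneracy of the metric are not separate fields of `MetricFamily`; they are
read off from the orthonormal basis given by the signature. -/
theorem exists_pulledForm_eq (t : J) {F : TangentTuple 𝓘(ℝ, E) (id : M → M) (Fin r ⊕ Fin s)}
    (hF : Function.Injective F.lin) : ∃ T : ((Fin r ⊕ Fin s) → ℝ) →ₗ[ℝ] ((Fin r ⊕ Fin s) → ℝ),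
      Function.Bijective T ∧ ∀ v w, pulledForm g t F v w = ip (sig r s) (T v) (T w) := by
  obtain ⟨b, hb⟩ := g.signature t F.base
  have hT : Function.Injective (b.equivFun.toLinearMap ∘ₗ F.lin) := b.equivFun.injective.comp hF
  refine ⟨b.equivFun.toLinearMap ∘ₗ F.lin,
    ⟨hT, LinearMap.injective_iff_surjective.1 hT⟩, fun v w => ?_⟩
  rw [← (isOrthonormal_iff (ε := sig r s) (g := g.g t F.base) b).1 hb]
  have h : ∀ v, Fintype.linearCombination ℝ b ((b.equivFun.toLinearMap ∘ₗ F.lin) v) = F.lin v :=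
    fun v => b.sum_equivFun (F.lin v)
  rw [h, h]
  rfl

theorem isUnit_formEnd_pulledForm (t : J)
    {F : TangentTuple 𝓘(ℝ, E) (id : M → M) (Fin r ⊕ Fin s)} (hF : Function.Injective F.lin) :
    IsUnit (formEnd (sig r s) (pulledForm g t F)) := by
  have hε := sig_sign r s
  obtain ⟨T, hT, h⟩ := exists_pulledForm_eq (g := g) t hF
  refine isUnit_of_injective ((injective_iff_map_eq_zero _).2 fun v hv => ?_)
  refine hT.1 ((eq_of_ip_eq hε fun w => ?_).trans (map_zero T).symm)
  obtain ⟨w, rfl⟩ := hT.2 w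
  rw [← h, ← ip_formEnd hε, hv]
  simp [ip]

theorem isSmoothField_of_smooth {f : M → TangentTuple 𝓘(ℝ, E) (id : M → M) (Fin r ⊕ Fin s)}
    {U : Set M} (hf : TangentTuple.Smooth 𝓘(ℝ, E) (id : M → M) f U)
    (hb : ∀ x ∈ U, (f x).base = x) (l : Fin r ⊕ Fin s) :
    IsSmoothField (E := E) (fun x => (show E from (f x).vec l)) U := by
  intro x hx
  obtain ⟨W, hW, hxW, G, hG, h⟩ := hf l x hx
  refine (((hG x hxW).contMDiffAt (hW.mem_nhds hxW)).contMDiffWithinAt).congr_of_eventuallyEq_of_mem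
    (s := U) ?_ hx
  filter_upwards [self_mem_nhdsWithin, mem_nhdsWithin_of_mem_nhds (hW.mem_nhds hxW)] with y hy hyW
  refine Eq.trans ?_ (h y hy hyW).symm
  exact congrArg (fun z => (⟨z, (show E from (f y).vec l)⟩ : TangentBundle 𝓘(ℝ, E) M)) (hb y hy).symm

theorem smoothAlong_formEnd {f : M → TangentTuple 𝓘(ℝ, E) (id : M → M) (Fin r ⊕ Fin s)}
    {U : Set M} (hU : IsOpen U) (hf : TangentTuple.Smooth 𝓘(ℝ, E) (id : M → M) f U)
    (hb : ∀ x ∈ U, (f x).base = x) :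
    SmoothAlong (cylModel E) (cylMap J M)
      𝓘(ℝ, ((Fin r ⊕ Fin s) → ℝ) →L[ℝ] ((Fin r ⊕ Fin s) → ℝ))
      (fun z => formEnd (sig r s) (pulledForm g z.1 (f z.2))) {z | z.2 ∈ U} := by
  have hbase : ∀ (t : J) (x : M) (F : TangentTuple 𝓘(ℝ, E) (id : M → M) (Fin r ⊕ Fin s)),
      F.base = x → ∀ k l, g.g t F.base (F.vec k) (F.vec l) =
        g.g t x (show E from F.vec k) (show E from F.vec l) := by
    rintro t x F rfl k l
    rfl
  have h : SmoothAlg (A := Module.End ℝ ((Fin r ⊕ Fin s) → ℝ)) (cylModel E) (cylMap J M)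
      (fun z : J × M => (formEnd (sig r s) (pulledForm g z.1 (f z.2))).toLinearMap)
      {z | z.2 ∈ U} := smoothAlg_end fun i k => by
    refine ((smoothAlong_const (sig r s i)).mul (g.smooth U _ _ hU
      (isSmoothField_of_smooth hf hb i) (isSmoothField_of_smooth hf hb k))).congr fun z hz => ?_
    rw [← hbase z.1 z.2 (f z.2) (hb _ hz) i k]
    change sig r s i * pulledForm g z.1 (f z.2) _ _ = _
    rw [pulledForm, LinearMap.compl₁₂_apply, TangentTuple.lin_single, TangentTuple.lin_single]
  refine SmoothAlg.toSpace fun φ => ?_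
  exact h (φ ∘ₗ LinearMap.toContinuousLinearMap.toLinearMap)

/-- Local frames of `(M, g t₀)` extend to local frames of the metrics `g t`, with the same
transition functions. -/
theorem exists_frame_extension [FiniteDimensional ℝ E] [T2Space M] [SecondCountableTopology M]
    (hJ : J.OrdConnected) {K : Type*} {U : K → Set M}
    (hU : ∀ i, IsOpen (U i)) (hcov : ∀ x, ∃ i, x ∈ U i)
    {f : K → M → TangentTuple 𝓘(ℝ, E) (id : M → M) (Fin r ⊕ Fin s)}
    (hf : ∀ i, TangentTuple.Smooth 𝓘(ℝ, E) (id : M → M) (f i) (U i))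
    (hfb : ∀ i, ∀ x ∈ U i, (f i x).base = x)
    (hfm : ∀ i, ∀ x ∈ U i, f i x ∈ PSO (sig r s) (g.g t₀) o.at_)
    {c : K → K → M → (SpinC (sig r s)).El}
    (hc : ∀ i k x, x ∈ U i → x ∈ U k → f k x = (f i x).transform (adC (c i k x))) :
    ∃ e : K → J × M → TangentTuple 𝓘(ℝ, E) (id : M → M) (Fin r ⊕ Fin s),
      (∀ i, TangentTuple.Smooth (cylModel E) (cylMap J M) (e i) {z | z.2 ∈ U i}) ∧
      (∀ i z, z.2 ∈ U i → (e i z).base = z.2) ∧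
      (∀ i z, z.2 ∈ U i → e i z ∈ PSO (sig r s) (g.g z.1) o.at_) ∧
      (∀ i k z, z.2 ∈ U i → z.2 ∈ U k → e k z = (e i z).transform (adC (c i k z.2))) ∧
      ∀ i x, e i (t₀, x) = f i x := by
  have hε := sig_sign r s
  have hinj : ∀ i x, x ∈ U i → Function.Injective (f i x).lin := fun i x hx =>
    TangentTuple.lin_injective (hfm i x hx)
  -- The new frames are the `f i` transformed by matrices `y i`. As the `y i` are conjugated by the
  -- transition functions, the new frames have the same ones; positive determinants keep the
  -- orientation.
  obtain ⟨y, hy, hyc, hyQ, hy₀⟩ := exists_isometry_family (E := E) hJ t₀ (adj := adj (sig r s))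
    (adj_mul hε) (adj_one hε) (adj_adj hε)
    (χ := LinearMap.det.comp
      (ContinuousLinearMap.toLinearMapRingHom : (((Fin r ⊕ Fin s) → ℝ) →L[ℝ] ((Fin r ⊕ Fin s) → ℝ)) →+* _).toMonoidHom)
    ContinuousLinearMap.continuous_det hU hcov
    (C := fun i k x => adU hε (c i k x)) (fun i k x _ _ => adj_adU hε _)
    (Q := fun i z => formEnd (sig r s) (pulledForm g z.1 (f i z.2)))
    (fun i => smoothAlong_formEnd (hU i) (hf i) (hfb i))
    (fun i z hz => adj_formEnd hε fun v w => by
      obtain ⟨T, -, hT⟩ := exists_pulledForm_eq (g := g) z.1 (hinj i z.2 hz)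
      rw [hT, hT, ip_comm])
    (fun i z hz => isUnit_formEnd_pulledForm z.1 (hinj i z.2 hz))
    (fun i k z hi hk => by
      rw [← adj_adU hε]
      refine ContinuousLinearMap.ext fun v => eq_of_ip_eq hε fun w => ?_
      rw [ContinuousLinearMap.mul_apply, ContinuousLinearMap.mul_apply, ip_adj hε,
        ip_formEnd hε, ip_formEnd hε, hc i k z.2 hi hk]
      rw [pulledForm, TangentTuple.lin_transform]
      rfl)
    (fun i x hx => ContinuousLinearMap.ext fun v => eq_of_ip_eq hε fun w => by
      rw [ip_formEnd hε]
      exact (isOrthonormal_iff (f i x).vec).1 (hfm i x hx).1 w v)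
  refine ⟨fun i z => (f i z.2).transform (y i z).toLinearMap, fun i => ?_, fun i z hz => hfb i _ hz,
    fun i z hz => ⟨?_, (hfm i z.2 hz).2.transform (hyQ i z hz).2⟩, fun i k z hi hk => ?_,
    fun i x => ?_⟩
  · have h1 : TangentTuple.Smooth (cylModel E) (cylMap J M) (fun z : J × M => f i z.2)
        {z | z.2 ∈ U i} := fun l => SmoothAlong.precomp (smoothAlong_snd _) (hf i l) fun z hz => hz
    refine h1.transform isInducing_cylMap ((smoothAlong_snd _).congr fun z hz => ?_) fun φ => ?_
    · exact congrArg id (hfb i _ hz)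
    · exact SmoothAlong.toAlg (hy i) (φ ∘ₗ LinearMap.toContinuousLinearMap.symm.toLinearMap)
  · refine (isOrthonormal_iff _).2 fun v w => ?_
    have h1 : ∀ v, Fintype.linearCombination ℝ ((f i z.2).transform (y i z).toLinearMap).vec v =
        (f i z.2).lin (y i z v) := fun v =>
      LinearMap.congr_fun (TangentTuple.lin_transform (f i z.2) (y i z).toLinearMap) v
    rw [h1, h1]
    refine (ip_formEnd hε (pulledForm g z.1 (f i z.2)) (y i z v) (y i z w)).symm.trans ?_
    rw [← ip_adj hε]
    exact congrArg (fun T : ((Fin r ⊕ Fin s) → ℝ) →L[ℝ] ((Fin r ⊕ Fin s) → ℝ) =>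
      ip (sig r s) v (T w)) ((mul_assoc _ _ _).symm.trans (hyQ i z hz).1)
  · beta_reduce
    rw [hc i k z.2 hi hk, TangentTuple.transform_transform, TangentTuple.transform_transform,
      hyc i k z hi hk]
    congr 1
    refine LinearMap.ext fun v => ?_
    have h := congrArg (fun T : ((Fin r ⊕ Fin s) → ℝ) →L[ℝ] ((Fin r ⊕ Fin s) → ℝ) => T v)
      (Units.mul_inv_cancel_left (adU hε (c i k z.2)) (y i z * adU hε (c i k z.2)))
    exact h
  · beta_reduce
    rw [hy₀]
    exact TangentTuple.transform_id _

end FrameExtension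

/-! ### Existence of pull-backs -/

section Pullback

open PrincipalBundle

variable {E : Type*} [NormedAddCommGroup E] [NormedSpace ℝ E] [FiniteDimensional ℝ E]
  {M : Type u} [TopologicalSpace M] [T2Space M] [SecondCountableTopology M]
  [ChartedSpace E M] [IsManifold 𝓘(ℝ, E) ∞ M]
  {r s : ℕ} {J : Set ℝ} {g : MetricFamily E M r s J}
  {o : ManifoldOrientation E M (Fin r ⊕ Fin s)} {t₀ : J}

/-- The cocycle `c` of `σ` does not depend on `t`. Included in the larger group it glues to `P`, and
since the extended frames `e i` of `g t` still transform by `c`, the frames `(∂_t, e i)` define an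
equivariant map on `P`. -/
theorem exists_pullback (hJ : J.OrdConnected) (σ : SpinCOn g o t₀) :
    ∃ τ : SpinCOnCyl g o, IsPullback t₀ σ τ := by
  have hε := sig_sign r s
  have hε' := ext_sign hε
  have hid : Topology.IsInducing (id : M → M) := Topology.IsInducing.id
  have hcyl : Topology.IsInducing (cylMap J M) := isInducing_cylMap
  choose p U hp hxU using σ.P.exists_section_at
  have hpr : ∀ i, ∀ x ∈ U i, σ.P.proj (p i x) = x := fun i => (hp i).2.1
  have hcov : ∀ x, ∃ i, x ∈ U i := fun x => ⟨x, hxU x⟩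
  have hpp : ∀ i k x, x ∈ U i → x ∈ U k → σ.P.proj (p i x) = σ.P.proj (p k x) :=
    fun i k x hi hk => by rw [hpr i x hi, hpr k x hk]
  let c : M → M → M → (SpinC (sig r s)).El := fun i k x => σ.P.diff (p i x) (p k x)
  obtain ⟨e, hes, heb, hem, hec, he₀⟩ := exists_frame_extension (g := g) (o := o) hJ
    (fun i => (hp i).1) hcov (f := fun i x => σ.frame (p i x)) (c := c)
    (fun i => σ.smooth_frame' (hp i)) (fun i x hx => (σ.frame_base _).trans (hpr i x hx))
    (fun i x _ => σ.frame_mem _) (fun i k x hi hk => (σ.adC_diff hε (hpp i k x hi hk)).symm)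
  let V : M → Set (J × M) := fun i => {z | z.2 ∈ U i}
  have hV : ∀ i, IsOpen (V i) := fun i => (hp i).1.preimage continuous_snd
  have hcovV : ∀ z, ∃ i, z ∈ V i := fun z => ⟨z.2, hxU z.2⟩
  have hcc : ∀ i k l x, x ∈ U i → x ∈ U k → x ∈ U l → c i k x * c k l x = c i l x :=
    fun i k l x hi hk hl => diff_mul_diff (hpp i k x hi hk) (hpp k l x hk hl)
  have hcs : ∀ i k, SmoothAlg (cylModel E) (cylMap J M)
      (fun z : J × M => LinearGroup.val (c i k z.2)) (V i ∩ V k) := fun i k =>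
    SmoothAlg.precomp (smoothAlong_snd _)
      (((hp i).mono ((hp i).1.inter (hp k).1) Set.inter_subset_left).diff hid
        ((hp k).mono ((hp i).1.inter (hp k).1) Set.inter_subset_right)) fun z hz => hz
  obtain ⟨P, q, hq, hqc⟩ := exists_of_cocycle (I := cylModel E) (j := cylMap J M)
    (𝒢 := SpinC (ext (sig r s))) hcyl.continuous hV hcovV
    (fun i k z => spinCIncl (sig r s) (c i k z.2))
    (fun i k l z hi hk hl => by rw [← map_mul, hcc i k l z.2 hi hk hl])
    (fun i k => smoothAlg_spinCIncl (hcs i k))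
  -- The circle parts of the `p i` are sections of `σ.L` with transition functions `sqC c` (see
  -- `hσd` below), so `L` is the pull-back of `σ.L`.
  obtain ⟨L, l, hl, hlc⟩ := exists_of_cocycle (I := cylModel E) (j := cylMap J M)
    (𝒢 := S1) hcyl.continuous hV hcovV (fun i k z => sqC (c i k z.2))
    (fun i k l z hi hk hl => by rw [← sqC_mul, hcc i k l z.2 hi hk hl])
    (fun i k => smoothAlg_sqC (hcs i k))
  have hqp : ∀ i, ∀ z ∈ V i, P.proj (q i z) = z := fun i => (hq i).2.1
  have hlp : ∀ i, ∀ z ∈ V i, L.proj (l i z) = z := fun i => (hl i).2.1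
  have hqd : ∀ i k z, z ∈ V i → z ∈ V k →
      P.diff (q i z) (q k z) = spinCIncl (sig r s) (c i k z.2) := fun i k z hi hk =>
    (diff_eq_iff (by rw [hqp i z hi, hqp k z hk])).2 (hqc i k z hi hk).symm
  have hσc : ∀ i x, x ∈ U i → σ.L.proj (σ.circle (p i x)) = x := fun i x hx =>
    (σ.proj_circle _).trans (hpr i x hx)
  have hσd : ∀ i k x, x ∈ U i → x ∈ U k →
      σ.L.diff (σ.circle (p i x)) (σ.circle (p k x)) = sqC (c i k x) := fun i k x hi hk => by
    rw [diff_eq_iff (by rw [hσc i x hi, hσc k x hk]), ← σ.circle_actC, act_diff (hpp i k x hi hk)]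
  obtain ⟨fr, hfr1, hfr2⟩ := exists_equivariant hcovV hqp
    (fun (A : TangentTuple (cylModel E) (cylMap J M) (Option (Fin r ⊕ Fin s))) a =>
      A.transform (adC a))
    (fun A a b => by rw [adC_mul hε', TangentTuple.transform_transform])
    (fun i z => cylTuple z.1 (e i z))
    (fun i k z hi hk => by
      rw [hqd i k z hi hk, adC_spinCIncl hε, cylTuple_transform, hec i k z hi hk])
  obtain ⟨ci, hci1, hci2⟩ := exists_equivariant hcovV hqp
    (fun (A : L.Total) a => L.act A (sqC a))
    (fun A a b => by rw [sqC_mul, L.act_mul]) l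
    (fun i k z hi hk => by rw [hqd i k z hi hk, sqC_spinCIncl, hlc i k z hi hk])
  -- The map is built on each slice separately; smoothness in `t` comes later from `smoothInto_map`,
  -- as the values on the sections `p i` are the smooth sections `q i`.
  have hF : ∀ t : J, ∃ D : σ.P.Total → P.Total, (∀ i, ∀ x ∈ U i, D (p i x) = q i (t, x)) ∧
      ∀ u a, D (σ.P.act u a) = P.act (D u) (spinCIncl (sig r s) a) := fun t =>
    exists_equivariant hcov hpr (fun (A : P.Total) a => P.act A (spinCIncl (sig r s) a))
      (fun A a b => by rw [map_mul, P.act_mul]) (fun i x => q i (t, x))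
      (fun i k x hi hk => hqc i k (t, x) hi hk)
  choose F hF1 hF2 using hF
  have hf : ∀ t : J, ∃ D : σ.L.Total → L.Total,
      (∀ i, ∀ x ∈ U i, D (σ.circle (p i x)) = l i (t, x)) ∧
      ∀ u a, D (σ.L.act u a) = L.act (D u) a := fun t =>
    exists_equivariant hcov hσc (fun (A : L.Total) a => L.act A a) L.act_mul
      (fun i x => l i (t, x))
      (fun i k x hi hk => by rw [hσd i k x hi hk]; exact hlc i k (t, x) hi hk)
  choose f hf1 hf2 using hf
  have hP : ∀ u, ∃ i a, P.proj u ∈ V i ∧ u = P.act (q i (P.proj u)) a := fun u =>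
    ⟨_, _, hxU (P.proj u).2, (act_diff (hqp _ _ (hxU (P.proj u).2))).symm⟩
  have hσP : ∀ u, ∃ i a, σ.P.proj u ∈ U i ∧ u = σ.P.act (p i (σ.P.proj u)) a := fun u =>
    ⟨_, _, hxU (σ.P.proj u), (act_diff (hpr _ _ (hxU (σ.P.proj u)))).symm⟩
  have hσL : ∀ u, ∃ i a, σ.L.proj u ∈ U i ∧
      u = σ.L.act (σ.circle (p i (σ.L.proj u))) a := fun u =>
    ⟨_, _, hxU (σ.L.proj u), (act_diff (hσc _ _ (hxU (σ.L.proj u)))).symm⟩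
  let D : EquivariantData (ε := ext (sig r s)) P L (cylMetric g) (cylOrientation o) :=
    { fr := fr
      ci := ci
      fr_mem := fun u => by
        obtain ⟨i, a, hi, hu⟩ := hP u
        rw [hu, hfr2, hfr1 i _ hi]
        exact TangentTuple.transform_mem (cylTuple_mem (hem i _ hi)) (isIsom_adC hε' a)
          (by rw [det_adC hε']; norm_num)
      fr_base := fun u => by
        obtain ⟨i, a, hi, hu⟩ := hP u
        conv_lhs => rw [hu, hfr2, hfr1 i _ hi]
        exact Prod.ext rfl (heb i _ hi)
      proj_ci := fun u => by
        obtain ⟨i, a, hi, hu⟩ := hP u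
        conv_lhs => rw [hu, hci2, hci1 i _ hi]
        rw [L.proj_act, hlp i _ hi]
      fr_act := hfr2
      ci_act := hci2
      exists_smooth := fun z => ⟨q z.2, V z.2, hq z.2, hxU z.2,
        (smooth_cylTuple (t := fun z : J × M => z.1) (smoothAlong_fst _)
          ((smoothAlong_snd _).congr fun y hy => heb z.2 y hy) (hes z.2)).congr
            fun y hy => hfr1 z.2 y hy,
        (hl z.2).1, fun y hy => by
          beta_reduce
          rw [hci1 z.2 y hy, hlp z.2 y hy],
        (hl z.2).2.2.congr fun y hy => hci1 z.2 y hy⟩ }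
  refine ⟨D.toSpinC hε' hcyl, fun w => F w.1 w.2, fun w => f w.1 w.2, fun t u => ?_, fun t u => ?_,
    hF2, hf2, fun s' W hs' => ?_, fun s' W hs' => ?_, fun t u => ?_, fun u => ?_, fun t u => ?_⟩
  · obtain ⟨i, a, hi, hu⟩ := hσP u
    beta_reduce
    conv_lhs => rw [hu, hF2, hF1 t i _ hi]
    exact (P.proj_act _ _).trans (hqp i (t, σ.P.proj u) hi)
  · obtain ⟨i, a, hi, hu⟩ := hσL u
    beta_reduce
    conv_lhs => rw [hu, hf2, hf1 t i _ hi]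
    exact (L.proj_act _ _).trans (hlp i (t, σ.L.proj u) hi)
  · refine smoothInto_map (I' := cylModel E) (j' := cylMap J M) hid hcyl continuous_snd
      (smoothAlong_snd _) (π := fun z : J × M => z.2) (F := fun z => F z.1)
      (ρ := spinCIncl (sig r s)) (cclIncl (sig r s)).toLinearMap (fun _ => rfl)
      (fun z => hF2 z.1) (fun z => ?_) hs'
    exact ⟨p z.2, U z.2, hp z.2, hxU z.2, V z.2, (hV z.2).mem_nhds (hxU z.2),
      (hq z.2).2.2.congr fun y hy => hF1 y.1 z.2 y.2 hy⟩
  · refine smoothInto_map (I' := cylModel E) (j' := cylMap J M) hid hcyl continuous_snd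
      (smoothAlong_snd _) (π := fun z : J × M => z.2) (F := fun z => f z.1) (ρ := id)
      LinearMap.id (fun _ => rfl) (fun z => hf2 z.1) (fun z => ?_) hs'
    exact ⟨fun x => σ.circle (p z.2 x), U z.2, σ.smooth_circle' (hp z.2), hxU z.2, V z.2,
      (hV z.2).mem_nhds (hxU z.2), (hl z.2).2.2.congr fun y hy => hf1 y.1 z.2 y.2 hy⟩
  · obtain ⟨i, a, hi, hu⟩ := hσP u
    refine ⟨(e i (t, σ.P.proj u)).transform (adC a), ?_⟩
    change fr (F t u) = _
    conv_lhs => rw [hu, hF2, hfr2, hF1 t i _ hi, hfr1 i (t, σ.P.proj u) hi]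
    rw [adC_spinCIncl hε, cylTuple_transform]
  · change fr (F t₀ u) = _
    obtain ⟨i, a, hi, hu⟩ := hσP u
    rw [hu, hF2, hfr2, hF1 t₀ i _ hi, hfr1 i (t₀, σ.P.proj u) hi, he₀, adC_spinCIncl hε,
      cylTuple_transform, σ.frame_actC hε]
  · change ci (F t u) = f t (σ.circle u)
    obtain ⟨i, a, hi, hu⟩ := hσP u
    rw [hu, hF2, hci2, hF1 t i _ hi, hci1 i (t, σ.P.proj u) hi, sqC_spinCIncl, σ.circle_actC, hf2,
      hf1 t i _ hi]

end Pullback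

end SpinCGeom

end

theorem mainTheorem12 {E : Type*} [NormedAddCommGroup E] [NormedSpace ℝ E]
    [FiniteDimensional ℝ E]
    {M : Type*} [TopologicalSpace M] [T2Space M] [SecondCountableTopology M]
    [ChartedSpace E M] [IsManifold 𝓘(ℝ, E) ∞ M]
    (r s : ℕ) (J : Set ℝ) (hJ : J.OrdConnected)
    (g : SpinCGeom.MetricFamily E M r s J)
    (o : SpinCGeom.ManifoldOrientation E M (Fin r ⊕ Fin s)) (t₀ : J) :
    ∃ e : SpinCGeom.SpinCClassesCyl g o ≃ SpinCGeom.SpinCClasses g o t₀,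
      (∀ (τ : SpinCGeom.SpinCOnCyl g o) (σ : SpinCGeom.SpinCOn g o t₀),
        e τ.cls = σ.cls ↔ SpinCGeom.IsRestriction t₀ τ σ) ∧
      (∀ (σ : SpinCGeom.SpinCOn g o t₀) (τ : SpinCGeom.SpinCOnCyl g o),
        e.symm σ.cls = τ.cls ↔ SpinCGeom.IsPullback t₀ σ τ) := by
  have hrefl : ∀ σ : SpinCGeom.SpinCOn g o t₀, σ.Isomorphic σ :=
    (SpinCGeom.SpinCStructure.isoSetoid _ _ _).iseqv.refl
  have hrefl' : ∀ τ : SpinCGeom.SpinCOnCyl g o, τ.Isomorphic τ :=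
    (SpinCGeom.SpinCStructure.isoSetoid _ _ _).iseqv.refl
  have hcls : ∀ {σ σ' : SpinCGeom.SpinCOn g o t₀}, σ.cls = σ'.cls ↔ σ.Isomorphic σ' :=
    fun {σ σ'} => ⟨fun h => Quotient.exact h, fun h => Quotient.sound h⟩
  have hcls' : ∀ {τ τ' : SpinCGeom.SpinCOnCyl g o}, τ.cls = τ'.cls ↔ τ.Isomorphic τ' :=
    fun {τ τ'} => ⟨fun h => Quotient.exact h, fun h => Quotient.sound h⟩
  choose res hres using fun τ : SpinCGeom.SpinCOnCyl g o =>
    SpinCGeom.exists_restriction τ t₀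
  let φ : SpinCGeom.SpinCClassesCyl g o → SpinCGeom.SpinCClasses g o t₀ :=
    Quotient.lift (fun τ => (res τ).cls) fun τ τ' h =>
      hcls.2 (((hres τ).congr (hrefl _) h).unique (hres τ'))
  have hφ : ∀ τ σ, φ τ.cls = σ.cls ↔ SpinCGeom.IsRestriction t₀ τ σ := fun τ σ =>
    hcls.trans ⟨fun h => (hres τ).congr h (hrefl' τ), fun h => (hres τ).unique h⟩
  -- Injective because the restriction determines the structure on the cylinder, surjective because
  -- a pull-back restricts to the given structure.
  have hbij : Function.Bijective φ := by
    constructor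
    · rintro ⟨τ⟩ ⟨τ'⟩ h
      exact hcls'.2 (((hφ τ (res τ')).1 h).unique_cyl hJ (hres τ'))
    · rintro ⟨σ⟩
      obtain ⟨τ, hτ⟩ := SpinCGeom.exists_pullback hJ σ
      exact ⟨τ.cls, (hφ τ σ).2 hτ.isRestriction⟩
  refine ⟨Equiv.ofBijective φ hbij, hφ, fun σ τ => ?_⟩
  rw [Equiv.symm_apply_eq, eq_comm]
  refine (hφ τ σ).trans ⟨fun h => ?_, fun h => h.isRestriction⟩
  -- A structure that restricts to `σ` is isomorphic to some pull-back of `σ`, and being a pull-back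
  -- passes to isomorphic structures.
  obtain ⟨τ', hτ'⟩ := SpinCGeom.exists_pullback hJ σ
  exact hτ'.congr (hτ'.isRestriction.unique_cyl hJ h)
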